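/- **Setting.** Let $d\in\{1,2,3\}$ and let $S_+\subset\mathbb Z^d$ be a finite generating set with $0\notin S_+$; put $S_-=-S_+$ and $S=S_+\cup S_-\cup\{0\}$. A *quantum walk with two-dimensional coin* on the Cayley graph $\Gamma(\mathbb Z^d,S_+)$ is a unitary operator on $\ell^2(\mathbb Z^d)\otimes\mathbb C^2$ of the form $A=\sum_{\mathbf h\in S}T_{\mathbf h}\otimes A_{\mathbf h}$, where $T_{\mathbf h}|\mathbf n\rangle=|\mathbf n+\mathbf h\rangle$ and the $A_{\mathbf h}$ are complex $2\times 2$ matrices with $A_{\mathbf h}\neq 0$ for $\mathbf h\in S_+\cup S_-$ ($A_{0}=0$ is allowed). The walk is *isotropic*, with isotropy group $L$, if $L$ is a group of automorphisms of the Cayley graph fixing the vertex $0$ and acting as permutations of the colours $S_+$ (i.e. every $l\in L$ satisfies $l(\mathbf n+\mathbf h)=l(\mathbf n)+\lambda(\mathbf h)$ for a permutation $\lambda$ of $S_+$), $L$ acts transitively on $S_+$, and there is a projective unitary representation $U$ of $L$ on $\mathbb C^2$ with $A_{l(\mathbf h)}=U_lA_{\mathbf h}U_l^\dagger$ for all $l\in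 L$, $\mathbf h\in S$, and $[U_l,A_{\mathbf h}]\ne 0$ whenever $\mathbf h\in S_+$ and $l(\mathbf h)\neq\mathbf h$. We write $U_L=P$ for a set $P$ of matrices if for every $\mathbf h_1\in S_+$ there is an orthonormal basis of $\mathbb C^2$ in which $A_{\mathbf h_1}$ annihilates the second and $A_{-\mathbf h_1}$ the first basis vector and in which the matrices $U_l$, $l\in L$, are, up to phase factors, exactly the elements of $P$. We say that $S_+$ is *realized by* a set $N\subset\mathbb R^d$ if there is an injective group homomorphism $\varphi:\mathbb Z^d\to\mathbb R^d$ with $\varphi(S_+)=N$. **Proposition.** The graphs admitting isotropic quantum walks with two-dimensional coin in dimensions $d=1,2,3$ are exactly the following. * **$d=1$ (integer lattice).** $\Gamma(\mathbb Z,S_+)$ admits an isotropic walk if and only if $S_+$ is realized by $\{1\}$ or by $\{1,-1\}$ (that is, $S_+=\{\mathbf h_1\}$ or $S_+=\{\mathbf h_1,-\mathbf h_1\}$ with $\mathbf h_1$ a generator of $\mathbb Z$). In the first case every isotropic walk has $U_L=\{I\}$, in the second every isotropic walk has $U_L=\{I,i\sigma_X\}$, and both occur. In both cases there are isotropic walks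 with $A_0\neq0$. * **$d=2$ (simple square lattice).** $\Gamma(\mathbb Z^2,S_+)$ admits an isotropic walk if and only if $S_+$ is realized by $\{(1,0),(0,1)\}$ or by $\{\pm(1,0),\pm(0,1)\}$ (that is, $S_+=\{\mathbf h_1,\mathbf h_2\}$ or $S_+=\{\pm\mathbf h_1,\pm\mathbf h_2\}$ with $\mathbf h_1,\mathbf h_2$ a basis of $\mathbb Z^2$). In the first case every isotropic walk has $U_L=\{I,i\sigma_X\}$ or $U_L=\{I,i\sigma_Z\}$, and both possibilities occur; in the second case every isotropic walk has $U_L=\{I,i\sigma_X,i\sigma_Y,i\sigma_Z\}$, and this occurs. Every isotropic walk has $A_0=0$. * **$d=3$ (body-centred cubic lattice).** $\Gamma(\mathbb Z^3,S_+)$ admits an isotropic walk if and only if $S_+$ is realized by $\{(1,1,1),(1,-1,-1),(-1,1,-1),(-1,-1,1)\}$ (that is, $S_+=\{\mathbf h_1,\mathbf h_2,\mathbf h_3,\mathbf h_4\}$ with $\mathbf h_1,\mathbf h_2,\mathbf h_3$ a basis of $\mathbb Z^3$ and $\mathbf h_1+\mathbf h_2+\mathbf h_3+\mathbf h_4=0$).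 Every isotropic walk has $U_L=\{I,i\sigma_X,i\sigma_Y,i\sigma_Z\}$, and this occurs. Every isotropic walk has $A_0=0$. -/

import Mathlib

open scoped Matrix

/-! ### Quantum walks on Cayley graphs of abelian groups (additive notation) -/

/-- `Sp` is a finite generating set `S₊` of `G` not containing the identity: every element of `G`
is a word in the elements of `Sp` and their inverses. -/
structure IsGeneratingSet {G : Type*} [AddCommGroup G] (Sp : Finset G) : Prop where
  zero_notMem : (0 : G) ∉ Sp
  closure_eq_top : AddSubgroup.closure (Sp : Set G) = ⊤

/-- The full set of steps `S = S₊ ∪ S₋ ∪ {e}`, where `S₋ = -S₊`. -/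
def stepSet {G : Type*} [AddCommGroup G] [DecidableEq G] (Sp : Finset G) : Finset G :=
  insert 0 (Sp ∪ Sp.image (fun h => -h))

/-- The Hilbert space `ℓ²(G) ⊗ ℂˢ`, realised as the space of square-summable functions
`G → ℂˢ`. -/
abbrev WalkSpace (G : Type*) (s : ℕ) : Type _ :=
  lp (fun _ : G => EuclideanSpace ℂ (Fin s)) 2

/-- The operator `W` on `ℓ²(G) ⊗ ℂˢ` is `∑_{h ∈ S} T_h ⊗ A_h`, where `T_h |g⟩ = |g + h⟩`;
in terms of functions, `(W ψ)(g) = ∑_{h ∈ S} A_h ψ(g - h)`. -/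
def IsWalkOperator {G : Type*} [AddCommGroup G] [DecidableEq G] {s : ℕ} (Sp : Finset G)
    (A : G → Matrix (Fin s) (Fin s) ℂ) (W : WalkSpace G s →L[ℂ] WalkSpace G s) : Prop :=
  ∀ (ψ : WalkSpace G s) (g : G),
    ((W ψ : WalkSpace G s) g).ofLp = ∑ h ∈ stepSet Sp, A h *ᵥ ((ψ : WalkSpace G s) (g - h)).ofLp

/-- The matrices `A_h`, `h ∈ S`, are the transition matrices of a quantum walk with coin `ℂˢ` on
the Cayley graph `Γ(G, S₊)`: the operator `∑_{h ∈ S} T_h ⊗ A_h` is unitary, and `A_h ≠ 0` for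
`h ∈ S₊ ∪ S₋` (whereas `A_e = 0` is allowed). -/
structure IsQuantumWalk {G : Type*} [AddCommGroup G] [DecidableEq G] {s : ℕ} (Sp : Finset G)
    (A : G → Matrix (Fin s) (Fin s) ℂ) : Prop where
  ne_zero : ∀ h ∈ Sp, A h ≠ 0
  neg_ne_zero : ∀ h ∈ Sp, A (-h) ≠ 0
  exists_unitary : ∃ W ∈ unitary (WalkSpace G s →L[ℂ] WalkSpace G s), IsWalkOperator Sp A W

/-- `l` is an automorphism of the Cayley graph `Γ(G, S₊)` (fixing the identity vertex) that can be
expressed as a permutation `p` of the colours `S₊`: `l (g h) = l (g) p (h)`. -/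
def IsColourAutomorphism {G : Type*} [AddCommGroup G] (Sp : Finset G) (l : Equiv.Perm G) : Prop :=
  l 0 = 0 ∧ ∃ p : Equiv.Perm Sp, ∀ (g : G) (h : Sp), l (g + h) = l g + p h

/-- The quantum walk with transition matrices `A` on `Γ(G, S₊)` is isotropic, with isotropy group
`L` represented on the coin space by the projective unitary representation `U`. -/
structure IsIsotropicWalk {G : Type*} [AddCommGroup G] [DecidableEq G] {s : ℕ} (Sp : Finset G)
    (A : G → Matrix (Fin s) (Fin s) ℂ) (L : Subgroup (Equiv.Perm G))
    (U : L → Matrix.unitaryGroup (Fin s) ℂ) : Prop where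
  isQuantumWalk : IsQuantumWalk Sp A
  colour : ∀ l ∈ L, IsColourAutomorphism Sp l
  /-- `U` is a projective representation. -/
  projective : ∀ l m : L, ∃ c : ℂ, ‖c‖ = 1 ∧
    (U (l * m) : Matrix (Fin s) (Fin s) ℂ) =
      c • ((U l : Matrix (Fin s) (Fin s) ℂ) * (U m : Matrix (Fin s) (Fin s) ℂ))
  /-- The evolution operator is `L`-covariant:
  `∑_{h ∈ S} T_h ⊗ A_h = ∑_{h ∈ S} T_{l(h)} ⊗ U_l A_h U_l†`. -/
  covariant : ∀ (l : L), ∀ h ∈ stepSet Sp,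
    A ((l : Equiv.Perm G) h) =
      (U l : Matrix (Fin s) (Fin s) ℂ) * A h * (U l : Matrix (Fin s) (Fin s) ℂ)ᴴ
  /-- `L` acts transitively on the set of generators of each given order. -/
  transitive : ∀ h ∈ Sp, ∀ h' ∈ Sp, addOrderOf h = addOrderOf h' → ∃ l ∈ L, l h = h'
  /-- Homogeneity: transition matrices of generators exchanged by `L` are distinguishable. -/
  homogeneous : ∀ (l : L), ∀ h ∈ Sp, (l : Equiv.Perm G) h ≠ h →
    ¬ Commute (U l : Matrix (Fin s) (Fin s) ℂ) (A h)

/-! ### The reference lattices -/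

/-- `ℝᵈ` carries a copy of `G` in which the generating set `S₊` is the set of vectors `N`. When
`S₊` generates `G`, the vertices of the Cayley graph are thereby the points of the lattice
generated by `N`, and the edges join each `x` to `x + v`, `v ∈ N`. -/
def RealizedBy {G : Type*} [AddCommGroup G] {d : ℕ} (Sp : Finset G)
    (N : Set (EuclideanSpace ℝ (Fin d))) : Prop :=
  ∃ φ : G →+ EuclideanSpace ℝ (Fin d), Function.Injective φ ∧ φ '' (Sp : Set G) = N

/-- Integer lattice with `S₊ = {h₁}`. -/
def integerSteps : Set (EuclideanSpace ℝ (Fin 1)) := {!₂[1]}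

/-- Integer lattice with `S₊ = S₋ = {h₁, -h₁}`. -/
def integerStepsSymm : Set (EuclideanSpace ℝ (Fin 1)) := {!₂[1], !₂[-1]}

/-- Simple square lattice with `S₊ = {h₁, h₂}`. -/
def squareSteps : Set (EuclideanSpace ℝ (Fin 2)) := {!₂[1, 0], !₂[0, 1]}

/-- Simple square lattice with `S₊ = S₋ = {h₁, h₂, -h₁, -h₂}`. -/
def squareStepsSymm : Set (EuclideanSpace ℝ (Fin 2)) :=
  {!₂[1, 0], !₂[0, 1], !₂[-1, 0], !₂[0, -1]}

/-- Body-centred cubic lattice with `S₊ = {h₁, h₂, h₃, h₄}`, `h₁ + h₂ + h₃ + h₄ = 0`; the set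
`S₊ ∪ S₋` consists of the eight nearest neighbours `(±1, ±1, ±1)` of the origin. -/
def bccSteps : Set (EuclideanSpace ℝ (Fin 3)) :=
  {!₂[1, 1, 1], !₂[1, -1, -1], !₂[-1, 1, -1], !₂[-1, -1, 1]}

/-! ### Ranges of the isotropy representations -/

/-- The Pauli matrix `σ_X`. -/
def pauliX : Matrix (Fin 2) (Fin 2) ℂ := !![0, 1; 1, 0]

/-- The Pauli matrix `σ_Y`. -/
def pauliY : Matrix (Fin 2) (Fin 2) ℂ := !![0, -Complex.I; Complex.I, 0]

/-- The Pauli matrix `σ_Z`. -/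
def pauliZ : Matrix (Fin 2) (Fin 2) ℂ := !![1, 0; 0, -1]

/-- `{I}` -/
def trivialRange : Set (Matrix (Fin 2) (Fin 2) ℂ) := {1}

/-- `{I, iσ_X}` -/
def rangeX : Set (Matrix (Fin 2) (Fin 2) ℂ) := {1, Complex.I • pauliX}

/-- `{I, iσ_Z}` -/
def rangeZ : Set (Matrix (Fin 2) (Fin 2) ℂ) := {1, Complex.I • pauliZ}

/-- The Heisenberg group `H = {I, iσ_X, iσ_Y, iσ_Z}` (as a set of representatives up to phases). -/
def heisenbergRange : Set (Matrix (Fin 2) (Fin 2) ℂ) :=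
  {1, Complex.I • pauliX, Complex.I • pauliY, Complex.I • pauliZ}

/-- `U_L = P` in the standard basis: whichever generator `h` is taken as `h₁`, after a unitary
change `B` of the basis of the coin space that makes the supports `|η_{±h}⟩` of `A_{±h}` the
eigenvectors of `σ_Z` (so `A_h` annihilates the second and `A_{-h}` the first basis vector), the
matrices `U_l`, `l ∈ L`, are up to phase factors exactly the elements of `P`. -/
def HasIsotropyRange {G : Type*} [AddCommGroup G] (Sp : Finset G)
    (A : G → Matrix (Fin 2) (Fin 2) ℂ) (L : Subgroup (Equiv.Perm G))
    (U : L → Matrix.unitaryGroup (Fin 2) ℂ) (P : Set (Matrix (Fin 2) (Fin 2) ℂ)) : Prop :=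
  ∀ h ∈ Sp, ∃ B ∈ Matrix.unitaryGroup (Fin 2) ℂ,
    (∀ i, (B * A h * Bᴴ) i 1 = 0) ∧ (∀ i, (B * A (-h) * Bᴴ) i 0 = 0) ∧
    (∀ l : L, ∃ p ∈ P, ∃ c : ℂ, ‖c‖ = 1 ∧ B * (U l : Matrix (Fin 2) (Fin 2) ℂ) * Bᴴ = c • p) ∧
    (∀ p ∈ P, ∃ l : L, ∃ c : ℂ, ‖c‖ = 1 ∧ B * (U l : Matrix (Fin 2) (Fin 2) ℂ) * Bᴴ = c • p)

/-- `Γ(G, S₊)` supports an isotropic quantum walk with a coin of dimension 2. -/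
def AdmitsIsotropicWalk {G : Type*} [AddCommGroup G] [DecidableEq G] (Sp : Finset G) : Prop :=
  ∃ (A : G → Matrix (Fin 2) (Fin 2) ℂ) (L : Subgroup (Equiv.Perm G))
    (U : L → Matrix.unitaryGroup (Fin 2) ℂ), IsIsotropicWalk Sp A L U

/-- There is an isotropic walk on `Γ(G, S₊)` with `U_L = P`. -/
def AdmitsIsotropyRange {G : Type*} [AddCommGroup G] [DecidableEq G] (Sp : Finset G)
    (P : Set (Matrix (Fin 2) (Fin 2) ℂ)) : Prop :=
  ∃ (A : G → Matrix (Fin 2) (Fin 2) ℂ) (L : Subgroup (Equiv.Perm G))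
    (U : L → Matrix.unitaryGroup (Fin 2) ℂ),
    IsIsotropicWalk Sp A L U ∧ HasIsotropyRange Sp A L U P

/-- There is an isotropic walk on `Γ(G, S₊)` with nonzero self-interaction `A_e`. -/
def SupportsSelfInteraction {G : Type*} [AddCommGroup G] [DecidableEq G] (Sp : Finset G) : Prop :=
  ∃ (A : G → Matrix (Fin 2) (Fin 2) ℂ) (L : Subgroup (Equiv.Perm G))
    (U : L → Matrix.unitaryGroup (Fin 2) ℂ), IsIsotropicWalk Sp A L U ∧ A 0 ≠ 0

/-- Every isotropic walk on `Γ(G, S₊)` has `U_L = P` for some `P` in the list `Ps`, and every `P`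
in the list occurs. -/
def IsotropyRangesAre {G : Type*} [AddCommGroup G] [DecidableEq G] (Sp : Finset G)
    (Ps : Set (Set (Matrix (Fin 2) (Fin 2) ℂ))) : Prop :=
  (∀ (A : G → Matrix (Fin 2) (Fin 2) ℂ) (L : Subgroup (Equiv.Perm G))
    (U : L → Matrix.unitaryGroup (Fin 2) ℂ), IsIsotropicWalk Sp A L U →
      ∃ P ∈ Ps, HasIsotropyRange Sp A L U P) ∧
  (∀ P ∈ Ps, AdmitsIsotropyRange Sp P)

/-! ### Invertible elements of group algebras -/

/-! Necessity rests on two algebraic facts and the geometry of vectors of equal length. Collect the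
transition matrices into a matrix over the group algebra, the symbol. Unitarity says that the symbol
is inverted by its adjoint, so its determinant is a unit, hence a monomial, and the symmetry of the
support under negation makes the monomial constant (`exists_det_walkSymbol`). Dividing by the sum of
all transition matrices, a unitary that commutes with the isotropy representation, gives a walk of
determinant one whose symbol at the trivial character is the identity
(`exists_normal_of_isIsotropicWalk`).

The first fact: each coefficient of the determinant is a sum of polarised determinants over
decompositions of a group element into two steps (`sum_polarDet`). An essentially unique
decomposition makes the two matrices orthogonal. All edges have the same length for an invariant
positive form, so `2h` decomposes only as `h + h`, edge matrices have rank one (`det_eq_zero`), and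
orthogonal ones share a kernel or a range.

The second fact: on the characters fixed by a nontrivial `l` the symbol commutes with the non-scalar
matrix `U l`. Its eigenvalues are then units of a group algebra, and its trace is a monomial plus
the inverse monomial (`exists_trace_eq_of_commute`). Since the real parts of the edge traces agree
and do not vanish, the edges have only the heights `0` and `± m` over the axis of `l`, and the
number at height zero is controlled by the trace of `A 0` (`exists_height`, `levelZero_card_lt`). In
dimension at least two the isotropy group therefore acts freely on edges (`eq_one_of_apply_eq`).

On the line, equal length leaves only one edge and its negative. In the plane, the bookkeeping of
shared kernels and ranges excludes hexagons (`add_notMem_edgeSet`) and then leaves only two pairs of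
edges (`exists_square`). In space, a double count shows that no edge is orthogonal to the axis of a
nontrivial rotation, so the edges lie on two opposite circles; comparing equal chords of such a
circle shows that every isotropy element squares to one (`mul_self_space`). The group is a Klein
four-group (`exists_klein`), each of whose edge orbits sums to zero: the body-centred cubic lattice.
Its representation is a Pauli one, and the remaining determinant relations put the kernel of each
generator matrix in a Pauli eigenspace (`exists_phase_of_rectangle`).

For existence in dimensions two and three the transition matrices are products of spectral
projections of Pauli matrices, so the walk is a composition of conditional shifts, and Pauli
conjugations act on the steps by sign changes (`exists_isIsotropicWalk_of_pauli`). On the line an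
explicit walk with self-interaction serves both generating sets. -/

theorem AddMonoidAlgebra.eq_single_of_mul_eq_one {G : Type*} [AddCommGroup G] [TwoUniqueSums G]
    {f g : AddMonoidAlgebra ℂ G} (h : f * g = 1) :
    ∃ x c, c ≠ 0 ∧ f = AddMonoidAlgebra.single x c ∧ g = AddMonoidAlgebra.single (-x) c⁻¹ := by
  classical
  have hf : f ≠ 0 := by rintro rfl; simp at h
  have hg : g ≠ 0 := by rintro rfl; simp at h
  have hfc : f.coeff.support.Nonempty := by
    rw [Finsupp.support_nonempty_iff]
    intro h0; apply hf; cases f; simp at h0; subst h0; rfl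
  have hgc : g.coeff.support.Nonempty := by
    rw [Finsupp.support_nonempty_iff]
    intro h0; apply hg; cases g; simp at h0; subst h0; rfl
  -- A sum of support elements attained only once cannot cancel in the product, so it must be the
  -- exponent of `1`.
  have key : ∀ p : G × G, p ∈ f.coeff.support ×ˢ g.coeff.support →
      UniqueAdd f.coeff.support g.coeff.support p.1 p.2 → p.1 + p.2 = 0 := by
    intro p hp hu
    by_contra hne
    have h1 := AddMonoidAlgebra.coeff_mul_add_of_uniqueAdd hu
    rw [h] at h1
    simp only [Finset.mem_product, Finsupp.mem_support_iff] at hp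
    rw [AddMonoidAlgebra.one_def, AddMonoidAlgebra.coeff_single, Finsupp.single_apply,
      if_neg (Ne.symm hne)] at h1
    exact mul_ne_zero hp.1 hp.2 h1.symm
  -- Otherwise there are two distinct pairs with unique sums; both sums are zero, which contradicts
  -- uniqueness.
  have hcard : f.coeff.support.card * g.coeff.support.card ≤ 1 := by
    by_contra hlt
    push Not at hlt
    obtain ⟨p, hp, r, hr, hpr, hup, hur⟩ := TwoUniqueSums.uniqueAdd_of_one_lt_card hlt
    have h1 := key p hp hup
    have h2 := key r hr hur
    simp only [Finset.mem_product] at hp hr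
    have := hup hr.1 hr.2 (by rw [h1, h2])
    exact hpr (Prod.ext this.1.symm this.2.symm)
  have hf1 : f.coeff.support.card = 1 := by
    have := hfc.card_pos; have := hgc.card_pos; nlinarith
  have hg1 : g.coeff.support.card = 1 := by
    have := hfc.card_pos; have := hgc.card_pos; nlinarith
  obtain ⟨x, hx⟩ := Finset.card_eq_one.1 hf1
  obtain ⟨y, hy⟩ := Finset.card_eq_one.1 hg1
  obtain ⟨hx0, hx⟩ := Finsupp.support_eq_singleton.1 hx
  obtain ⟨hy0, hy⟩ := Finsupp.support_eq_singleton.1 hy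
  have hfs : f = AddMonoidAlgebra.single x (f.coeff x) := by
    cases f; exact congrArg _ hx
  have hgs : g = AddMonoidAlgebra.single y (g.coeff y) := by
    cases g; exact congrArg _ hy
  generalize f.coeff x = a at hfs hx0
  generalize g.coeff y = b at hgs hy0
  subst hfs hgs
  rw [AddMonoidAlgebra.single_mul_single, AddMonoidAlgebra.one_def] at h
  have h' := congrArg AddMonoidAlgebra.coeff h
  rw [AddMonoidAlgebra.coeff_single, AddMonoidAlgebra.coeff_single, Finsupp.single_eq_single_iff] at h'
  rcases h' with ⟨h1, h2⟩ | ⟨h1, h2⟩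
  · refine ⟨x, a, hx0, rfl, ?_⟩
    rw [eq_neg_of_add_eq_zero_right h1, eq_inv_of_mul_eq_one_right h2]
  · simp at h2

/-! ### The symbol of a walk -/

section Symbol

set_option linter.unusedSectionVars false

variable {G : Type*} [AddCommGroup G] [DecidableEq G]

/-- The matrix Laurent polynomial `∑_{x ∈ S} A_x z^x`. -/
noncomputable def walkSymbol (S : Finset G) (A : G → Matrix (Fin 2) (Fin 2) ℂ) :
    Matrix (Fin 2) (Fin 2) (AddMonoidAlgebra ℂ G) :=
  fun i j => ∑ x ∈ S, AddMonoidAlgebra.single x (A x i j)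

theorem coeff_sum_single (S : Finset G) (f : G → ℂ) (hf : ∀ x ∉ S, f x = 0) (y : G) :
    (∑ x ∈ S, AddMonoidAlgebra.single x (f x)).coeff y = f y := by
  rw [AddMonoidAlgebra.coeff_sum, Finsupp.finsetSum_apply]
  simp only [AddMonoidAlgebra.coeff_single, Finsupp.single_apply]
  rw [Finset.sum_ite_eq' S y]
  split_ifs with h
  · rfl
  · exact (hf y h).symm

theorem coeff_walkSymbol {S : Finset G} {A : G → Matrix (Fin 2) (Fin 2) ℂ}
    (hA : ∀ x ∉ S, A x = 0) (i j : Fin 2) (y : G) : (walkSymbol S A i j).coeff y = A y i j :=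
  coeff_sum_single S (fun x => A x i j) (fun x hx => by simp [hA x hx]) y

theorem coeff_sum_single_mul (S : Finset G) (f : G → ℂ)
    (g : AddMonoidAlgebra ℂ G) (y : G) :
    ((∑ x ∈ S, AddMonoidAlgebra.single x (f x)) * g).coeff y =
      ∑ x ∈ S, f x * g.coeff (y - x) := by
  rw [Finset.sum_mul, AddMonoidAlgebra.coeff_sum, Finsupp.finsetSum_apply]
  refine Finset.sum_congr rfl fun x _ => ?_
  rw [AddMonoidAlgebra.coeff_single_mul_apply, neg_add_eq_sub]

theorem map_walkSymbol {R : Type*} [CommRing R] [Algebra ℂ R] (S : Finset G)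
    (A : G → Matrix (Fin 2) (Fin 2) ℂ) (f : AddMonoidAlgebra ℂ G →+* R) (i j : Fin 2) :
    (walkSymbol S A).map f i j = ∑ x ∈ S, f (AddMonoidAlgebra.single x (A x i j)) := by
  simp [walkSymbol]

/-- The sum of the coefficients. -/
noncomputable def augmentation (G : Type*) [AddCommGroup G] : AddMonoidAlgebra ℂ G →+* ℂ :=
  (AddMonoidAlgebra.lift ℂ ℂ G 1).toRingHom

theorem augmentation_single (x : G) (c : ℂ) :
    augmentation G (AddMonoidAlgebra.single x c) = c := by
  simp [augmentation]

theorem map_augmentation_walkSymbol (S : Finset G) (A : G → Matrix (Fin 2) (Fin 2) ℂ) :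
    (walkSymbol S A).map (augmentation G) = ∑ x ∈ S, A x := by
  ext i j
  simp [walkSymbol, augmentation_single, Matrix.sum_apply]

theorem det_coeff_walkSymbol {S : Finset G} {A : G → Matrix (Fin 2) (Fin 2) ℂ}
    (hA : ∀ x ∉ S, A x = 0) (g : G) :
    (walkSymbol S A).det.coeff g =
      ∑ x ∈ S, (A x 0 0 * A (g - x) 1 1 - A x 0 1 * A (g - x) 1 0) := by
  rw [Matrix.det_fin_two, AddMonoidAlgebra.coeff_sub, Finsupp.sub_apply]
  unfold walkSymbol
  rw [coeff_sum_single_mul, coeff_sum_single_mul, ← Finset.sum_sub_distrib]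
  refine Finset.sum_congr rfl fun x _ => ?_
  have h1 := coeff_walkSymbol hA 1 1 (g - x)
  have h2 := coeff_walkSymbol hA 1 0 (g - x)
  unfold walkSymbol at h1 h2
  rw [h1, h2]

/-- The transition matrices of the adjoint walk. -/
theorem walkSymbol_star_mul {S : Finset G} {A : G → Matrix (Fin 2) (Fin 2) ℂ}
    (hS : ∀ x ∈ S, -x ∈ S) (hA : ∀ x ∉ S, A x = 0)
    (hconv : ∀ y, ∑ g ∈ S, (A g)ᴴ * A (g - y) = if y = 0 then 1 else 0) :
    walkSymbol S (fun x => (A (-x))ᴴ) * walkSymbol S A = 1 := by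
  ext i j y
  have h1 := hconv (-y)
  rw [Matrix.mul_apply, AddMonoidAlgebra.coeff_sum, Finsupp.finsetSum_apply]
  have h2 : ∀ k, (walkSymbol S (fun x => (A (-x))ᴴ) i k * walkSymbol S A k j).coeff y =
      ∑ x ∈ S, (A (-x))ᴴ i k * A (y - x) k j := by
    intro k
    conv_lhs => rw [walkSymbol]
    rw [coeff_sum_single_mul]
    simp only [coeff_walkSymbol hA]
  simp only [h2]
  rw [Finset.sum_comm]
  have h3 : ∑ x ∈ S, ∑ k, (A (-x))ᴴ i k * A (y - x) k j =
      (∑ g ∈ S, (A g)ᴴ * A (g - -y)) i j := by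
    rw [Matrix.sum_apply]
    refine Finset.sum_bij' (fun x _ => -x) (fun x _ => -x) (fun x hx => hS x hx)
      (fun x hx => hS x hx) (by simp) (by simp) ?_
    intro x _
    rw [Matrix.mul_apply, show -x - -y = y - x by abel]
  rw [h3, h1]
  by_cases hy : y = 0
  · subst hy
    by_cases hij : i = j
    · subst hij; simp
    · simp [hij]
  · by_cases hij : i = j
    · subst hij; simp [hy, AddMonoidAlgebra.one_def]
    · simp [hij, hy]

/-- The determinant is a unit of the group algebra, hence a monomial with exponent `m`. The adjugate
is the determinant times the inverse, and the inverse is the adjoint symbol; coefficientwise this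
relates the adjugate at `y` to the adjoint at `m - y`. It remains to see that `m` vanishes. -/
theorem exists_det_walkSymbol [TwoUniqueSums G] [IsAddTorsionFree G] {S : Finset G}
    {A : G → Matrix (Fin 2) (Fin 2) ℂ}
    (hS : ∀ x ∈ S, -x ∈ S) (hA : ∀ x ∉ S, A x = 0)
    (hconv : ∀ y, ∑ g ∈ S, (A g)ᴴ * A (g - y) = if y = 0 then 1 else 0)
    (hsymm : ∀ x, A x ≠ 0 → A (-x) ≠ 0) :
    ∃ c : ℂ, c ≠ 0 ∧ (∀ y, (A y).adjugate = c • (A (-y))ᴴ) ∧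
      (walkSymbol S A).det = AddMonoidAlgebra.single 0 c := by
  have hM := walkSymbol_star_mul hS hA hconv
  have hdet := congrArg Matrix.det hM
  rw [Matrix.det_mul, Matrix.det_one, mul_comm] at hdet
  obtain ⟨m, c, hc, hd, -⟩ := AddMonoidAlgebra.eq_single_of_mul_eq_one hdet
  have hadj : (walkSymbol S A).det • walkSymbol S (fun x => (A (-x))ᴴ) =
      (walkSymbol S A).adjugate := by
    have := congrArg (· * (walkSymbol S A).adjugate) hM
    simp only [mul_assoc, Matrix.mul_adjugate, one_mul] at this
    rw [← this]; simp
  have hA' : ∀ x ∉ S, (A (-x))ᴴ = 0 := by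
    intro x hx
    rw [hA (-x) (fun h => hx (by simpa using hS _ h)), Matrix.conjTranspose_zero]
  have hcoef : ∀ y i j, c * (A (m - y))ᴴ i j = (A y).adjugate i j := by
    intro y i j
    have h := congrArg (fun M => (M i j).coeff y) hadj
    simp only [Matrix.smul_apply, hd, smul_eq_mul] at h
    rw [AddMonoidAlgebra.coeff_single_mul_apply, coeff_walkSymbol hA', neg_add_eq_sub, neg_sub] at h
    rw [h, Matrix.adjugate_fin_two, Matrix.adjugate_fin_two]
    fin_cases i <;> fin_cases j <;> simp [coeff_walkSymbol hA]
  have hmat : ∀ y, (A y).adjugate = c • (A (m - y))ᴴ := by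
    intro y; ext i j; rw [← hcoef]; simp
  -- The adjugate is an involution on two-by-two matrices, so it vanishes only at zero.
  have hne : ∀ y, A y ≠ 0 → A (m - y) ≠ 0 := by
    intro y hy h0
    apply hy
    have := hmat y
    rw [h0] at this
    simp only [Matrix.conjTranspose_zero, smul_zero] at this
    have h2 := congrArg Matrix.adjugate this
    rw [Matrix.adjugate_adjugate', Matrix.adjugate_zero] at h2
    simpa using h2
  classical
  -- The finite support is stable under negation and under `y ↦ m - y`, hence under translation by
  -- `-m`. Comparing the sum of its elements before and after gives a positive multiple of `m` equal
  -- to zero.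
  have hm : m = 0 := by
    set T := S.filter (fun x => A x ≠ 0) with hT
    have hmem : ∀ x, x ∈ T ↔ A x ≠ 0 := by
      intro x
      simp only [hT, Finset.mem_filter, and_iff_right_iff_imp]
      intro h; by_contra hx; exact h (hA x hx)
    have hT0 : T.Nonempty := by
      by_contra hemp
      have h0 := hconv 0
      have : ∀ x ∈ S, (A x)ᴴ * A (x - 0) = 0 := by
        intro x hx
        have : A x = 0 := by
          by_contra hx0
          exact hemp ⟨x, (hmem x).2 hx0⟩
        simp [this]
      rw [Finset.sum_eq_zero this] at h0
      have := congrFun (congrFun h0 0) 0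
      simp at this
    have himg : ∀ y ∈ T, y - m ∈ T := by
      intro y hy
      rw [hmem] at hy ⊢
      rw [← neg_sub]
      exact hsymm _ (hne _ hy)
    have hTT : T.image (fun y => y - m) = T := by
      apply Finset.eq_of_subset_of_card_le
      · intro y hy
        obtain ⟨z, hz, rfl⟩ := Finset.mem_image.1 hy
        exact himg z hz
      · rw [Finset.card_image_of_injective _ (sub_left_injective)]
    have hsum : ∑ y ∈ T, y = ∑ y ∈ T, (y - m) := by
      conv_lhs => rw [← hTT]
      rw [Finset.sum_image (fun a _ b _ h => sub_left_injective h)]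
    rw [Finset.sum_sub_distrib, Finset.sum_const] at hsum
    have h1 : T.card • m = 0 := by
      rw [eq_comm, sub_eq_self] at hsum
      exact hsum
    exact (nsmul_eq_zero_iff_right hT0.card_pos.ne').1 h1
  subst hm
  exact ⟨c, hc, fun y => by simpa using hmat y, hd⟩

/-- Unitarity of the evolution operator in terms of the transition matrices. -/
theorem IsWalkOperator.convolution_eq {Sp : Finset G} {A : G → Matrix (Fin 2) (Fin 2) ℂ}
    {W : WalkSpace G 2 →L[ℂ] WalkSpace G 2} (hA : ∀ x ∉ stepSet Sp, A x = 0)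
    (hW : IsWalkOperator Sp A W) (hU : W ∈ unitary (WalkSpace G 2 →L[ℂ] WalkSpace G 2)) (y : G) :
    ∑ g ∈ stepSet Sp, (A g)ᴴ * A (g - y) = if y = 0 then 1 else 0 := by
  have hsingle : ∀ (x : G) (v : EuclideanSpace ℂ (Fin 2)) (g : G),
      ((W (lp.single 2 x v) : WalkSpace G 2) g).ofLp = A (g - x) *ᵥ v.ofLp := by
    intro x v g
    rw [hW]
    by_cases hg : g - x ∈ stepSet Sp
    · rw [Finset.sum_eq_single_of_mem _ hg]
      · rw [show g - (g - x) = x by abel, lp.single_apply_self]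
      · intro h _ hne
        rw [lp.single_apply_ne]
        · simp
        · intro h2; apply hne; rw [← h2]; abel
    · rw [hA _ hg, Matrix.zero_mulVec]
      refine Finset.sum_eq_zero fun h hh => ?_
      rw [lp.single_apply_ne]
      · simp
      · intro h2; apply hg; rw [← h2]; simpa using hh
  have hinner : ∀ v w : EuclideanSpace ℂ (Fin 2),
      inner ℂ (W (lp.single 2 0 v)) (W (lp.single 2 y w)) =
        inner ℂ (lp.single 2 (0 : G) v : WalkSpace G 2) (lp.single 2 y w) := by
    intro v w
    rw [← ContinuousLinearMap.adjoint_inner_right, ← ContinuousLinearMap.star_eq_adjoint,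
      ← mul_apply_eq_comp, Unitary.star_mul_self_of_mem hU,
      one_apply_eq_self]
  ext i j
  have h := hinner (EuclideanSpace.single i 1) (EuclideanSpace.single j 1)
  rw [lp.inner_single_left] at h
  have hs := lp.hasSum_inner (𝕜 := ℂ) (W (lp.single 2 0 (EuclideanSpace.single i 1)))
    (W (lp.single 2 y (EuclideanSpace.single j 1)))
  have hterm : ∀ g : G, inner ℂ ((W (lp.single 2 0 (EuclideanSpace.single i 1)) : WalkSpace G 2) g)
      ((W (lp.single 2 y (EuclideanSpace.single j 1)) : WalkSpace G 2) g) =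
      ((A g)ᴴ * A (g - y)) i j := by
    intro g
    rw [EuclideanSpace.inner_eq_star_dotProduct, hsingle, hsingle]
    simp [Matrix.mul_apply, dotProduct, Matrix.mulVec_single, mul_comm]
  simp only [hterm] at hs
  have hs2 : HasSum (fun g => ((A g)ᴴ * A (g - y)) i j)
      (∑ g ∈ stepSet Sp, ((A g)ᴴ * A (g - y)) i j) := by
    apply hasSum_sum_of_ne_finset_zero
    intro g hg
    simp [hA g hg]
  rw [Matrix.sum_apply, hs2.unique hs, h]
  by_cases hy : y = 0
  · subst hy
    rw [lp.single_apply_self, EuclideanSpace.inner_single_left]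
    simp [Matrix.one_apply]
  · rw [lp.single_apply_ne _ _ _ (Ne.symm hy)]
    simp [hy]

end Symbol

/-! ### Constructing walks from their transition matrices -/

section Construction

variable {G : Type*} [AddCommGroup G]

theorem summable_shift_norm (ψ : WalkSpace G 2) (h : G) :
    Summable fun g => ‖(ψ : WalkSpace G 2) (g - h)‖ ^ 2 := by
  have := (lp.memℓp ψ).summable (by simp)
  simp only [ENNReal.toReal_ofNat, Real.rpow_ofNat] at this
  exact this.comp_injective (Equiv.subRight h).injective

/-- The function `g ↦ B ψ(g - h)`. -/
noncomputable def shiftFun (h : G) (B : Matrix (Fin 2) (Fin 2) ℂ) (ψ : WalkSpace G 2) :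
    G → EuclideanSpace ℂ (Fin 2) :=
  fun g => Matrix.toEuclideanCLM (n := Fin 2) (𝕜 := ℂ) B ((ψ : WalkSpace G 2) (g - h))

theorem norm_shiftFun_sq_le (h : G) (B : Matrix (Fin 2) (Fin 2) ℂ) (ψ : WalkSpace G 2) (g : G) :
    ‖shiftFun h B ψ g‖ ^ 2 ≤
      ‖Matrix.toEuclideanCLM (n := Fin 2) (𝕜 := ℂ) B‖ ^ 2 * ‖(ψ : WalkSpace G 2) (g - h)‖ ^ 2 := by
  rw [← mul_pow]
  exact pow_le_pow_left₀ (norm_nonneg _) (ContinuousLinearMap.le_opNorm _ _) 2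

theorem memℓp_shiftFun (h : G) (B : Matrix (Fin 2) (Fin 2) ℂ) (ψ : WalkSpace G 2) :
    Memℓp (shiftFun h B ψ) 2 := by
  apply memℓp_gen
  simp only [ENNReal.toReal_ofNat, Real.rpow_ofNat]
  exact Summable.of_nonneg_of_le (fun _ => sq_nonneg _) (norm_shiftFun_sq_le h B ψ)
    ((summable_shift_norm ψ h).mul_left _)

/-- The operator `T_h ⊗ B`. -/
noncomputable def shiftOp (h : G) (B : Matrix (Fin 2) (Fin 2) ℂ) :
    WalkSpace G 2 →L[ℂ] WalkSpace G 2 :=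
  LinearMap.mkContinuous
    { toFun := fun ψ => ⟨shiftFun h B ψ, memℓp_shiftFun h B ψ⟩
      map_add' := fun ψ φ => by
        ext1; funext g
        change shiftFun h B (ψ + φ) g = shiftFun h B ψ g + shiftFun h B φ g
        simp [shiftFun]
      map_smul' := fun c ψ => by
        ext1; funext g
        simp [shiftFun] }
    ‖Matrix.toEuclideanCLM (n := Fin 2) (𝕜 := ℂ) B‖ (fun ψ => by
      apply lp.norm_le_of_tsum_le (by simp) (by positivity)
      simp only [ENNReal.toReal_ofNat, Real.rpow_ofNat]
      have h1 : ∑' g, ‖(ψ : WalkSpace G 2) (g - h)‖ ^ 2 = ‖ψ‖ ^ 2 := by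
        have h2 := lp.norm_rpow_eq_tsum (p := 2) (by simp) ψ
        simp only [ENNReal.toReal_ofNat, Real.rpow_ofNat] at h2
        rw [h2]
        exact (Equiv.subRight h).tsum_eq (fun g => ‖(ψ : WalkSpace G 2) g‖ ^ 2)
      rw [mul_pow, ← h1, ← tsum_mul_left]
      refine Summable.tsum_le_tsum (norm_shiftFun_sq_le h B ψ) ?_
        ((summable_shift_norm ψ h).mul_left _)
      exact Summable.of_nonneg_of_le (fun _ => sq_nonneg _) (norm_shiftFun_sq_le h B ψ)
        ((summable_shift_norm ψ h).mul_left _))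

theorem shiftOp_apply (h : G) (B : Matrix (Fin 2) (Fin 2) ℂ) (ψ : WalkSpace G 2) (g : G) :
    ((shiftOp h B ψ : WalkSpace G 2) g) =
      Matrix.toEuclideanCLM (n := Fin 2) (𝕜 := ℂ) B ((ψ : WalkSpace G 2) (g - h)) := rfl

theorem star_shiftOp (h : G) (B : Matrix (Fin 2) (Fin 2) ℂ) :
    star (shiftOp h B) = shiftOp (-h) Bᴴ := by
  rw [ContinuousLinearMap.star_eq_adjoint, eq_comm, ContinuousLinearMap.eq_adjoint_iff]
  intro ψ φ
  rw [lp.inner_eq_tsum, lp.inner_eq_tsum, ← (Equiv.subRight h).tsum_eq]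
  refine tsum_congr fun g => ?_
  rw [shiftOp_apply, shiftOp_apply, ← Matrix.star_eq_conjTranspose, map_star,
    ContinuousLinearMap.star_eq_adjoint, ContinuousLinearMap.adjoint_inner_left]
  simp

theorem shiftOp_mul (h k : G) (B C : Matrix (Fin 2) (Fin 2) ℂ) :
    shiftOp h B * shiftOp k C = shiftOp (h + k) (B * C) := by
  ext1 ψ
  ext1; funext g
  rw [mul_apply_eq_comp, shiftOp_apply, shiftOp_apply, shiftOp_apply, map_mul, mul_apply_eq_comp,
    sub_sub]

theorem shiftOp_zero_one : shiftOp (0 : G) 1 = 1 := by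
  ext1 ψ
  ext1; funext g
  rw [shiftOp_apply, map_one, one_apply_eq_self, one_apply_eq_self, sub_zero]

theorem shiftOp_zero (h : G) : shiftOp h 0 = 0 := by
  ext1 ψ
  ext1; funext g
  rw [shiftOp_apply, map_zero]
  rfl

theorem shiftOp_add (h : G) (B C : Matrix (Fin 2) (Fin 2) ℂ) :
    shiftOp h (B + C) = shiftOp h B + shiftOp h C := by
  ext1 ψ
  ext1; funext g
  rw [shiftOp_apply, map_add]
  rfl

theorem shiftOp_sum {ι : Type*} (s : Finset ι) (h : G) (B : ι → Matrix (Fin 2) (Fin 2) ℂ) :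
    shiftOp h (∑ i ∈ s, B i) = ∑ i ∈ s, shiftOp h (B i) := by
  classical
  induction s using Finset.induction_on with
  | empty => simp [shiftOp_zero]
  | insert a s ha ih => rw [Finset.sum_insert ha, Finset.sum_insert ha, shiftOp_add, ih]

variable [DecidableEq G]

/-- Grouping the double sum by the difference of the two steps turns it into a sum of shifts of
convolutions. The homomorphism `e` is negation for `star W * W` and the identity for `W * star W`.
-/
theorem sum_shiftOp_eq_one {S : Finset G} {B C : G → Matrix (Fin 2) (Fin 2) ℂ} (e : G →+ G)
    (hC : ∀ x ∉ S, C x = 0)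
    (h : ∀ y, ∑ g ∈ S, B g * C (g - y) = if y = 0 then 1 else 0) :
    ∑ g ∈ S, ∑ g' ∈ S, shiftOp (e (g - g')) (B g * C g') = 1 := by
  -- Inserting `0` guarantees the surviving term even before `S` is known to be nonempty.
  set D := insert 0 ((S ×ˢ S).image fun p => p.1 - p.2) with hD
  have h1 : ∀ g ∈ S, ∑ g' ∈ S, shiftOp (e (g - g')) (B g * C g') =
      ∑ y ∈ D, shiftOp (e y) (B g * C (g - y)) := by
    intro g hg
    have h2 : ∑ y ∈ S.image (fun g' => g - g'), shiftOp (e y) (B g * C (g - y)) =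
        ∑ g' ∈ S, shiftOp (e (g - g')) (B g * C g') := by
      rw [Finset.sum_image (fun a _ b _ hab => sub_right_injective hab)]
      simp
    rw [← h2]
    apply Finset.sum_subset
    · intro y hy
      obtain ⟨g', hg', rfl⟩ := Finset.mem_image.1 hy
      exact Finset.mem_insert_of_mem (Finset.mem_image.2 ⟨(g, g'), by simp [hg, hg'], rfl⟩)
    · intro y _ hy
      have : g - y ∉ S := fun hgy => hy (Finset.mem_image.2 ⟨g - y, hgy, by abel⟩)
      rw [hC _ this, mul_zero, shiftOp_zero]
  rw [Finset.sum_congr rfl h1, Finset.sum_comm]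
  simp only [← shiftOp_sum, h]
  rw [Finset.sum_eq_single_of_mem 0 (Finset.mem_insert_self _ _)]
  · simp [shiftOp_zero_one]
  · intro y _ hy
    simp [hy, shiftOp_zero]

/-- An isometry of an infinite-dimensional space need not be surjective, so both convolution
identities are assumed, one for each order of the product with the adjoint. -/
theorem exists_unitary_of_convolution {Sp : Finset G} {A : G → Matrix (Fin 2) (Fin 2) ℂ}
    (hA : ∀ x ∉ stepSet Sp, A x = 0)
    (h₁ : ∀ y, ∑ g ∈ stepSet Sp, (A g)ᴴ * A (g - y) = if y = 0 then 1 else 0)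
    (h₂ : ∀ y, ∑ g ∈ stepSet Sp, A g * (A (g - y))ᴴ = if y = 0 then 1 else 0) :
    ∃ W ∈ unitary (WalkSpace G 2 →L[ℂ] WalkSpace G 2), IsWalkOperator Sp A W := by
  refine ⟨∑ g ∈ stepSet Sp, shiftOp g (A g), ?_, ?_⟩
  · rw [Unitary.mem_iff, star_sum]
    simp only [star_shiftOp]
    rw [Finset.sum_mul_sum, Finset.sum_mul_sum]
    simp only [shiftOp_mul]
    constructor
    · rw [← sum_shiftOp_eq_one (negAddMonoidHom : G →+ G) hA h₁]
      refine Finset.sum_congr rfl fun g _ => Finset.sum_congr rfl fun g' _ => ?_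
      simp [neg_add_eq_sub]
    · rw [← sum_shiftOp_eq_one (AddMonoidHom.id G) (C := fun x => (A x)ᴴ)
        (fun x hx => by simp [hA x hx]) h₂]
      refine Finset.sum_congr rfl fun g _ => Finset.sum_congr rfl fun g' _ => ?_
      simp [sub_eq_add_neg]
  · intro ψ g
    rw [sum_apply, lp.coeFn_sum, Finset.sum_apply, WithLp.ofLp_sum]
    refine Finset.sum_congr rfl fun h _ => ?_
    rw [shiftOp_apply]
    simp

end Construction

/-! ### Normalised walks -/

section Normal

set_option linter.unusedSectionVars false

variable {G : Type*} [AddCommGroup G] [DecidableEq G]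

/-- The set `S₊ ∪ S₋`. -/
def edgeSet (Sp : Finset G) : Finset G := Sp ∪ Sp.image (fun h => -h)

theorem mem_edgeSet {Sp : Finset G} {x : G} : x ∈ edgeSet Sp ↔ x ∈ Sp ∨ -x ∈ Sp := by
  simp only [edgeSet, Finset.mem_union, Finset.mem_image]
  constructor
  · rintro (h | ⟨y, hy, rfl⟩)
    · exact Or.inl h
    · exact Or.inr (by simpa using hy)
  · rintro (h | h)
    · exact Or.inl h
    · exact Or.inr ⟨-x, h, neg_neg x⟩

theorem neg_mem_edgeSet {Sp : Finset G} {x : G} (h : x ∈ edgeSet Sp) : -x ∈ edgeSet Sp := by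
  rw [mem_edgeSet] at h ⊢
  rw [neg_neg]; exact h.symm

theorem mem_stepSet {Sp : Finset G} {x : G} : x ∈ stepSet Sp ↔ x = 0 ∨ x ∈ edgeSet Sp := by
  rw [stepSet, Finset.mem_insert]; rfl

theorem neg_mem_stepSet {Sp : Finset G} {x : G} (h : x ∈ stepSet Sp) : -x ∈ stepSet Sp := by
  rw [mem_stepSet] at h ⊢
  rcases h with rfl | h
  · simp
  · exact Or.inr (neg_mem_edgeSet h)

theorem zero_notMem_edgeSet {Sp : Finset G} (h : IsGeneratingSet Sp) : (0 : G) ∉ edgeSet Sp := by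
  rw [mem_edgeSet]; simpa using h.zero_notMem

theorem sum_stepSet {M : Type*} [AddCommMonoid M] {Sp : Finset G} (h : IsGeneratingSet Sp)
    (f : G → M) : ∑ x ∈ stepSet Sp, f x = f 0 + ∑ x ∈ edgeSet Sp, f x := by
  rw [stepSet, Finset.sum_insert]
  · rfl
  · exact zero_notMem_edgeSet h

/-- An isotropic walk all of whose symbols have determinant one, and whose symbol at the trivial
character is the identity. -/
structure IsNormalWalk (Sp : Finset G) (A : G → Matrix (Fin 2) (Fin 2) ℂ)
    (L : Subgroup (Equiv.Perm G)) (U : L → Matrix.unitaryGroup (Fin 2) ℂ) : Prop where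
  gen : IsGeneratingSet Sp
  map_add : ∀ l : L, ∀ x y, (l : Equiv.Perm G) (x + y) = (l : Equiv.Perm G) x + (l : Equiv.Perm G) y
  map_mem : ∀ l : L, ∀ h ∈ Sp, (l : Equiv.Perm G) h ∈ Sp
  trans : ∀ h ∈ Sp, ∀ h' ∈ Sp, ∃ l : L, (l : Equiv.Perm G) h = h'
  projective : ∀ l m : L, ∃ c : ℂ, ‖c‖ = 1 ∧
    (U (l * m) : Matrix (Fin 2) (Fin 2) ℂ) =
      c • ((U l : Matrix (Fin 2) (Fin 2) ℂ) * (U m : Matrix (Fin 2) (Fin 2) ℂ))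
  ne_zero : ∀ h ∈ edgeSet Sp, A h ≠ 0
  eq_zero : ∀ x ∉ stepSet Sp, A x = 0
  adjugate_eq : ∀ x, (A x).adjugate = (A (-x))ᴴ
  sum_eq : ∑ x ∈ stepSet Sp, A x = 1
  det_eq : (walkSymbol (stepSet Sp) A).det = 1
  covariant : ∀ (l : L) (x : G), A ((l : Equiv.Perm G) x) =
      (U l : Matrix (Fin 2) (Fin 2) ℂ) * A x * (U l : Matrix (Fin 2) (Fin 2) ℂ)ᴴ
  faithful : ∀ l : L, (∃ c : ℂ, (U l : Matrix (Fin 2) (Fin 2) ℂ) = c • 1) → l = 1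

theorem IsColourAutomorphism.map_add {Sp : Finset G} {l : Equiv.Perm G}
    (hl : IsColourAutomorphism Sp l) (hg : IsGeneratingSet Sp) (x y : G) :
    l (x + y) = l x + l y := by
  obtain ⟨h0, p, hp⟩ := hl
  have hy : y ∈ AddSubgroup.closure (Sp : Set G) := by rw [hg.closure_eq_top]; trivial
  induction hy using AddSubgroup.closure_induction generalizing x with
  | mem y hy =>
    have h1 := hp x ⟨y, hy⟩
    have h2 := hp 0 ⟨y, hy⟩
    simp only [zero_add, h0] at h1 h2
    rw [h1, h2]
  | zero => simp [h0]
  | add a b _ _ iha ihb => rw [← add_assoc, ihb, iha, ihb, add_assoc]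
  | neg a _ iha =>
    have h1 := iha (x + -a)
    have h2 := iha (-a)
    rw [neg_add_cancel, h0] at h2
    rw [neg_add_cancel_right] at h1
    rw [h1, add_assoc, add_comm (l a), ← h2, add_zero]

theorem IsColourAutomorphism.map_mem {Sp : Finset G} {l : Equiv.Perm G}
    (hl : IsColourAutomorphism Sp l) {h : G} (hh : h ∈ Sp) : l h ∈ Sp := by
  obtain ⟨h0, p, hp⟩ := hl
  have h2 := hp 0 ⟨h, hh⟩
  simp only [zero_add, h0] at h2
  rw [h2]; exact (p _).2

/-- The factor to split off is the value of the symbol at the trivial character. It is unitary with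
determinant `c`, and it commutes with every `U l` because `l` only permutes the steps, so covariance
survives the division. -/
theorem exists_normal_of_isIsotropicWalk [TwoUniqueSums G] [IsAddTorsionFree G] {Sp : Finset G}
    (hg : IsGeneratingSet Sp)
    {A : G → Matrix (Fin 2) (Fin 2) ℂ} {L : Subgroup (Equiv.Perm G)}
    {U : L → Matrix.unitaryGroup (Fin 2) ℂ} (h : IsIsotropicWalk Sp A L U) :
    ∃ (W : Matrix (Fin 2) (Fin 2) ℂ) (A' : G → Matrix (Fin 2) (Fin 2) ℂ),
      IsNormalWalk Sp A' L U ∧ Wᴴ * W = 1 ∧ ∀ x ∈ stepSet Sp, A x = W * A' x := by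
  have hadd : ∀ l : L, ∀ x y, (l : Equiv.Perm G) (x + y) =
      (l : Equiv.Perm G) x + (l : Equiv.Perm G) y :=
    fun l x y => (h.colour l l.2).map_add hg x y
  have hzero : ∀ l : L, (l : Equiv.Perm G) 0 = 0 := fun l => (h.colour l l.2).1
  have hneg : ∀ l : L, ∀ x, (l : Equiv.Perm G) (-x) = -(l : Equiv.Perm G) x := by
    intro l x
    have := hadd l (-x) x
    rw [neg_add_cancel, hzero] at this
    exact eq_neg_of_add_eq_zero_left this.symm
  have hmem : ∀ l : L, ∀ x ∈ Sp, (l : Equiv.Perm G) x ∈ Sp :=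
    fun l x hx => (h.colour l l.2).map_mem hx
  have hstep : ∀ l : L, ∀ x ∈ stepSet Sp, (l : Equiv.Perm G) x ∈ stepSet Sp := by
    intro l x hx
    rw [mem_stepSet, mem_edgeSet] at hx ⊢
    rcases hx with rfl | hx | hx
    · exact Or.inl (hzero l)
    · exact Or.inr (Or.inl (hmem l x hx))
    · exact Or.inr (Or.inr (by rw [← hneg]; exact hmem l _ hx))
  have hstep' : ∀ l : L, ∀ x ∉ stepSet Sp, (l : Equiv.Perm G) x ∉ stepSet Sp := by
    intro l x hx hlx
    apply hx
    have := hstep l⁻¹ _ hlx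
    simpa using this
  -- The hypotheses see `A` only on the steps; extension by zero makes all later identities valid on
  -- the whole group.
  set B : G → Matrix (Fin 2) (Fin 2) ℂ := fun x => if x ∈ stepSet Sp then A x else 0 with hB
  have hBS : ∀ x ∈ stepSet Sp, B x = A x := fun x hx => if_pos hx
  have hB0 : ∀ x ∉ stepSet Sp, B x = 0 := fun x hx => if_neg hx
  obtain ⟨W, hWu, hW⟩ := h.isQuantumWalk.exists_unitary
  have hW' : IsWalkOperator Sp B W := by
    intro ψ g
    rw [hW]
    exact Finset.sum_congr rfl fun x hx => by rw [hBS x hx]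
  have hconv := hW'.convolution_eq hB0 hWu
  have hBne : ∀ x ∈ edgeSet Sp, B x ≠ 0 := by
    intro x hx
    rw [hBS x (mem_stepSet.2 (Or.inr hx))]
    rcases mem_edgeSet.1 hx with hx | hx
    · exact h.isQuantumWalk.ne_zero x hx
    · simpa using h.isQuantumWalk.neg_ne_zero _ hx
  have hsymm : ∀ x, B x ≠ 0 → B (-x) ≠ 0 := by
    intro x hx
    by_cases hxS : x ∈ stepSet Sp
    · rcases mem_stepSet.1 hxS with rfl | hx'
      · simpa using hx
      · exact hBne _ (neg_mem_edgeSet hx')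
    · exact absurd (hB0 x hxS) hx
  obtain ⟨c, hc, hadj, hdet⟩ :=
    exists_det_walkSymbol (fun x hx => neg_mem_stepSet hx) hB0 hconv hsymm
  set W₀ := ∑ x ∈ stepSet Sp, B x with hW₀
  -- The augmentation evaluates at the trivial character; applied to the inversion relation of the
  -- symbol it yields unitarity of `W₀`.
  have hWW : W₀ᴴ * W₀ = 1 := by
    have h1 := congrArg (fun M => M.map (augmentation G))
      (walkSymbol_star_mul (fun x hx => neg_mem_stepSet hx) hB0 hconv)
    simp only [Matrix.map_mul, map_augmentation_walkSymbol] at h1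
    rw [Matrix.map_one _ (map_zero _) (map_one _)] at h1
    rw [← h1, hW₀, Matrix.conjTranspose_sum]
    congr 1
    exact Finset.sum_bij' (fun x _ => -x) (fun x _ => -x) (fun x hx => neg_mem_stepSet hx)
      (fun x hx => neg_mem_stepSet hx) (by simp) (by simp) (by simp)
  have hWW' : W₀ * W₀ᴴ = 1 := mul_eq_one_comm.1 hWW
  have hdetW : W₀.det = c := by
    have h1 := congrArg (augmentation G) hdet
    rw [RingHom.map_det, augmentation_single] at h1
    rw [← h1, hW₀, ← map_augmentation_walkSymbol]
    rfl
  have hcc : star c * c = 1 := by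
    rw [← hdetW, ← Matrix.det_conjTranspose, ← Matrix.det_mul, hWW, Matrix.det_one]
  have hadjW : W₀.adjugate = c • W₀ᴴ := by
    have h1 := Matrix.adjugate_mul W₀
    have h2 := congrArg (· * W₀ᴴ) h1
    simp only [mul_assoc, hWW', mul_one, hdetW] at h2
    simpa using h2
  have hcovB : ∀ (l : L) (x : G), B ((l : Equiv.Perm G) x) =
      (U l : Matrix (Fin 2) (Fin 2) ℂ) * B x * (U l : Matrix (Fin 2) (Fin 2) ℂ)ᴴ := by
    intro l x
    by_cases hx : x ∈ stepSet Sp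
    · rw [hBS _ hx, hBS _ (hstep l x hx), h.covariant l x hx]
    · rw [hB0 _ hx, hB0 _ (hstep' l x hx)]; simp
  have hUU : ∀ l : L, (U l : Matrix (Fin 2) (Fin 2) ℂ)ᴴ * (U l : Matrix (Fin 2) (Fin 2) ℂ) = 1 :=
    fun l => Matrix.mem_unitaryGroup_iff'.1 (U l).2
  have hUU' : ∀ l : L, (U l : Matrix (Fin 2) (Fin 2) ℂ) * (U l : Matrix (Fin 2) (Fin 2) ℂ)ᴴ = 1 :=
    fun l => Matrix.mem_unitaryGroup_iff.1 (U l).2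
  have hcomm : ∀ l : L, (U l : Matrix (Fin 2) (Fin 2) ℂ) * W₀ =
      W₀ * (U l : Matrix (Fin 2) (Fin 2) ℂ) := by
    intro l
    have h1 : (U l : Matrix (Fin 2) (Fin 2) ℂ) * W₀ * (U l : Matrix (Fin 2) (Fin 2) ℂ)ᴴ = W₀ := by
      rw [hW₀, Finset.mul_sum, Finset.sum_mul]
      refine Finset.sum_bij' (fun x _ => (l : Equiv.Perm G) x)
        (fun x _ => ((l⁻¹ : L) : Equiv.Perm G) x) (fun x hx => hstep l x hx)
        (fun x hx => hstep l⁻¹ x hx) (by simp) (by simp) ?_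
      intro x _
      rw [hcovB]
    conv_rhs => rw [← h1]
    rw [mul_assoc _ _ (U l : Matrix (Fin 2) (Fin 2) ℂ), hUU, mul_one]
  have hcomm' : ∀ l : L, W₀ᴴ * (U l : Matrix (Fin 2) (Fin 2) ℂ) =
      (U l : Matrix (Fin 2) (Fin 2) ℂ) * W₀ᴴ := by
    intro l
    calc W₀ᴴ * (U l : Matrix (Fin 2) (Fin 2) ℂ)
        = W₀ᴴ * ((U l : Matrix (Fin 2) (Fin 2) ℂ) * W₀) * W₀ᴴ := by
          rw [mul_assoc, mul_assoc, hWW', mul_one]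
      _ = _ := by rw [hcomm, ← mul_assoc W₀ᴴ, hWW, one_mul]
  refine ⟨W₀, fun x => W₀ᴴ * B x, ?_, hWW, ?_⟩
  · refine ⟨hg, hadd, hmem, ?_, h.projective, ?_, ?_, ?_, ?_, ?_, ?_, ?_⟩
    · intro x hx y hy
      -- All generators have infinite order, so transitivity on generators of each order is
      -- transitivity on `Sp`.
      have hord : ∀ x ∈ Sp, addOrderOf x = 0 := by
        intro x hx
        rw [addOrderOf_eq_zero_iff']
        intro n hn hn0
        exact hg.zero_notMem (((nsmul_eq_zero_iff_right hn.ne').1 hn0) ▸ hx)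
      obtain ⟨l, hl, hlx⟩ := h.transitive x hx y hy (by rw [hord x hx, hord y hy])
      exact ⟨⟨l, hl⟩, hlx⟩
    · intro x hx h0
      apply hBne x hx
      rw [← one_mul (B x), ← hWW', mul_assoc, h0, mul_zero]
    · intro x hx
      simp [hB0 x hx]
    · intro x
      rw [Matrix.adjugate_mul_distrib, hadj, ← Matrix.adjugate_conjTranspose, hadjW,
        Matrix.conjTranspose_smul, Matrix.conjTranspose_conjTranspose, Matrix.conjTranspose_mul,
        Matrix.conjTranspose_conjTranspose, smul_mul_smul_comm, mul_comm c, hcc, one_smul]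
    · rw [← Finset.mul_sum, hWW]
    · have h1 : walkSymbol (stepSet Sp) (fun x => W₀ᴴ * B x) =
          (W₀ᴴ).map (AddMonoidAlgebra.singleZeroRingHom) * walkSymbol (stepSet Sp) B := by
        ext1 i j
        simp only [walkSymbol, Matrix.mul_apply, Matrix.map_apply, Finset.mul_sum]
        rw [Finset.sum_comm]
        refine Finset.sum_congr rfl fun x _ => ?_
        refine (map_sum (AddMonoidAlgebra.singleAddHom x) _ _).trans ?_
        refine Finset.sum_congr rfl fun k _ => ?_
        simp [AddMonoidAlgebra.single_mul_single]
      rw [h1, Matrix.det_mul, hdet]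
      have h2 : ((W₀ᴴ).map (AddMonoidAlgebra.singleZeroRingHom (R := ℂ) (M := G))).det =
          AddMonoidAlgebra.singleZeroRingHom (W₀ᴴ).det := (RingHom.map_det _ _).symm
      rw [h2, Matrix.det_conjTranspose, hdetW]
      simp [AddMonoidAlgebra.single_mul_single, AddMonoidAlgebra.one_def]
      exact hcc
    · intro l x
      rw [hcovB, ← mul_assoc, ← mul_assoc, hcomm', ← mul_assoc]
    -- A scalar `U l` commutes with every transition matrix, so by homogeneity `l` moves no
    -- generator.
    · rintro l ⟨a, ha⟩
      have hfix : ∀ x ∈ Sp, (l : Equiv.Perm G) x = x := by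
        intro x hx
        by_contra hne
        apply h.homogeneous l x hx hne
        rw [ha]
        exact (Commute.one_left _).smul_left _
      ext x
      have hx : x ∈ AddSubgroup.closure (Sp : Set G) := by rw [hg.closure_eq_top]; trivial
      change (l : Equiv.Perm G) x = x
      induction hx using AddSubgroup.closure_induction with
      | mem x hx => exact hfix x hx
      | zero => exact hzero l
      | add a b _ _ iha ihb => rw [hadd, iha, ihb]
      | neg a _ iha => rw [hneg, iha]
  · intro x hx
    rw [← mul_assoc, hWW', one_mul, hBS x hx]

/-- The range of the isotropy representation may be computed for the normalised walk. -/
theorem HasIsotropyRange.of_mul_left {Sp : Finset G} {A A' : G → Matrix (Fin 2) (Fin 2) ℂ}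
    {L : Subgroup (Equiv.Perm G)} {U : L → Matrix.unitaryGroup (Fin 2) ℂ}
    {P : Set (Matrix (Fin 2) (Fin 2) ℂ)} {W : Matrix (Fin 2) (Fin 2) ℂ}
    (hW : ∀ x ∈ stepSet Sp, A x = W * A' x) (h : HasIsotropyRange Sp A' L U P) :
    HasIsotropyRange Sp A L U P := by
  intro x hx
  obtain ⟨B, hB, h1, h2, h3, h4⟩ := h x hx
  have hBB : Bᴴ * B = 1 := Matrix.mem_unitaryGroup_iff'.1 hB
  have key : ∀ M, B * (W * M) * Bᴴ = (B * W * Bᴴ) * (B * M * Bᴴ) := by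
    intro M
    calc B * (W * M) * Bᴴ = B * W * (Bᴴ * B) * M * Bᴴ := by rw [hBB]; simp [mul_assoc]
      _ = _ := by simp [mul_assoc]
  have hx1 : x ∈ stepSet Sp := mem_stepSet.2 (Or.inr (mem_edgeSet.2 (Or.inl hx)))
  refine ⟨B, hB, fun i => ?_, fun i => ?_, h3, h4⟩
  · rw [hW x hx1, key, Matrix.mul_apply]
    exact Finset.sum_eq_zero fun j _ => by rw [h1, mul_zero]
  · rw [hW _ (neg_mem_stepSet hx1), key, Matrix.mul_apply]
    exact Finset.sum_eq_zero fun j _ => by rw [h2, mul_zero]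

end Normal

/-! ### Two-by-two matrices -/

/-- The polarisation of the determinant on two-by-two matrices. -/
def polarDet (A B : Matrix (Fin 2) (Fin 2) ℂ) : ℂ :=
  A 0 0 * B 1 1 + A 1 1 * B 0 0 - A 0 1 * B 1 0 - A 1 0 * B 0 1

/-- The squared Hilbert-Schmidt norm. -/
noncomputable def matrixNormSq (A : Matrix (Fin 2) (Fin 2) ℂ) : ℝ :=
  Complex.normSq (A 0 0) + Complex.normSq (A 0 1) + Complex.normSq (A 1 0) + Complex.normSq (A 1 1)

theorem polarDet_comm (A B : Matrix (Fin 2) (Fin 2) ℂ) : polarDet A B = polarDet B A := by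
  simp only [polarDet]; ring

theorem polarDet_self (A : Matrix (Fin 2) (Fin 2) ℂ) : polarDet A A = 2 * A.det := by
  rw [polarDet, Matrix.det_fin_two]; ring

theorem polarDet_zero_left (B : Matrix (Fin 2) (Fin 2) ℂ) : polarDet 0 B = 0 := by
  simp [polarDet]

theorem polarDet_zero_right (B : Matrix (Fin 2) (Fin 2) ℂ) : polarDet B 0 = 0 := by
  simp [polarDet]

/-- In this form the invariance under unitary conjugation becomes visible. -/
theorem polarDet_eq_trace (A B : Matrix (Fin 2) (Fin 2) ℂ) :
    polarDet A B = (A * B.adjugate).trace := by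
  rw [Matrix.adjugate_fin_two, Matrix.trace_fin_two, polarDet]
  simp [Matrix.mul_apply, Fin.sum_univ_two]
  ring

theorem adjugate_conj_unitary {U : Matrix (Fin 2) (Fin 2) ℂ} (hU : Uᴴ * U = 1)
    (A : Matrix (Fin 2) (Fin 2) ℂ) : (U * A * Uᴴ).adjugate = U * A.adjugate * Uᴴ := by
  have hU' : U * Uᴴ = 1 := mul_eq_one_comm.1 hU
  have h1 : U.adjugate = U.det • Uᴴ := by
    have h2 := congrArg (· * Uᴴ) (Matrix.adjugate_mul U)
    simp only [mul_assoc, hU', mul_one] at h2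
    simpa using h2
  have hd : star U.det * U.det = 1 := by
    rw [← Matrix.det_conjTranspose, ← Matrix.det_mul, hU, Matrix.det_one]
  rw [Matrix.adjugate_mul_distrib, Matrix.adjugate_mul_distrib, ← Matrix.adjugate_conjTranspose, h1,
    Matrix.conjTranspose_smul, Matrix.conjTranspose_conjTranspose]
  simp only [Matrix.smul_mul, Matrix.mul_smul, smul_smul, mul_assoc, mul_comm U.det, hd, one_smul]

theorem polarDet_conj_unitary {U : Matrix (Fin 2) (Fin 2) ℂ} (hU : Uᴴ * U = 1)
    (A B : Matrix (Fin 2) (Fin 2) ℂ) :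
    polarDet (U * A * Uᴴ) (U * B * Uᴴ) = polarDet A B := by
  rw [polarDet_eq_trace, polarDet_eq_trace, adjugate_conj_unitary hU]
  calc (U * A * Uᴴ * (U * B.adjugate * Uᴴ)).trace
      = (U * (A * (Uᴴ * U) * B.adjugate) * Uᴴ).trace := by simp only [mul_assoc]
    _ = (Uᴴ * U * (A * (Uᴴ * U) * B.adjugate)).trace := by
        rw [Matrix.trace_mul_comm]; simp only [mul_assoc]
    _ = _ := by rw [hU, one_mul, mul_one]

theorem polarDet_conjTranspose_adjugate (A B : Matrix (Fin 2) (Fin 2) ℂ) :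
    polarDet A.adjugateᴴ B.adjugateᴴ = star (polarDet A B) := by
  rw [Matrix.adjugate_fin_two, Matrix.adjugate_fin_two]
  simp [polarDet]
  ring

/-- For a normalised walk the second argument is the matrix of the opposite step, so the constant
coefficient of the determinant becomes a sum of squared norms. -/
theorem polarDet_adjugate_self (A : Matrix (Fin 2) (Fin 2) ℂ) :
    polarDet A A.adjugateᴴ = (matrixNormSq A : ℂ) := by
  rw [Matrix.adjugate_fin_two]
  simp [polarDet, matrixNormSq, Complex.normSq_eq_conj_mul_self]
  ring

theorem matrixNormSq_pos {A : Matrix (Fin 2) (Fin 2) ℂ} (h : A ≠ 0) : 0 < matrixNormSq A := by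
  unfold matrixNormSq
  by_contra hle
  apply h
  have h1 := Complex.normSq_nonneg (A 0 0)
  have h2 := Complex.normSq_nonneg (A 0 1)
  have h3 := Complex.normSq_nonneg (A 1 0)
  have h4 := Complex.normSq_nonneg (A 1 1)
  rw [Matrix.eta_fin_two A, Complex.normSq_eq_zero.1 (show Complex.normSq (A 0 0) = 0 by linarith),
    Complex.normSq_eq_zero.1 (show Complex.normSq (A 0 1) = 0 by linarith),
    Complex.normSq_eq_zero.1 (show Complex.normSq (A 1 0) = 0 by linarith),
    Complex.normSq_eq_zero.1 (show Complex.normSq (A 1 1) = 0 by linarith)]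
  ext i j
  fin_cases i <;> fin_cases j <;> rfl

theorem trace_re_sq_le (A : Matrix (Fin 2) (Fin 2) ℂ) :
    A.trace.re ^ 2 ≤ 2 * matrixNormSq A := by
  simp only [Matrix.trace_fin_two, matrixNormSq, Complex.normSq_apply, Complex.add_re]
  nlinarith [sq_nonneg ((A 0 0).re - (A 1 1).re), sq_nonneg (A 0 0).im, sq_nonneg (A 1 1).im,
    sq_nonneg (A 0 1).re, sq_nonneg (A 0 1).im, sq_nonneg (A 1 0).re, sq_nonneg (A 1 0).im]

/-- A vanishing determinant makes the products of the moduli on the two diagonals equal, so the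
cross term of the trace is absorbed by the off-diagonal entries. This saves a factor of two over the
general bound. -/
theorem trace_re_sq_le_of_det_eq_zero {A : Matrix (Fin 2) (Fin 2) ℂ} (h : A.det = 0) :
    A.trace.re ^ 2 ≤ matrixNormSq A := by
  have h1 : ‖A 0 0‖ * ‖A 1 1‖ = ‖A 0 1‖ * ‖A 1 0‖ := by
    rw [Matrix.det_fin_two, sub_eq_zero] at h
    rw [← norm_mul, h, norm_mul]
  have h2 : |A.trace.re| ≤ ‖A 0 0‖ + ‖A 1 1‖ := by
    rw [Matrix.trace_fin_two]
    exact (Complex.abs_re_le_norm _).trans (norm_add_le _ _)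
  simp only [matrixNormSq, Complex.normSq_eq_norm_sq]
  rw [← sq_abs]
  calc |A.trace.re| ^ 2 ≤ (‖A 0 0‖ + ‖A 1 1‖) ^ 2 := pow_le_pow_left₀ (abs_nonneg _) h2 2
    _ ≤ _ := by nlinarith [sq_nonneg (‖A 0 1‖ - ‖A 1 0‖)]

/-- The commutant of a non-scalar matrix. -/
theorem exists_eq_add_of_commute {R : Type*} [CommRing R] [Algebra ℂ R]
    {U : Matrix (Fin 2) (Fin 2) ℂ} (hU : ∀ c : ℂ, U ≠ c • 1) {M : Matrix (Fin 2) (Fin 2) R}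
    (h : M * U.map (algebraMap ℂ R) = U.map (algebraMap ℂ R) * M) :
    ∃ s t : R, M = s • 1 + t • U.map (algebraMap ℂ R) := by
  have h00 := congrFun (congrFun h 0) 0
  have h01 := congrFun (congrFun h 0) 1
  have h10 := congrFun (congrFun h 1) 0
  simp only [Matrix.mul_apply, Fin.sum_univ_two, Matrix.map_apply] at h00 h01 h10
  set f := algebraMap ℂ R
  -- Commuting with `U` means that the two off-diagonal entries and the diagonal difference of `M`
  -- are proportional to those of `U`. The factor `t` is read off from whichever of these three
  -- numbers does not vanish for `U`.
  have finish : ∀ t : R, M 0 1 = t * f (U 0 1) → M 1 0 = t * f (U 1 0) →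
      M 0 0 - M 1 1 = t * (f (U 0 0) - f (U 1 1)) → ∃ s t : R, M = s • 1 + t • U.map f := by
    intro t h1 h2 h3
    refine ⟨M 0 0 - t * f (U 0 0), t, ?_⟩
    ext i j
    fin_cases i <;> fin_cases j
    · simp
    · simp [h1]
    · simp [h2]
    · simp; linear_combination -h3
  have hinv : ∀ z : ℂ, z ≠ 0 → f z⁻¹ * f z = 1 := by
    intro z hz; rw [← map_mul, inv_mul_cancel₀ hz, map_one]
  by_cases hb : U 0 1 = 0
  · by_cases hc : U 1 0 = 0
    · have hd : U 0 0 - U 1 1 ≠ 0 := by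
        intro hd
        apply hU (U 0 0)
        ext i j
        fin_cases i <;> fin_cases j
        · simp
        · simp [hb]
        · simp [hc]
        · simp; exact (sub_eq_zero.1 hd).symm
      have hi := hinv _ hd
      rw [map_sub] at hi
      rw [hb, map_zero] at h01
      rw [hc, map_zero] at h10
      refine finish (f (U 0 0 - U 1 1)⁻¹ * (M 0 0 - M 1 1)) ?_ ?_ ?_
      · rw [hb, map_zero, mul_zero]
        linear_combination (-(M 0 1)) * hi - f (U 0 0 - U 1 1)⁻¹ * h01
      · rw [hc, map_zero, mul_zero]
        linear_combination (-(M 1 0)) * hi + f (U 0 0 - U 1 1)⁻¹ * h10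
      · linear_combination (-(M 0 0 - M 1 1)) * hi
    · have hi := hinv _ hc
      refine finish (f (U 1 0)⁻¹ * M 1 0) ?_ ?_ ?_
      · linear_combination (-(M 0 1)) * hi + f (U 1 0)⁻¹ * h00
      · linear_combination (-(M 1 0)) * hi
      · linear_combination (-(M 0 0 - M 1 1)) * hi - f (U 1 0)⁻¹ * h10
  · have hi := hinv _ hb
    refine finish (f (U 0 1)⁻¹ * M 0 1) ?_ ?_ ?_
    · linear_combination (-(M 0 1)) * hi
    · linear_combination (-(M 1 0)) * hi - f (U 0 1)⁻¹ * h00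
    · linear_combination (-(M 0 0 - M 1 1)) * hi + f (U 0 1)⁻¹ * h01

/-- A matrix of determinant one over a group algebra that commutes with a non-scalar matrix, and
whose augmentation is the identity, has the trace of a one-parameter subgroup. -/
theorem exists_trace_eq_of_commute {G : Type*} [AddCommGroup G] [TwoUniqueSums G]
    {U : Matrix (Fin 2) (Fin 2) ℂ} (hU : ∀ c : ℂ, U ≠ c • 1)
    {M : Matrix (Fin 2) (Fin 2) (AddMonoidAlgebra ℂ G)} (hdet : M.det = 1)
    (haug : M.map (augmentation G) = 1)
    (h : M * U.map (algebraMap ℂ (AddMonoidAlgebra ℂ G)) =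
      U.map (algebraMap ℂ (AddMonoidAlgebra ℂ G)) * M) :
    ∃ m : G, M.trace = AddMonoidAlgebra.single m 1 + AddMonoidAlgebra.single (-m) 1 := by
  classical
  obtain ⟨s, t, hst⟩ := exists_eq_add_of_commute hU h
  -- A square root of the discriminant; `p` and `q` below are the eigenvalues of `U`.
  obtain ⟨r, hr⟩ : ∃ r : ℂ, r * r = U.trace * U.trace - 4 * U.det := by
    obtain ⟨r, hr⟩ := IsAlgClosed.exists_pow_nat_eq (U.trace * U.trace - 4 * U.det) (n := 2)
      (by norm_num)
    exact ⟨r, by rw [← sq, hr]⟩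
  set f := algebraMap ℂ (AddMonoidAlgebra ℂ G)
  set p := (U.trace + r) / 2 with hp
  set q := (U.trace - r) / 2 with hq
  have hpq : p + q = U 0 0 + U 1 1 := by rw [hp, hq, Matrix.trace_fin_two]; ring
  have hpq' : p * q = U 0 0 * U 1 1 - U 0 1 * U 1 0 := by
    rw [← Matrix.det_fin_two]; linear_combination (-1/4) * hr
  have hfs : f p + f q = f (U 0 0) + f (U 1 1) := by rw [← map_add, hpq, map_add]
  have hfm : f p * f q = f (U 0 0) * f (U 1 1) - f (U 0 1) * f (U 1 0) := by
    rw [← map_mul, hpq', map_sub, map_mul, map_mul]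
  -- The eigenvalues of `M` lie in the group algebra and multiply to the determinant, so they are
  -- mutually inverse monomials.
  have hmul : (s + t * f p) * (s + t * f q) = 1 := by
    rw [← hdet, Matrix.det_fin_two, hst]
    simp
    linear_combination s * t * hfs + t ^ 2 * hfm
  have htr : M.trace = (s + t * f p) + (s + t * f q) := by
    rw [Matrix.trace_fin_two, hst]
    simp
    linear_combination - t * hfs
  obtain ⟨m, c, hc, h1, h2⟩ := AddMonoidAlgebra.eq_single_of_mul_eq_one hmul
  have haf : ∀ z, augmentation G (f z) = z := by
    intro z
    change augmentation G (AddMonoidAlgebra.single 0 z) = z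
    exact augmentation_single 0 z
  have hε : ∀ i j, augmentation G (M i j) = (1 : Matrix (Fin 2) (Fin 2) ℂ) i j := fun i j =>
    congrFun (congrFun haug i) j
  -- At the trivial character `M` is the identity and `U` is not scalar, so the coefficient of `U`
  -- vanishes there. Both monomials then have coefficient one.
  have hεt : augmentation G t = 0 := by
    by_contra ht
    apply hU ((1 - augmentation G s) / augmentation G t)
    have e : ∀ i j, augmentation G s * (1 : Matrix (Fin 2) (Fin 2) ℂ) i j +
        augmentation G t * U i j = (1 : Matrix (Fin 2) (Fin 2) ℂ) i j := by
      intro i j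
      conv_rhs => rw [← hε, hst]
      fin_cases i <;> fin_cases j <;> simp [haf]
    ext i j
    rw [Matrix.smul_apply, smul_eq_mul, div_mul_eq_mul_div, eq_div_iff ht]
    linear_combination e i j
  have hεs : augmentation G s = 1 := by
    have := hε 0 0
    rw [hst] at this
    simpa [hεt] using this
  have hc1 : c = 1 := by
    have := congrArg (augmentation G) h1
    rw [augmentation_single] at this
    rw [← this]; simp [hεs, hεt]
  refine ⟨m, ?_⟩
  rw [htr, h1, h2, hc1, inv_one]

/-! ### General properties of normalised walks -/

namespace IsNormalWalk

set_option linter.unusedSectionVars false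

section General

variable {G : Type*} [AddCommGroup G] [DecidableEq G] {Sp : Finset G}
  {A : G → Matrix (Fin 2) (Fin 2) ℂ} {L : Subgroup (Equiv.Perm G)}
  {U : L → Matrix.unitaryGroup (Fin 2) ℂ} (hw : IsNormalWalk Sp A L U)

include hw

/-- The automorphism of the group given by an element of the isotropy group. -/
def hom (l : L) : G →+ G := AddMonoidHom.mk' l.1 (hw.map_add l)

theorem map_zero (l : L) : l.1 0 = 0 := (hw.hom l).map_zero
theorem map_neg (l : L) (x : G) : l.1 (-x) = -l.1 x := (hw.hom l).map_neg x
theorem map_nsmul (l : L) (n : ℕ) (x : G) : l.1 (n • x) = n • l.1 x := (hw.hom l).map_nsmul n x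

theorem map_mem_edgeSet (l : L) {x : G} (hx : x ∈ edgeSet Sp) : l.1 x ∈ edgeSet Sp := by
  rw [mem_edgeSet] at hx ⊢
  rcases hx with hx | hx
  · exact Or.inl (hw.map_mem l x hx)
  · exact Or.inr (by rw [← hw.map_neg]; exact hw.map_mem l _ hx)

theorem unitary_left (l : L) : (U l : Matrix (Fin 2) (Fin 2) ℂ)ᴴ * U l = 1 :=
  Matrix.mem_unitaryGroup_iff'.1 (U l).2

theorem unitary_right (l : L) : (U l : Matrix (Fin 2) (Fin 2) ℂ) * (U l : Matrix (Fin 2) (Fin 2) ℂ)ᴴ = 1 :=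
  Matrix.mem_unitaryGroup_iff.1 (U l).2

theorem addHom_ext {H : Type*} [AddCommGroup H] {f g : G →+ H} (h : ∀ x ∈ Sp, f x = g x) : f = g :=
  AddMonoidHom.eq_of_eqOn_dense hw.gen.closure_eq_top h

theorem eq_one_of_forall (l : L) (h : ∀ x ∈ Sp, l.1 x = x) : l = 1 := by
  have h1 : hw.hom l = AddMonoidHom.id G := hw.addHom_ext h
  ext x
  exact DFunLike.congr_fun h1 x

theorem eq_of_forall {l m : L} (h : ∀ x ∈ Sp, l.1 x = m.1 x) : l = m := by
  have h1 : hw.hom l = hw.hom m := hw.addHom_ext h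
  ext x
  exact DFunLike.congr_fun h1 x

theorem finite : Finite L := by
  let f : L → (Sp → Sp) := fun l x => ⟨l.1 x.1, hw.map_mem l x.1 x.2⟩
  refine Finite.of_injective f fun l m hlm => hw.eq_of_forall fun x hx => ?_
  exact congrArg Subtype.val (congrFun hlm ⟨x, hx⟩)

theorem apply_neg_eq (x : G) : A (-x) = (A x).adjugateᴴ := by
  rw [hw.adjugate_eq, Matrix.conjTranspose_conjTranspose]

theorem sum_polarDet (g : G) :
    ∑ x ∈ stepSet Sp, polarDet (A x) (A (g - x)) = if g = 0 then 2 else 0 := by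
  have hdet : ∀ B : G → Matrix (Fin 2) (Fin 2) ℂ, (∀ x ∉ stepSet Sp, B x = 0) →
      (walkSymbol (stepSet Sp) B).det = 1 →
      ∑ x ∈ stepSet Sp, (B x 0 0 * B (g - x) 1 1 - B x 0 1 * B (g - x) 1 0) =
        if g = 0 then 1 else 0 := by
    intro B hB h1
    rw [← det_coeff_walkSymbol hB, h1, AddMonoidAlgebra.one_def, AddMonoidAlgebra.coeff_single,
      Finsupp.single_apply]
    simp only [eq_comm]
  have h1 := hdet A hw.eq_zero hw.det_eq
  -- Exchanging both basis vectors preserves the determinant; the sum of the two coefficient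
  -- formulas is symmetric in the pair of steps.
  have h2 := hdet (fun x => (A x).submatrix (Equiv.swap 0 1) (Equiv.swap 0 1))
    (fun x hx => by simp [hw.eq_zero x hx]) (by
      rw [← hw.det_eq, ← Matrix.det_submatrix_equiv_self (Equiv.swap 0 1)]
      rfl)
  simp only [Matrix.submatrix_apply, Equiv.swap_apply_left, Equiv.swap_apply_right] at h2
  have h3 : ∑ x ∈ stepSet Sp, polarDet (A x) (A (g - x)) =
      ∑ x ∈ stepSet Sp, (A x 0 0 * A (g - x) 1 1 - A x 0 1 * A (g - x) 1 0) +
      ∑ x ∈ stepSet Sp, (A x 1 1 * A (g - x) 0 0 - A x 1 0 * A (g - x) 0 1) := by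
    rw [← Finset.sum_add_distrib]
    refine Finset.sum_congr rfl fun x _ => ?_
    rw [polarDet]; ring
  rw [h3, h1, h2]
  split_ifs <;> norm_num

/-- The coefficient of the determinant at `a + b` has no contribution besides the pair itself,
counted once if `a = b` and twice otherwise; it vanishes since `a + b` is not the identity. -/
theorem polarDet_eq_zero_of_unique {a b : G} (hab : a + b ≠ 0)
    (h : ∀ x ∈ stepSet Sp, a + b - x ∈ stepSet Sp → x = a ∨ x = b) :
    polarDet (A a) (A b) = 0 := by
  have hs := hw.sum_polarDet (a + b)
  rw [if_neg hab] at hs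
  by_cases ha : a ∈ stepSet Sp
  swap
  · rw [hw.eq_zero a ha, polarDet_zero_left]
  by_cases hb : b ∈ stepSet Sp
  swap
  · rw [hw.eq_zero b hb, polarDet_zero_right]
  have hz : ∀ x ∈ stepSet Sp, x ∉ ({a, b} : Finset G) → polarDet (A x) (A (a + b - x)) = 0 := by
    intro x hx hxab
    by_cases hx' : a + b - x ∈ stepSet Sp
    · exact absurd (h x hx hx') (by simpa using hxab)
    · rw [hw.eq_zero _ hx', polarDet_zero_right]
  have hsub : ({a, b} : Finset G) ⊆ stepSet Sp := by
    intro x hx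
    rw [Finset.mem_insert, Finset.mem_singleton] at hx
    rcases hx with rfl | rfl <;> assumption
  rw [← Finset.sum_subset hsub hz] at hs
  by_cases hne : a = b
  · subst hne
    simpa using hs
  · rw [Finset.sum_pair hne, add_sub_cancel_left, add_sub_cancel_right, polarDet_comm (A b)] at hs
    linear_combination hs / 2

theorem sum_matrixNormSq : ∑ x ∈ stepSet Sp, matrixNormSq (A x) = 2 := by
  have h := hw.sum_polarDet 0
  simp only [zero_sub, hw.apply_neg_eq, polarDet_adjugate_self, if_true] at h
  exact_mod_cast h

theorem trace_map (l : L) (x : G) : (A (l.1 x)).trace = (A x).trace := by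
  rw [hw.covariant, Matrix.trace_mul_comm, ← mul_assoc, hw.unitary_left, one_mul]

theorem trace_neg (x : G) : (A (-x)).trace = star (A x).trace := by
  rw [hw.apply_neg_eq, Matrix.trace_conjTranspose, Matrix.adjugate_fin_two]
  simp [Matrix.trace_fin_two, add_comm]

theorem matrixNormSq_neg (x : G) : matrixNormSq (A (-x)) = matrixNormSq (A x) := by
  rw [hw.apply_neg_eq, Matrix.adjugate_fin_two]
  simp [matrixNormSq]
  ring

theorem matrixNormSq_map (l : L) (x : G) : matrixNormSq (A (l.1 x)) = matrixNormSq (A x) := by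
  have h : ((matrixNormSq (A (l.1 x)) : ℝ) : ℂ) = matrixNormSq (A x) := by
    rw [← polarDet_adjugate_self, ← polarDet_adjugate_self, ← hw.apply_neg_eq, ← hw.apply_neg_eq,
      ← hw.map_neg, hw.covariant, hw.covariant, polarDet_conj_unitary (hw.unitary_left l)]
  exact_mod_cast h

theorem polarDet_map (l : L) (x y : G) :
    polarDet (A (l.1 x)) (A (l.1 y)) = polarDet (A x) (A y) := by
  rw [hw.covariant, hw.covariant, polarDet_conj_unitary (hw.unitary_left l)]

theorem polarDet_neg (x y : G) :
    polarDet (A (-x)) (A (-y)) = star (polarDet (A x) (A y)) := by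
  rw [hw.apply_neg_eq, hw.apply_neg_eq, polarDet_conjTranspose_adjugate]

/-- A function invariant under the isotropy group and inversion is constant on the edges. -/
theorem eq_of_invariant {β : Type*} (f : G → β) (h1 : ∀ (l : L) x, f (l.1 x) = f x)
    (h2 : ∀ x, f (-x) = f x) {x y : G} (hx : x ∈ edgeSet Sp) (hy : y ∈ edgeSet Sp) : f x = f y := by
  have key : ∀ x ∈ Sp, ∀ y ∈ Sp, f x = f y := by
    intro x hx y hy
    obtain ⟨l, rfl⟩ := hw.trans x hx y hy
    exact (h1 l x).symm
  rw [mem_edgeSet] at hx hy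
  rcases hx with hx | hx <;> rcases hy with hy | hy
  · exact key x hx y hy
  · rw [← h2 y]; exact key x hx _ hy
  · rw [← h2 x]; exact key _ hx y hy
  · rw [← h2 x, ← h2 y]; exact key _ hx _ hy

theorem matrixNormSq_eq {x y : G} (hx : x ∈ edgeSet Sp) (hy : y ∈ edgeSet Sp) :
    matrixNormSq (A x) = matrixNormSq (A y) :=
  hw.eq_of_invariant (fun x => matrixNormSq (A x)) hw.matrixNormSq_map hw.matrixNormSq_neg hx hy

theorem trace_re_eq {x y : G} (hx : x ∈ edgeSet Sp) (hy : y ∈ edgeSet Sp) :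
    (A x).trace.re = (A y).trace.re :=
  hw.eq_of_invariant (fun x => (A x).trace.re) (fun l x => by rw [hw.trace_map])
    (fun x => by rw [hw.trace_neg]; rfl) hx hy

/-- The trace of the normalisation `sum_eq`, with all edges contributing the same real part. -/
theorem sum_trace_re (x : G) (hx : x ∈ edgeSet Sp) :
    (A 0).trace.re + (edgeSet Sp).card * (A x).trace.re = 2 := by
  have h := congrArg (fun M => (Matrix.trace M).re) hw.sum_eq
  simp only [Matrix.trace_sum, Matrix.trace_one] at h
  rw [sum_stepSet hw.gen, Complex.add_re, Complex.re_sum,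
    Finset.sum_congr rfl (fun y hy => hw.trace_re_eq hy hx)] at h
  simpa using h

/-- The trace of the restriction of the walk to the fixed characters of an automorphism. -/
theorem exists_trace_sum_eq {G' : Type*} [AddCommGroup G'] [DecidableEq G'] [TwoUniqueSums G']
    {l : L} (hl : l ≠ 1) (q : G →+ G') (hq : ∀ x, q (l.1 x) = q x) :
    ∃ m : G', ∀ c, ∑ x ∈ stepSet Sp with q x = c, (A x).trace =
      (if c = m then 1 else 0) + (if c = -m then 1 else 0) := by
  -- Pushing forward along `q` restricts the symbol to the characters that factor through `q`; these
  -- are fixed by `l`, so covariance becomes commutation with `U l`.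
  set M := (walkSymbol (stepSet Sp) A).map (AddMonoidAlgebra.mapDomainRingHom ℂ q) with hM
  have hMij : ∀ i j, M i j = ∑ x ∈ stepSet Sp, AddMonoidAlgebra.single (q x) (A x i j) := by
    intro i j
    rw [hM, map_walkSymbol]
    simp
  have hdet : M.det = 1 := by
    have h1 : M.det = AddMonoidAlgebra.mapDomainRingHom ℂ q (walkSymbol (stepSet Sp) A).det :=
      (RingHom.map_det _ _).symm
    rw [h1, hw.det_eq, _root_.map_one]
  have haug : M.map (augmentation G') = 1 := by
    rw [← hw.sum_eq]
    ext i j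
    rw [Matrix.map_apply, hMij, map_sum, Matrix.sum_apply]
    simp [augmentation_single]
  have hcomm : M * (U l : Matrix (Fin 2) (Fin 2) ℂ).map
      (algebraMap ℂ (AddMonoidAlgebra ℂ G')) =
      (U l : Matrix (Fin 2) (Fin 2) ℂ).map (algebraMap ℂ (AddMonoidAlgebra ℂ G')) * M := by
    have hcov : ∀ x, A (l.1 x) * U l = U l * A x := by
      intro x
      rw [hw.covariant, mul_assoc, hw.unitary_left, mul_one]
    have e1 : ∀ i j, (M * (U l : Matrix (Fin 2) (Fin 2) ℂ).map
        (algebraMap ℂ (AddMonoidAlgebra ℂ G'))) i j =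
        ∑ x ∈ stepSet Sp, AddMonoidAlgebra.single (q x) ((A x * U l) i j) := by
      intro i j
      rw [Matrix.mul_apply]
      simp only [hMij, Finset.sum_mul, Matrix.map_apply]
      rw [Finset.sum_comm]
      refine Finset.sum_congr rfl fun x _ => ?_
      rw [Matrix.mul_apply]
      refine Eq.trans ?_ (map_sum (AddMonoidAlgebra.singleAddHom (q x)) _ _).symm
      refine Finset.sum_congr rfl fun k _ => ?_
      change _ * AddMonoidAlgebra.single 0 _ = AddMonoidAlgebra.single _ _
      rw [AddMonoidAlgebra.single_mul_single, add_zero]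
      rfl
    have e2 : ∀ i j, ((U l : Matrix (Fin 2) (Fin 2) ℂ).map
        (algebraMap ℂ (AddMonoidAlgebra ℂ G')) * M) i j =
        ∑ x ∈ stepSet Sp, AddMonoidAlgebra.single (q x) ((U l * A x) i j) := by
      intro i j
      rw [Matrix.mul_apply]
      simp only [hMij, Finset.mul_sum, Matrix.map_apply]
      rw [Finset.sum_comm]
      refine Finset.sum_congr rfl fun x _ => ?_
      rw [Matrix.mul_apply]
      refine Eq.trans ?_ (map_sum (AddMonoidAlgebra.singleAddHom (q x)) _ _).symm
      refine Finset.sum_congr rfl fun k _ => ?_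
      change AddMonoidAlgebra.single 0 _ * _ = AddMonoidAlgebra.single _ _
      rw [AddMonoidAlgebra.single_mul_single, zero_add]
      rfl
    have hmem : ∀ (l : L), ∀ x ∈ stepSet Sp, l.1 x ∈ stepSet Sp := by
      intro l x hx
      rw [mem_stepSet] at hx ⊢
      exact hx.imp (fun h => by rw [h, hw.map_zero]) (hw.map_mem_edgeSet l)
    ext1 i j
    rw [e1, e2]
    symm
    refine Finset.sum_bij' (fun x _ => l.1 x) (fun x _ => (l⁻¹).1 x) (fun x hx => hmem l x hx)
      (fun x hx => hmem l⁻¹ x hx) (by simp) (by simp) ?_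
    intro x _
    rw [hq, hcov]
  have hns : ∀ c : ℂ, (U l : Matrix (Fin 2) (Fin 2) ℂ) ≠ c • 1 :=
    fun c hc => hl (hw.faithful l ⟨c, hc⟩)
  obtain ⟨m, hm⟩ := exists_trace_eq_of_commute hns hdet haug hcomm
  refine ⟨m, fun c => ?_⟩
  have h1 := congrArg (fun f => AddMonoidAlgebra.coeff f c) hm
  have h2 : M.trace = ∑ x ∈ stepSet Sp, AddMonoidAlgebra.single (q x) ((A x).trace) := by
    rw [Matrix.trace_fin_two, hMij, hMij, ← Finset.sum_add_distrib]
    refine Finset.sum_congr rfl fun x _ => ?_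
    rw [Matrix.trace_fin_two, AddMonoidAlgebra.single_add]
  simp only [h2, AddMonoidAlgebra.coeff_sum, Finsupp.finsetSum_apply, AddMonoidAlgebra.coeff_add,
    Finsupp.add_apply, AddMonoidAlgebra.coeff_single, Finsupp.single_apply] at h1
  rw [Finset.sum_filter, h1]
  simp only [eq_comm]

end General

end IsNormalWalk

/-! ### Walks on free abelian groups: the invariant form and the heights -/

namespace IsNormalWalk

set_option linter.unusedSectionVars false

variable {d : ℕ} {Sp : Finset (Fin d → ℤ)}
  {A : (Fin d → ℤ) → Matrix (Fin 2) (Fin 2) ℂ} {L : Subgroup (Equiv.Perm (Fin d → ℤ))}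
  {U : L → Matrix.unitaryGroup (Fin 2) ℂ} (hw : IsNormalWalk Sp A L U)

include hw

/-- The dot product averaged over the isotropy group. -/
noncomputable def form : (Fin d → ℤ) →ₗ[ℤ] (Fin d → ℤ) →ₗ[ℤ] ℤ :=
  haveI := hw.finite
  letI := Fintype.ofFinite L
  LinearMap.mk₂ ℤ (fun x y => ∑ l : L, l.1 x ⬝ᵥ l.1 y)
    (fun x y z => by simp [hw.map_add, add_dotProduct, Finset.sum_add_distrib])
    (fun c x y => by
      have h : ∀ l : L, l.1 (c • x) = c • l.1 x := fun l => (hw.hom l).map_zsmul c x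
      simp only [h, smul_dotProduct, Finset.smul_sum])
    (fun x y z => by simp [hw.map_add, dotProduct_add, Finset.sum_add_distrib])
    (fun c x y => by
      have h : ∀ l : L, l.1 (c • y) = c • l.1 y := fun l => (hw.hom l).map_zsmul c y
      simp only [h, dotProduct_smul, Finset.smul_sum])

theorem form_comm (x y : Fin d → ℤ) : hw.form x y = hw.form y x := by
  simp only [form, LinearMap.mk₂_apply, dotProduct_comm]

theorem form_map (l : L) (x y : Fin d → ℤ) : hw.form (l.1 x) (l.1 y) = hw.form x y := by
  have := hw.finite
  let := Fintype.ofFinite L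
  simp only [form, LinearMap.mk₂_apply]
  exact Equiv.sum_comp (Equiv.mulRight l) (fun m : L => m.1 x ⬝ᵥ m.1 y)

theorem form_self_pos {x : Fin d → ℤ} (hx : x ≠ 0) : 0 < hw.form x x := by
  have := hw.finite
  let := Fintype.ofFinite L
  simp only [form, LinearMap.mk₂_apply]
  refine Finset.sum_pos' (fun l _ => ?_) ⟨1, Finset.mem_univ _, ?_⟩
  · exact Finset.sum_nonneg fun i _ => mul_self_nonneg _
  · obtain ⟨i, hi⟩ := Function.ne_iff.1 hx
    exact Finset.sum_pos' (fun i _ => mul_self_nonneg _)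
      ⟨i, Finset.mem_univ _, mul_self_pos.2 hi⟩

theorem form_self_nonneg (x : Fin d → ℤ) : 0 ≤ hw.form x x := by
  by_cases hx : x = 0
  · simp [hx]
  · exact (hw.form_self_pos hx).le

theorem eq_zero_of_form_self_le {x : Fin d → ℤ} (hx : hw.form x x ≤ 0) : x = 0 := by
  by_contra h
  exact absurd (hw.form_self_pos h) (by omega)

theorem form_eq {x y : Fin d → ℤ} (hx : x ∈ edgeSet Sp) (hy : y ∈ edgeSet Sp) :
    hw.form x x = hw.form y y :=
  hw.eq_of_invariant (fun x => hw.form x x) (fun l x => hw.form_map l x x) (by simp) hx hy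

theorem form_le {x y : Fin d → ℤ} (hx : x ∈ stepSet Sp) (hy : y ∈ edgeSet Sp) :
    hw.form x x ≤ hw.form y y := by
  rcases mem_stepSet.1 hx with rfl | hx
  · simpa using hw.form_self_nonneg y
  · exact (hw.form_eq hx hy).le

/-- Nonzero orthogonal vectors are independent. Metric geometry over the integers is reduced to this
bound: a coincidence of points is proved by exhibiting too many orthogonal vectors. -/
theorem le_of_pairwise_form_eq_zero {n : ℕ} (v : Fin n → (Fin d → ℤ)) (hv : ∀ i, v i ≠ 0)
    (h : ∀ i j, i ≠ j → hw.form (v i) (v j) = 0) : n ≤ d := by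
  have hli : LinearIndependent ℤ v := by
    rw [Fintype.linearIndependent_iff]
    intro g hg i
    have h1 : hw.form (∑ j, g j • v j) (v i) = 0 := by rw [hg]; simp
    rw [map_sum, LinearMap.sum_apply, Finset.sum_eq_single i] at h1
    · simp only [map_smul, LinearMap.smul_apply, smul_eq_mul] at h1
      exact (mul_eq_zero.1 h1).resolve_right (hw.form_self_pos (hv i)).ne'
    · intro j _ hj
      rw [map_smul, LinearMap.smul_apply, h j i hj, smul_zero]
    · simp
  simpa using hli.fintype_card_le_finrank

/-- Strict convexity: two steps no longer than `h` can add up to `2h` only if both equal `h`. The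
polarised determinant of `A h` with itself therefore vanishes. -/
theorem det_eq_zero {h : Fin d → ℤ} (hh : h ∈ edgeSet Sp) : (A h).det = 0 := by
  have hne : h + h ≠ 0 := by
    intro h0
    rw [← two_nsmul, nsmul_eq_zero_iff_right two_ne_zero] at h0
    exact zero_notMem_edgeSet hw.gen (h0 ▸ hh)
  have h1 := hw.polarDet_eq_zero_of_unique hne (fun x hx hx' => by
    left
    have e1 := hw.form_le hx hh
    have e2 := hw.form_le hx' hh
    have e3 : hw.form (x - h) (x - h) ≤ 0 := by
      simp only [_root_.map_add, _root_.map_sub, LinearMap.add_apply, LinearMap.sub_apply] at e2 ⊢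
      have := hw.form_comm x h
      linarith
    exact sub_eq_zero.1 (hw.eq_zero_of_form_self_le e3))
  rw [polarDet_self] at h1
  simpa using h1

/-- The sum over the cyclic group generated by an automorphism. -/
noncomputable def orbitSum (l : L) : (Fin d → ℤ) →+ (Fin d → ℤ) :=
  ∑ j ∈ Finset.range (orderOf l), hw.hom (l ^ j)

theorem orbitSum_apply (l : L) (x : Fin d → ℤ) :
    hw.orbitSum l x = ∑ j ∈ Finset.range (orderOf l), (l ^ j).1 x := by
  rw [orbitSum, AddMonoidHom.finsetSum_apply]; rfl

theorem orderOf_pos (l : L) : 0 < orderOf l := by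
  have := hw.finite
  exact _root_.orderOf_pos l

theorem orbitSum_map (l : L) (x : Fin d → ℤ) : hw.orbitSum l (l.1 x) = hw.orbitSum l x := by
  rw [orbitSum_apply, orbitSum_apply]
  have h : ∀ j, (l ^ j).1 (l.1 x) = (l ^ (j + 1)).1 x := fun j => by
    rw [pow_succ]; rfl
  simp only [h]
  have h1 := Finset.sum_range_succ (fun j => (l ^ j).1 x) (orderOf l)
  have h2 := Finset.sum_range_succ' (fun j => (l ^ j).1 x) (orderOf l)
  rw [h1, pow_orderOf_eq_one, pow_zero] at h2
  exact (add_right_cancel h2).symm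

theorem map_orbitSum (l : L) (x : Fin d → ℤ) : l.1 (hw.orbitSum l x) = hw.orbitSum l x := by
  conv_rhs => rw [← hw.orbitSum_map]
  rw [orbitSum_apply, orbitSum_apply]
  refine (map_sum (hw.hom l) _ _).trans (Finset.sum_congr rfl fun j _ => ?_)
  change (l * l ^ j).1 x = (l ^ j * l).1 x
  rw [← pow_succ, ← pow_succ']

theorem pow_apply_of_fixed {l : L} {u : Fin d → ℤ} (hu : l.1 u = u) (j : ℕ) : (l ^ j).1 u = u := by
  induction j with
  | zero => rfl
  | succ j ih =>
    rw [pow_succ]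
    change (l ^ j).1 (l.1 u) = u
    rw [hu, ih]

theorem orbitSum_of_fixed {l : L} {u : Fin d → ℤ} (hu : l.1 u = u) :
    hw.orbitSum l u = orderOf l • u := by
  rw [orbitSum_apply, Finset.sum_congr rfl fun j _ => hw.pow_apply_of_fixed hu j]
  simp

theorem form_orbitSum {l : L} {u : Fin d → ℤ} (hu : l.1 u = u) (y : Fin d → ℤ) :
    hw.form u (hw.orbitSum l y) = orderOf l * hw.form u y := by
  rw [orbitSum_apply, map_sum]
  have h : ∀ j ∈ Finset.range (orderOf l), hw.form u ((l ^ j).1 y) = hw.form u y := fun j _ => by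
    conv_lhs => rw [← hw.pow_apply_of_fixed hu j]
    exact hw.form_map _ _ _
  rw [Finset.sum_congr rfl h]
  simp

theorem sum_matrixNormSq_eq {x : Fin d → ℤ} (hx : x ∈ edgeSet Sp) :
    matrixNormSq (A 0) + (edgeSet Sp).card * matrixNormSq (A x) = 2 := by
  have h := hw.sum_matrixNormSq
  rw [sum_stepSet hw.gen, Finset.sum_congr rfl (fun y hy => hw.matrixNormSq_eq hy hx)] at h
  simpa using h

/-- Otherwise the trace of `A 0` would have real part two, and `A 0` alone would exhaust the total
squared norm two, leaving nothing for the edges. -/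
theorem trace_re_ne_zero {x : Fin d → ℤ} (hx : x ∈ edgeSet Sp) : (A x).trace.re ≠ 0 := by
  intro h0
  have h1 := hw.sum_trace_re x hx
  have h2 := hw.sum_matrixNormSq_eq hx
  have h3 := trace_re_sq_le (A 0)
  have h4 := matrixNormSq_pos (hw.ne_zero x hx)
  have h5 : (0 : ℝ) < (edgeSet Sp).card := by exact_mod_cast Finset.card_pos.2 ⟨x, hx⟩
  rw [h0, mul_zero, add_zero] at h1
  rw [h1] at h3
  have := mul_pos h5 h4
  linarith

/-- The edges orthogonal to the axis of an automorphism. -/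
noncomputable def levelZero (l : L) : Finset (Fin d → ℤ) :=
  (edgeSet Sp).filter fun x => hw.orbitSum l x = 0

/-- The heights of the edges over the axis of a nontrivial automorphism are `0` or `± m`. -/
theorem exists_height {l : L} (hl : l ≠ 1) {x₀ : Fin d → ℤ} (hx₀ : x₀ ∈ edgeSet Sp) :
    ∃ m, (∀ x ∈ edgeSet Sp, hw.orbitSum l x = 0 ∨ hw.orbitSum l x = m ∨ hw.orbitSum l x = -m) ∧
      (m ≠ 0 → (A 0).trace.re + (hw.levelZero l).card * (A x₀).trace.re = 0) := by
  -- The orbit sum is invariant under `l`, so it can serve as the quotient map; its values are the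
  -- heights over the axis.
  obtain ⟨m, hm⟩ := hw.exists_trace_sum_eq hl (hw.orbitSum l) (hw.orbitSum_map l)
  have hτ := hw.trace_re_ne_zero hx₀
  have hsum : ∀ c, (∑ x ∈ edgeSet Sp with hw.orbitSum l x = c, (A x).trace).re =
      ((edgeSet Sp).filter fun x => hw.orbitSum l x = c).card * (A x₀).trace.re := by
    intro c
    rw [Complex.re_sum, Finset.sum_congr rfl
      (fun y hy => hw.trace_re_eq (Finset.mem_filter.1 hy).1 hx₀)]
    simp
  have hsplit : ∀ c, ∑ x ∈ stepSet Sp with hw.orbitSum l x = c, (A x).trace =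
      (if c = 0 then (A 0).trace else 0) +
        ∑ x ∈ edgeSet Sp with hw.orbitSum l x = c, (A x).trace := by
    intro c
    rw [Finset.sum_filter, sum_stepSet hw.gen, Finset.sum_filter, _root_.map_zero]
    simp only [eq_comm]
  refine ⟨m, fun x hx => ?_, fun hm0 => ?_⟩
  -- At any other height the traces sum to zero, which is impossible for a nonempty set of edges
  -- with a common nonzero real part of the trace.
  · by_contra! hne
    have h := hm (hw.orbitSum l x)
    rw [hsplit, if_neg hne.1, if_neg hne.2.1, if_neg hne.2.2, zero_add, zero_add] at h
    have h' := congrArg Complex.re h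
    rw [hsum, Complex.zero_re, mul_eq_zero] at h'
    rcases h' with h' | h'
    · rw [Nat.cast_eq_zero, Finset.card_eq_zero] at h'
      have : x ∈ (edgeSet Sp).filter fun y => hw.orbitSum l y = hw.orbitSum l x :=
        Finset.mem_filter.2 ⟨hx, rfl⟩
      rw [h'] at this
      simp at this
    · exact hτ h'
  · have h := hm 0
    rw [hsplit, if_pos rfl, if_neg (Ne.symm hm0), if_neg (by simpa using hm0)] at h
    have h' := congrArg Complex.re h
    rw [Complex.add_re, hsum] at h'
    simpa [levelZero] using h'

/-- A nonzero height must be `m` or `-m`, so the height of `x` itself can play the role of `m`. -/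
theorem exists_height' {l : L} (hl : l ≠ 1) {x : Fin d → ℤ} (hx : x ∈ edgeSet Sp)
    (h0 : hw.orbitSum l x ≠ 0) :
    (∀ y ∈ edgeSet Sp, hw.orbitSum l y = 0 ∨ hw.orbitSum l y = hw.orbitSum l x ∨
      hw.orbitSum l y = -hw.orbitSum l x) ∧
      (A 0).trace.re + (hw.levelZero l).card * (A x).trace.re = 0 := by
  obtain ⟨m, h1, h2⟩ := hw.exists_height hl hx
  have hm : m ≠ 0 := by
    rintro rfl
    rcases h1 x hx with h | h | h
    · exact h0 h
    · exact h0 h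
    · exact h0 (by simpa using h)
  refine ⟨fun y hy => ?_, h2 hm⟩
  rcases h1 x hx with h | h | h
  · exact absurd h h0
  · rw [h]; exact h1 y hy
  · rw [h, neg_neg]
    rcases h1 y hy with h' | h' | h'
    · exact Or.inl h'
    · exact Or.inr (Or.inr h')
    · exact Or.inr (Or.inl h')

/-- Let `s` count the edges, `N` those at height zero, and let `τ` be the common real part of the
edge traces. The level condition gives `A 0` the real trace `-Nτ`, and the total trace gives `(s -
N)τ = 2`. The bounds of traces by norms, with total squared norm two, yield `N² + 2s ≤ (s - N)²`,
hence `2N < s`. -/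
theorem levelZero_card_lt {l : L} (hl : l ≠ 1) {x : Fin d → ℤ} (hx : x ∈ edgeSet Sp)
    (h0 : hw.orbitSum l x ≠ 0) : 2 * (hw.levelZero l).card < (edgeSet Sp).card := by
  have h1 := (hw.exists_height' hl hx h0).2
  have h2 := hw.sum_trace_re x hx
  have h3 := hw.sum_matrixNormSq_eq hx
  have h4 := trace_re_sq_le (A 0)
  have h5 := trace_re_sq_le_of_det_eq_zero (hw.det_eq_zero hx)
  have h6 := hw.trace_re_ne_zero hx
  have h7 : (0 : ℝ) < (edgeSet Sp).card := by exact_mod_cast Finset.card_pos.2 ⟨x, hx⟩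
  set τ := (A x).trace.re
  set b := (A 0).trace.re
  set N : ℝ := ((hw.levelZero l).card : ℝ) with hN
  set s : ℝ := ((edgeSet Sp).card : ℝ) with hs
  have hb : b = -(N * τ) := by linarith
  have h8 : (s - N) * τ = 2 := by rw [← h2, hb]; ring
  have h9 : b ^ 2 + 2 * s * τ ^ 2 ≤ 4 := by nlinarith
  have h10 : τ ^ 2 * (N ^ 2 + 2 * s) ≤ τ ^ 2 * (s - N) ^ 2 := by
    have : τ ^ 2 * (s - N) ^ 2 = 4 := by rw [← mul_pow, mul_comm, h8]; norm_num
    rw [this]; rw [hb] at h9; nlinarith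
  have h11 : N ^ 2 + 2 * s ≤ (s - N) ^ 2 := le_of_mul_le_mul_left h10 (by positivity)
  have h12 : 2 * N < s := by
    by_contra hle
    push Not at hle
    nlinarith
  rw [hN, hs] at h12
  exact_mod_cast h12

/-- The level condition expresses this number through the real traces of `A 0` and of the edges, and
these do not depend on the automorphism. -/
theorem levelZero_card_eq {l m : L} (hl : l ≠ 1) (hm : m ≠ 1) {x y : Fin d → ℤ}
    (hx : x ∈ edgeSet Sp) (hy : y ∈ edgeSet Sp) (hlx : hw.orbitSum l x ≠ 0)
    (hmy : hw.orbitSum m y ≠ 0) : (hw.levelZero l).card = (hw.levelZero m).card := by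
  have h1 := (hw.exists_height' hl hx hlx).2
  have h2 := (hw.exists_height' hm hy hmy).2
  rw [hw.trace_re_eq hy hx] at h2
  have h3 := hw.trace_re_ne_zero hx
  have h4 : ((hw.levelZero l).card : ℝ) = (hw.levelZero m).card := by
    apply mul_right_cancel₀ h3; linarith
  exact_mod_cast h4

end IsNormalWalk

/-! ### Adapted bases -/

theorem exists_unitary_column {v : Fin 2 → ℂ} (hv : v ≠ 0) :
    ∃ B ∈ Matrix.unitaryGroup (Fin 2) ℂ, ∃ c : ℂ, ∀ i, Bᴴ i 1 = c * v i := by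
  have hpos : 0 < Complex.normSq (v 0) + Complex.normSq (v 1) := by
    by_contra hle
    apply hv
    have h0 := Complex.normSq_nonneg (v 0)
    have h1 := Complex.normSq_nonneg (v 1)
    have e0 : v 0 = 0 := Complex.normSq_eq_zero.1 (by linarith)
    have e1 : v 1 = 0 := Complex.normSq_eq_zero.1 (by linarith)
    ext i
    fin_cases i
    · exact e0
    · exact e1
  set n : ℝ := (Real.sqrt (Complex.normSq (v 0) + Complex.normSq (v 1)))⁻¹ with hn
  have hn2 : (n : ℂ) * n * (v 0 * star (v 0) + v 1 * star (v 1)) = 1 := by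
    have h1 : n * n * (Complex.normSq (v 0) + Complex.normSq (v 1)) = 1 := by
      rw [hn, ← mul_inv, Real.mul_self_sqrt hpos.le, inv_mul_cancel₀ hpos.ne']
    have h2 : ((n * n * (Complex.normSq (v 0) + Complex.normSq (v 1)) : ℝ) : ℂ) = 1 := by
      rw [h1]; simp
    push_cast at h2
    rw [← Complex.mul_conj, ← Complex.mul_conj] at h2
    exact h2
  -- The second row is the conjugate of the normalised vector, so that the second column of the
  -- adjoint is the vector itself; the first row completes it to an orthonormal basis.
  refine ⟨!![n * v 1, -(n * v 0); n * star (v 0), n * star (v 1)], ?_, n, ?_⟩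
  · rw [Matrix.mem_unitaryGroup_iff]
    ext i j
    fin_cases i <;> fin_cases j <;>
      simp [Matrix.mul_apply, Fin.sum_univ_two, Matrix.star_apply] <;>
      simp only [← starRingEnd_apply] at hn2
    · linear_combination hn2
    · ring
    · ring
    · linear_combination hn2
  · intro i
    fin_cases i <;> simp

theorem exists_unitary_kernel {P : Matrix (Fin 2) (Fin 2) ℂ} (hP : P.det = 0) :
    ∃ B ∈ Matrix.unitaryGroup (Fin 2) ℂ, ∀ i, (B * P * Bᴴ) i 1 = 0 := by
  obtain ⟨v, hv, hPv⟩ := Matrix.exists_mulVec_eq_zero_iff.2 hP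
  obtain ⟨B, hB, c, hc⟩ := exists_unitary_column hv
  refine ⟨B, hB, fun i => ?_⟩
  have h1 : ∀ j, (P * Bᴴ) j 1 = 0 := by
    intro j
    have h2 := congrFun hPv j
    simp only [Matrix.mulVec, dotProduct, Pi.zero_apply, Fin.sum_univ_two] at h2
    rw [Matrix.mul_apply, Fin.sum_univ_two, hc, hc]
    linear_combination c * h2
  rw [mul_assoc, Matrix.mul_apply]
  exact Finset.sum_eq_zero fun j _ => by rw [h1, mul_zero]

theorem unitary_entries {V : Matrix (Fin 2) (Fin 2) ℂ} (hV : V ∈ Matrix.unitaryGroup (Fin 2) ℂ) :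
    star (V 0 0) * V 0 0 + star (V 1 0) * V 1 0 = 1 ∧
    star (V 0 1) * V 0 1 + star (V 1 1) * V 1 1 = 1 ∧
    V 0 0 * star (V 0 0) + V 0 1 * star (V 0 1) = 1 ∧
    V 1 0 * star (V 1 0) + V 1 1 * star (V 1 1) = 1 := by
  have h1 := Matrix.mem_unitaryGroup_iff'.1 hV
  have h2 := Matrix.mem_unitaryGroup_iff.1 hV
  have a := congrFun (congrFun h1 0) 0
  have b := congrFun (congrFun h1 1) 1
  have c := congrFun (congrFun h2 0) 0
  have e := congrFun (congrFun h2 1) 1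
  simp only [Matrix.mul_apply, Fin.sum_univ_two, Matrix.star_apply, Matrix.one_apply_eq] at a b c e
  exact ⟨a, b, c, e⟩

theorem star_mul_self_eq_zero_iff {z : ℂ} : star z * z = 0 ↔ z = 0 := by
  simp

theorem unitary_diagonal {V : Matrix (Fin 2) (Fin 2) ℂ} (hV : V ∈ Matrix.unitaryGroup (Fin 2) ℂ)
    (h : V 0 1 = 0) : V 1 0 = 0 ∧ star (V 0 0) * V 0 0 = 1 ∧ star (V 1 1) * V 1 1 = 1 := by
  obtain ⟨a, b, c, -⟩ := unitary_entries hV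
  rw [h] at b c
  simp only [star_zero, mul_zero, add_zero, zero_add] at b c
  rw [mul_comm] at c
  rw [c] at a
  exact ⟨star_mul_self_eq_zero_iff.1 (by linear_combination a), c, b⟩

theorem unitary_antidiagonal {V : Matrix (Fin 2) (Fin 2) ℂ}
    (hV : V ∈ Matrix.unitaryGroup (Fin 2) ℂ) (h : V 0 0 = 0) :
    V 1 1 = 0 ∧ star (V 0 1) * V 0 1 = 1 ∧ star (V 1 0) * V 1 0 = 1 := by
  obtain ⟨a, b, c, -⟩ := unitary_entries hV
  rw [h] at a c
  simp only [star_zero, mul_zero, zero_add] at a c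
  rw [mul_comm] at c
  rw [c] at b
  exact ⟨star_mul_self_eq_zero_iff.1 (by linear_combination b), c, a⟩

/-- The second basis vector is taken to be an eigenvector, that is, a kernel vector of `V - p` for
an eigenvalue `p`. -/
theorem exists_unitary_diagonal (V : Matrix (Fin 2) (Fin 2) ℂ) :
    ∃ B ∈ Matrix.unitaryGroup (Fin 2) ℂ, (B * V * Bᴴ) 0 1 = 0 := by
  obtain ⟨r, hr⟩ : ∃ r : ℂ, r * r = V.trace * V.trace - 4 * V.det := by
    obtain ⟨r, hr⟩ := IsAlgClosed.exists_pow_nat_eq (V.trace * V.trace - 4 * V.det) (n := 2)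
      (by norm_num)
    exact ⟨r, by rw [← sq, hr]⟩
  set p := (V.trace + r) / 2 with hp
  have hdet : (V - p • 1).det = 0 := by
    rw [Matrix.trace_fin_two, Matrix.det_fin_two] at hr
    rw [Matrix.trace_fin_two] at hp
    rw [Matrix.det_fin_two]
    simp
    rw [hp]
    linear_combination (1/4) * hr
  obtain ⟨B, hB, h⟩ := exists_unitary_kernel hdet
  refine ⟨B, hB, ?_⟩
  have h0 := h 0
  have hBB : B * Bᴴ = 1 := Matrix.mem_unitaryGroup_iff.1 hB
  rw [mul_sub, sub_mul, Matrix.mul_smul, Matrix.smul_mul, mul_one, hBB] at h0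
  simpa using h0

theorem exists_sqrt_phase {z : ℂ} (hz : star z * z = 1) : ∃ g : ℂ, g * g = z ∧ star g * g = 1 := by
  obtain ⟨g, hg⟩ := IsAlgClosed.exists_pow_nat_eq z (n := 2) (by norm_num)
  refine ⟨g, by rw [← sq, hg], ?_⟩
  rw [← hg] at hz
  have h1 : ‖g‖ ^ 4 = 1 := by
    have := congrArg norm hz
    simp only [norm_mul, norm_star, norm_pow, norm_one] at this
    rw [← this]; ring
  have h2 : ‖g‖ = 1 := by
    have := norm_nonneg g
    nlinarith [sq_nonneg (‖g‖ ^ 2 - 1), sq_nonneg (‖g‖ - 1)]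
  have h3 := Complex.normSq_eq_conj_mul_self (z := g)
  rw [Complex.normSq_eq_norm_sq, h2] at h3
  simpa using h3.symm

theorem norm_eq_one_of_star_mul_self {z : ℂ} (h : star z * z = 1) : ‖z‖ = 1 := by
  have := congrArg norm h
  simp only [norm_mul, norm_star, norm_one] at this
  nlinarith [norm_nonneg z]

theorem mem_unitaryGroup_diagonal {a b : ℂ} (ha : star a * a = 1) (hb : star b * b = 1) :
    !![a, 0; 0, b] ∈ Matrix.unitaryGroup (Fin 2) ℂ := by
  rw [Matrix.mem_unitaryGroup_iff']
  ext i j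
  fin_cases i <;> fin_cases j <;>
    simp [Matrix.mul_apply, Fin.sum_univ_two, Matrix.star_apply] <;>
    simpa using by assumption

theorem diagonal_conj (a b : ℂ) (V : Matrix (Fin 2) (Fin 2) ℂ) :
    !![a, 0; 0, b] * V * !![a, 0; 0, b]ᴴ =
      !![a * V 0 0 * star a, a * V 0 1 * star b; b * V 1 0 * star a, b * V 1 1 * star b] := by
  ext i j
  fin_cases i <;> fin_cases j <;>
    simp [Matrix.mul_apply, Fin.sum_univ_two, Matrix.vecMul, dotProduct]

theorem conj_mul_conj {B : Matrix (Fin 2) (Fin 2) ℂ} (hB : B ∈ Matrix.unitaryGroup (Fin 2) ℂ)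
    (M N : Matrix (Fin 2) (Fin 2) ℂ) : (B * M * Bᴴ) * (B * N * Bᴴ) = B * (M * N) * Bᴴ := by
  have hBB : Bᴴ * B = 1 := Matrix.mem_unitaryGroup_iff'.1 hB
  calc _ = B * M * (Bᴴ * B) * N * Bᴴ := by simp only [mul_assoc]
    _ = _ := by rw [hBB]; simp only [mul_assoc, one_mul]

theorem conj_smul_one {B : Matrix (Fin 2) (Fin 2) ℂ} (hB : B ∈ Matrix.unitaryGroup (Fin 2) ℂ)
    (c : ℂ) : B * (c • (1 : Matrix (Fin 2) (Fin 2) ℂ)) * Bᴴ = c • 1 := by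
  have hBB : B * Bᴴ = 1 := Matrix.mem_unitaryGroup_iff.1 hB
  simp [hBB]

theorem conj_unitary_injective {B : Matrix (Fin 2) (Fin 2) ℂ} (hB : B ∈ Matrix.unitaryGroup (Fin 2) ℂ)
    {M N : Matrix (Fin 2) (Fin 2) ℂ} (h : B * M * Bᴴ = B * N * Bᴴ) : M = N := by
  have hBB : Bᴴ * B = 1 := Matrix.mem_unitaryGroup_iff'.1 hB
  have key : ∀ M, Bᴴ * (B * M * Bᴴ) * B = M := by
    intro M
    calc _ = (Bᴴ * B) * M * (Bᴴ * B) := by simp only [mul_assoc]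
      _ = M := by rw [hBB, one_mul, mul_one]
  rw [← key M, h, key]

theorem conj_mem_unitaryGroup {B V : Matrix (Fin 2) (Fin 2) ℂ}
    (hB : B ∈ Matrix.unitaryGroup (Fin 2) ℂ) (hV : V ∈ Matrix.unitaryGroup (Fin 2) ℂ) :
    B * V * Bᴴ ∈ Matrix.unitaryGroup (Fin 2) ℂ :=
  mul_mem (mul_mem hB hV) (Unitary.star_mem hB)

/-- All rows of `P` are multiples of the first coordinate covector, so the relation makes this
covector a left eigenvector of `V`. -/
theorem eq_zero_of_mul_eq_smul {P V : Matrix (Fin 2) (Fin 2) ℂ} (hP : P ≠ 0)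
    (hk : ∀ i, P i 1 = 0) {c : ℂ} (h : P * V = c • P) : V 0 1 = 0 := by
  have h1 : ∀ i, P i 0 * V 0 1 = 0 := by
    intro i
    have := congrFun (congrFun h i) 1
    simpa [Matrix.mul_apply, Fin.sum_univ_two, hk] using this
  by_contra hne
  apply hP
  ext i j
  fin_cases j
  · simpa [hne] using h1 i
  · simpa using hk i

/-- A triangular unitary is diagonal; a scalar square makes its eigenvalues equal up to sign, and
the sign is minus because the matrix is not scalar. -/
theorem eq_smul_pauliZ {V : Matrix (Fin 2) (Fin 2) ℂ} (hV : V ∈ Matrix.unitaryGroup (Fin 2) ℂ)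
    (h : V 0 1 = 0) (hs : ∀ c : ℂ, V ≠ c • 1) {a : ℂ} (ha : V * V = a • 1) :
    ∃ c : ℂ, ‖c‖ = 1 ∧ V = c • (Complex.I • pauliZ) := by
  obtain ⟨h1, h2, h3⟩ := unitary_diagonal hV h
  have e0 := congrFun (congrFun ha 0) 0
  have e1 := congrFun (congrFun ha 1) 1
  simp [Matrix.mul_apply, Fin.sum_univ_two, h, h1] at e0 e1
  have e2 : V 1 1 = -V 0 0 := by
    have : (V 1 1 - V 0 0) * (V 1 1 + V 0 0) = 0 := by linear_combination e1 - e0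
    rcases mul_eq_zero.1 this with h' | h'
    · exfalso
      apply hs (V 0 0)
      ext i j
      fin_cases i <;> fin_cases j <;> simp [h, h1]
      linear_combination h'
    · linear_combination h'
  refine ⟨-Complex.I * V 0 0, ?_, ?_⟩
  · rw [norm_mul, norm_neg, Complex.norm_I, one_mul]
    exact norm_eq_one_of_star_mul_self h2
  · have hI := Complex.I_mul_I
    ext i j
    fin_cases i <;> fin_cases j <;> simp [h, h1, e2, pauliZ]
    · linear_combination (V 0 0) * hI
    · linear_combination (-V 0 0) * hI

/-- Conjugation by diagonal phases changes the ratio of the two off-diagonal entries; a square root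
`g` of that ratio makes them equal. -/
theorem exists_diagonal_conj_eq_smul_pauliX {V : Matrix (Fin 2) (Fin 2) ℂ}
    (hV : V ∈ Matrix.unitaryGroup (Fin 2) ℂ) (h : V 0 0 = 0) :
    ∃ g : ℂ, star g * g = 1 ∧ ∃ c : ℂ, ‖c‖ = 1 ∧
      !![1, 0; 0, g] * V * !![1, 0; 0, g]ᴴ = c • (Complex.I • pauliX) := by
  obtain ⟨h1, h2, h3⟩ := unitary_antidiagonal hV h
  obtain ⟨g, hg, hgg⟩ := exists_sqrt_phase (z := V 0 1 * star (V 1 0)) (by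
    rw [star_mul, star_star]; linear_combination (star (V 1 0) * V 1 0) * h2 + h3)
  refine ⟨g, hgg, -Complex.I * (V 0 1 * star g), ?_, ?_⟩
  · rw [norm_mul, norm_mul, norm_neg, Complex.norm_I, norm_star, one_mul,
      norm_eq_one_of_star_mul_self hgg, norm_eq_one_of_star_mul_self h2, one_mul]
  · have hI := Complex.I_mul_I
    rw [diagonal_conj]
    ext i j
    fin_cases i <;> fin_cases j <;> simp [h, h1, pauliX]
    · simp only [← starRingEnd_apply] at *
      linear_combination (V 0 1 * starRingEnd ℂ g) * hI
    · simp only [← starRingEnd_apply] at *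
      linear_combination (V 0 1 * starRingEnd ℂ g) * hI + V 1 0 * starRingEnd ℂ g * hg
        - g * V 1 0 * hgg + V 0 1 * starRingEnd ℂ g * h3

/-- A simultaneous Pauli form of two commuting projective involutions, adapted to a kernel. -/
theorem exists_pauli_basis {P V W : Matrix (Fin 2) (Fin 2) ℂ} (hP : P ≠ 0) (hdet : P.det = 0)
    (hV : V ∈ Matrix.unitaryGroup (Fin 2) ℂ) (hW : W ∈ Matrix.unitaryGroup (Fin 2) ℂ)
    (hVs : ∀ c : ℂ, V ≠ c • 1) (hWs : ∀ c : ℂ, W ≠ c • 1) (hVWs : ∀ c : ℂ, V * W ≠ c • 1)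
    (hV2 : ∃ a : ℂ, V * V = a • 1) (hW2 : ∃ a : ℂ, W * W = a • 1)
    (hVW : ∃ a : ℂ, V * W = a • (W * V)) (hk : ∃ a : ℂ, P * V = a • P) :
    ∃ B ∈ Matrix.unitaryGroup (Fin 2) ℂ, (∀ i, (B * P * Bᴴ) i 1 = 0) ∧
      (∃ c : ℂ, ‖c‖ = 1 ∧ B * V * Bᴴ = c • (Complex.I • pauliZ)) ∧
      (∃ c : ℂ, ‖c‖ = 1 ∧ B * W * Bᴴ = c • (Complex.I • pauliX)) ∧
      (∃ c : ℂ, ‖c‖ = 1 ∧ B * (V * W) * Bᴴ = c • (Complex.I • pauliY)) := by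
  obtain ⟨B, hB, hBk⟩ := exists_unitary_kernel hdet
  obtain ⟨a, ha⟩ := hV2
  obtain ⟨b, hb⟩ := hW2
  obtain ⟨e, he⟩ := hVW
  obtain ⟨k, hk⟩ := hk
  have hsc : ∀ M, (∀ c : ℂ, M ≠ c • (1 : Matrix (Fin 2) (Fin 2) ℂ)) →
      ∀ c : ℂ, B * M * Bᴴ ≠ c • 1 := by
    intro M hM c hc
    apply hM c
    apply conj_unitary_injective hB
    rw [hc, conj_smul_one hB]
  have hsq : ∀ M, ∀ c : ℂ, M * M = c • (1 : Matrix (Fin 2) (Fin 2) ℂ) →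
      (B * M * Bᴴ) * (B * M * Bᴴ) = c • 1 := by
    intro M c hc
    rw [conj_mul_conj hB, hc, conj_smul_one hB]
  have hV' := conj_mem_unitaryGroup hB hV
  have hW' := conj_mem_unitaryGroup hB hW
  have hP' : B * P * Bᴴ ≠ 0 := fun h0 => hP (conj_unitary_injective hB (by rw [h0]; simp))
  have hPV : (B * P * Bᴴ) * (B * V * Bᴴ) = k • (B * P * Bᴴ) := by
    rw [conj_mul_conj hB, hk]; simp
  have hVW' : (B * V * Bᴴ) * (B * W * Bᴴ) = e • ((B * W * Bᴴ) * (B * V * Bᴴ)) := by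
    rw [conj_mul_conj hB, conj_mul_conj hB, he]; simp
  have hVW2 : B * (V * W) * Bᴴ = (B * V * Bᴴ) * (B * W * Bᴴ) := (conj_mul_conj hB _ _).symm
  have hs1 := hsc V hVs
  have hs2 := hsc W hWs
  have hs3 := hsc (V * W) hVWs
  have hsq1 := hsq V a ha
  have hsq2 := hsq W b hb
  rw [hVW2] at hs3
  have hV01 := eq_zero_of_mul_eq_smul hP' hBk hPV
  obtain ⟨c, hc, hVc⟩ := eq_smul_pauliZ hV' hV01 hs1 hsq1
  have hcne : c * Complex.I ≠ 0 := by
    apply mul_ne_zero _ Complex.I_ne_zero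
    rintro rfl; simp at hc
  -- If this entry survived, the commutation phase would be one and `W` would commute with `σ_Z`. It
  -- would then be diagonal, another multiple of `σ_Z`, and `V * W` would be scalar.
  have hW00 : (B * W * Bᴴ) 0 0 = 0 := by
    set W' := B * W * Bᴴ
    by_contra hne
    rw [hVc] at hVW'
    have e00 := congrFun (congrFun hVW' 0) 0
    have e01 := congrFun (congrFun hVW' 0) 1
    simp [pauliZ, Matrix.mul_apply, Fin.sum_univ_two] at e00 e01
    have he1 : e = 1 := by
      have : (e - 1) * (c * Complex.I * W' 0 0) = 0 := by linear_combination -e00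
      rcases mul_eq_zero.1 this with h' | h'
      · exact sub_eq_zero.1 h'
      · exact absurd h' (mul_ne_zero hcne hne)
    have h01 : W' 0 1 = 0 := by
      have : (c * Complex.I) * W' 0 1 = 0 := by
        rw [he1] at e01; linear_combination e01 / 2
      exact (mul_eq_zero.1 this).resolve_left hcne
    obtain ⟨c', -, hc'⟩ := eq_smul_pauliZ hW' h01 hs2 hsq2
    apply hs3 (-(c * c'))
    rw [hVc, hc']
    have hI := Complex.I_mul_I
    ext i j
    fin_cases i <;> fin_cases j <;> simp [pauliZ, Matrix.mul_apply, Fin.sum_univ_two]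
    · linear_combination c * c' * hI
    · linear_combination c * c' * hI
  obtain ⟨g, hg, c', hc', hX⟩ := exists_diagonal_conj_eq_smul_pauliX hW' hW00
  have hD := mem_unitaryGroup_diagonal (a := 1) (by simp) hg
  have hassoc : ∀ M, (!![1, 0; 0, g] * B) * M * (!![1, 0; 0, g] * B)ᴴ =
      !![1, 0; 0, g] * (B * M * Bᴴ) * !![1, 0; 0, g]ᴴ := by
    intro M
    simp only [Matrix.conjTranspose_mul, mul_assoc]
  have hZ : !![1, 0; 0, g] * (B * V * Bᴴ) * !![1, 0; 0, g]ᴴ = c • (Complex.I • pauliZ) := by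
    rw [hVc, diagonal_conj]
    ext i j
    fin_cases i <;> fin_cases j <;> simp [pauliZ]
    simp only [← starRingEnd_apply] at *
    linear_combination (c * Complex.I) * hg
  -- The phase of the product comes from `σ_Z σ_X = i σ_Y` and the two factors `i`.
  refine ⟨!![1, 0; 0, g] * B, mul_mem hD hB, ?_, ⟨c, hc, ?_⟩, ⟨c', hc', ?_⟩,
    ⟨-(c * c'), by rw [norm_neg, norm_mul, hc, hc', one_mul], ?_⟩⟩
  · intro i
    rw [hassoc, diagonal_conj]
    fin_cases i <;> simp [hBk]
  · rw [hassoc, hZ]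
  · rw [hassoc, hX]
  · rw [hassoc, hVW2, ← conj_mul_conj hD, hZ, hX]
    have hI := Complex.I_mul_I
    ext i j
    fin_cases i <;> fin_cases j <;> simp [pauliZ, pauliX, pauliY, Matrix.mul_apply, Fin.sum_univ_two]
    · linear_combination c * c' * hI
    · linear_combination -c * c' * hI

/-! ### Isotropy representations in adapted coin bases -/

namespace IsNormalWalk

set_option linter.unusedSectionVars false

section Conj

variable {G : Type*} [AddCommGroup G] [DecidableEq G] {Sp : Finset G}
  {A : G → Matrix (Fin 2) (Fin 2) ℂ} {L : Subgroup (Equiv.Perm G)}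
  {U : L → Matrix.unitaryGroup (Fin 2) ℂ} (hw : IsNormalWalk Sp A L U)

include hw

/-- A change of orthonormal basis in the coin space. -/
theorem conj (B : Matrix.unitaryGroup (Fin 2) ℂ) :
    IsNormalWalk Sp (fun x => (B : Matrix (Fin 2) (Fin 2) ℂ) * A x * (B : Matrix (Fin 2) (Fin 2) ℂ)ᴴ)
      L (fun l => B * U l * B⁻¹) := by
  have hB : (B : Matrix (Fin 2) (Fin 2) ℂ)ᴴ * B = 1 := Matrix.mem_unitaryGroup_iff'.1 B.2
  have hB' : (B : Matrix (Fin 2) (Fin 2) ℂ) * (B : Matrix (Fin 2) (Fin 2) ℂ)ᴴ = 1 :=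
    Matrix.mem_unitaryGroup_iff.1 B.2
  have hcoe : ∀ l, ((B * U l * B⁻¹ : Matrix.unitaryGroup (Fin 2) ℂ) : Matrix (Fin 2) (Fin 2) ℂ) =
      B * U l * (B : Matrix (Fin 2) (Fin 2) ℂ)ᴴ := fun l => rfl
  have hcancel : ∀ M, (B : Matrix (Fin 2) (Fin 2) ℂ)ᴴ *
      (B * M * (B : Matrix (Fin 2) (Fin 2) ℂ)ᴴ) * B = M := by
    intro M
    calc _ = ((B : Matrix (Fin 2) (Fin 2) ℂ)ᴴ * B) * M * ((B : Matrix (Fin 2) (Fin 2) ℂ)ᴴ * B) := by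
          simp only [mul_assoc]
      _ = M := by rw [hB, one_mul, mul_one]
  have hmul : ∀ M N : Matrix (Fin 2) (Fin 2) ℂ, (B * M * (B : Matrix (Fin 2) (Fin 2) ℂ)ᴴ) *
      (B * N * (B : Matrix (Fin 2) (Fin 2) ℂ)ᴴ) =
      B * (M * N) * (B : Matrix (Fin 2) (Fin 2) ℂ)ᴴ := by
    intro M N
    calc _ = B * M * ((B : Matrix (Fin 2) (Fin 2) ℂ)ᴴ * B) * N *
          (B : Matrix (Fin 2) (Fin 2) ℂ)ᴴ := by simp only [mul_assoc]
      _ = _ := by rw [hB]; simp only [mul_assoc, one_mul]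
  refine ⟨hw.gen, hw.map_add, hw.map_mem, hw.trans, ?_, ?_, ?_, ?_, ?_, ?_, ?_, ?_⟩
  · intro l m
    obtain ⟨c, hc, h⟩ := hw.projective l m
    refine ⟨c, hc, ?_⟩
    rw [hcoe, hcoe, hcoe, h, hmul, Matrix.mul_smul, Matrix.smul_mul]
  · intro h hh h0
    apply hw.ne_zero h hh
    rw [← hcancel (A h), h0]; simp
  · intro x hx
    simp [hw.eq_zero x hx]
  · intro x
    rw [adjugate_conj_unitary hB, hw.adjugate_eq]
    simp only [Matrix.conjTranspose_mul, Matrix.conjTranspose_conjTranspose, mul_assoc]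
  · rw [← Finset.sum_mul, ← Finset.mul_sum, hw.sum_eq, mul_one, hB']
  · have h1 : walkSymbol (stepSet Sp)
        (fun x => (B : Matrix (Fin 2) (Fin 2) ℂ) * A x * (B : Matrix (Fin 2) (Fin 2) ℂ)ᴴ) =
        (B : Matrix (Fin 2) (Fin 2) ℂ).map (AddMonoidAlgebra.singleZeroRingHom) *
          walkSymbol (stepSet Sp) A *
        ((B : Matrix (Fin 2) (Fin 2) ℂ)ᴴ).map (AddMonoidAlgebra.singleZeroRingHom) := by
      ext1 i j
      have hs : ∀ x, AddMonoidAlgebra.single x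
          (((B : Matrix (Fin 2) (Fin 2) ℂ) * A x * (B : Matrix (Fin 2) (Fin 2) ℂ)ᴴ) i j) =
          ∑ k, ∑ m, AddMonoidAlgebra.single x
            ((B : Matrix (Fin 2) (Fin 2) ℂ) i m * A x m k * (B : Matrix (Fin 2) (Fin 2) ℂ)ᴴ k j) := by
        intro x
        rw [Matrix.mul_apply]
        refine (map_sum (AddMonoidAlgebra.singleAddHom x) _ _).trans ?_
        refine Finset.sum_congr rfl fun k _ => ?_
        rw [Matrix.mul_apply, Finset.sum_mul]
        exact map_sum (AddMonoidAlgebra.singleAddHom x) _ _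
      refine (Finset.sum_congr rfl fun x _ => hs x).trans ?_
      simp only [walkSymbol, Matrix.mul_apply, Matrix.map_apply, Finset.mul_sum, Finset.sum_mul]
      rw [Finset.sum_comm]
      refine Finset.sum_congr rfl fun k _ => ?_
      rw [Finset.sum_comm]
      refine Finset.sum_congr rfl fun m _ => ?_
      refine Finset.sum_congr rfl fun x _ => ?_
      simp [AddMonoidAlgebra.single_mul_single]
    have h2 : ∀ M : Matrix (Fin 2) (Fin 2) ℂ,
        (M.map (AddMonoidAlgebra.singleZeroRingHom (R := ℂ) (M := G))).det =
        AddMonoidAlgebra.singleZeroRingHom M.det := fun M => (RingHom.map_det _ _).symm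
    rw [h1, Matrix.det_mul, Matrix.det_mul, hw.det_eq, mul_one, h2, h2, ← map_mul,
      ← Matrix.det_mul, hB', Matrix.det_one, map_one]
  · intro l x
    rw [hcoe, hw.covariant]
    have : ((B : Matrix (Fin 2) (Fin 2) ℂ) * (U l : Matrix (Fin 2) (Fin 2) ℂ) * (B : Matrix (Fin 2) (Fin 2) ℂ)ᴴ)ᴴ =
        (B : Matrix (Fin 2) (Fin 2) ℂ) * (U l : Matrix (Fin 2) (Fin 2) ℂ)ᴴ * (B : Matrix (Fin 2) (Fin 2) ℂ)ᴴ := by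
      simp only [Matrix.conjTranspose_mul, Matrix.conjTranspose_conjTranspose, mul_assoc]
    rw [this, hmul, hmul]
  · rintro l ⟨c, hc⟩
    apply hw.faithful l
    refine ⟨c, ?_⟩
    rw [hcoe] at hc
    rw [← hcancel (U l : Matrix (Fin 2) (Fin 2) ℂ), hc]
    simp [hB]

/-- The matrix of `-h` is the adjoint of the adjugate of the matrix of `h`, so a vanishing second
column of one becomes a vanishing first column of the other. -/
theorem conj_neg_column {B : Matrix (Fin 2) (Fin 2) ℂ} (hB : B ∈ Matrix.unitaryGroup (Fin 2) ℂ)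
    {h : G} (hk : ∀ i, (B * A h * Bᴴ) i 1 = 0) : ∀ i, (B * A (-h) * Bᴴ) i 0 = 0 := by
  have h1 := (hw.conj ⟨B, hB⟩).apply_neg_eq h
  intro i
  change (B * A (-h) * Bᴴ) = (B * A h * Bᴴ).adjugateᴴ at h1
  rw [h1, Matrix.adjugate_fin_two]
  fin_cases i <;> simp [hk]

theorem exists_map_one : ∃ c : ℂ, ‖c‖ = 1 ∧ (U 1 : Matrix (Fin 2) (Fin 2) ℂ) = c • 1 := by
  obtain ⟨c, hc, h⟩ := hw.projective 1 1
  rw [mul_one] at h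
  have h1 := congrArg (fun M => M * (U 1 : Matrix (Fin 2) (Fin 2) ℂ)ᴴ) h
  simp only [Matrix.smul_mul, mul_assoc, hw.unitary_right, mul_one] at h1
  have hc0 : c ≠ 0 := by rintro rfl; simp at hc
  refine ⟨c⁻¹, by rw [norm_inv, hc, inv_one], ?_⟩
  rw [h1, smul_smul, inv_mul_cancel₀ hc0, one_smul]

theorem ne_smul_one {l : L} (hl : l ≠ 1) (c : ℂ) : (U l : Matrix (Fin 2) (Fin 2) ℂ) ≠ c • 1 :=
  fun hc => hl (hw.faithful l ⟨c, hc⟩)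

theorem mul_eq_smul (l m : L) : ∃ c : ℂ, ‖c‖ = 1 ∧
    (U l : Matrix (Fin 2) (Fin 2) ℂ) * (U m : Matrix (Fin 2) (Fin 2) ℂ) =
      c • (U (l * m) : Matrix (Fin 2) (Fin 2) ℂ) := by
  obtain ⟨c, hc, h⟩ := hw.projective l m
  have hc0 : c ≠ 0 := by rintro rfl; simp at hc
  refine ⟨c⁻¹, by rw [norm_inv, hc, inv_one], ?_⟩
  rw [h, smul_smul, inv_mul_cancel₀ hc0, one_smul]

theorem mul_self_eq_smul {l : L} (hl : l * l = 1) :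
    ∃ c : ℂ, (U l : Matrix (Fin 2) (Fin 2) ℂ) * (U l : Matrix (Fin 2) (Fin 2) ℂ) = c • 1 := by
  obtain ⟨c, -, h⟩ := hw.mul_eq_smul l l
  obtain ⟨c', -, h'⟩ := hw.exists_map_one
  refine ⟨c * c', ?_⟩
  rw [h, hl, h', smul_smul]

/-- The adapted basis at an edge when the isotropy group is a Klein four-group one of whose
elements preserves the kernel of the transition matrix. -/
theorem exists_heisenberg_basis {h : G} (hh : h ∈ Sp) (hdet : (A h).det = 0) {l m : L}
    (hl : l ≠ 1) (hm : m ≠ 1) (hlm : l ≠ m) (hll : l * l = 1) (hmm : m * m = 1)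
    (hcomm : m * l = l * m) (hall : ∀ n : L, n = 1 ∨ n = l ∨ n = m ∨ n = l * m)
    (hk : ∃ a : ℂ, A h * (U l : Matrix (Fin 2) (Fin 2) ℂ) = a • A h) :
    ∃ B ∈ Matrix.unitaryGroup (Fin 2) ℂ,
      (∀ i, (B * A h * Bᴴ) i 1 = 0) ∧ (∀ i, (B * A (-h) * Bᴴ) i 0 = 0) ∧
      (∀ n : L, ∃ p ∈ heisenbergRange, ∃ c : ℂ, ‖c‖ = 1 ∧
        B * (U n : Matrix (Fin 2) (Fin 2) ℂ) * Bᴴ = c • p) ∧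
      (∀ p ∈ heisenbergRange, ∃ n : L, ∃ c : ℂ, ‖c‖ = 1 ∧
        B * (U n : Matrix (Fin 2) (Fin 2) ℂ) * Bᴴ = c • p) := by
  have hlm1 : l * m ≠ 1 := by
    intro h1
    apply hlm
    rw [← mul_one l, ← hmm, ← mul_assoc, h1, one_mul]
  obtain ⟨c1, hc1, e1⟩ := hw.mul_eq_smul l m
  obtain ⟨c2, hc2, e2⟩ := hw.mul_eq_smul m l
  obtain ⟨c0, hc0, e0⟩ := hw.exists_map_one
  have hne : ∀ c : ℂ, ‖c‖ = 1 → c ≠ 0 := by rintro c hc rfl; simp at hc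
  obtain ⟨B, hB, hk, ⟨z, hz, hZ⟩, ⟨x, hx, hX⟩, ⟨y, hy, hY⟩⟩ := exists_pauli_basis
    (hw.ne_zero h (mem_edgeSet.2 (Or.inl hh))) hdet (U l).2 (U m).2 (hw.ne_smul_one hl)
    (hw.ne_smul_one hm) (by
      intro c hc
      apply hw.ne_smul_one hlm1 (c1⁻¹ * c)
      rw [← smul_smul, ← hc, e1, smul_smul, inv_mul_cancel₀ (hne c1 hc1), one_smul])
    (hw.mul_self_eq_smul hll) (hw.mul_self_eq_smul hmm)
    ⟨c1 * c2⁻¹, by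
      rw [e1, e2, hcomm, smul_smul, mul_assoc, inv_mul_cancel₀ (hne c2 hc2), mul_one]⟩ hk
  have h1 : B * (U 1 : Matrix (Fin 2) (Fin 2) ℂ) * Bᴴ = c0 • 1 := by
    rw [e0, conj_smul_one hB]
  have hY' : B * (U (l * m) : Matrix (Fin 2) (Fin 2) ℂ) * Bᴴ =
      (c1⁻¹ * y) • (Complex.I • pauliY) := by
    rw [e1] at hY
    rw [← smul_smul, ← hY, Matrix.mul_smul, Matrix.smul_mul, smul_smul,
      inv_mul_cancel₀ (hne c1 hc1), one_smul]
  have hcy : ‖c1⁻¹ * y‖ = 1 := by rw [norm_mul, norm_inv, hc1, hy, inv_one, one_mul]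
  refine ⟨B, hB, hk, hw.conj_neg_column hB hk, ?_, ?_⟩
  · intro n
    rcases hall n with rfl | rfl | rfl | rfl
    · exact ⟨1, by simp [heisenbergRange], c0, hc0, h1⟩
    · exact ⟨_, by simp [heisenbergRange], z, hz, hZ⟩
    · exact ⟨_, by simp [heisenbergRange], x, hx, hX⟩
    · exact ⟨_, by simp [heisenbergRange], _, hcy, hY'⟩
  · intro p hp
    simp only [heisenbergRange, Set.mem_insert_iff, Set.mem_singleton_iff] at hp
    rcases hp with rfl | rfl | rfl | rfl
    · exact ⟨1, c0, hc0, h1⟩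
    · exact ⟨m, x, hx, hX⟩
    · exact ⟨l * m, _, hcy, hY'⟩
    · exact ⟨l, z, hz, hZ⟩

/-- The adapted basis at an edge when the isotropy group has two elements and the nontrivial one
interchanges the kernel of the transition matrix with its orthogonal complement. -/
theorem exists_rangeX_basis {h : G} {l : L} (hall : ∀ n : L, n = 1 ∨ n = l)
    {B : Matrix (Fin 2) (Fin 2) ℂ} (hB : B ∈ Matrix.unitaryGroup (Fin 2) ℂ)
    (hk : ∀ i, (B * A h * Bᴴ) i 1 = 0)
    (hU : (B * (U l : Matrix (Fin 2) (Fin 2) ℂ) * Bᴴ) 0 0 = 0) :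
    ∃ B ∈ Matrix.unitaryGroup (Fin 2) ℂ,
      (∀ i, (B * A h * Bᴴ) i 1 = 0) ∧ (∀ i, (B * A (-h) * Bᴴ) i 0 = 0) ∧
      (∀ n : L, ∃ p ∈ rangeX, ∃ c : ℂ, ‖c‖ = 1 ∧
        B * (U n : Matrix (Fin 2) (Fin 2) ℂ) * Bᴴ = c • p) ∧
      (∀ p ∈ rangeX, ∃ n : L, ∃ c : ℂ, ‖c‖ = 1 ∧
        B * (U n : Matrix (Fin 2) (Fin 2) ℂ) * Bᴴ = c • p) := by
  obtain ⟨g, hg, c, hc, hX⟩ := exists_diagonal_conj_eq_smul_pauliX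
    (conj_mem_unitaryGroup hB (U l).2) hU
  have hD := mem_unitaryGroup_diagonal (a := 1) (by simp) hg
  have hassoc : ∀ M, (!![1, 0; 0, g] * B) * M * (!![1, 0; 0, g] * B)ᴴ =
      !![1, 0; 0, g] * (B * M * Bᴴ) * !![1, 0; 0, g]ᴴ := by
    intro M
    simp only [Matrix.conjTranspose_mul, mul_assoc]
  have hDB := mul_mem hD hB
  have hk' : ∀ i, ((!![1, 0; 0, g] * B) * A h * (!![1, 0; 0, g] * B)ᴴ) i 1 = 0 := by
    intro i
    rw [hassoc, diagonal_conj]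
    fin_cases i <;> simp [hk]
  obtain ⟨c0, hc0, e0⟩ := hw.exists_map_one
  have h1 : (!![1, 0; 0, g] * B) * (U 1 : Matrix (Fin 2) (Fin 2) ℂ) * (!![1, 0; 0, g] * B)ᴴ =
      c0 • 1 := by
    rw [e0, conj_smul_one hDB]
  refine ⟨_, hDB, hk', hw.conj_neg_column hDB hk', ?_, ?_⟩
  · intro n
    rcases hall n with rfl | rfl
    · exact ⟨1, by simp [rangeX], c0, hc0, h1⟩
    · exact ⟨Complex.I • pauliX, by simp [rangeX], c, hc, by rw [hassoc, hX]⟩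
  · intro p hp
    simp only [rangeX, Set.mem_insert_iff, Set.mem_singleton_iff] at hp
    rcases hp with rfl | rfl
    · exact ⟨1, c0, hc0, h1⟩
    · exact ⟨l, c, hc, by rw [hassoc, hX]⟩

/-- The adapted basis at an edge when the isotropy group has two elements and the nontrivial one
preserves the kernel of the transition matrix. -/
theorem exists_rangeZ_basis {h : G} {l : L} (hl : l ≠ 1) (hll : l * l = 1)
    (hall : ∀ n : L, n = 1 ∨ n = l)
    {B : Matrix (Fin 2) (Fin 2) ℂ} (hB : B ∈ Matrix.unitaryGroup (Fin 2) ℂ)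
    (hk : ∀ i, (B * A h * Bᴴ) i 1 = 0)
    (hU : (B * (U l : Matrix (Fin 2) (Fin 2) ℂ) * Bᴴ) 0 1 = 0) :
    ∃ B ∈ Matrix.unitaryGroup (Fin 2) ℂ,
      (∀ i, (B * A h * Bᴴ) i 1 = 0) ∧ (∀ i, (B * A (-h) * Bᴴ) i 0 = 0) ∧
      (∀ n : L, ∃ p ∈ rangeZ, ∃ c : ℂ, ‖c‖ = 1 ∧
        B * (U n : Matrix (Fin 2) (Fin 2) ℂ) * Bᴴ = c • p) ∧
      (∀ p ∈ rangeZ, ∃ n : L, ∃ c : ℂ, ‖c‖ = 1 ∧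
        B * (U n : Matrix (Fin 2) (Fin 2) ℂ) * Bᴴ = c • p) := by
  obtain ⟨a, ha⟩ := hw.mul_self_eq_smul hll
  obtain ⟨c, hc, hZ⟩ := eq_smul_pauliZ (conj_mem_unitaryGroup hB (U l).2) hU
    (fun c hc => hw.ne_smul_one hl c (conj_unitary_injective hB (by rw [hc, conj_smul_one hB])))
    (a := a) (by rw [conj_mul_conj hB, ha, conj_smul_one hB])
  obtain ⟨c0, hc0, e0⟩ := hw.exists_map_one
  have h1 : B * (U 1 : Matrix (Fin 2) (Fin 2) ℂ) * Bᴴ = c0 • 1 := by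
    rw [e0, conj_smul_one hB]
  refine ⟨B, hB, hk, hw.conj_neg_column hB hk, ?_, ?_⟩
  · intro n
    rcases hall n with rfl | rfl
    · exact ⟨1, by simp [rangeZ], c0, hc0, h1⟩
    · exact ⟨_, by simp [rangeZ], c, hc, hZ⟩
  · intro p hp
    simp only [rangeZ, Set.mem_insert_iff, Set.mem_singleton_iff] at hp
    rcases hp with rfl | rfl
    · exact ⟨1, c0, hc0, h1⟩
    · exact ⟨l, c, hc, hZ⟩

end Conj

end IsNormalWalk

namespace IsNormalWalk

set_option linter.unusedSectionVars false

variable {d : ℕ} {Sp : Finset (Fin d → ℤ)}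
  {A : (Fin d → ℤ) → Matrix (Fin 2) (Fin 2) ℂ} {L : Subgroup (Equiv.Perm (Fin d → ℤ))}
  {U : L → Matrix.unitaryGroup (Fin 2) ℂ} (hw : IsNormalWalk Sp A L U)

include hw

/-! ### Freeness of the isotropy group -/

theorem dim_le_card {T : Finset (Fin d → ℤ)}
    (hT : ∀ x ∈ Sp, x ∈ Submodule.span ℤ (T : Set (Fin d → ℤ))) : d ≤ T.card := by
  have htop : Submodule.span ℤ (T : Set (Fin d → ℤ)) = ⊤ := by
    rw [eq_top_iff]
    intro x _
    have hx : x ∈ AddSubgroup.closure (Sp : Set (Fin d → ℤ)) := by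
      rw [hw.gen.closure_eq_top]; trivial
    have hle : AddSubgroup.closure (Sp : Set (Fin d → ℤ)) ≤
        (Submodule.span ℤ (T : Set (Fin d → ℤ))).toAddSubgroup :=
      (AddSubgroup.closure_le _).2 hT
    exact hle hx
  have h := finrank_span_finset_le_card (R := ℤ) T
  rw [Set.finrank, htop, finrank_top] at h
  simpa using h

theorem neg_ne_self {x : Fin d → ℤ} (hx : x ∈ edgeSet Sp) : -x ≠ x := by
  intro h
  have : x = 0 := by
    have h2 : (2 : ℕ) • x = 0 := by rw [two_nsmul]; nth_rw 1 [← h]; exact neg_add_cancel x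
    exact (nsmul_eq_zero_iff_right two_ne_zero).1 h2
  exact zero_notMem_edgeSet hw.gen (this ▸ hx)

theorem ne_zero_of_mem {x : Fin d → ℤ} (hx : x ∈ edgeSet Sp) : x ≠ 0 := by
  rintro rfl
  exact zero_notMem_edgeSet hw.gen hx

theorem exists_mem_ne (hd : 2 ≤ d) (h : Fin d → ℤ) : ∃ x ∈ edgeSet Sp, x ≠ h ∧ x ≠ -h := by
  by_contra! hall
  have := hw.dim_le_card (T := {h}) (by
    intro x hx
    rw [Finset.coe_singleton, Submodule.mem_span_singleton]
    by_cases hxh : x = h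
    · exact ⟨1, by simp [hxh]⟩
    · exact ⟨-1, by simp [hall x (mem_edgeSet.2 (Or.inl hx)) hxh]⟩)
  simp at this
  omega

theorem eq_of_form_eq {x y : Fin d → ℤ} (hx : x ∈ edgeSet Sp) (hy : y ∈ edgeSet Sp)
    (h : hw.form x y = hw.form x x) : y = x := by
  have e := hw.form_eq hy hx
  refine sub_eq_zero.1 (hw.eq_zero_of_form_self_le ?_)
  simp only [_root_.map_sub, LinearMap.sub_apply]
  rw [hw.form_comm y x]
  linarith

/-- Suppose a nontrivial `l` fixes the edge `h`. An edge whose height is that of `h` up to sign has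
the same length and the same component along `h` up to sign, so it is `± h`. All other edges are at
height zero; there are at least two of them, yet fewer than half of all edges, which is impossible.
-/
theorem eq_one_of_apply_eq (hd : 2 ≤ d) {l : L} {h : Fin d → ℤ} (hh : h ∈ edgeSet Sp)
    (hl : l.1 h = h) : l = 1 := by
  by_contra hne
  have hq : hw.orbitSum l h = orderOf l • h := hw.orbitSum_of_fixed hl
  have hk : (orderOf l : ℤ) ≠ 0 := by exact_mod_cast (hw.orderOf_pos l).ne'
  have hq0 : hw.orbitSum l h ≠ 0 := by
    rw [hq]
    intro h0
    rcases smul_eq_zero.1 h0 with h1 | h1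
    · exact (hw.orderOf_pos l).ne' h1
    · exact hw.ne_zero_of_mem hh h1
  have hfq : hw.form h (hw.orbitSum l h) = orderOf l * hw.form h h := hw.form_orbitSum hl h
  have hsub : ∀ x ∈ edgeSet Sp, x = h ∨ x = -h ∨ hw.orbitSum l x = 0 := by
    intro x hx
    have hfx := hw.form_orbitSum hl x
    rcases (hw.exists_height' hne hh hq0).1 x hx with h0 | h0 | h0
    · exact Or.inr (Or.inr h0)
    · left
      rw [h0, hfq] at hfx
      exact hw.eq_of_form_eq hh hx (mul_left_cancel₀ hk hfx).symm
    · right; left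
      rw [h0, _root_.map_neg, hfq] at hfx
      have h1 : -hw.form h h = hw.form h x := by
        apply mul_left_cancel₀ hk; linarith
      have := hw.eq_of_form_eq hh (neg_mem_edgeSet hx) (by rw [_root_.map_neg, ← h1, neg_neg])
      rw [← this, neg_neg]
  have hcard : (edgeSet Sp).card ≤ 2 + (hw.levelZero l).card := by
    have : edgeSet Sp ⊆ {h, -h} ∪ hw.levelZero l := by
      intro x hx
      simp only [Finset.mem_union, Finset.mem_insert, Finset.mem_singleton, levelZero,
        Finset.mem_filter]
      rcases hsub x hx with h0 | h0 | h0
      · exact Or.inl (Or.inl h0)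
      · exact Or.inl (Or.inr h0)
      · exact Or.inr ⟨hx, h0⟩
    exact (Finset.card_le_card this).trans ((Finset.card_union_le _ _).trans
      (Nat.add_le_add_right Finset.card_le_two _))
  have hlt := hw.levelZero_card_lt hne hh hq0
  obtain ⟨x, hx, hx1, hx2⟩ := hw.exists_mem_ne hd h
  have hx0 : hw.orbitSum l x = 0 := by
    rcases hsub x hx with h0 | h0 | h0
    · exact absurd h0 hx1
    · exact absurd h0 hx2
    · exact h0
  have h2 : ({x, -x} : Finset (Fin d → ℤ)) ⊆ hw.levelZero l := by
    intro y hy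
    simp only [Finset.mem_insert, Finset.mem_singleton] at hy
    rcases hy with rfl | rfl
    · exact Finset.mem_filter.2 ⟨hx, hx0⟩
    · exact Finset.mem_filter.2 ⟨neg_mem_edgeSet hx, by rw [_root_.map_neg, hx0, neg_zero]⟩
  have h3 := Finset.card_le_card h2
  rw [Finset.card_pair (hw.neg_ne_self hx).symm] at h3
  omega

theorem eq_of_apply_eq (hd : 2 ≤ d) {l m : L} {h : Fin d → ℤ} (hh : h ∈ edgeSet Sp)
    (hlm : l.1 h = m.1 h) : l = m := by
  have h1 : (m⁻¹ * l).1 h = h := by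
    change m.1⁻¹ (l.1 h) = h
    rw [hlm]; simp
  exact (inv_mul_eq_one.1 (hw.eq_one_of_apply_eq hd hh h1)).symm

/-- The orbit map of `h` is injective by freeness and surjective by transitivity. -/
theorem natCard_eq (hd : 2 ≤ d) {h : Fin d → ℤ} (hh : h ∈ Sp) : Nat.card L = Sp.card := by
  rw [← Nat.card_eq_finsetCard]
  refine Nat.card_congr (Equiv.ofBijective (fun l : L => ⟨l.1 h, hw.map_mem l h hh⟩) ⟨?_, ?_⟩)
  · intro l m hlm
    exact hw.eq_of_apply_eq hd (mem_edgeSet.2 (Or.inl hh)) (congrArg Subtype.val hlm)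
  · rintro ⟨x, hx⟩
    obtain ⟨l, hl⟩ := hw.trans h hh x hx
    exact ⟨l, Subtype.ext hl⟩

/-- Either no edge is inverse to a generator, or the generators are closed under inversion. -/
theorem exists_card_filter_eq : ∃ c : ℕ, 0 < c ∧ ∀ p : (Fin d → ℤ) → Prop, ∀ [DecidablePred p],
    (∀ x, p (-x) ↔ p x) → ((edgeSet Sp).filter p).card = c * (Sp.filter p).card := by
  by_cases hs : ∀ x ∈ Sp, -x ∈ Sp
  · refine ⟨1, one_pos, fun p _ _ => ?_⟩
    have : edgeSet Sp = Sp := by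
      ext x
      rw [mem_edgeSet]
      exact ⟨fun h => h.elim id fun h => by simpa using hs _ h, Or.inl⟩
    rw [this, one_mul]
  · push Not at hs
    obtain ⟨x, hx, hnx⟩ := hs
    have hdis : ∀ y ∈ Sp, -y ∉ Sp := by
      intro y hy hny
      obtain ⟨l, rfl⟩ := hw.trans y hy x hx
      rw [← hw.map_neg] at hnx
      exact hnx (hw.map_mem l _ hny)
    refine ⟨2, two_pos, fun p _ hp => ?_⟩
    have hdisj : Disjoint (Sp.filter p) ((Sp.filter p).image fun x => -x) := by
      rw [Finset.disjoint_left]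
      intro y hy hy'
      obtain ⟨z, hz, rfl⟩ := Finset.mem_image.1 hy'
      exact hdis z (Finset.mem_filter.1 hz).1 (Finset.mem_filter.1 hy).1
    have : (edgeSet Sp).filter p = (Sp.filter p) ∪ ((Sp.filter p).image fun x => -x) := by
      ext y
      simp only [Finset.mem_filter, mem_edgeSet, Finset.mem_union, Finset.mem_image]
      constructor
      · rintro ⟨h | h, hy⟩
        · exact Or.inl ⟨h, hy⟩
        · exact Or.inr ⟨-y, ⟨h, (hp y).2 hy⟩, neg_neg y⟩
      · rintro (⟨h, hy⟩ | ⟨z, ⟨hz, hpz⟩, rfl⟩)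
        · exact ⟨Or.inl h, hy⟩
        · exact ⟨Or.inr (by simpa using hz), (hp z).2 hpz⟩
    rw [this, Finset.card_union_of_disjoint hdisj, Finset.card_image_of_injective _ neg_injective,
      two_mul]

theorem orbitSum_conj (l m : L) (x : Fin d → ℤ) :
    hw.orbitSum (m * l * m⁻¹) (m.1 x) = m.1 (hw.orbitSum l x) := by
  rw [orbitSum_apply, orbitSum_apply]
  refine Eq.trans ?_ (map_sum (hw.hom m) _ _).symm
  have ho : orderOf (m * l * m⁻¹) = orderOf l := by
    have := orderOf_injective (MulAut.conj m).toMonoidHom (MulAut.conj m).injective l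
    simpa using this
  rw [ho]
  refine Finset.sum_congr rfl fun j _ => ?_
  rw [conj_pow]
  change m.1 ((l ^ j).1 (m.1⁻¹ (m.1 x))) = _
  simp
  rfl

/-- The determinant of an automorphism. -/
noncomputable def detHom : L →* ℤ where
  toFun l := LinearMap.det (hw.hom l).toIntLinearMap
  map_one' := by
    rw [← LinearMap.det_id (A := ℤ) (M := Fin d → ℤ)]
    rfl
  map_mul' l m := by
    rw [← LinearMap.det_comp]
    rfl

theorem detHom_eq (l : L) : hw.detHom l = 1 ∨ hw.detHom l = -1 := by
  have h1 : hw.detHom l * hw.detHom l⁻¹ = 1 := by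
    rw [← _root_.map_mul, mul_inv_cancel, _root_.map_one]
  exact Int.isUnit_iff.1 (IsUnit.of_mul_eq_one _ h1)

/-- For an isometry `M` of the invariant form `F`, `MᵀF(M - 1) = -(M - 1)ᵀF`. With determinant one
and odd dimension, taking determinants gives `det (M - 1) = -det (M - 1)`, so `M - 1` is singular.
-/
theorem exists_fixed (hodd : Odd d) {l : L} (hl : hw.detHom l = 1) :
    ∃ u : Fin d → ℤ, u ≠ 0 ∧ l.1 u = u := by
  set M := LinearMap.toMatrix' (hw.hom l).toIntLinearMap with hM
  set F := LinearMap.toMatrix₂' ℤ hw.form with hF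
  have hMv : ∀ x, M *ᵥ x = l.1 x := fun x => LinearMap.toMatrix'_mulVec _ x
  have hdetM : M.det = 1 := by rw [hM, LinearMap.det_toMatrix']; exact hl
  have hMF : Mᵀ * F * M = F := by
    rw [hM, hF, ← LinearMap.toMatrix₂'_compl₁₂]
    congr 1
    exact LinearMap.ext₂ fun x y => hw.form_map l x y
  have hFdet : F.det ≠ 0 := by
    intro h0
    obtain ⟨v, hv, hFv⟩ := Matrix.exists_mulVec_eq_zero_iff.2 h0
    have h1 : hw.form v v = v ⬝ᵥ F *ᵥ v := by
      rw [← Matrix.toLinearMap₂'_apply', hF, Matrix.toLinearMap₂'_toMatrix']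
    rw [hFv, dotProduct_zero] at h1
    exact hv (hw.eq_zero_of_form_self_le h1.le)
  have hkey : Mᵀ * F * (M - 1) = -((M - 1)ᵀ * F) := by
    rw [mul_sub, hMF, Matrix.transpose_sub, sub_mul, mul_one, Matrix.transpose_one, one_mul]
    abel
  have hdet := congrArg Matrix.det hkey
  rw [Matrix.det_neg, Matrix.det_mul, Matrix.det_mul, Matrix.det_mul, Matrix.det_transpose,
    Matrix.det_transpose, hdetM, Fintype.card_fin, hodd.neg_one_pow] at hdet
  have h2 : F.det * (M - 1).det = 0 := by linarith
  have h3 := (mul_eq_zero.1 h2).resolve_left hFdet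
  obtain ⟨u, hu, hMu⟩ := Matrix.exists_mulVec_eq_zero_iff.2 h3
  refine ⟨u, hu, ?_⟩
  rw [Matrix.sub_mulVec, Matrix.one_mulVec, hMv] at hMu
  exact sub_eq_zero.1 hMu

theorem exists_orbitSum_ne_zero {l : L} {u : Fin d → ℤ} (hu : u ≠ 0) (hl : l.1 u = u) :
    ∃ x ∈ Sp, hw.orbitSum l x ≠ 0 := by
  by_contra! h
  have h1 : hw.orbitSum l = 0 := hw.addHom_ext h
  have h2 := hw.orbitSum_of_fixed hl
  rw [h1, AddMonoidHom.zero_apply] at h2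
  rcases smul_eq_zero.1 h2.symm with h3 | h3
  · exact (hw.orderOf_pos l).ne' h3
  · exact hu h3

end IsNormalWalk

/-! ### Rotations in odd dimension and the heights over their axes -/

namespace IsNormalWalk

set_option linter.unusedSectionVars false

section Levels

variable {d : ℕ} {Sp : Finset (Fin d → ℤ)}
  {A : (Fin d → ℤ) → Matrix (Fin 2) (Fin 2) ℂ} {L : Subgroup (Equiv.Perm (Fin d → ℤ))}
  {U : L → Matrix.unitaryGroup (Fin 2) ℂ} (hw : IsNormalWalk Sp A L U)

include hw

/-- The rotation subgroup of the isotropy group. -/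
noncomputable def rotations : Subgroup L := hw.detHom.toHomUnits.ker

theorem mem_rotations {l : L} : l ∈ hw.rotations ↔ hw.detHom l = 1 := by
  rw [rotations, MonoidHom.mem_ker, Units.ext_iff]
  rfl

theorem natCard_le_two_mul : Nat.card L ≤ 2 * Nat.card hw.rotations := by
  rw [← Subgroup.card_mul_index hw.rotations, mul_comm]
  refine Nat.mul_le_mul_right _ ?_
  rw [rotations, Subgroup.index_ker]
  refine (Nat.card_le_card_of_injective _ Subtype.val_injective).trans ?_
  rw [Nat.card_eq_fintype_card]
  decide

theorem exists_rotation_orbitSum_ne_zero (hodd : Odd d) {l : L} (hl : l ∈ hw.rotations) :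
    ∃ x ∈ Sp, hw.orbitSum l x ≠ 0 := by
  obtain ⟨u, hu, hlu⟩ := hw.exists_fixed hodd (hw.mem_rotations.1 hl)
  exact hw.exists_orbitSum_ne_zero hu hlu

/-- A nontrivial rotation leaves no edge in the plane orthogonal to its axis. -/
theorem filter_orbitSum_eq_empty (hd : 2 ≤ d) (hodd : Odd d) {l : L} (hl : l ∈ hw.rotations)
    (hl1 : l ≠ 1) : Sp.filter (fun x => hw.orbitSum l x = 0) = ∅ := by
  classical
  have := hw.finite
  let := Fintype.ofFinite L
  obtain ⟨c, hc, hcard⟩ := hw.exists_card_filter_eq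
  have hV : (edgeSet Sp).card = c * Sp.card := by
    have := hcard (fun _ => True) (fun _ => Iff.rfl)
    simpa using this
  have hN : ∀ m : L, (hw.levelZero m).card = c * (Sp.filter fun x => hw.orbitSum m x = 0).card :=
    fun m => hcard (fun x => hw.orbitSum m x = 0) (fun x => by rw [_root_.map_neg, neg_eq_zero])
  set N := (Sp.filter fun x => hw.orbitSum l x = 0).card with hNdef
  obtain ⟨x₀, hx₀, hq₀⟩ := hw.exists_rotation_orbitSum_ne_zero hodd hl
  have hx₀' : x₀ ∈ edgeSet Sp := mem_edgeSet.2 (Or.inl hx₀)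
  have hlt : 2 * N < Sp.card := by
    have h1 := hw.levelZero_card_lt hl1 hx₀' hq₀
    rw [hN, hV, mul_left_comm] at h1
    exact Nat.lt_of_mul_lt_mul_left h1
  have hNm : ∀ m ∈ hw.rotations, m ≠ 1 → (Sp.filter fun x => hw.orbitSum m x = 0).card = N := by
    intro m hm hm1
    obtain ⟨y, hy, hqy⟩ := hw.exists_rotation_orbitSum_ne_zero hodd hm
    have h1 := hw.levelZero_card_eq hm1 hl1 (mem_edgeSet.2 (Or.inl hy)) hx₀' hqy hq₀
    rw [hN, hN] at h1
    exact Nat.eq_of_mul_eq_mul_left hc h1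
  set T : Finset L := Finset.univ.filter fun m => m ∈ hw.rotations ∧ m ≠ 1 with hT
  have hTcard : T.card + 1 = Nat.card hw.rotations := by
    have h1 : Nat.card hw.rotations = (Finset.univ.filter fun m => m ∈ hw.rotations).card := by
      rw [Nat.card_eq_fintype_card, Fintype.card_subtype]
    have h2 : T = (Finset.univ.filter fun m => m ∈ hw.rotations).erase 1 := by
      ext m
      simp [hT, and_comm]
    rw [h1, h2, Finset.card_erase_add_one]
    simp [hw.rotations.one_mem]
  -- Incidences between nontrivial rotations and generators orthogonal to their axes, counted in two
  -- ways.
  have hcount : ∑ m ∈ T, (Sp.filter fun x => hw.orbitSum m x = 0).card =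
      ∑ x ∈ Sp, (T.filter fun m => hw.orbitSum m x = 0).card :=
    Finset.sum_card_bipartiteAbove_eq_sum_card_bipartiteBelow (fun m x => hw.orbitSum m x = 0)
  -- Conjugation by `g` carries the rotations having `x₀` at height zero to those having `g x₀` at
  -- height zero, so the count is the same for every generator.
  have ht : ∀ x ∈ Sp, (T.filter fun m => hw.orbitSum m x = 0).card =
      (T.filter fun m => hw.orbitSum m x₀ = 0).card := by
    intro x hx
    obtain ⟨g, rfl⟩ := hw.trans x₀ hx₀ x hx
    symm
    have hn : hw.rotations.Normal := MonoidHom.normal_ker _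
    refine Finset.card_bij' (fun m _ => g * m * g⁻¹) (fun m _ => g⁻¹ * m * g) ?_ ?_ ?_ ?_
    · intro m hm
      simp only [hT, Finset.mem_filter, Finset.mem_univ, true_and] at hm ⊢
      refine ⟨⟨hn.conj_mem m hm.1.1 g, fun h => hm.1.2 (conj_eq_one_iff.1 h)⟩, ?_⟩
      rw [hw.orbitSum_conj, hm.2, hw.map_zero]
    · intro m hm
      simp only [hT, Finset.mem_filter, Finset.mem_univ, true_and] at hm ⊢
      have h1 := hw.orbitSum_conj m g⁻¹ (g.1 x₀)
      have h2 : (g⁻¹).1 (g.1 x₀) = x₀ := by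
        change g.1⁻¹ (g.1 x₀) = x₀
        simp
      rw [h2, hm.2, hw.map_zero, inv_inv] at h1
      refine ⟨⟨by simpa using hn.conj_mem m hm.1.1 g⁻¹, fun h => hm.1.2 ?_⟩, h1⟩
      have h3 : g⁻¹ * m * g⁻¹⁻¹ = 1 := by rw [inv_inv]; exact h
      exact conj_eq_one_iff.1 h3
    · intro m _
      group
    · intro m _
      group
  rw [Finset.sum_congr rfl ht, Finset.sum_const, smul_eq_mul] at hcount
  rw [Finset.sum_congr rfl fun m hm => hNm m (by simpa [hT] using (Finset.mem_filter.1 hm).2.1)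
    (Finset.mem_filter.1 hm).2.2, Finset.sum_const, smul_eq_mul] at hcount
  have hdvd : Nat.card hw.rotations ∣ Sp.card := by
    rw [← hw.natCard_eq hd hx₀]
    exact Subgroup.card_subgroup_dvd_card _
  -- Let `r` be the number of rotations. By the count, `(r - 1) N` is a multiple of `Sp.card`, which
  -- `r` divides by Lagrange; hence `r` divides `N`. Since `2N < Sp.card ≤ 2r`, only `N = 0`
  -- remains.
  have hdN : Nat.card hw.rotations ∣ N := by
    have h1 : Nat.card hw.rotations ∣ T.card * N := by
      rw [hcount]; exact hdvd.mul_right _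
    have h2 : T.card * N + N = Nat.card hw.rotations * N := by rw [← hTcard]; ring
    exact (Nat.dvd_add_right h1).1 (h2 ▸ dvd_mul_right _ _)
  have hle := hw.natCard_le_two_mul
  rw [hw.natCard_eq hd hx₀] at hle
  have hN0 : N = 0 := Nat.eq_zero_of_dvd_of_lt hdN (by omega)
  exact Finset.card_eq_zero.1 hN0

/-- The group has as many elements as there are generators, at least three, and the rotations have
index at most two. -/
theorem exists_rotation_ne_one (hd : 3 ≤ d) : ∃ l ∈ hw.rotations, l ≠ 1 := by
  have := hw.finite
  have h1 : 3 ≤ Sp.card := hd.trans (hw.dim_le_card fun x hx => Submodule.subset_span hx)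
  obtain ⟨h, hh⟩ : Sp.Nonempty := Finset.card_pos.1 (by omega)
  have h2 := hw.natCard_le_two_mul
  rw [hw.natCard_eq (by omega) hh] at h2
  have h3 : 1 < Nat.card hw.rotations := by omega
  have : Nontrivial hw.rotations := Finite.one_lt_card_iff_nontrivial.1 h3
  obtain ⟨⟨l, hl⟩, hne⟩ := exists_ne (1 : hw.rotations)
  exact ⟨l, hl, fun h => hne (Subtype.ext h)⟩

theorem edges_nonempty (hd : 3 ≤ d) : ∃ h, h ∈ Sp := by
  have h1 : 3 ≤ Sp.card := hd.trans (hw.dim_le_card fun x hx => Submodule.subset_span hx)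
  exact Finset.card_pos.1 (by omega)

theorem rotation_levelZero_card (hd : 3 ≤ d) (hodd : Odd d) {l : L} (hl : l ∈ hw.rotations)
    (hl1 : l ≠ 1) : (hw.levelZero l).card = 0 := by
  obtain ⟨c, hc, hcard⟩ := hw.exists_card_filter_eq
  have := hcard (fun x => hw.orbitSum l x = 0) (fun x => by rw [_root_.map_neg, neg_eq_zero])
  rw [hw.filter_orbitSum_eq_empty (by omega) hodd hl hl1] at this
  rw [levelZero, this]
  simp

/-- All the edges have a nonzero height over the axis of an automorphism. -/
theorem orbitSum_ne_zero (hd : 3 ≤ d) (hodd : Odd d) {l : L} (hl : l ≠ 1) {x y : Fin d → ℤ}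
    (hx : x ∈ edgeSet Sp) (hq : hw.orbitSum l x ≠ 0) (hy : y ∈ edgeSet Sp) :
    hw.orbitSum l y ≠ 0 := by
  obtain ⟨m, hm, hm1⟩ := hw.exists_rotation_ne_one hd
  obtain ⟨z, hz, hqz⟩ := hw.exists_rotation_orbitSum_ne_zero hodd hm
  have h1 := hw.levelZero_card_eq hl hm1 hx (mem_edgeSet.2 (Or.inl hz)) hq hqz
  rw [hw.rotation_levelZero_card hd hodd hm hm1, Finset.card_eq_zero] at h1
  intro h0
  have : y ∈ hw.levelZero l := Finset.mem_filter.2 ⟨hy, h0⟩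
  rw [h1] at this
  simp at this

theorem height_eq_or_eq_neg (hd : 3 ≤ d) (hodd : Odd d) {l : L} (hl : l ≠ 1) {x y : Fin d → ℤ}
    (hx : x ∈ edgeSet Sp) (hq : hw.orbitSum l x ≠ 0) (hy : y ∈ edgeSet Sp) :
    hw.orbitSum l y = hw.orbitSum l x ∨ hw.orbitSum l y = -hw.orbitSum l x :=
  ((hw.exists_height' hl hx hq).1 y hy).resolve_left (hw.orbitSum_ne_zero hd hodd hl hx hq hy)

/-- A nontrivial rotation has no edge at height zero, so `A 0` is the only contribution to the
vanishing trace there. -/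
theorem trace_zero_re_eq_zero (hd : 3 ≤ d) (hodd : Odd d) : (A 0).trace.re = 0 := by
  obtain ⟨m, hm, hm1⟩ := hw.exists_rotation_ne_one hd
  obtain ⟨z, hz, hqz⟩ := hw.exists_rotation_orbitSum_ne_zero hodd hm
  have h := (hw.exists_height' hm1 (mem_edgeSet.2 (Or.inl hz)) hqz).2
  rw [hw.rotation_levelZero_card hd hodd hm hm1] at h
  simpa using h

end Levels

/-! ### Dimension three: the circles of edges at a given height -/

section Space

variable {Sp : Finset (Fin 3 → ℤ)}
  {A : (Fin 3 → ℤ) → Matrix (Fin 2) (Fin 2) ℂ} {L : Subgroup (Equiv.Perm (Fin 3 → ℤ))}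
  {U : L → Matrix.unitaryGroup (Fin 2) ℂ} (hw : IsNormalWalk Sp A L U)

include hw

theorem form_nsmul_left (n : ℕ) (x y : Fin 3 → ℤ) : hw.form (n • x) y = n * hw.form x y := by
  rw [_root_.map_nsmul, LinearMap.smul_apply, nsmul_eq_mul]

theorem form_nsmul_right (n : ℕ) (x y : Fin 3 → ℤ) : hw.form x (n • y) = n * hw.form x y := by
  rw [_root_.map_nsmul, nsmul_eq_mul]

/-- In the plane orthogonal to `u`, both vectors are orthogonal to `D`, hence collinear, and equal
lengths leave only a sign. Otherwise `u`, `D`, `E - E'` and `E + E'` would be four orthogonal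
nonzero vectors. -/
theorem eq_or_eq_neg_of_form {u D E E' : Fin 3 → ℤ} (hu : u ≠ 0) (hD : D ≠ 0)
    (huD : hw.form u D = 0) (huE : hw.form u E = 0) (huE' : hw.form u E' = 0)
    (hDE : hw.form D E = 0) (hDE' : hw.form D E' = 0) (hE : hw.form E E = hw.form E' E') :
    E = E' ∨ E = -E' := by
  by_contra! hne
  have h := hw.le_of_pairwise_form_eq_zero ![u, D, E - E', E + E'] (by
    intro i
    fin_cases i
    · exact hu
    · exact hD
    · exact sub_ne_zero.2 hne.1
    · exact fun h => hne.2 (eq_neg_of_add_eq_zero_left h)) (by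
    have e1 := hw.form_comm D u
    have e2 := hw.form_comm E u
    have e3 := hw.form_comm E' u
    have e4 := hw.form_comm E D
    have e5 := hw.form_comm E' D
    have e6 := hw.form_comm E E'
    intro i j hij
    fin_cases i <;> fin_cases j <;> first
      | exact absurd rfl hij
      | (simp [*]; done)
      | (simp [*]; ring))
  omega

/-- Two edges at the same height that are not antipodal share their kernels or their ranges. -/
theorem polarDet_eq_zero_of_orbitSum_eq {l : L} (hl : l ≠ 1) {h h' : Fin 3 → ℤ}
    (hh : h ∈ edgeSet Sp) (hh' : h' ∈ edgeSet Sp) (hq : hw.orbitSum l h ≠ 0)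
    (he : hw.orbitSum l h' = hw.orbitSum l h)
    (hne : orderOf l • (h + h') ≠ 2 • hw.orbitSum l h) : polarDet (A h) (A h') = 0 := by
  have hk : (orderOf l : ℤ) ≠ 0 := by exact_mod_cast (hw.orderOf_pos l).ne'
  have hfix := hw.map_orbitSum l h
  have hheight := fun y hy => hw.height_eq_or_eq_neg (by norm_num) (by decide) hl hh hq (y := y) hy
  set u := hw.orbitSum l h with hu
  have hf : ∀ y, hw.form u (hw.orbitSum l y) = orderOf l * hw.form u y := hw.form_orbitSum hfix
  have h2u : u + u ≠ 0 := by
    rw [← two_nsmul]; exact fun h0 => hq ((nsmul_eq_zero_iff_right two_ne_zero).1 h0)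
  refine hw.polarDet_eq_zero_of_unique (fun h0 => ?_) (fun x hx hy => ?_)
  · have := congrArg (hw.orbitSum l) h0
    rw [_root_.map_add, he, _root_.map_zero] at this
    exact h2u this
  · set y := h + h' - x with hydef
    have hsum : hw.orbitSum l x + hw.orbitSum l y = u + u := by
      rw [← _root_.map_add, hydef, add_sub_cancel, _root_.map_add, he]
    -- Steps have only the heights `0` and `± u`, so a total height `2u` forces both summands to
    -- have height `u`.
    have hstep : ∀ x ∈ stepSet Sp, ∀ y ∈ stepSet Sp, hw.orbitSum l x + hw.orbitSum l y = u + u →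
        x ∈ edgeSet Sp ∧ hw.orbitSum l x = u := by
      intro x hx y hy hs
      have hy' : hw.orbitSum l y = 0 ∨ hw.orbitSum l y = u ∨ hw.orbitSum l y = -u := by
        rcases mem_stepSet.1 hy with rfl | hy
        · exact Or.inl (_root_.map_zero _)
        · exact Or.inr (hheight y hy)
      have hu3 : ∀ n : ℕ, n ≠ 0 → n • u ≠ 0 := fun n hn h0 =>
        hq ((nsmul_eq_zero_iff_right hn).1 h0)
      rcases mem_stepSet.1 hx with rfl | hx
      · exfalso
        rw [_root_.map_zero, zero_add] at hs
        rcases hy' with h0 | h0 | h0 <;> rw [h0] at hs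
        · exact h2u hs.symm
        · exact hq (by simpa using hs)
        · apply hu3 3 (by norm_num)
          rw [show (3 : ℕ) • u = u + u - -u by abel, hs, sub_self]
      · refine ⟨hx, (hheight x hx).resolve_right fun h0 => ?_⟩
        rw [h0] at hs
        rcases hy' with h0 | h0 | h0 <;> rw [h0] at hs
        · apply hu3 3 (by norm_num)
          rw [show (3 : ℕ) • u = u + u - (-u + 0) by abel, hs, sub_self]
        · rw [neg_add_cancel] at hs
          exact h2u hs.symm
        · apply hu3 4 (by norm_num)
          rw [show (4 : ℕ) • u = u + u - (-u + -u) by abel, hs, sub_self]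
    obtain ⟨hxV, hqx⟩ := hstep x hx y hy hsum
    obtain ⟨hyV, hqy⟩ := hstep y hy x hx (by rw [add_comm]; exact hsum)
    have f1 := hf h
    have f2 := hf h'
    have f3 := hf x
    have f4 := hf y
    rw [← hu] at f1
    rw [he, f1] at f2
    rw [hqx, f1] at f3
    rw [hqy, f1] at f4
    have f2 := mul_left_cancel₀ hk f2
    have f3 := mul_left_cancel₀ hk f3
    have f4 := mul_left_cancel₀ hk f4
    have n1 := hw.form_eq hh' hh
    have n2 := hw.form_eq hxV hh
    have n3 := hw.form_eq hyV hh
    have hxy : x + y = h + h' := by rw [hydef]; abel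
    have g1 := congrArg (fun z => hw.form z z) hxy
    have g2 := congrArg (fun z => hw.form z (x - y)) hxy
    have c1 := hw.form_comm h' h
    have c2 := hw.form_comm y x
    -- The chords from `h'` to `h` and from `y` to `x` have the same midpoint, which is not the
    -- centre of the circle. Both are orthogonal to the axis and to the direction from the centre to
    -- the midpoint, and they have the same length.
    have hdiff : h - h' = x - y ∨ h - h' = -(x - y) := by
      refine hw.eq_or_eq_neg_of_form (u := u) (D := orderOf l • (h + h') - 2 • u) hq
        (sub_ne_zero.2 hne) ?_ ?_ ?_ ?_ ?_ ?_ <;>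
      simp only [_root_.map_add, _root_.map_sub, LinearMap.add_apply, LinearMap.sub_apply,
        hw.form_nsmul_left, hw.form_nsmul_right, Nat.cast_ofNat] at g1 g2 ⊢
      · linear_combination -2 * f1 - (orderOf l : ℤ) * f2
      · linarith
      · linarith
      · linear_combination (orderOf l : ℤ) * (-n1 + c1) - 2 * f2
      · linear_combination (-(orderOf l : ℤ)) * g2 + (orderOf l : ℤ) * (n2 - n3 + c2) - 2 * (f4 - f3)
      · linarith
    have h2 : ∀ a b : Fin 3 → ℤ, (2 : ℕ) • a = 2 • b → a = b := fun a b h => by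
      rw [← sub_eq_zero, ← smul_sub] at h
      exact sub_eq_zero.1 ((nsmul_eq_zero_iff_right two_ne_zero).1 h)
    rcases hdiff with h0 | h0
    · left
      apply h2
      rw [show (2 : ℕ) • x = (x + y) + (x - y) by abel, hxy, ← h0]; abel
    · right
      apply h2
      rw [show (2 : ℕ) • x = (x + y) - -(x - y) by abel, hxy, ← h0]; abel

end Space

end IsNormalWalk

/-! ### Arithmetic of matrix entries that forces an eigenvalue ratio to be real -/

/-- The letters stand for squared moduli of the entries of two matrices, and `a + ib` for an
eigenvalue ratio. If `b ≠ 0`, the imaginary part forces a common off-diagonal weight `Q`, in the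
same position in both matrices when it is nonzero, and a common diagonal weight `S` with `S + aQ =
0`. Then `hd` leaves only `Q = S`, which needs `a = -1`, or `Q = 0`, which contradicts `S > 0`. -/
theorem sq_eq_one_of_chord_real {a b P Q R T P' Q' R' T' : ℝ} (hab : a ^ 2 + b ^ 2 = 1)
    (hQ : 0 ≤ Q) (hR : 0 ≤ R)
    (hP' : 0 ≤ P') (hQ' : 0 ≤ Q') (hR' : 0 ≤ R') (hT' : 0 ≤ T')
    (h1 : P = 0 ∨ T = 0) (h2 : Q = 0 ∨ R = 0) (h3 : P' = 0 ∨ T' = 0) (h4 : Q' = 0 ∨ R' = 0)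
    (hpos : 0 < P + T)
    (hre : P + T + a * (Q + R) + (P' + T' + a * (Q' + R')) = 0)
    (him : b * (R - Q + (Q' - R')) = 0)
    (hn : P + T + Q + R = P' + T' + Q' + R') (hd : P * P' + T * T' = Q * Q' + R * R') : b = 0 := by
  by_contra hb
  have e := (mul_eq_zero.1 him).resolve_left hb
  have ha : -1 < a := by
    have : 0 < b ^ 2 := by positivity
    nlinarith
  have key : ∀ Q, 0 ≤ Q → P + T = P' + T' → P + T + a * Q = 0 →
      P * P' + T * T' = Q * Q → False := by
    intro Q hQ hS hre hd
    have hd' : P * P' + T * T' = (P + T) * (P + T) ∨ P * P' + T * T' = 0 := by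
      rcases h1 with h1 | h1 <;> rcases h3 with h3 | h3 <;> rw [h1, h3] at hS ⊢
      · left; have : T' = T := by linarith
        rw [this]; ring
      · right; ring
      · right; ring
      · left; have : P' = P := by linarith
        rw [this]; ring
    rcases hd' with h | h
    · have : Q = P + T := by nlinarith
      rw [this] at hre
      nlinarith
    · have : Q = 0 := by nlinarith
      rw [this] at hre
      linarith
  rcases h2 with h2 | h2 <;> rcases h4 with h4 | h4 <;> rw [h2, h4] at e hre hn hd
  · have : R' = R := by linarith
    subst this
    exact key R' hR (by linarith) (by linarith) (by linarith)
  · have h5 : R = 0 := by linarith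
    have h6 : Q' = 0 := by linarith
    rw [h5, h6] at hre
    linarith
  · have h5 : Q = 0 := by linarith
    have h6 : R' = 0 := by linarith
    rw [h5, h6] at hre
    linarith
  · have : Q' = Q := by linarith
    subst this
    exact key Q' hQ (by linarith) (by linarith) (by linarith)

theorem mul_star_eq_normSq (z : ℂ) : z * star z = (Complex.normSq z : ℂ) :=
  Complex.mul_conj z

theorem normSq_add_of_mul_eq_zero {x y : ℂ} (h : x = 0 ∨ y = 0) :
    Complex.normSq (x + y) = Complex.normSq x + Complex.normSq y := by
  rcases h with rfl | rfl <;> simp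

theorem mul_self_eq_one_of_chord {w p q r t p' q' r' t' : ℂ} (hw : star w * w = 1)
    (h1 : p * t = 0) (h2 : q * r = 0) (h3 : p' * t' = 0) (h4 : q' * r' = 0) (hpt : p + t ≠ 0)
    (hc : p * star p + t * star t + star w * (q * star q) + w * (r * star r) +
      (p' * star p' + t' * star t' + w * (q' * star q') + star w * (r' * star r')) = 0)
    (hn : p * star p + t * star t + q * star q + r * star r =
      p' * star p' + t' * star t' + q' * star q' + r' * star r')
    (hd : p * star p' + t * star t' + q * star q' + r * star r' = 0) : w * w = 1 := by
  simp only [mul_star_eq_normSq] at hc hn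
  have hab : w.re ^ 2 + w.im ^ 2 = 1 := by
    have := congrArg Complex.re hw
    simp at this
    linarith
  have hcr := congrArg Complex.re hc
  have hci := congrArg Complex.im hc
  have hnr := congrArg Complex.re hn
  simp at hcr hci hnr
  have hz : ∀ {x y : ℂ}, x * y = 0 → Complex.normSq x = 0 ∨ Complex.normSq y = 0 := by
    intro x y h
    rcases mul_eq_zero.1 h with h | h <;> simp [h]
  have hpos : 0 < Complex.normSq p + Complex.normSq t := by
    rcases mul_eq_zero.1 h1 with h | h <;> subst h
    · rw [zero_add] at hpt
      simpa using Complex.normSq_pos.2 hpt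
    · rw [add_zero] at hpt
      simpa using Complex.normSq_pos.2 hpt
  have hdd : Complex.normSq p * Complex.normSq p' + Complex.normSq t * Complex.normSq t' =
      Complex.normSq q * Complex.normSq q' + Complex.normSq r * Complex.normSq r' := by
    have e : p * star p' + t * star t' = -(q * star q' + r * star r') := by linear_combination hd
    have e' := congrArg Complex.normSq e
    rw [Complex.normSq_neg, normSq_add_of_mul_eq_zero, normSq_add_of_mul_eq_zero] at e'
    · simpa using e'
    · rcases mul_eq_zero.1 h2 with h | h <;> simp [h]
    · rcases mul_eq_zero.1 h1 with h | h <;> simp [h]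
  have hb := sq_eq_one_of_chord_real hab (Complex.normSq_nonneg q)
    (Complex.normSq_nonneg r) (Complex.normSq_nonneg p')
    (Complex.normSq_nonneg q') (Complex.normSq_nonneg r') (Complex.normSq_nonneg t')
    (hz h1) (hz h2) (hz h3) (hz h4) hpos (by linarith) (by linarith) (by linarith) hdd
  apply Complex.ext
  · simp [hb]
    rw [hb] at hab
    linarith
  · simp [hb]

/-- If `w` is not real, the imaginary part gives `|q| = |r|`. The real part then bounds `|p|² +
|t|²` by `2|q|²` with a factor smaller than one, whereas `|q|² = |p||t|` by the determinant; this
contradicts the inequality of arithmetic and geometric means. -/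
theorem mul_self_eq_one_of_antipodal {w p q r t : ℂ} (hw : star w * w = 1)
    (hdet : p * t = q * r) (hpt : p + t ≠ 0)
    (hc : p * star p + t * star t + w * (q * star q) + star w * (r * star r) = 0) : w * w = 1 := by
  simp only [mul_star_eq_normSq] at hc
  have hab : w.re ^ 2 + w.im ^ 2 = 1 := by
    have := congrArg Complex.re hw
    simp at this
    linarith
  have hcr := congrArg Complex.re hc
  have hci := congrArg Complex.im hc
  have hdn := congrArg Complex.normSq hdet
  simp at hcr hci hdn
  have hP := Complex.normSq_nonneg p
  have hQ := Complex.normSq_nonneg q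
  have hR := Complex.normSq_nonneg r
  have hT := Complex.normSq_nonneg t
  have hpos : 0 < Complex.normSq p + Complex.normSq t := by
    by_contra hle
    apply hpt
    rw [Complex.normSq_eq_zero.1 (show Complex.normSq p = 0 by linarith),
      Complex.normSq_eq_zero.1 (show Complex.normSq t = 0 by linarith), add_zero]
  have hb : w.im = 0 := by
    by_contra hb
    have e : Complex.normSq q = Complex.normSq r := by
      have : w.im * (Complex.normSq q - Complex.normSq r) = 0 := by linarith
      have := (mul_eq_zero.1 this).resolve_left hb
      linarith
    rw [← e] at hcr hdn
    have ha : w.re ^ 2 < 1 := by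
      have : 0 < w.im ^ 2 := by positivity
      linarith
    have h4 : (Complex.normSq p + Complex.normSq t) ^ 2 = w.re ^ 2 * (2 * Complex.normSq q) ^ 2 := by
      have : Complex.normSq p + Complex.normSq t = -(w.re * (2 * Complex.normSq q)) := by linarith
      rw [this]; ring
    have h5 : (2 * Complex.normSq q) ^ 2 ≤ (Complex.normSq p + Complex.normSq t) ^ 2 := by
      nlinarith [sq_nonneg (Complex.normSq p - Complex.normSq t)]
    have h6 : 0 < (Complex.normSq p + Complex.normSq t) ^ 2 := by positivity
    nlinarith
  apply Complex.ext
  · simp [hb]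
    rw [hb] at hab
    linarith
  · simp [hb]

/-! ### Diagonalisation of an isotropy element and equal chords -/

namespace IsNormalWalk

set_option linter.unusedSectionVars false

section Diagonal

variable {G : Type*} [AddCommGroup G] [DecidableEq G] {Sp : Finset G}
  {A : G → Matrix (Fin 2) (Fin 2) ℂ} {L : Subgroup (Equiv.Perm G)}
  {U : L → Matrix.unitaryGroup (Fin 2) ℂ} (hw : IsNormalWalk Sp A L U)

include hw

theorem mul_self_eq_one {l : L} {c : ℂ}
    (h : (U l : Matrix (Fin 2) (Fin 2) ℂ) * (U l : Matrix (Fin 2) (Fin 2) ℂ) = c • 1) :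
    l * l = 1 := by
  obtain ⟨c', -, h'⟩ := hw.projective l l
  apply hw.faithful
  exact ⟨c' * c, by rw [h', h, smul_smul]⟩

/-- The walk in an eigenbasis of an element of the isotropy representation. -/
theorem exists_diagonal (l : L) : ∃ (A' : G → Matrix (Fin 2) (Fin 2) ℂ)
    (U' : L → Matrix.unitaryGroup (Fin 2) ℂ), IsNormalWalk Sp A' L U' ∧
      ∃ w : ℂ, star w * w = 1 ∧ (w * w = 1 → l * l = 1) ∧
      ∀ x, A' (l.1 x) = !![A' x 0 0, star w * A' x 0 1; w * A' x 1 0, A' x 1 1] := by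
  obtain ⟨B, hB, hd⟩ := exists_unitary_diagonal (U l : Matrix (Fin 2) (Fin 2) ℂ)
  have hw' := hw.conj ⟨B, hB⟩
  refine ⟨_, _, hw', ?_⟩
  set V : Matrix (Fin 2) (Fin 2) ℂ := B * (U l : Matrix (Fin 2) (Fin 2) ℂ) * Bᴴ with hV
  obtain ⟨h10, hu, hv⟩ := unitary_diagonal (conj_mem_unitaryGroup hB (U l).2) hd
  rw [← hV] at h10 hu hv
  change V 0 1 = 0 at hd
  -- The ratio of the two eigenvalues of `U l`; conjugation depends on nothing else.
  refine ⟨V 1 1 * star (V 0 0), ?_, ?_, ?_⟩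
  · rw [star_mul, star_star]
    linear_combination (star (V 0 0) * V 0 0) * hv + hu
  · intro h
    refine hw'.mul_self_eq_one (l := l) (c := V 0 0 * V 0 0) ?_
    change V * V = _
    have e : V 1 1 * V 1 1 = V 0 0 * V 0 0 := by
      linear_combination (V 0 0 * V 0 0) * h - V 1 1 * V 1 1 * (star (V 0 0) * V 0 0 + 1) * hu
    ext i j
    fin_cases i <;> fin_cases j <;> simp [Matrix.mul_apply, Fin.sum_univ_two, hd, h10, e]
  · intro x
    have h1 := hw'.covariant l x
    change _ = V * _ * Vᴴ at h1
    rw [h1]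
    change V * (B * A x * Bᴴ) * Vᴴ = !![(B * A x * Bᴴ) 0 0,
      star (V 1 1 * star (V 0 0)) * (B * A x * Bᴴ) 0 1;
      V 1 1 * star (V 0 0) * (B * A x * Bᴴ) 1 0, (B * A x * Bᴴ) 1 1]
    generalize B * A x * Bᴴ = M
    have hu' : V 0 0 * starRingEnd ℂ (V 0 0) = 1 := by rw [mul_comm]; exact hu
    have hv' : V 1 1 * starRingEnd ℂ (V 1 1) = 1 := by rw [mul_comm]; exact hv
    ext i j
    fin_cases i <;> fin_cases j <;>
      simp [Matrix.mul_apply, Fin.sum_univ_two, hd, h10]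
    · linear_combination M 0 0 * hu'
    · ring
    · ring
    · linear_combination M 1 1 * hv'

end Diagonal

section Space

variable {Sp : Finset (Fin 3 → ℤ)}
  {A : (Fin 3 → ℤ) → Matrix (Fin 2) (Fin 2) ℂ} {L : Subgroup (Equiv.Perm (Fin 3 → ℤ))}
  {U : L → Matrix.unitaryGroup (Fin 2) ℂ} (hw : IsNormalWalk Sp A L U)

include hw

theorem form_orbitSum_eq {l : L} {h x : Fin 3 → ℤ} (hq : hw.orbitSum l x = hw.orbitSum l h) :
    orderOf l * hw.form (hw.orbitSum l h) x = hw.form (hw.orbitSum l h) (hw.orbitSum l h) := by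
  rw [← hw.form_orbitSum (hw.map_orbitSum l h), hq]

/-- Two chords of the circle of edges at a given height are equal only if they are the same or
symmetric about the centre. -/
theorem eq_or_of_chord {l : L} {h h' x x' : Fin 3 → ℤ}
    (hh : h ∈ edgeSet Sp) (hh' : h' ∈ edgeSet Sp) (hx : x ∈ edgeSet Sp) (hx' : x' ∈ edgeSet Sp)
    (hq : hw.orbitSum l h ≠ 0) (qh' : hw.orbitSum l h' = hw.orbitSum l h)
    (qx : hw.orbitSum l x = hw.orbitSum l h) (qx' : hw.orbitSum l x' = hw.orbitSum l h)
    (hne : h' ≠ h) (hE : x - x' = h' - h) :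
    x = h' ∨ orderOf l • (x + h) = 2 • hw.orbitSum l h := by
  have hk : (orderOf l : ℤ) ≠ 0 := by exact_mod_cast (hw.orderOf_pos l).ne'
  have hk' := (hw.orderOf_pos l).ne'
  have f1 := hw.form_orbitSum_eq (l := l) (h := h) rfl
  have f2 := hw.form_orbitSum_eq qh'
  have f3 := hw.form_orbitSum_eq qx
  have f4 := hw.form_orbitSum_eq qx'
  set u := hw.orbitSum l h with hu
  rw [← f1] at f2 f3 f4
  have f2 := mul_left_cancel₀ hk f2
  have f3 := mul_left_cancel₀ hk f3
  have f4 := mul_left_cancel₀ hk f4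
  have n1 := hw.form_eq hh' hh
  have n2 := hw.form_eq hx hh
  have n3 := hw.form_eq hx' hh
  have c1 := hw.form_comm h' h
  have c2 := hw.form_comm x' x
  have c3 := hw.form_comm h u
  have c4 := hw.form_comm h' u
  have c5 := hw.form_comm x u
  have c6 := hw.form_comm x' u
  have g1 := congrArg (fun z => hw.form z z) hE
  have g2 := congrArg (fun z => hw.form z (x + x')) hE
  -- The vectors from the centre to the midpoints of the two chords are orthogonal to the axis and
  -- to the common chord direction. Chords of the same length are equally far from the centre, so
  -- these vectors agree up to sign.
  have hor : orderOf l • (h' + h) - 2 • u = orderOf l • (x + x') - 2 • u ∨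
      orderOf l • (h' + h) - 2 • u = -(orderOf l • (x + x') - 2 • u) := by
    refine hw.eq_or_eq_neg_of_form (u := u) (D := h' - h) hq (sub_ne_zero.2 hne) ?_ ?_ ?_ ?_ ?_ ?_ <;>
    simp only [_root_.map_add, _root_.map_sub, LinearMap.add_apply, LinearMap.sub_apply,
      hw.form_nsmul_left, hw.form_nsmul_right, Nat.cast_ofNat] at g1 g2 ⊢
    · linarith
    · linear_combination 2 * f1 + (orderOf l : ℤ) * f2
    · linear_combination 2 * f1 + (orderOf l : ℤ) * (f3 + f4)
    · linear_combination (orderOf l : ℤ) * (n1 + c1) - 2 * (c4 - c3 + f2)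
    · linear_combination (-(orderOf l : ℤ)) * (g2 - n2 + n3 + c2) - 2 * (c4 - c3 + f2)
    · rw [c3, c4, c5, c6]
      linear_combination (orderOf l : ℤ) ^ 2 * (g1 + 2 * n1 - 2 * n2 - 2 * n3) +
        4 * (orderOf l : ℤ) * (f3 + f4 - f2)
  have h2 : ∀ (n : ℕ), n ≠ 0 → ∀ a b : Fin 3 → ℤ, n • a = n • b → a = b := fun n hn a b h => by
    rw [← sub_eq_zero, ← smul_sub] at h
    exact sub_eq_zero.1 ((nsmul_eq_zero_iff_right hn).1 h)
  rcases hor with h0 | h0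
  · left
    have h3 := h2 _ hk' _ _ (sub_left_injective h0)
    apply h2 2 two_ne_zero
    rw [show (2 : ℕ) • x = (x + x') + (x - x') by abel, hE, ← h3]; abel
  · right
    apply h2 2 two_ne_zero
    have h3 : orderOf l • (h' + h) + orderOf l • (x + x') = 2 • (2 • u) := by
      have := congrArg (fun z => z + (2 • u + orderOf l • (x + x'))) h0
      rw [show orderOf l • (h' + h) - 2 • u + (2 • u + orderOf l • (x + x')) =
        orderOf l • (h' + h) + orderOf l • (x + x') by abel] at this
      rw [this]; abel
    rw [← h3, ← smul_add, smul_comm]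
    congr 1
    rw [show x' = x - (h' - h) by rw [← hE]; abel]
    abel

end Space

end IsNormalWalk

/-! ### Dimension three: elements with a nonzero height are involutions -/

namespace IsNormalWalk

set_option linter.unusedSectionVars false

variable {Sp : Finset (Fin 3 → ℤ)}
  {A : (Fin 3 → ℤ) → Matrix (Fin 2) (Fin 2) ℂ} {L : Subgroup (Equiv.Perm (Fin 3 → ℤ))}
  {U : L → Matrix.unitaryGroup (Fin 2) ℂ} (hw : IsNormalWalk Sp A L U)

include hw

theorem nsmul_right_cancel {n : ℕ} (hn : n ≠ 0) {a b : Fin 3 → ℤ} (h : n • a = n • b) : a = b := by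
  rw [← sub_eq_zero, ← smul_sub] at h
  exact sub_eq_zero.1 ((nsmul_eq_zero_iff_right hn).1 h)

/-- Consecutive edges of an orbit of an automorphism of order at least three are not antipodal. -/
theorem nsmul_add_map_ne {l : L} (hll : l * l ≠ 1) {y : Fin 3 → ℤ} (hy : y ∈ edgeSet Sp) :
    orderOf l • (y + l.1 y) ≠ 2 • hw.orbitSum l y := by
  intro h
  have h1 := congrArg l.1 h
  rw [hw.map_nsmul, hw.map_nsmul, hw.map_orbitSum, ← h, hw.map_add] at h1
  have h2 := hw.nsmul_right_cancel (hw.orderOf_pos l).ne' h1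
  rw [add_comm] at h2
  exact hll (hw.eq_one_of_apply_eq (by norm_num) hy (add_right_cancel h2))

section Diagonal

variable {l : L} (hll : l * l ≠ 1) {w : ℂ} (hww : star w * w = 1) (hw1 : w * w ≠ 1)
  (hD : ∀ x, A (l.1 x) = !![A x 0 0, star w * A x 0 1; w * A x 1 0, A x 1 1])
  {h : Fin 3 → ℤ} (hh : h ∈ edgeSet Sp) (hq : hw.orbitSum l h ≠ 0)

include hll hww hw1 hD hh hq

/-- The edges `y` and `l y` have the same height and are not antipodal, so their matrices are
orthogonal. Comparison with the vanishing determinant leaves the off-diagonal product times `2 - w -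
star w`, which is nonzero because `w ≠ 1`. -/
theorem entries_of_diagonal {y : Fin 3 → ℤ} (hy : y ∈ edgeSet Sp) :
    A y 0 0 * A y 1 1 = 0 ∧ A y 0 1 * A y 1 0 = 0 := by
  have hl : l ≠ 1 := by rintro rfl; exact hll (one_mul 1)
  have h1 := hw.polarDet_eq_zero_of_orbitSum_eq hl hy (hw.map_mem_edgeSet l hy)
    (hw.orbitSum_ne_zero (by norm_num) (by decide) hl hh hq hy) (hw.orbitSum_map l y)
    (hw.nsmul_add_map_ne hll hy)
  have h2 := hw.det_eq_zero hy
  rw [Matrix.det_fin_two] at h2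
  rw [hD y] at h1
  simp [polarDet] at h1
  have h3 : (2 - w - star w) * (A y 0 1 * A y 1 0) = 0 := by
    simp only [← starRingEnd_apply] at *
    linear_combination h1 - 2 * h2
  have h4 : (2 - w - star w) ≠ 0 := by
    intro h0
    have : (w - 1) * (w - 1) = 0 := by linear_combination (-w) * h0 - hww
    have : w = 1 := by simpa [sub_eq_zero] using this
    exact hw1 (by rw [this, one_mul])
  have h5 := (mul_eq_zero.1 h3).resolve_left h4
  exact ⟨by linear_combination h2 + h5, h5⟩

/-- Neither summand can be zero, and their heights cancel, so `l h - h` is written as a chord of the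
circle through `h`. An equal chord is the same chord or its reflection in the centre, which runs
from `l c` to `c` for the antipode `c` of `h`. -/
theorem chord_pairs {x : Fin 3 → ℤ} (hx : x ∈ stepSet Sp) (hx' : l.1 h - h - x ∈ stepSet Sp) :
    x = l.1 h ∨ x = -h ∨ ∃ c ∈ edgeSet Sp, orderOf l • (c + h) = 2 • hw.orbitSum l h ∧
      (x = c ∨ x = -l.1 c) := by
  have hl : l ≠ 1 := by rintro rfl; exact hll (one_mul 1)
  have hlh : l.1 h ≠ h := fun h0 => hl (hw.eq_one_of_apply_eq (by norm_num) hh h0)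
  have hne := fun y hy => hw.orbitSum_ne_zero (by norm_num) (by decide) hl hh hq (y := y) hy
  have hheight := fun y hy => hw.height_eq_or_eq_neg (by norm_num) (by decide) hl hh hq (y := y) hy
  set x' := l.1 h - h - x with hx'def
  have hsum : x + x' = l.1 h - h := by rw [hx'def]; abel
  have hqs : hw.orbitSum l x + hw.orbitSum l x' = 0 := by
    rw [← _root_.map_add, hsum, _root_.map_sub, hw.orbitSum_map, sub_self]
  have hg : l.1 h - h ≠ 0 := sub_ne_zero.2 hlh
  have hlhV := hw.map_mem_edgeSet l hh
  have hk' := (hw.orderOf_pos l).ne'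
  rcases mem_stepSet.1 hx with h0 | hxV
  · exfalso
    rw [h0, zero_add] at hsum
    rw [h0, _root_.map_zero, zero_add] at hqs
    rcases mem_stepSet.1 hx' with h1 | h1
    · exact hg (by rw [← hsum, h1])
    · exact hne _ h1 hqs
  rcases mem_stepSet.1 hx' with h0 | hxV'
  · exfalso
    rw [h0, _root_.map_zero, add_zero] at hqs
    exact hne _ hxV hqs
  rcases hheight x hxV with h0 | h0
  · have h1 : hw.orbitSum l (-x') = hw.orbitSum l h := by
      rw [_root_.map_neg, ← h0]; exact (eq_neg_of_add_eq_zero_left hqs).symm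
    rcases hw.eq_or_of_chord hh hlhV hxV (neg_mem_edgeSet hxV') hq (hw.orbitSum_map l h) h0 h1 hlh
      (by rw [sub_neg_eq_add, hsum]) with h2 | h2
    · exact Or.inl h2
    · exact Or.inr (Or.inr ⟨x, hxV, h2, Or.inl rfl⟩)
  · have h1 : hw.orbitSum l x' = hw.orbitSum l h := by
      rw [h0] at hqs
      exact (neg_add_eq_zero.1 hqs).symm
    rcases hw.eq_or_of_chord hh hlhV hxV' (neg_mem_edgeSet hxV) hq (hw.orbitSum_map l h) h1
      (by rw [_root_.map_neg, h0, neg_neg]) hlh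
      (by rw [sub_neg_eq_add, add_comm, hsum]) with h2 | h2
    · right; left
      rw [h2] at hsum
      rw [sub_eq_add_neg, add_comm] at hsum
      exact add_left_cancel hsum
    · refine Or.inr (Or.inr ⟨x', hxV', h2, Or.inr ?_⟩)
      have h3 := congrArg l.1 h2
      rw [hw.map_nsmul, hw.map_nsmul, hw.map_orbitSum, ← h2, hw.map_add] at h3
      have h4 := hw.nsmul_right_cancel hk' h3
      have h5 : x = l.1 h - h - x' := by rw [← hsum]; abel
      rw [h5, show l.1 h - h - x' = (l.1 x' + l.1 h) - (x' + h) - l.1 x' by abel, h4, sub_self,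
        zero_sub]

/-- The coefficient of the determinant at `l h - h` involves one chord, or two if the antipode of
`h` is an edge. In either case the resulting relation makes `w` real, against `hw1`. -/
theorem false_of_diagonal : False := by
  have hl : l ≠ 1 := by rintro rfl; exact hll (one_mul 1)
  have hlh : l.1 h ≠ h := fun h0 => hl (hw.eq_one_of_apply_eq (by norm_num) hh h0)
  have hk' := (hw.orderOf_pos l).ne'
  have hg : l.1 h - h ≠ 0 := sub_ne_zero.2 hlh
  have hne := fun y hy => hw.orbitSum_ne_zero (by norm_num) (by decide) hl hh hq (y := y) hy
  have hheight := fun y hy => hw.height_eq_or_eq_neg (by norm_num) (by decide) hl hh hq (y := y) hy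
  have hpairs := fun x => hw.chord_pairs hll hww hw1 hD hh hq (x := x)
  have hent := fun y => hw.entries_of_diagonal hll hww hw1 hD hh hq (y := y)
  have hpol : ∀ y, polarDet (A (l.1 y)) (A (-y)) =
      A y 0 0 * star (A y 0 0) + A y 1 1 * star (A y 1 1) + star w * (A y 0 1 * star (A y 0 1)) +
        w * (A y 1 0 * star (A y 1 0)) := by
    intro y
    rw [hD, hw.apply_neg_eq, Matrix.adjugate_fin_two]
    simp [polarDet]
    ring
  have htr : ∀ y ∈ edgeSet Sp, A y 0 0 + A y 1 1 ≠ 0 := by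
    intro y hy h0
    apply hw.trace_re_ne_zero hy
    rw [Matrix.trace_fin_two, h0, Complex.zero_re]
  obtain ⟨h1, h2⟩ := hent h hh
  by_cases hc : ∃ c ∈ edgeSet Sp, orderOf l • (c + h) = 2 • hw.orbitSum l h
  · obtain ⟨c, hcV, hc⟩ := hc
    have huniq : ∀ c', orderOf l • (c' + h) = 2 • hw.orbitSum l h → c' = c := by
      intro c' hc'
      rw [← hc] at hc'
      exact add_right_cancel (hw.nsmul_right_cancel hk' hc')
    have hlc : c + h = l.1 c + l.1 h := by
      have h3 := congrArg l.1 hc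
      rw [hw.map_nsmul, hw.map_nsmul, hw.map_orbitSum, ← hc, hw.map_add] at h3
      exact (hw.nsmul_right_cancel hk' h3).symm
    have hch : c ≠ h := by
      rintro rfl
      apply hlh
      have : (2 : ℕ) • l.1 c = 2 • c := by rw [two_nsmul, two_nsmul, ← hlc]
      exact hw.nsmul_right_cancel two_ne_zero this
    have hclh : c ≠ l.1 h := by
      rintro rfl
      exact hw.nsmul_add_map_ne hll hh (by rw [add_comm, hc])
    have hqc : hw.orbitSum l c = hw.orbitSum l h := by
      have h3 := congrArg (hw.orbitSum l) hc
      rw [_root_.map_nsmul, _root_.map_nsmul, _root_.map_add,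
        hw.orbitSum_of_fixed (hw.map_orbitSum l h), smul_comm] at h3
      have h4 := hw.nsmul_right_cancel hk' h3
      rw [two_nsmul] at h4
      exact add_right_cancel h4
    have hself : ∀ y ∈ edgeSet Sp, ∀ z ∈ edgeSet Sp, hw.orbitSum l y = hw.orbitSum l h →
        hw.orbitSum l z = hw.orbitSum l h → y ≠ -z := by
      rintro y hy z hz h3 h4 rfl
      rw [_root_.map_neg, h4] at h3
      have h5 : (2 : ℕ) • hw.orbitSum l h = 0 := by
        rw [two_nsmul]; nth_rw 1 [← h3]; exact neg_add_cancel _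
      exact hq ((nsmul_eq_zero_iff_right two_ne_zero).1 h5)
    have hlhV := hw.map_mem_edgeSet l hh
    have hlcV := hw.map_mem_edgeSet l hcV
    have qlh := hw.orbitSum_map l h
    have qlc : hw.orbitSum l (l.1 c) = hw.orbitSum l h := by rw [hw.orbitSum_map, hqc]
    -- The four steps kept in this sum are the two orderings of each of the two chords.
    have hs := hw.sum_polarDet (l.1 h - h)
    rw [if_neg hg] at hs
    have hsub : ({l.1 h, -h, c, -l.1 c} : Finset (Fin 3 → ℤ)) ⊆ stepSet Sp := by
      intro x hx
      simp only [Finset.mem_insert, Finset.mem_singleton] at hx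
      rcases hx with rfl | rfl | rfl | rfl
      · exact mem_stepSet.2 (Or.inr hlhV)
      · exact mem_stepSet.2 (Or.inr (neg_mem_edgeSet hh))
      · exact mem_stepSet.2 (Or.inr hcV)
      · exact mem_stepSet.2 (Or.inr (neg_mem_edgeSet hlcV))
    have hzero : ∀ x ∈ stepSet Sp, x ∉ ({l.1 h, -h, c, -l.1 c} : Finset (Fin 3 → ℤ)) →
        polarDet (A x) (A (l.1 h - h - x)) = 0 := by
      intro x hx hxT
      by_cases hx' : l.1 h - h - x ∈ stepSet Sp
      · exfalso
        apply hxT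
        simp only [Finset.mem_insert, Finset.mem_singleton]
        rcases hpairs x hx hx' with h3 | h3 | ⟨c', -, hc', h3⟩
        · exact Or.inl h3
        · exact Or.inr (Or.inl h3)
        · rw [huniq c' hc'] at h3
          exact Or.inr (Or.inr h3)
      · rw [hw.eq_zero _ hx', polarDet_zero_right]
    rw [← Finset.sum_subset hsub hzero, Finset.sum_insert, Finset.sum_insert, Finset.sum_pair] at hs
    rotate_left
    · exact hself c hcV _ hlcV hqc qlc
    · simp only [Finset.mem_insert, Finset.mem_singleton, not_or]
      refine ⟨(hself c hcV h hh hqc rfl).symm, fun h3 => ?_⟩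
      have h4 : h = l.1 c := neg_injective h3
      rw [h4] at hlc hclh
      apply hclh
      rw [← h4] at hlc
      rw [← h4, hlc.symm.trans (add_comm c h) |> add_left_cancel]
    · simp only [Finset.mem_insert, Finset.mem_singleton, not_or]
      exact ⟨hself _ hlhV h hh qlh rfl, hclh.symm, hself _ hlhV _ hlcV qlh qlc⟩
    have e1 : l.1 h - h - l.1 h = -h := by abel
    have e2 : l.1 h - h - -h = l.1 h := by abel
    have e3 : l.1 h - h - c = -l.1 c := by
      rw [show l.1 h - h - c = l.1 h - (c + h) by abel, hlc]; abel
    have e4 : l.1 h - h - -l.1 c = c := by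
      rw [show l.1 h - h - -l.1 c = (l.1 c + l.1 h) - h by abel, ← hlc]; abel
    rw [e1, e2, e3, e4, polarDet_comm (A (-h)), hpol, polarDet_comm (A (-l.1 c))] at hs
    have hpolc : polarDet (A c) (A (-l.1 c)) =
        A c 0 0 * star (A c 0 0) + A c 1 1 * star (A c 1 1) + w * (A c 0 1 * star (A c 0 1)) +
        star w * (A c 1 0 * star (A c 1 0)) := by
      have h3 := hw.polarDet_neg (-c) (l.1 c)
      rw [neg_neg] at h3
      rw [h3, polarDet_comm, hpol]
      simp
      ring
    rw [hpolc] at hs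
    -- A diameter is its own reflection in the centre, so `h - c` is a difference of edges in only
    -- one way.
    have hdiam : polarDet (A h) (A (-c)) = 0 := by
      refine hw.polarDet_eq_zero_of_unique ?_ ?_
      · rw [← sub_eq_add_neg]; exact sub_ne_zero.2 hch.symm
      · intro x hx hx'
        set x' := h + -c - x with hx'def
        have hsum : x + x' = h - c := by rw [hx'def]; abel
        have hqs : hw.orbitSum l x + hw.orbitSum l x' = 0 := by
          rw [← _root_.map_add, hsum, _root_.map_sub, hqc, sub_self]
        have hhc : ∀ y ∈ edgeSet Sp, ∀ z ∈ edgeSet Sp, hw.orbitSum l y = hw.orbitSum l h →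
            hw.orbitSum l z = hw.orbitSum l h → y - z = h - c → y = h := by
          intro y hy z hz qy qz hE
          rcases hw.eq_or_of_chord hcV hh hy hz (by rw [hqc]; exact hq) hqc.symm
            (by rw [qy, hqc]) (by rw [qz, hqc]) hch.symm hE with h3 | h3
          · exact h3
          · rw [hqc, ← hc, add_comm c h] at h3
            exact add_right_cancel (hw.nsmul_right_cancel hk' h3)
        rcases mem_stepSet.1 hx with h0 | hxV
        · exfalso
          rw [h0, zero_add] at hsum
          rw [h0, _root_.map_zero, zero_add] at hqs
          rcases mem_stepSet.1 hx' with h3 | h3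
          · rw [h3] at hsum
            exact sub_ne_zero.2 hch.symm hsum.symm
          · exact hne _ h3 hqs
        rcases mem_stepSet.1 hx' with h0 | hxV'
        · exfalso
          rw [h0, _root_.map_zero, add_zero] at hqs
          exact hne _ hxV hqs
        rcases hheight x hxV with h0 | h0
        · left
          refine hhc x hxV _ (neg_mem_edgeSet hxV') h0 ?_ (by rw [sub_neg_eq_add, hsum])
          rw [_root_.map_neg, ← h0]; exact (eq_neg_of_add_eq_zero_left hqs).symm
        · right
          have h3 := hhc x' hxV' _ (neg_mem_edgeSet hxV) (by
            rw [h0] at hqs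
            exact (neg_add_eq_zero.1 hqs).symm) (by rw [_root_.map_neg, h0, neg_neg])
            (by rw [sub_neg_eq_add, add_comm, hsum])
          rw [h3, sub_eq_add_neg, add_comm] at hsum
          exact add_left_cancel hsum
    have hdiam' : A h 0 0 * star (A c 0 0) + A h 1 1 * star (A c 1 1) +
        A h 0 1 * star (A c 0 1) + A h 1 0 * star (A c 1 0) = 0 := by
      rw [hw.apply_neg_eq, Matrix.adjugate_fin_two] at hdiam
      simp [polarDet] at hdiam
      simp only [← starRingEnd_apply]
      linear_combination hdiam
    obtain ⟨h3, h4⟩ := hent c hcV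
    have hn := hw.matrixNormSq_eq hh hcV
    have hn' : (matrixNormSq (A h) : ℂ) = matrixNormSq (A c) := by rw [hn]
    simp only [matrixNormSq, Complex.ofReal_add, ← mul_star_eq_normSq] at hn'
    exact hw1 (mul_self_eq_one_of_chord hww h1 h2 h3 h4 (htr h hh)
      (by linear_combination hs / 2) (by linear_combination hn') hdiam')
  -- Without an antipodal edge the decomposition of `l h - h` is unique.
  · have h3 : polarDet (A (l.1 h)) (A (-h)) = 0 := by
      refine hw.polarDet_eq_zero_of_unique ?_ ?_
      · rw [← sub_eq_add_neg]; exact hg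
      · intro x hx hx'
        rw [← sub_eq_add_neg] at hx'
        rcases hpairs x hx hx' with h3 | h3 | ⟨c, hcV, h3, -⟩
        · exact Or.inl h3
        · exact Or.inr h3
        · exact absurd ⟨c, hcV, h3⟩ hc
    rw [hpol] at h3
    have hww' : star (star w) * star w = 1 := by rw [star_star, mul_comm]; exact hww
    have h4 := mul_self_eq_one_of_antipodal hww' (p := A h 0 0) (q := A h 0 1) (r := A h 1 0)
      (t := A h 1 1) (by rw [h1, h2]) (htr h hh) (by rw [star_star]; exact h3)
    apply hw1
    have := congrArg star h4
    simpa using this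

end Diagonal

theorem mul_self_eq_one_of_orbitSum_ne_zero {l : L} {h : Fin 3 → ℤ} (hh : h ∈ edgeSet Sp)
    (hq : hw.orbitSum l h ≠ 0) : l * l = 1 := by
  by_contra hll
  obtain ⟨A', U', hw', w, hww, hw1, hD⟩ := hw.exists_diagonal l
  exact hw'.false_of_diagonal hll hww (fun h0 => hll (hw1 h0)) hD hh hq

end IsNormalWalk

/-! ### Arithmetic of the rectangle relations -/

/-- Two squares of equal modulus on the same coordinate axis agree up to sign, so the numbers agree
up to a fourth root of unity. -/
theorem exists_phase_of_sq_real {z w : ℂ} (hn : Complex.normSq z = Complex.normSq w)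
    (h : ((z * z).im = 0 ∧ (w * w).im = 0) ∨ ((z * z).re = 0 ∧ (w * w).re = 0)) :
    ∃ e : ℂ, (e = 1 ∨ e = -1 ∨ e = Complex.I ∨ e = -Complex.I) ∧ z = e * w := by
  have h2 : z * z = w * w ∨ z * z = -(w * w) := by
    have hn2 : Complex.normSq (z * z) = Complex.normSq (w * w) := by simp [hn]
    rw [Complex.normSq_apply, Complex.normSq_apply] at hn2
    rcases h with ⟨h1, h3⟩ | ⟨h1, h3⟩ <;> rw [h1, h3] at hn2
    · have : (z * z).re * (z * z).re = (w * w).re * (w * w).re := by linarith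
      rcases mul_self_eq_mul_self_iff.1 this with h4 | h4
      · exact Or.inl (Complex.ext h4 (by rw [h1, h3]))
      · exact Or.inr (Complex.ext h4 (by rw [Complex.neg_im, h1, h3, neg_zero]))
    · have : (z * z).im * (z * z).im = (w * w).im * (w * w).im := by linarith
      rcases mul_self_eq_mul_self_iff.1 this with h4 | h4
      · exact Or.inl (Complex.ext (by rw [h1, h3]) h4)
      · exact Or.inr (Complex.ext (by rw [Complex.neg_re, h1, h3, neg_zero]) h4)
  rcases h2 with h2 | h2
  · rcases mul_self_eq_mul_self_iff.1 h2 with h3 | h3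
    · exact ⟨1, by simp, by rw [h3, one_mul]⟩
    · exact ⟨-1, by simp, by rw [h3, neg_one_mul]⟩
  · have h3 : z * z = (Complex.I * w) * (Complex.I * w) := by
      rw [h2]; linear_combination (-w * w) * Complex.I_mul_I
    rcases mul_self_eq_mul_self_iff.1 h3 with h4 | h4
    · exact ⟨Complex.I, by simp, h4⟩
    · exact ⟨-Complex.I, by simp, by rw [h4]; ring⟩

/-- The relations between the entries of a transition matrix on the body-centred cubic lattice
force its kernel to be an eigenspace of a Pauli matrix. -/
theorem exists_phase_of_rectangle {p q r t : ℂ} (hdet : p * t = q * r)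
    (hZ : p * star p + t * star t - q * star q - r * star r = 0)
    (hX : p * star t + t * star p + q * star r + r * star q = 0)
    (hY : p * star t + t * star p - q * star r - r * star q = 0)
    (h1 : (p * t).re = 0) (h2 : (p * p + t * t - q * q - r * r).re = 0)
    (h3 : (p * p + t * t + q * q + r * r).re = 0) :
    (p = 0 ∧ r = 0) ∨ (q = 0 ∧ t = 0) ∨
      ∃ e : ℂ, (e = 1 ∨ e = -1 ∨ e = Complex.I ∨ e = -Complex.I) ∧ q = e * p ∧ t = e * r := by
  have hpt : (p * star t).re = 0 := by
    have := congrArg Complex.re (show p * star t + t * star p = 0 by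
      linear_combination (hX + hY) / 2)
    simp at this ⊢
    linarith
  have hqr : (q * star r).re = 0 := by
    have := congrArg Complex.re (show q * star r + r * star q = 0 by
      linear_combination (hX - hY) / 2)
    simp at this ⊢
    linarith
  have hZ' : Complex.normSq p + Complex.normSq t = Complex.normSq q + Complex.normSq r := by
    simp only [mul_star_eq_normSq] at hZ
    have := congrArg Complex.re hZ
    simp at this
    linarith
  have hp2 : (p * p + t * t).re = 0 := by
    rw [Complex.sub_re, Complex.sub_re] at h2
    rw [Complex.add_re, Complex.add_re] at h3
    linarith
  have hq2 : (q * q + r * r).re = 0 := by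
    rw [Complex.sub_re, Complex.sub_re] at h2
    rw [Complex.add_re, Complex.add_re] at h3
    rw [Complex.add_re]
    linarith
  have hqr1 : (q * r).re = 0 := by rw [← hdet]; exact h1
  -- The first two conditions say that the real parts have product zero and so do the imaginary
  -- parts: one number is real and the other imaginary. The third condition then equates the moduli.
  have key : ∀ x y : ℂ, (x * star y).re = 0 → (x * y).re = 0 → (x * x + y * y).re = 0 →
      x * y ≠ 0 → (x * x).im = 0 ∧ Complex.normSq x = Complex.normSq y := by
    intro x y e1 e2 e3 hxy
    obtain ⟨hx, hy⟩ := mul_ne_zero_iff.1 hxy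
    have him : x.re * x.im = 0 ∧ y.re * y.im = 0 := by
      simp at e1 e2
      have e4 : x.re * y.re = 0 := by linarith
      have e5 : x.im * y.im = 0 := by linarith
      rcases mul_eq_zero.1 e4 with e4 | e4 <;> rcases mul_eq_zero.1 e5 with e5 | e5
      · exact absurd (Complex.ext e4 e5) hx
      · simp [e4, e5]
      · simp [e4, e5]
      · exact absurd (Complex.ext e4 e5) hy
    refine ⟨by simp; linarith [him.1], ?_⟩
    simp at e1 e2 e3
    have e4 : x.re * y.re = 0 := by linarith
    have e5 : x.im * y.im = 0 := by linarith
    rw [Complex.normSq_apply, Complex.normSq_apply]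
    rcases mul_eq_zero.1 e4 with e4 | e4 <;> rcases mul_eq_zero.1 e5 with e5 | e5
    · exact absurd (Complex.ext e4 e5) hx
    · rw [e4, e5] at e3 ⊢; linarith
    · rw [e4, e5] at e3 ⊢; linarith
    · exact absurd (Complex.ext e4 e5) hy
  by_cases h0 : p * t = 0
  · have h0' : q * r = 0 := by rw [← hdet, h0]
    rcases mul_eq_zero.1 h0 with hp | ht <;> rcases mul_eq_zero.1 h0' with hq | hr
    · right; right
      subst hp hq
      simp at hZ'
      obtain ⟨e, he, hte⟩ := exists_phase_of_sq_real hZ' (Or.inr ⟨by simpa using hp2, by simpa using hq2⟩)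
      exact ⟨e, he, by simp, hte⟩
    · exact Or.inl ⟨hp, hr⟩
    · exact Or.inr (Or.inl ⟨hq, ht⟩)
    · right; right
      subst ht hr
      simp at hZ'
      obtain ⟨e, he, hte⟩ := exists_phase_of_sq_real hZ'.symm (Or.inr ⟨by simpa using hq2, by simpa using hp2⟩)
      exact ⟨e, he, hte, by simp⟩
  · right; right
    have h0' : q * r ≠ 0 := by rw [← hdet]; exact h0
    obtain ⟨k1, k2⟩ := key p t hpt h1 hp2 h0
    obtain ⟨k3, k4⟩ := key q r hqr hqr1 hq2 h0'
    obtain ⟨e, he, hqe⟩ := exists_phase_of_sq_real (z := q) (w := p) (by linarith) (Or.inl ⟨k3, k1⟩)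
    refine ⟨e, he, hqe, mul_left_cancel₀ (mul_ne_zero_iff.1 h0).1 ?_⟩
    rw [hdet, hqe]; ring

/-! ### Dimension three: the isotropy group is a Klein four-group -/

namespace IsNormalWalk

set_option linter.unusedSectionVars false

section Space

variable {Sp : Finset (Fin 3 → ℤ)}
  {A : (Fin 3 → ℤ) → Matrix (Fin 2) (Fin 2) ℂ} {L : Subgroup (Equiv.Perm (Fin 3 → ℤ))}
  {U : L → Matrix.unitaryGroup (Fin 2) ℂ} (hw : IsNormalWalk Sp A L U)

include hw

theorem orbitSum_of_mul_self {l : L} (hl : l ≠ 1) (hll : l * l = 1) (x : Fin 3 → ℤ) :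
    hw.orbitSum l x = x + l.1 x := by
  have ho : orderOf l = 2 := orderOf_eq_prime (by rw [sq, hll]) hl
  rw [orbitSum_apply, ho, Finset.sum_range_succ, Finset.sum_range_one, pow_zero, pow_one]
  rfl

theorem apply_apply {l : L} (hll : l * l = 1) (x : Fin 3 → ℤ) : l.1 (l.1 x) = x := by
  change (l * l).1 x = x
  rw [hll]; rfl

theorem rotation_mul_self {l : L} (hl : l ∈ hw.rotations) : l * l = 1 := by
  obtain ⟨x, hx, hqx⟩ := hw.exists_rotation_orbitSum_ne_zero (by decide) hl
  exact hw.mul_self_eq_one_of_orbitSum_ne_zero (mem_edgeSet.2 (Or.inl hx)) hqx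

/-- Let `l` be a nontrivial rotation, an involution. Then `-l` is an involution in the group as
well, and the heights over both give `x + l x = ±(h + l h)` and `x - l x = ±(h - l h)` for every
generator. So every generator is `± h` or `± l h`, too few for rank three. -/
theorem neg_notMem_of_forall {s : L} (hs : ∀ x, s.1 x = -x) : False := by
  obtain ⟨h, hh⟩ := hw.edges_nonempty le_rfl
  have hh' : h ∈ edgeSet Sp := mem_edgeSet.2 (Or.inl hh)
  obtain ⟨l, hl, hl1⟩ := hw.exists_rotation_ne_one le_rfl
  have hll := hw.rotation_mul_self hl
  obtain ⟨z, hz, hqz⟩ := hw.exists_rotation_orbitSum_ne_zero (by decide) hl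
  have hz' : z ∈ edgeSet Sp := mem_edgeSet.2 (Or.inl hz)
  have hsl : ∀ x, (s * l).1 x = -l.1 x := fun x => hs _
  have hsl2 : (s * l) * (s * l) = 1 := by
    refine hw.eq_of_forall fun x _ => ?_
    change (s * l).1 ((s * l).1 x) = x
    rw [hsl, hsl, hw.map_neg, hw.apply_apply hll, neg_neg]
  have hsl1 : s * l ≠ 1 := by
    intro h0
    have h1 : -l.1 z = z := by rw [← hsl, h0]; rfl
    rw [hw.orbitSum_of_mul_self hl1 hll] at hqz
    apply hqz
    nth_rw 1 [← h1]
    exact neg_add_cancel _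
  have hq1 : hw.orbitSum (s * l) h ≠ 0 := by
    rw [hw.orbitSum_of_mul_self hsl1 hsl2, hsl, ← sub_eq_add_neg, sub_ne_zero]
    exact fun h0 => hl1 (hw.eq_one_of_apply_eq (by norm_num) hh' h0.symm)
  have hq2 := hw.orbitSum_ne_zero le_rfl (by decide) hl1 hz' hqz hh'
  have := hw.dim_le_card (T := {h, l.1 h}) (by
    intro x hx
    have hx' : x ∈ edgeSet Sp := mem_edgeSet.2 (Or.inl hx)
    have e1 := hw.height_eq_or_eq_neg le_rfl (by decide) hsl1 hh' hq1 hx'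
    have e2 := hw.height_eq_or_eq_neg le_rfl (by decide) hl1 hh' hq2 hx'
    simp only [hw.orbitSum_of_mul_self hsl1 hsl2, hw.orbitSum_of_mul_self hl1 hll, hsl] at e1 e2
    have h2 : ∀ y, (2 : ℕ) • x = 2 • y → x = y := fun y => hw.nsmul_right_cancel two_ne_zero
    have h3 : (2 : ℕ) • x = (x + -l.1 x) + (x + l.1 x) := by rw [two_nsmul]; abel
    have hmh : h ∈ Submodule.span ℤ (({h, l.1 h} : Finset (Fin 3 → ℤ)) : Set (Fin 3 → ℤ)) :=
      Submodule.subset_span (by simp)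
    have hml : l.1 h ∈ Submodule.span ℤ (({h, l.1 h} : Finset (Fin 3 → ℤ)) : Set (Fin 3 → ℤ)) :=
      Submodule.subset_span (by simp)
    rcases e1 with e1 | e1 <;> rcases e2 with e2 | e2 <;> rw [e1, e2] at h3
    · rw [h2 h (by rw [h3, two_nsmul]; abel)]; exact hmh
    · rw [h2 (-l.1 h) (by rw [h3, two_nsmul]; abel)]; exact neg_mem hml
    · rw [h2 (l.1 h) (by rw [h3, two_nsmul]; abel)]; exact hml
    · rw [h2 (-h) (by rw [h3, two_nsmul]; abel)]; exact neg_mem hmh)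
  have h4 := this.trans Finset.card_le_two
  omega

/-- No automorphism in the isotropy group has its orbit sums all equal to zero. -/
theorem orbitSum_ne_zero_of_ne_one {s : L} (hs1 : s ≠ 1) {h : Fin 3 → ℤ} (hh : h ∈ edgeSet Sp) :
    hw.orbitSum s h ≠ 0 := by
  intro hs0
  have hall : ∀ x ∈ Sp, hw.orbitSum s x = 0 := by
    intro x hx
    by_contra hne
    exact hw.orbitSum_ne_zero le_rfl (by decide) hs1 (mem_edgeSet.2 (Or.inl hx)) hne hh hs0
  have hzero : hw.orbitSum s = 0 := hw.addHom_ext hall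
  -- The determinant is a sign, so a square is always a rotation.
  have hrot : s * s ∈ hw.rotations := by
    rw [hw.mem_rotations, _root_.map_mul]
    rcases hw.detHom_eq s with h0 | h0 <;> rw [h0] <;> norm_num
  by_cases hss : s * s = 1
  · refine hw.neg_notMem_of_forall (s := s) fun x => ?_
    have := DFunLike.congr_fun hzero x
    rw [hw.orbitSum_of_mul_self hs1 hss, AddMonoidHom.zero_apply] at this
    exact (neg_eq_of_add_eq_zero_right this).symm
  · set l := s * s with hl
    have hll := hw.rotation_mul_self hrot
    obtain ⟨z, hz, hqz⟩ := hw.exists_rotation_orbitSum_ne_zero (by decide) hrot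
    have hqh := hw.orbitSum_ne_zero le_rfl (by decide) hss (mem_edgeSet.2 (Or.inl hz)) hqz hh
    have ho : orderOf l = 2 := orderOf_eq_prime (by rw [sq, hll]) hss
    have ho4 : orderOf s = 4 := by
      have := orderOf_eq_prime_pow (p := 2) (n := 1) (x := s) (by
        rw [pow_one, sq]; exact hss) (by
        rw [show 2 ^ (1 + 1) = 2 * 2 by norm_num, pow_mul, sq s, ← hl, sq, hll])
      simpa using this
    have hsum : ∀ x, x + s.1 x + l.1 x + l.1 (s.1 x) = 0 := by
      intro x
      have := DFunLike.congr_fun hzero x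
      rw [orbitSum_apply, ho4, Finset.sum_range_succ, Finset.sum_range_succ, Finset.sum_range_succ,
        Finset.sum_range_one, pow_zero, pow_one, pow_succ s 2, sq, ← hl] at this
      exact this
    have hsh : -s.1 h ∈ edgeSet Sp := neg_mem_edgeSet (hw.map_mem_edgeSet s hh)
    obtain ⟨A', U', hw', w, hww, hw1, hD⟩ := hw.exists_diagonal s
    -- Here `s` has order four. Since the orbit sums of `s` vanish, `-s h` lies over the axis of `s
    -- * s` at the same height as `h`, and it is not antipodal to `h`. The resulting orthogonality
    -- makes the eigenvalue ratio of `U s` real, so `s * s = 1` after all.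
    have hpol' := hw'.polarDet_eq_zero_of_orbitSum_eq hss hh hsh hqh (by
      change hw.orbitSum l _ = hw.orbitSum l _
      rw [_root_.map_neg, hw.orbitSum_of_mul_self hss hll, hw.orbitSum_of_mul_self hss hll,
        neg_eq_iff_add_eq_zero, ← hsum h]
      abel) (by
      change _ ≠ 2 • hw.orbitSum l _
      rw [ho]
      intro h0
      have h1 := hw.nsmul_right_cancel two_ne_zero h0
      rw [hw.orbitSum_of_mul_self hss hll] at h1
      have h2 := add_left_cancel h1
      have h3 : l.1 h = s.1 (s.1 h) := rfl
      rw [h3, ← hw.map_neg] at h2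
      have h4 := s.1.injective h2
      apply hss
      refine hw.eq_one_of_apply_eq (by norm_num) hh ?_
      rw [h3, ← h4, hw.map_neg, ← h4, neg_neg])
    have hdet := hw'.det_eq_zero hh
    rw [Matrix.det_fin_two, sub_eq_zero] at hdet
    rw [hw'.apply_neg_eq, hD, Matrix.adjugate_fin_two] at hpol'
    simp [polarDet] at hpol'
    refine hss (hw1 (mul_self_eq_one_of_antipodal hww hdet (fun h0 => ?_) ?_))
    · apply hw'.trace_re_ne_zero hh
      rw [Matrix.trace_fin_two, h0, Complex.zero_re]
    · simp only [← starRingEnd_apply]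
      linear_combination hpol'

theorem mul_self_space (l : L) : l * l = 1 := by
  obtain ⟨h, hh⟩ := hw.edges_nonempty le_rfl
  by_cases hl : l = 1
  · rw [hl, one_mul]
  · exact hw.mul_self_eq_one_of_orbitSum_ne_zero (mem_edgeSet.2 (Or.inl hh))
      (hw.orbitSum_ne_zero_of_ne_one hl (mem_edgeSet.2 (Or.inl hh)))

theorem mul_comm_space (l m : L) : l * m = m * l := by
  have h1 := hw.mul_self_space (l * m)
  calc l * m = l * (l * m * (l * m)) * m := by rw [h1, mul_one]
    _ = (l * l) * (m * l) * (m * m) := by group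
    _ = m * l := by rw [hw.mul_self_space l, hw.mul_self_space m, one_mul, mul_one]

theorem add_map_ne_zero {l : L} (hl : l ≠ 1) {h : Fin 3 → ℤ} (hh : h ∈ edgeSet Sp) :
    h + l.1 h ≠ 0 := by
  rw [← hw.orbitSum_of_mul_self hl (hw.mul_self_space l)]
  exact hw.orbitSum_ne_zero_of_ne_one hl hh

theorem map_add_map_ne_zero {l m : L} (hlm : l ≠ m) {h : Fin 3 → ℤ} (hh : h ∈ edgeSet Sp) :
    l.1 h + m.1 h ≠ 0 := by
  intro h0
  have h1 : (l * m) ≠ 1 := fun h1 => hlm (by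
    rw [← mul_one l, ← hw.mul_self_space m, ← mul_assoc, h1, one_mul])
  apply hw.add_map_ne_zero h1 hh
  have h2 := congrArg l.1 h0
  rw [hw.map_add, hw.map_zero, hw.apply_apply (hw.mul_self_space l)] at h2
  exact h2

/-- The generators in the orbit of a Klein four-group sum to zero. -/
theorem sum_eq_zero {l m : L} (hl : l ≠ 1) (hm : m ≠ 1) (hlm : l ≠ m) {h : Fin 3 → ℤ}
    (hh : h ∈ edgeSet Sp) : h + l.1 h + m.1 h + (l * m).1 h = 0 := by
  have e1 := hw.height_eq_or_eq_neg le_rfl (by decide) hl hh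
    (hw.orbitSum_ne_zero_of_ne_one hl hh) (hw.map_mem_edgeSet m hh)
  have e2 := hw.height_eq_or_eq_neg le_rfl (by decide) hm hh
    (hw.orbitSum_ne_zero_of_ne_one hm hh) (hw.map_mem_edgeSet l hh)
  simp only [hw.orbitSum_of_mul_self hl (hw.mul_self_space l),
    hw.orbitSum_of_mul_self hm (hw.mul_self_space m)] at e1 e2
  have h1 : l.1 (m.1 h) = (l * m).1 h := rfl
  have h2 : m.1 (l.1 h) = (l * m).1 h := by rw [hw.mul_comm_space l m]; rfl
  rw [h1] at e1
  rw [h2] at e2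
  -- A minus sign in either relation is the claim; two plus signs would give `m h = l h`, contrary
  -- to freeness.
  rcases e1 with e1 | e1
  · rcases e2 with e2 | e2
    · exfalso
      have h3 : (2 : ℕ) • m.1 h = 2 • l.1 h := by
        rw [two_nsmul, two_nsmul]
        have h4 : (m.1 h + (l * m).1 h) - (l.1 h + (l * m).1 h) = (h + l.1 h) - (h + m.1 h) := by
          rw [e1, e2]
        have h5 : m.1 h - l.1 h = l.1 h - m.1 h := by
          rw [show m.1 h - l.1 h = (m.1 h + (l * m).1 h) - (l.1 h + (l * m).1 h) by abel, h4]
          abel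
        calc m.1 h + m.1 h = (m.1 h - l.1 h) + l.1 h + m.1 h := by abel
          _ = _ := by rw [h5]; abel
      exact hlm (hw.eq_of_apply_eq (by norm_num) hh (hw.nsmul_right_cancel two_ne_zero h3)).symm
    · rw [show h + l.1 h + m.1 h + (l * m).1 h = (l.1 h + (l * m).1 h) + (h + m.1 h) by abel, e2]
      abel
  · rw [show h + l.1 h + m.1 h + (l * m).1 h = (m.1 h + (l * m).1 h) + (h + l.1 h) by abel, e1]
    abel

/-- The isotropy group of a walk in dimension three is a Klein four-group. -/
theorem exists_klein : ∃ l m : L, l ≠ 1 ∧ m ≠ 1 ∧ l ≠ m ∧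
    ∀ n : L, n = 1 ∨ n = l ∨ n = m ∨ n = l * m := by
  have := hw.finite
  let := Fintype.ofFinite L
  obtain ⟨h, hh⟩ := hw.edges_nonempty le_rfl
  have hh' : h ∈ edgeSet Sp := mem_edgeSet.2 (Or.inl hh)
  have hcard : 2 < Fintype.card L := by
    rw [← Nat.card_eq_fintype_card, hw.natCard_eq (by norm_num) hh]
    exact hw.dim_le_card fun x hx => Submodule.subset_span hx
  obtain ⟨a, b, c, hab, hac, hbc⟩ := Fintype.two_lt_card_iff.1 hcard
  have hl : a⁻¹ * b ≠ 1 := fun h => hab (inv_mul_eq_one.1 h)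
  have hm : a⁻¹ * c ≠ 1 := fun h => hac (inv_mul_eq_one.1 h)
  have hlm : a⁻¹ * b ≠ a⁻¹ * c := fun h => hbc (mul_left_cancel h)
  generalize a⁻¹ * b = l at hl hlm
  generalize a⁻¹ * c = m at hm hlm
  refine ⟨l, m, hl, hm, hlm, fun n => ?_⟩
  by_contra! hn
  obtain ⟨hn1, hnl, hnm, hnlm⟩ := hn
  have h1 := hw.sum_eq_zero hl hm hlm hh'
  have h2 := hw.sum_eq_zero hl hn1 hnl.symm hh'
  have hmn : m * n ≠ 1 := fun h0 => hnm (by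
    rw [← one_mul n, ← hw.mul_self_space m, mul_assoc, h0, mul_one])
  have hlmn : l ≠ m * n := fun h0 => hnlm (by
    rw [h0, hw.mul_comm_space m n, mul_assoc, hw.mul_self_space m, mul_one])
  have h3 := hw.sum_eq_zero hl hmn hlmn hh'
  have c1 : (l * m).1 h = m.1 (l.1 h) := by rw [hw.mul_comm_space l m]; rfl
  have c2 : (l * n).1 h = n.1 (l.1 h) := by rw [hw.mul_comm_space l n]; rfl
  have c3 : (l * (m * n)).1 h = m.1 (n.1 (l.1 h)) := by
    rw [hw.mul_comm_space l (m * n)]; rfl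
  have c4 : (m * n).1 h = m.1 (n.1 h) := rfl
  rw [c1] at h1
  rw [c2] at h2
  rw [c3, c4] at h3
  -- For a further element `n`, the sum relations of the Klein groups generated by `l` with `m`,
  -- with `n` and with `m * n` say that each of the three sends `W` to `-W`. The first two make `m *
  -- n` fix `W`, so `W` would vanish.
  set W := h + l.1 h with hW
  have k1 : m.1 W = -W := by
    rw [hW, hw.map_add, ← hW]
    exact (neg_eq_of_add_eq_zero_right (by rw [← add_assoc]; exact h1)).symm
  have k2 : n.1 W = -W := by
    rw [hW, hw.map_add, ← hW]
    exact (neg_eq_of_add_eq_zero_right (by rw [← add_assoc]; exact h2)).symm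
  have k3 : m.1 (n.1 W) = -W := by
    rw [hW, hw.map_add, hw.map_add, ← hW]
    exact (neg_eq_of_add_eq_zero_right (by rw [← add_assoc]; exact h3)).symm
  rw [k2, hw.map_neg, k1, neg_neg] at k3
  apply hw.add_map_ne_zero hl hh'
  rw [← hW]
  have : (2 : ℕ) • W = 0 := by rw [two_nsmul]; nth_rw 1 [k3]; exact neg_add_cancel _
  exact (nsmul_eq_zero_iff_right two_ne_zero).1 this

/-- Because the Klein orbit sums to zero, `-n h` has the height of `h` over the axis of `k`. The
antipode of `h` on that circle is `k h`, which differs from `-n h`. -/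
theorem polarDet_neg_map_eq_zero {k n : L} (hk : k ≠ 1) (hn : n ≠ 1) (hkn : k ≠ n)
    {h : Fin 3 → ℤ} (hh : h ∈ edgeSet Sp) : polarDet (A h) (A (-n.1 h)) = 0 := by
  have hkk := hw.mul_self_space k
  refine hw.polarDet_eq_zero_of_orbitSum_eq hk hh (neg_mem_edgeSet (hw.map_mem_edgeSet n hh))
    (hw.orbitSum_ne_zero_of_ne_one hk hh) ?_ ?_
  · rw [_root_.map_neg, hw.orbitSum_of_mul_self hk hkk, hw.orbitSum_of_mul_self hk hkk,
      neg_eq_iff_add_eq_zero, ← hw.sum_eq_zero hk hn hkn hh]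
    change n.1 h + (k * n).1 h + _ = _
    abel
  · rw [show orderOf k = 2 from orderOf_eq_prime (by rw [sq, hkk]) hk]
    intro h0
    have h1 := hw.nsmul_right_cancel two_ne_zero h0
    rw [hw.orbitSum_of_mul_self hk hkk] at h1
    apply hw.map_add_map_ne_zero hkn hh
    rw [← add_left_cancel h1, neg_add_cancel]

/-- The element `h + l h` decomposes in exactly two ways up to order, the other being `-m h - (l *
m) h`. The second contributes the complex conjugate of the first, so the vanishing coefficient is a
multiple of the real part. -/
theorem polarDet_map_re_eq_zero {l m : L} (hl : l ≠ 1) (hm : m ≠ 1) (hlm : l ≠ m)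
    (hall : ∀ n : L, n = 1 ∨ n = l ∨ n = m ∨ n = l * m) {h : Fin 3 → ℤ} (hh : h ∈ Sp) :
    (polarDet (A h) (A (l.1 h))).re = 0 := by
  have hh' : h ∈ edgeSet Sp := mem_edgeSet.2 (Or.inl hh)
  have hll := hw.mul_self_space l
  have hlm1 : l * m ≠ 1 := fun h1 => hlm (by
    rw [← mul_one l, ← hw.mul_self_space m, ← mul_assoc, h1, one_mul])
  have hlml : l * m ≠ l := fun h1 => hm (mul_left_cancel (h1.trans (mul_one l).symm))
  have hlmm : l * m ≠ m := fun h1 => hl (mul_right_cancel (h1.trans (one_mul m).symm))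
  have hs0 := hw.sum_eq_zero hl hm hlm hh'
  have hu := hw.orbitSum_ne_zero_of_ne_one hl hh'
  have qm : hw.orbitSum l (m.1 h) = -hw.orbitSum l h := by
    rw [hw.orbitSum_of_mul_self hl hll, hw.orbitSum_of_mul_self hl hll, eq_neg_iff_add_eq_zero,
      ← hs0]
    change m.1 h + (l * m).1 h + _ = _
    abel
  have qlm : hw.orbitSum l ((l * m).1 h) = -hw.orbitSum l h := by
    rw [← qm, ← hw.orbitSum_map l (m.1 h)]; rfl
  have ql : hw.orbitSum l (l.1 h) = hw.orbitSum l h := hw.orbitSum_map l h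
  have hheight := fun y hy => hw.height_eq_or_eq_neg le_rfl (by decide) hl hh' hu (y := y) hy
  have hV : ∀ x ∈ edgeSet Sp, ∃ n : L, x = n.1 h ∨ x = -n.1 h := by
    intro x hx
    rcases mem_edgeSet.1 hx with hx | hx
    · obtain ⟨n, hn⟩ := hw.trans h hh x hx
      exact ⟨n, Or.inl hn.symm⟩
    · obtain ⟨n, hn⟩ := hw.trans h hh _ hx
      exact ⟨n, Or.inr (by rw [hn, neg_neg])⟩
  have hu3 : ∀ n : ℕ, n ≠ 0 → n • hw.orbitSum l h ≠ 0 := fun n hn h0 =>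
    hu ((nsmul_eq_zero_iff_right hn).1 h0)
  have hsum := hw.sum_polarDet (h + l.1 h)
  rw [if_neg (hw.add_map_ne_zero hl hh')] at hsum
  have hmem : ∀ n : L, n.1 h ∈ stepSet Sp := fun n =>
    mem_stepSet.2 (Or.inr (hw.map_mem_edgeSet n hh'))
  have hsub : ({h, l.1 h, -m.1 h, -(l * m).1 h} : Finset (Fin 3 → ℤ)) ⊆ stepSet Sp := by
    intro x hx
    simp only [Finset.mem_insert, Finset.mem_singleton] at hx
    rcases hx with rfl | rfl | rfl | rfl
    · exact mem_stepSet.2 (Or.inr hh')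
    · exact hmem l
    · exact neg_mem_stepSet (hmem m)
    · exact neg_mem_stepSet (hmem (l * m))
  have hneg : ∀ y, hw.orbitSum l y = -hw.orbitSum l h → ∀ z ∈ stepSet Sp,
      hw.orbitSum l y + hw.orbitSum l z ≠ hw.orbitSum l h + hw.orbitSum l h := by
    intro y hy z hz h0
    rw [hy] at h0
    rcases mem_stepSet.1 hz with rfl | hz
    · rw [_root_.map_zero] at h0
      apply hu3 3 (by norm_num)
      rw [show (3 : ℕ) • hw.orbitSum l h = hw.orbitSum l h + hw.orbitSum l h -
        (-hw.orbitSum l h + 0) by abel, h0, sub_self]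
    · rcases hheight z hz with h1 | h1 <;> rw [h1] at h0
      · rw [neg_add_cancel] at h0
        apply hu3 2 (by norm_num)
        rw [two_nsmul, h0]
      · apply hu3 4 (by norm_num)
        rw [show (4 : ℕ) • hw.orbitSum l h = hw.orbitSum l h + hw.orbitSum l h -
          (-hw.orbitSum l h + -hw.orbitSum l h) by abel, h0, sub_self]
  have hzero : ∀ x ∈ stepSet Sp, x ∉ ({h, l.1 h, -m.1 h, -(l * m).1 h} : Finset (Fin 3 → ℤ)) →
      polarDet (A x) (A (h + l.1 h - x)) = 0 := by
    intro x hx hxT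
    by_cases hx' : h + l.1 h - x ∈ stepSet Sp
    swap
    · rw [hw.eq_zero _ hx', polarDet_zero_right]
    exfalso
    simp only [Finset.mem_insert, Finset.mem_singleton, not_or] at hxT
    have hq : hw.orbitSum l x + hw.orbitSum l (h + l.1 h - x) =
        hw.orbitSum l h + hw.orbitSum l h := by
      rw [← _root_.map_add, add_sub_cancel, _root_.map_add, ql]
    rcases mem_stepSet.1 hx with rfl | hxV
    · rw [_root_.map_zero, zero_add] at hq
      rcases mem_stepSet.1 hx' with h1 | h1
      · rw [h1, _root_.map_zero] at hq
        apply hu3 2 (by norm_num)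
        rw [two_nsmul, ← hq]
      · rcases hheight _ h1 with h2 | h2 <;> rw [h2] at hq
        · exact hu (by simpa using hq)
        · apply hu3 3 (by norm_num)
          rw [show (3 : ℕ) • hw.orbitSum l h = hw.orbitSum l h + hw.orbitSum l h -
            (-hw.orbitSum l h) by abel, ← hq, sub_self]
    · obtain ⟨n, hn⟩ := hV x hxV
      rcases hall n with rfl | rfl | rfl | rfl <;> rcases hn with rfl | rfl
      · exact hxT.1 rfl
      · exact hneg (-h) (by rw [_root_.map_neg]) _ hx' hq
      · exact hxT.2.1 rfl
      · exact hneg _ (by rw [_root_.map_neg, ql]) _ hx' hq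
      · exact hneg _ qm _ hx' hq
      · exact hxT.2.2.1 rfl
      · exact hneg _ qlm _ hx' hq
      · exact hxT.2.2.2 rfl
  have hd : ∀ n k : L, n ≠ k → n.1 h ≠ k.1 h := fun n k hnk h0 =>
    hnk (hw.eq_of_apply_eq (by norm_num) hh' h0)
  have hd' : ∀ n k : L, n ≠ k → n.1 h ≠ -k.1 h := fun n k hnk h0 =>
    hw.map_add_map_ne_zero hnk hh' (by rw [h0, neg_add_cancel])
  rw [← Finset.sum_subset hsub hzero, Finset.sum_insert, Finset.sum_insert, Finset.sum_pair] at hsum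
  rotate_left
  · exact fun h0 => hd _ _ hlmm.symm (neg_injective h0)
  · simp only [Finset.mem_insert, Finset.mem_singleton, not_or]
    exact ⟨hd' _ _ hlm, hd' _ _ hlml.symm⟩
  · simp only [Finset.mem_insert, Finset.mem_singleton, not_or]
    exact ⟨hd 1 l hl.symm, hd' 1 m hm.symm, hd' 1 _ hlm1.symm⟩
  have e1 : h + l.1 h - h = l.1 h := by abel
  have e2 : h + l.1 h - l.1 h = h := by abel
  have e3 : h + l.1 h - -m.1 h = -(l * m).1 h := by
    rw [sub_neg_eq_add]; exact eq_neg_of_add_eq_zero_left hs0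
  have e4 : h + l.1 h - -(l * m).1 h = -m.1 h := by
    rw [sub_neg_eq_add]
    apply eq_neg_of_add_eq_zero_left
    rw [← hs0]; abel
  have e5 : (l * m).1 h = m.1 (l.1 h) := by rw [hw.mul_comm_space l m]; rfl
  rw [e1, e2, e3, e4, polarDet_comm (A (l.1 h)), polarDet_comm (A (-(l * m).1 h)),
    hw.polarDet_neg, e5, hw.polarDet_map] at hsum
  have := congrArg Complex.re hsum
  simp at this
  linarith

end Space

end IsNormalWalk

/-! ### Realisation of generating sets -/

/-- A generating set contained in the span of `d` vectors is realised by prescribing independent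
images of these vectors. -/
theorem exists_realization {d : ℕ} {Sp : Finset (Fin d → ℤ)} (hg : IsGeneratingSet Sp)
    (v : Fin d → (Fin d → ℤ)) (hv : ∀ x ∈ Sp, x ∈ Submodule.span ℤ (Set.range v))
    (w : Fin d → EuclideanSpace ℝ (Fin d)) (hw : LinearIndependent ℤ w) :
    ∃ φ : (Fin d → ℤ) →+ EuclideanSpace ℝ (Fin d), Function.Injective φ ∧ ∀ i, φ (v i) = w i := by
  set ψ : (Fin d → ℤ) →ₗ[ℤ] (Fin d → ℤ) := Fintype.linearCombination ℤ v with hψ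
  have hsurj : Function.Surjective ψ := by
    rw [← LinearMap.range_eq_top, hψ, Fintype.range_linearCombination, eq_top_iff]
    intro x _
    have hx : x ∈ AddSubgroup.closure (Sp : Set (Fin d → ℤ)) := by
      rw [hg.closure_eq_top]; trivial
    exact (AddSubgroup.closure_le (Submodule.span ℤ (Set.range v)).toAddSubgroup).2 hv hx
  -- A surjective endomorphism of a finitely generated module is injective, so `d` generating
  -- vectors form a basis.
  have hinj := OrzechProperty.injective_of_surjective_endomorphism ψ hsurj
  let e := LinearEquiv.ofBijective ψ ⟨hinj, hsurj⟩
  refine ⟨((Fintype.linearCombination ℤ w).comp e.symm.toLinearMap).toAddMonoidHom,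
    (linearIndependent_iff_injective_fintypeLinearCombination.1 hw).comp e.symm.injective, fun i => ?_⟩
  have h1 : e.symm (v i) = Pi.single i 1 := by
    rw [LinearEquiv.symm_apply_eq]
    change v i = ψ (Pi.single i 1)
    rw [hψ, Fintype.linearCombination_apply_single, one_smul]
  change Fintype.linearCombination ℤ w (e.symm (v i)) = w i
  rw [h1, Fintype.linearCombination_apply_single, one_smul]

theorem linearIndependent_bcc : LinearIndependent ℤ
    ![!₂[(1 : ℝ), 1, 1], !₂[(1 : ℝ), -1, -1], !₂[(-1 : ℝ), 1, -1]] := by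
  rw [Fintype.linearIndependent_iff]
  intro g hg
  have h0 := congrArg (fun x : EuclideanSpace ℝ (Fin 3) => x 0) hg
  have h1 := congrArg (fun x : EuclideanSpace ℝ (Fin 3) => x 1) hg
  have h2 := congrArg (fun x : EuclideanSpace ℝ (Fin 3) => x 2) hg
  simp [Fin.sum_univ_three] at h0 h1 h2
  norm_cast at h0 h1 h2
  intro i
  fin_cases i <;> simp <;> omega

/-! ### Pauli bases and the body-centred cubic lattice -/

namespace IsNormalWalk

set_option linter.unusedSectionVars false

section Pauli

variable {G : Type*} [AddCommGroup G] [DecidableEq G] {Sp : Finset G}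
  {A : G → Matrix (Fin 2) (Fin 2) ℂ} {L : Subgroup (Equiv.Perm G)}
  {U : L → Matrix.unitaryGroup (Fin 2) ℂ} (hw : IsNormalWalk Sp A L U)

include hw

/-- The walk in a basis in which a Klein four-group is represented by the Pauli matrices. -/
theorem exists_pauli {l m : L} (hl : l ≠ 1) (hm : m ≠ 1) (hlm : l ≠ m) (hll : l * l = 1)
    (hmm : m * m = 1) (hcomm : m * l = l * m) :
    ∃ B : Matrix.unitaryGroup (Fin 2) ℂ,
      (∃ c : ℂ, ‖c‖ = 1 ∧ ((B * U l * B⁻¹ : Matrix.unitaryGroup (Fin 2) ℂ) :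
        Matrix (Fin 2) (Fin 2) ℂ) = c • (Complex.I • pauliZ)) ∧
      (∃ c : ℂ, ‖c‖ = 1 ∧ ((B * U m * B⁻¹ : Matrix.unitaryGroup (Fin 2) ℂ) :
        Matrix (Fin 2) (Fin 2) ℂ) = c • (Complex.I • pauliX)) ∧
      (∃ c : ℂ, ‖c‖ = 1 ∧ ((B * U (l * m) * B⁻¹ : Matrix.unitaryGroup (Fin 2) ℂ) :
        Matrix (Fin 2) (Fin 2) ℂ) = c • (Complex.I • pauliY)) := by
  have hlm1 : l * m ≠ 1 := fun h1 => hlm (by rw [← mul_one l, ← hmm, ← mul_assoc, h1, one_mul])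
  obtain ⟨c1, hc1, e1⟩ := hw.mul_eq_smul l m
  obtain ⟨c2, hc2, e2⟩ := hw.mul_eq_smul m l
  have hne : ∀ c : ℂ, ‖c‖ = 1 → c ≠ 0 := by rintro c hc rfl; simp at hc
  obtain ⟨a, ha⟩ := hw.mul_self_eq_smul hll
  obtain ⟨u, hu⟩ := IsAlgClosed.exists_pow_nat_eq a (n := 2) (by norm_num)
  set V : Matrix (Fin 2) (Fin 2) ℂ := (U l : Matrix (Fin 2) (Fin 2) ℂ) with hV
  -- One of the two factors is singular. It is nonzero and satisfies an eigenvalue relation with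
  -- `V`, so it can play the role of `P` in `exists_pauli_basis`.
  have hprod : (V - u • 1) * (V + u • 1) = 0 := by
    rw [sub_mul, mul_add, mul_add, ha, ← hu]
    simp [sq, smul_smul]
    abel
  have hk : ∃ P : Matrix (Fin 2) (Fin 2) ℂ, P ≠ 0 ∧ P.det = 0 ∧ ∃ b : ℂ, P * V = b • P := by
    have hdet := congrArg Matrix.det hprod
    rw [Matrix.det_mul, Matrix.det_zero, mul_eq_zero] at hdet
    rcases hdet with h | h
    · refine ⟨_, sub_ne_zero.2 (hw.ne_smul_one hl u), h, -u, ?_⟩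
      rw [mul_add, Matrix.mul_smul, mul_one] at hprod
      rw [neg_smul]; exact eq_neg_of_add_eq_zero_left hprod
    · refine ⟨_, fun h0 => hw.ne_smul_one hl (-u) ?_, h, u, ?_⟩
      · rw [neg_smul]; exact eq_neg_of_add_eq_zero_left h0
      · have h1 : (V + u • 1) * (V - u • 1) = 0 := by
          rw [add_mul, mul_sub, mul_sub, ha, ← hu]
          simp [sq, smul_smul]
        rw [mul_sub, Matrix.mul_smul, mul_one] at h1
        exact sub_eq_zero.1 h1
  obtain ⟨P, hP, hPd, hPk⟩ := hk
  obtain ⟨B, hB, -, hZ, hX, y, hy, hY⟩ := exists_pauli_basis hP hPd (U l).2 (U m).2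
    (hw.ne_smul_one hl) (hw.ne_smul_one hm) (by
      intro c hc
      apply hw.ne_smul_one hlm1 (c1⁻¹ * c)
      rw [← smul_smul, ← hc, e1, smul_smul, inv_mul_cancel₀ (hne c1 hc1), one_smul])
    (hw.mul_self_eq_smul hll) (hw.mul_self_eq_smul hmm)
    ⟨c1 * c2⁻¹, by
      rw [e1, e2, hcomm, smul_smul, mul_assoc, inv_mul_cancel₀ (hne c2 hc2), mul_one]⟩ hPk
  refine ⟨⟨B, hB⟩, hZ, hX, c1⁻¹ * y, ?_, ?_⟩
  · rw [norm_mul, norm_inv, hc1, hy, inv_one, one_mul]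
  · rw [e1] at hY
    rw [← smul_smul, ← hY, Matrix.mul_smul, Matrix.smul_mul, smul_smul,
      inv_mul_cancel₀ (hne c1 hc1), one_smul]
    rfl

theorem apply_of_pauliZ {l : L} {c : ℂ} (hc : ‖c‖ = 1)
    (h : (U l : Matrix (Fin 2) (Fin 2) ℂ) = c • (Complex.I • pauliZ)) (x : G) :
    A (l.1 x) = !![A x 0 0, -A x 0 1; -A x 1 0, A x 1 1] := by
  have hcc : c * starRingEnd ℂ c = 1 := by
    rw [Complex.mul_conj, Complex.normSq_eq_norm_sq, hc]; simp
  rw [hw.covariant, h]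
  have hI := Complex.I_mul_I
  ext i j
  fin_cases i <;> fin_cases j <;>
    simp [pauliZ, Matrix.mul_apply, Fin.sum_univ_two, Matrix.vecMul, dotProduct]
  · linear_combination (-Complex.I * Complex.I * A x 0 0) * hcc - A x 0 0 * hI
  · linear_combination (Complex.I * Complex.I * A x 0 1) * hcc + A x 0 1 * hI
  · linear_combination (Complex.I * Complex.I * A x 1 0) * hcc + A x 1 0 * hI
  · linear_combination (-Complex.I * Complex.I * A x 1 1) * hcc - A x 1 1 * hI

theorem apply_of_pauliX {l : L} {c : ℂ} (hc : ‖c‖ = 1)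
    (h : (U l : Matrix (Fin 2) (Fin 2) ℂ) = c • (Complex.I • pauliX)) (x : G) :
    A (l.1 x) = !![A x 1 1, A x 1 0; A x 0 1, A x 0 0] := by
  have hcc : c * starRingEnd ℂ c = 1 := by
    rw [Complex.mul_conj, Complex.normSq_eq_norm_sq, hc]; simp
  rw [hw.covariant, h]
  have hI := Complex.I_mul_I
  ext i j
  fin_cases i <;> fin_cases j <;>
    simp [pauliX, Matrix.mul_apply, Fin.sum_univ_two, Matrix.vecMul, dotProduct]
  · linear_combination (-Complex.I * Complex.I * A x 1 1) * hcc - A x 1 1 * hI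
  · linear_combination (-Complex.I * Complex.I * A x 1 0) * hcc - A x 1 0 * hI
  · linear_combination (-Complex.I * Complex.I * A x 0 1) * hcc - A x 0 1 * hI
  · linear_combination (-Complex.I * Complex.I * A x 0 0) * hcc - A x 0 0 * hI

/-- A transition matrix invariant under the Pauli matrices is real scalar. -/
theorem apply_zero_eq_zero_of_klein {l m : L} (hl : l ≠ 1) (hm : m ≠ 1) (hlm : l ≠ m)
    (hll : l * l = 1) (hmm : m * m = 1) (hcomm : m * l = l * m) (htr : (A 0).trace.re = 0) :
    A 0 = 0 := by
  obtain ⟨B, ⟨c, hc, hZ⟩, ⟨c', hc', hX⟩, -⟩ := hw.exists_pauli hl hm hlm hll hmm hcomm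
  have hw' := hw.conj B
  set M := (B : Matrix (Fin 2) (Fin 2) ℂ) * A 0 * (B : Matrix (Fin 2) (Fin 2) ℂ)ᴴ with hM
  have h1 := hw'.apply_of_pauliZ hc hZ 0
  have h2 := hw'.apply_of_pauliX hc' hX 0
  rw [hw.map_zero] at h1 h2
  rw [← hM] at h1 h2
  have e1 := congrFun (congrFun h1 0) 1
  have e2 := congrFun (congrFun h1 1) 0
  have e3 := congrFun (congrFun h2 0) 0
  simp at e1 e2 e3
  have f1 : M 0 1 = 0 := by linear_combination e1 / 2
  have f2 : M 1 0 = 0 := by linear_combination e2 / 2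
  have h3 := hw'.adjugate_eq 0
  rw [neg_zero] at h3
  rw [← hM, Matrix.adjugate_fin_two] at h3
  have h4 := congrFun (congrFun h3 0) 0
  simp at h4
  have htr' : M.trace = (A 0).trace := by
    have hB : (B : Matrix (Fin 2) (Fin 2) ℂ)ᴴ * B = 1 := Matrix.mem_unitaryGroup_iff'.1 B.2
    rw [hM, Matrix.trace_mul_comm, ← mul_assoc, hB, one_mul]
  rw [← htr', Matrix.trace_fin_two, ← e3] at htr
  rw [← e3] at h4
  have h5 : M 0 0 = 0 := by
    apply Complex.ext
    · simp at htr ⊢; linarith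
    · have := congrArg Complex.im h4
      simp at this ⊢; linarith
  have hM0 : M = 0 := by
    ext i j
    fin_cases i <;> fin_cases j <;> simp [f1, f2, h5, ← e3]
  exact conj_unitary_injective B.2 (by rw [← hM, hM0]; simp)

end Pauli

section Space

variable {Sp : Finset (Fin 3 → ℤ)}
  {A : (Fin 3 → ℤ) → Matrix (Fin 2) (Fin 2) ℂ} {L : Subgroup (Equiv.Perm (Fin 3 → ℤ))}
  {U : L → Matrix.unitaryGroup (Fin 2) ℂ} (hw : IsNormalWalk Sp A L U)

include hw

theorem apply_zero_eq_zero_space : A 0 = 0 := by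
  obtain ⟨l, m, hl, hm, hlm, -⟩ := hw.exists_klein
  exact hw.apply_zero_eq_zero_of_klein hl hm hlm (hw.mul_self_space l) (hw.mul_self_space m)
    (hw.mul_comm_space m l) (hw.trace_zero_re_eq_zero le_rfl (by decide))

theorem realizedBy_bccSteps : RealizedBy Sp bccSteps := by
  obtain ⟨l, m, hl, hm, hlm, hall⟩ := hw.exists_klein
  obtain ⟨h, hh⟩ := hw.edges_nonempty le_rfl
  have hs := hw.sum_eq_zero hl hm hlm (mem_edgeSet.2 (Or.inl hh))
  have hlmh : (l * m).1 h = -(h + l.1 h + m.1 h) := eq_neg_of_add_eq_zero_right hs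
  have hSp : ∀ x, x ∈ Sp ↔ x = h ∨ x = l.1 h ∨ x = m.1 h ∨ x = (l * m).1 h := by
    intro x
    constructor
    · intro hx
      obtain ⟨n, rfl⟩ := hw.trans h hh x hx
      rcases hall n with rfl | rfl | rfl | rfl
      · exact Or.inl rfl
      · exact Or.inr (Or.inl rfl)
      · exact Or.inr (Or.inr (Or.inl rfl))
      · exact Or.inr (Or.inr (Or.inr rfl))
    · rintro (rfl | rfl | rfl | rfl)
      · exact hh
      all_goals exact hw.map_mem _ _ hh
  have h0 : h ∈ Submodule.span ℤ (Set.range ![h, l.1 h, m.1 h]) :=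
    Submodule.subset_span ⟨0, rfl⟩
  have h1 : l.1 h ∈ Submodule.span ℤ (Set.range ![h, l.1 h, m.1 h]) :=
    Submodule.subset_span ⟨1, rfl⟩
  have h2 : m.1 h ∈ Submodule.span ℤ (Set.range ![h, l.1 h, m.1 h]) :=
    Submodule.subset_span ⟨2, rfl⟩
  obtain ⟨φ, hφ, hφv⟩ := exists_realization hw.gen ![h, l.1 h, m.1 h] (by
    intro x hx
    rcases (hSp x).1 hx with rfl | rfl | rfl | rfl
    · exact h0
    · exact h1
    · exact h2
    · rw [hlmh]; exact neg_mem (add_mem (add_mem h0 h1) h2)) _ linearIndependent_bcc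
  refine ⟨φ, hφ, ?_⟩
  have e0 : φ h = !₂[(1 : ℝ), 1, 1] := hφv 0
  have e1 : φ (l.1 h) = !₂[(1 : ℝ), -1, -1] := hφv 1
  have e2 : φ (m.1 h) = !₂[(-1 : ℝ), 1, -1] := hφv 2
  have e3 : φ ((l * m).1 h) = !₂[(-1 : ℝ), -1, 1] := by
    rw [hlmh, _root_.map_neg, _root_.map_add, _root_.map_add, e0, e1, e2]
    ext i
    fin_cases i <;> simp
  have hSp' : (Sp : Set (Fin 3 → ℤ)) = {h, l.1 h, m.1 h, (l * m).1 h} := by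
    ext x
    simpa using hSp x
  rw [hSp', Set.image_insert_eq, Set.image_insert_eq, Set.image_insert_eq, Set.image_singleton,
    e0, e1, e2, e3, bccSteps]

/-- In a Pauli basis, covariance expresses the matrices of the orbit of `h` by the entries of one
matrix `M`, and the orthogonality relations become the hypotheses of `exists_phase_of_rectangle`.
The kernel of `M` is thus an eigenspace of some Pauli matrix; whichever it is, its group element is
the one taken to preserve the kernel in `exists_heisenberg_basis`. -/
theorem hasIsotropyRange_space : HasIsotropyRange Sp A L U heisenbergRange := by
  obtain ⟨l, m, hl, hm, hlm, hall⟩ := hw.exists_klein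
  have hll := hw.mul_self_space l
  have hmm := hw.mul_self_space m
  have hlm1 : l * m ≠ 1 := fun h1 => hlm (by rw [← mul_one l, ← hmm, ← mul_assoc, h1, one_mul])
  have hlml : l * m ≠ l := fun h1 => hm (mul_left_cancel (h1.trans (mul_one l).symm))
  have hlmm : l * m ≠ m := fun h1 => hl (mul_right_cancel (h1.trans (one_mul m).symm))
  intro h hh
  have hh' : h ∈ edgeSet Sp := mem_edgeSet.2 (Or.inl hh)
  obtain ⟨B, ⟨c, hc, hZ⟩, ⟨c', hc', hX⟩, ⟨c'', hc'', hY⟩⟩ :=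
    hw.exists_pauli hl hm hlm hll hmm (hw.mul_comm_space m l)
  have hw' := hw.conj B
  have aZ := hw'.apply_of_pauliZ hc hZ
  have aX := hw'.apply_of_pauliX hc' hX
  have q1 := hw'.polarDet_neg_map_eq_zero hm hl hlm.symm hh'
  have q2 := hw'.polarDet_neg_map_eq_zero hl hm hlm hh'
  have q3 := hw'.polarDet_neg_map_eq_zero hl hlm1 hlml.symm hh'
  have p1 := hw'.polarDet_map_re_eq_zero hl hm hlm hall hh
  have p2 := hw'.polarDet_map_re_eq_zero hm hl hlm.symm (fun n => by
    rcases hall n with h | h | h | h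
    · exact Or.inl h
    · exact Or.inr (Or.inr (Or.inl h))
    · exact Or.inr (Or.inl h)
    · exact Or.inr (Or.inr (Or.inr (h.trans (hw.mul_comm_space l m))))) hh
  have hlmm' : l * m * m = l := by rw [mul_assoc, hmm, mul_one]
  have p3 := hw'.polarDet_map_re_eq_zero hlm1 hm hlmm (fun n => by
    rw [hlmm']
    rcases hall n with h | h | h | h
    · exact Or.inl h
    · exact Or.inr (Or.inr (Or.inr h))
    · exact Or.inr (Or.inr (Or.inl h))
    · exact Or.inr (Or.inl h)) hh
  have hlmh : (l * m).1 h = l.1 (m.1 h) := rfl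
  have hdet := hw'.det_eq_zero hh'
  rw [hw'.apply_neg_eq] at q1 q2 q3
  rw [hlmh, aZ, aX] at q3 p3
  rw [aZ] at q1 p1
  rw [aX] at q2 p2
  rw [Matrix.adjugate_fin_two] at q1 q2 q3
  set M := (B : Matrix (Fin 2) (Fin 2) ℂ) * A h * (B : Matrix (Fin 2) (Fin 2) ℂ)ᴴ with hM
  rw [Matrix.det_fin_two, sub_eq_zero] at hdet
  have hk : ∀ (n : L) (a : ℂ), M * ((B * U n * B⁻¹ : Matrix.unitaryGroup (Fin 2) ℂ) :
        Matrix (Fin 2) (Fin 2) ℂ) = a • M →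
      ∃ a : ℂ, A h * (U n : Matrix (Fin 2) (Fin 2) ℂ) = a • A h := by
    intro n a hn
    refine ⟨a, conj_unitary_injective B.2 ?_⟩
    rw [← conj_mul_conj B.2, Matrix.mul_smul, Matrix.smul_mul]
    exact hn
  have hd := hw.det_eq_zero hh'
  have fZ : ∀ a : ℂ, M * pauliZ = a • M → ∃ B ∈ Matrix.unitaryGroup (Fin 2) ℂ,
      (∀ i, (B * A h * Bᴴ) i 1 = 0) ∧ (∀ i, (B * A (-h) * Bᴴ) i 0 = 0) ∧
      (∀ n : L, ∃ p ∈ heisenbergRange, ∃ c : ℂ, ‖c‖ = 1 ∧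
        B * (U n : Matrix (Fin 2) (Fin 2) ℂ) * Bᴴ = c • p) ∧
      (∀ p ∈ heisenbergRange, ∃ n : L, ∃ c : ℂ, ‖c‖ = 1 ∧
        B * (U n : Matrix (Fin 2) (Fin 2) ℂ) * Bᴴ = c • p) := fun a ha =>
    hw.exists_heisenberg_basis hh hd hl hm hlm hll hmm (hw.mul_comm_space m l) hall
      (hk l (c * Complex.I * a) (by
        rw [hZ, Matrix.mul_smul, Matrix.mul_smul, ha, smul_smul, smul_smul]))
  have fX : ∀ a : ℂ, M * pauliX = a • M → ∃ B ∈ Matrix.unitaryGroup (Fin 2) ℂ,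
      (∀ i, (B * A h * Bᴴ) i 1 = 0) ∧ (∀ i, (B * A (-h) * Bᴴ) i 0 = 0) ∧
      (∀ n : L, ∃ p ∈ heisenbergRange, ∃ c : ℂ, ‖c‖ = 1 ∧
        B * (U n : Matrix (Fin 2) (Fin 2) ℂ) * Bᴴ = c • p) ∧
      (∀ p ∈ heisenbergRange, ∃ n : L, ∃ c : ℂ, ‖c‖ = 1 ∧
        B * (U n : Matrix (Fin 2) (Fin 2) ℂ) * Bᴴ = c • p) := fun a ha =>
    hw.exists_heisenberg_basis hh hd hm hl hlm.symm hmm hll (hw.mul_comm_space l m)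
      (fun n => by
        rcases hall n with h | h | h | h
        · exact Or.inl h
        · exact Or.inr (Or.inr (Or.inl h))
        · exact Or.inr (Or.inl h)
        · exact Or.inr (Or.inr (Or.inr (h.trans (hw.mul_comm_space l m)))))
      (hk m (c' * Complex.I * a) (by
        rw [hX, Matrix.mul_smul, Matrix.mul_smul, ha, smul_smul, smul_smul]))
  have fY : ∀ a : ℂ, M * pauliY = a • M → ∃ B ∈ Matrix.unitaryGroup (Fin 2) ℂ,
      (∀ i, (B * A h * Bᴴ) i 1 = 0) ∧ (∀ i, (B * A (-h) * Bᴴ) i 0 = 0) ∧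
      (∀ n : L, ∃ p ∈ heisenbergRange, ∃ c : ℂ, ‖c‖ = 1 ∧
        B * (U n : Matrix (Fin 2) (Fin 2) ℂ) * Bᴴ = c • p) ∧
      (∀ p ∈ heisenbergRange, ∃ n : L, ∃ c : ℂ, ‖c‖ = 1 ∧
        B * (U n : Matrix (Fin 2) (Fin 2) ℂ) * Bᴴ = c • p) := fun a ha =>
    hw.exists_heisenberg_basis hh hd hlm1 hm hlmm (hw.mul_self_space _) hmm (hw.mul_comm_space _ _)
      (fun n => by
        rw [hlmm']
        rcases hall n with h | h | h | h
        · exact Or.inl h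
        · exact Or.inr (Or.inr (Or.inr h))
        · exact Or.inr (Or.inr (Or.inl h))
        · exact Or.inr (Or.inl h))
      (hk (l * m) (c'' * Complex.I * a) (by
        rw [hY, Matrix.mul_smul, Matrix.mul_smul, ha, smul_smul, smul_smul]))
  have hI := Complex.I_mul_I
  rcases exists_phase_of_rectangle (p := M 0 0) (q := M 0 1) (r := M 1 0) (t := M 1 1) hdet
    (by simp [polarDet] at q1; simp only [← starRingEnd_apply]; linear_combination q1)
    (by simp [polarDet] at q2; simp only [← starRingEnd_apply]; linear_combination q2)
    (by simp [polarDet] at q3; simp only [← starRingEnd_apply]; linear_combination q3)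
    (by
      have : polarDet M !![M 0 0, -M 0 1; -M 1 0, M 1 1] = 4 * (M 0 0 * M 1 1) := by
        simp [polarDet]; linear_combination -2 * hdet
      rw [this] at p1
      simp at p1 ⊢; linarith)
    (by
      have : polarDet M !![M 1 1, M 1 0; M 0 1, M 0 0] =
          M 0 0 * M 0 0 + M 1 1 * M 1 1 - M 0 1 * M 0 1 - M 1 0 * M 1 0 := by
        simp [polarDet]
      rw [this] at p2
      exact p2)
    (by
      have : polarDet M !![M 1 1, -M 1 0; -M 0 1, M 0 0] =
          M 0 0 * M 0 0 + M 1 1 * M 1 1 + M 0 1 * M 0 1 + M 1 0 * M 1 0 := by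
        simp [polarDet]
      simp only [Matrix.of_apply, Matrix.cons_val', Matrix.cons_val_zero, Matrix.cons_val_one,
        Matrix.cons_val_fin_one] at p3
      rw [this] at p3
      exact p3) with ⟨h1, h2⟩ | ⟨h1, h2⟩ | ⟨e, he, h1, h2⟩
  · refine fZ (-1) ?_
    ext i j
    fin_cases i <;> fin_cases j <;> simp [Matrix.mul_apply, Fin.sum_univ_two, pauliZ, h1, h2]
  · refine fZ 1 ?_
    ext i j
    fin_cases i <;> fin_cases j <;> simp [Matrix.mul_apply, Fin.sum_univ_two, pauliZ, h1, h2]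
  · rcases he with rfl | rfl | rfl | rfl
    · refine fX 1 ?_
      ext i j
      fin_cases i <;> fin_cases j <;> simp [Matrix.mul_apply, Fin.sum_univ_two, pauliX, h1, h2]
    · refine fX (-1) ?_
      ext i j
      fin_cases i <;> fin_cases j <;> simp [Matrix.mul_apply, Fin.sum_univ_two, pauliX, h1, h2]
    · refine fY (-1) ?_
      ext i j
      fin_cases i <;> fin_cases j <;> simp [Matrix.mul_apply, Fin.sum_univ_two, pauliY, h1, h2]
      · linear_combination (M 0 0) * hI
      · ring
      · linear_combination (M 1 0) * hI
      · ring
    · refine fY 1 ?_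
      ext i j
      fin_cases i <;> fin_cases j <;> simp [Matrix.mul_apply, Fin.sum_univ_two, pauliY, h1, h2]
      · linear_combination (-M 0 0) * hI
      · ring
      · linear_combination (-M 1 0) * hI
      · ring

end Space

end IsNormalWalk

/-! ### Kernels and ranges of matrices of rank one -/

/-- The rows of the two matrices are parallel: for matrices of rank one, the kernels coincide. -/
def SameKer (A B : Matrix (Fin 2) (Fin 2) ℂ) : Prop := ∀ i j, A i 0 * B j 1 = A i 1 * B j 0

theorem SameKer.symm {A B : Matrix (Fin 2) (Fin 2) ℂ} (h : SameKer A B) : SameKer B A :=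
  fun i j => by linear_combination -h j i

theorem SameKer.trans {A B C : Matrix (Fin 2) (Fin 2) ℂ} (hB : B ≠ 0) (h : SameKer A B)
    (h' : SameKer B C) : SameKer A C := by
  intro i j
  by_contra hne
  apply hB
  have h0 : ∀ k, B k 0 = 0 := by
    intro k
    by_contra hk
    apply hne
    apply mul_left_cancel₀ hk
    linear_combination A i 0 * h' k j + C j 0 * h i k
  have h1 : ∀ k, B k 1 = 0 := by
    intro k
    by_contra hk
    apply hne
    apply mul_left_cancel₀ hk
    linear_combination A i 1 * h' k j + C j 1 * h i k
  ext k m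
  fin_cases m
  · exact h0 k
  · exact h1 k

theorem SameKer.mul {A B : Matrix (Fin 2) (Fin 2) ℂ} (h : SameKer A B)
    (X X' Y : Matrix (Fin 2) (Fin 2) ℂ) : SameKer (X * A * Y) (X' * B * Y) := by
  intro i j
  simp only [Matrix.mul_apply, Fin.sum_univ_two]
  linear_combination (Y 0 0 * Y 1 1 - Y 0 1 * Y 1 0) *
    (X i 0 * X' j 0 * h 0 0 + X i 0 * X' j 1 * h 0 1 + X i 1 * X' j 0 * h 1 0 +
      X i 1 * X' j 1 * h 1 1)

theorem SameKer.conjTranspose_adjugate {A B : Matrix (Fin 2) (Fin 2) ℂ} (h : SameKer A B) :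
    SameKer A.adjugateᴴ B.adjugateᴴ := by
  intro i j
  have h' : ∀ i j, starRingEnd ℂ (A i 0) * starRingEnd ℂ (B j 1) =
      starRingEnd ℂ (A i 1) * starRingEnd ℂ (B j 0) := fun i j => by
    rw [← map_mul, h i j, map_mul]
  rw [Matrix.adjugate_fin_two, Matrix.adjugate_fin_two]
  fin_cases i <;> fin_cases j <;> simp
  · linear_combination -h' 1 1
  · linear_combination -h' 1 0
  · linear_combination -h' 0 1
  · linear_combination -h' 0 0

/-- Each nonzero row of the adjoint of the adjugate is orthogonal to a row of `A`; parallelism would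
make sums of squared moduli vanish. -/
theorem not_sameKer_conjTranspose_adjugate {A : Matrix (Fin 2) (Fin 2) ℂ} (hA : A ≠ 0) :
    ¬ SameKer A A.adjugateᴴ := by
  intro h
  apply hA
  have h1 := h 0 1
  have h2 := h 1 0
  rw [Matrix.adjugate_fin_two] at h1 h2
  simp at h1 h2
  rw [Complex.mul_conj, Complex.mul_conj] at h1 h2
  norm_cast at h1 h2
  have a := Complex.normSq_nonneg (A 0 0)
  have b := Complex.normSq_nonneg (A 0 1)
  have c := Complex.normSq_nonneg (A 1 0)
  have d := Complex.normSq_nonneg (A 1 1)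
  have a' := Complex.normSq_eq_zero.1 (show Complex.normSq (A 0 0) = 0 by linarith)
  have b' := Complex.normSq_eq_zero.1 (show Complex.normSq (A 0 1) = 0 by linarith)
  have c' := Complex.normSq_eq_zero.1 (show Complex.normSq (A 1 0) = 0 by linarith)
  have d' := Complex.normSq_eq_zero.1 (show Complex.normSq (A 1 1) = 0 by linarith)
  ext i j
  fin_cases i <;> fin_cases j <;> assumption

theorem exists_mul_of_det_eq_zero {A : Matrix (Fin 2) (Fin 2) ℂ} (h : A.det = 0) :
    ∃ a b : Fin 2 → ℂ, ∀ i j, A i j = a i * b j := by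
  rw [Matrix.det_fin_two, sub_eq_zero] at h
  by_cases h0 : A 0 0 = 0
  · by_cases h1 : A 0 1 = 0
    · refine ⟨![0, 1], ![A 1 0, A 1 1], fun i j => ?_⟩
      fin_cases i <;> fin_cases j <;> simp [h0, h1]
    · refine ⟨![A 0 1, A 1 1], ![0, 1], fun i j => ?_⟩
      rw [h0, zero_mul] at h
      have := (mul_eq_zero.1 h.symm).resolve_left h1
      fin_cases i <;> fin_cases j <;> simp [h0, this]
  · refine ⟨![A 0 0, A 1 0], ![1, A 0 1 / A 0 0], fun i j => ?_⟩
    fin_cases i <;> fin_cases j <;> simp <;> field_simp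
    linear_combination h

/-- Two matrices of rank one that are orthogonal for the polarised determinant have the same
kernel or the same range. -/
theorem sameKer_or_of_polarDet_eq_zero {A B : Matrix (Fin 2) (Fin 2) ℂ} (hA : A.det = 0)
    (hB : B.det = 0) (h : polarDet A B = 0) : SameKer A B ∨ SameKer Aᵀ Bᵀ := by
  obtain ⟨a, b, hab⟩ := exists_mul_of_det_eq_zero hA
  obtain ⟨a', b', hab'⟩ := exists_mul_of_det_eq_zero hB
  -- For outer products the polarised determinant factors into a minor of the row vectors and a
  -- minor of the column vectors.
  have h1 : (b 0 * b' 1 - b 1 * b' 0) * (a 0 * a' 1 - a 1 * a' 0) = 0 := by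
    rw [polarDet] at h
    simp only [hab, hab'] at h
    linear_combination h
  rcases mul_eq_zero.1 h1 with h2 | h2
  · left
    intro i j
    rw [hab, hab, hab', hab']
    linear_combination a i * a' j * h2
  · right
    intro i j
    rw [Matrix.transpose_apply, Matrix.transpose_apply, Matrix.transpose_apply,
      Matrix.transpose_apply, hab, hab, hab', hab']
    linear_combination b i * b' j * h2

/-- A nonzero matrix with a vanishing column has a nonzero row supported in the other column, and
the rows of the second matrix are parallel to it. -/
theorem SameKer.column {A C B : Matrix (Fin 2) (Fin 2) ℂ} (h : SameKer A C) (hA : A ≠ 0)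
    (hB : B ∈ Matrix.unitaryGroup (Fin 2) ℂ) {k : Fin 2} (hk : ∀ i, (B * A * Bᴴ) i k = 0) :
    ∀ i, (B * C * Bᴴ) i k = 0 := by
  have h' : SameKer (B * A * Bᴴ) (B * C * Bᴴ) := h.mul B B Bᴴ
  have hA' : B * A * Bᴴ ≠ 0 := fun h0 => hA (conj_unitary_injective hB (by rw [h0]; simp))
  generalize B * A * Bᴴ = M at *
  generalize B * C * Bᴴ = N at *
  intro i
  by_contra hne
  apply hA'
  fin_cases k
  · ext j m
    fin_cases m
    · exact hk j
    · have := h' j i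
      have h0 := hk j
      simp at h0 hne ⊢
      rw [h0, zero_mul] at this
      exact (mul_eq_zero.1 this.symm).resolve_right hne
  · ext j m
    fin_cases m
    · have := h' j i
      have h0 := hk j
      simp at h0 hne ⊢
      rw [h0, zero_mul] at this
      exact (mul_eq_zero.1 this).resolve_right hne
    · exact hk j

theorem unitary_diagonal' {V : Matrix (Fin 2) (Fin 2) ℂ} (hV : V ∈ Matrix.unitaryGroup (Fin 2) ℂ)
    (h : V 1 0 = 0) : V 0 1 = 0 := by
  obtain ⟨a, b, c, e⟩ := unitary_entries hV
  rw [h] at a e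
  simp only [star_zero, mul_zero, add_zero, zero_add] at a e
  rw [mul_comm] at e
  rw [e] at b
  exact star_mul_self_eq_zero_iff.1 (by linear_combination b)

/-! ### Edges that share a kernel or a range -/

namespace IsNormalWalk

set_option linter.unusedSectionVars false

section General

variable {G : Type*} [AddCommGroup G] [DecidableEq G] {Sp : Finset G}
  {A : G → Matrix (Fin 2) (Fin 2) ℂ} {L : Subgroup (Equiv.Perm G)}
  {U : L → Matrix.unitaryGroup (Fin 2) ℂ} (hw : IsNormalWalk Sp A L U)

include hw

theorem conj_apply {B : Matrix (Fin 2) (Fin 2) ℂ} (hB : B ∈ Matrix.unitaryGroup (Fin 2) ℂ)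
    (l : L) (x : G) : B * A (l.1 x) * Bᴴ =
      (B * (U l : Matrix (Fin 2) (Fin 2) ℂ) * Bᴴ) * (B * A x * Bᴴ) *
        (B * (U l : Matrix (Fin 2) (Fin 2) ℂ) * Bᴴ)ᴴ :=
  (hw.conj ⟨B, hB⟩).covariant l x

/-- Covariance carries the kernel of the matrix of `h` to that of `l h`. The adjoint of the
representing unitary therefore sends the `j`th basis vector into the kernel of the first matrix,
which is spanned by the second basis vector. -/
theorem unitary_entry_eq_zero {h : G} (hh : h ∈ edgeSet Sp) {l : L}
    {B : Matrix (Fin 2) (Fin 2) ℂ} (hB : B ∈ Matrix.unitaryGroup (Fin 2) ℂ)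
    (hk : ∀ i, (B * A h * Bᴴ) i 1 = 0) {j : Fin 2}
    (hk' : ∀ i, (B * A (l.1 h) * Bᴴ) i j = 0) :
    (B * (U l : Matrix (Fin 2) (Fin 2) ℂ) * Bᴴ) j 0 = 0 := by
  have hV := conj_mem_unitaryGroup hB (U l).2
  have hne : B * A h * Bᴴ ≠ 0 :=
    fun h0 => hw.ne_zero h hh (conj_unitary_injective hB (by rw [h0]; simp))
  have h1 := hw.conj_apply hB l h
  set V := B * (U l : Matrix (Fin 2) (Fin 2) ℂ) * Bᴴ
  set M := B * A h * Bᴴ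
  have h2 : Vᴴ * (B * A (l.1 h) * Bᴴ) = M * Vᴴ := by
    have hVV : Vᴴ * V = 1 := Matrix.mem_unitaryGroup_iff'.1 hV
    rw [h1, ← mul_assoc, ← mul_assoc, hVV, one_mul]
  have h3 : ∀ i, (M * Vᴴ) i j = 0 := by
    intro i
    rw [← h2, Matrix.mul_apply]
    exact Finset.sum_eq_zero fun k _ => by rw [hk', mul_zero]
  by_contra hV0
  apply hne
  ext i k
  fin_cases k
  · have := h3 i
    rw [Matrix.mul_apply, Fin.sum_univ_two, hk, zero_mul, add_zero, Matrix.conjTranspose_apply,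
      mul_eq_zero] at this
    exact this.resolve_right (by simpa using hV0)
  · exact hk i

/-- An element of the isotropy group moving an edge to one with the same kernel has this kernel
as an eigenspace. -/
theorem exists_mul_eq_smul_of_sameKer {h : G} (hh : h ∈ edgeSet Sp) (hdet : (A h).det = 0) {l : L}
    (hs : SameKer (A h) (A (l.1 h))) :
    ∃ a : ℂ, A h * (U l : Matrix (Fin 2) (Fin 2) ℂ) = a • A h := by
  obtain ⟨B, hB, hk⟩ := exists_unitary_kernel hdet
  have h1 := hw.unitary_entry_eq_zero hh hB hk (hs.column (hw.ne_zero h hh) hB hk)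
  refine ⟨(B * (U l : Matrix (Fin 2) (Fin 2) ℂ) * Bᴴ) 0 0, conj_unitary_injective hB ?_⟩
  rw [← conj_mul_conj hB, Matrix.mul_smul, Matrix.smul_mul]
  have h2 := unitary_diagonal' (conj_mem_unitaryGroup hB (U l).2) h1
  ext i j
  rw [Matrix.mul_apply, Fin.sum_univ_two, hk, zero_mul, add_zero, Matrix.smul_apply, smul_eq_mul]
  fin_cases j
  · exact mul_comm _ _
  · simp only [Fin.mk_one]
    rw [h2, hk, mul_zero, mul_zero]

/-- The relations of having the same kernel or the same range. -/
structure IsShareRel (_ : IsNormalWalk Sp A L U) (K : G → G → Prop) : Prop where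
  symm : ∀ {x y}, K x y → K y x
  trans : ∀ {x y z}, y ∈ edgeSet Sp → K x y → K y z → K x z
  neg : ∀ {x y}, K x y → K (-x) (-y)
  map : ∀ (l : L) {x y}, K x y → K (l.1 x) (l.1 y)
  irrefl : ∀ {x}, x ∈ edgeSet Sp → ¬ K x (-x)

theorem isShareRel_ker : hw.IsShareRel fun x y => SameKer (A x) (A y) where
  symm h := h.symm
  trans hy h h' := h.trans (hw.ne_zero _ hy) h'
  neg h := by rw [hw.apply_neg_eq, hw.apply_neg_eq]; exact h.conjTranspose_adjugate
  map l x y h := by rw [hw.covariant, hw.covariant]; exact h.mul _ _ _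
  irrefl hx := by rw [hw.apply_neg_eq]; exact not_sameKer_conjTranspose_adjugate (hw.ne_zero _ hx)

theorem isShareRel_ran : hw.IsShareRel fun x y => SameKer (A x)ᵀ (A y)ᵀ where
  symm h := h.symm
  trans hy h h' := h.trans (fun h0 => hw.ne_zero _ hy (Matrix.transpose_eq_zero.1 h0)) h'
  neg {x y} h := by
    have e : ∀ M : Matrix (Fin 2) (Fin 2) ℂ, (M.adjugateᴴ)ᵀ = Mᵀ.adjugateᴴ := fun M => by
      rw [← Matrix.adjugate_transpose]; rfl
    rw [hw.apply_neg_eq, hw.apply_neg_eq, e, e]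
    exact h.conjTranspose_adjugate
  map l x y h := by
    rw [hw.covariant, hw.covariant, Matrix.transpose_mul, Matrix.transpose_mul,
      Matrix.transpose_mul, Matrix.transpose_mul, ← mul_assoc, ← mul_assoc]
    exact h.mul _ _ _
  irrefl {x} hx := by
    have e : ∀ M : Matrix (Fin 2) (Fin 2) ℂ, (M.adjugateᴴ)ᵀ = Mᵀ.adjugateᴴ := fun M => by
      rw [← Matrix.adjugate_transpose]; rfl
    rw [hw.apply_neg_eq, e]
    exact not_sameKer_conjTranspose_adjugate
      (fun h0 => hw.ne_zero _ hx (Matrix.transpose_eq_zero.1 h0))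

end General

/-! ### Dimension one -/

section Line

variable {Sp : Finset (Fin 1 → ℤ)}
  {A : (Fin 1 → ℤ) → Matrix (Fin 2) (Fin 2) ℂ} {L : Subgroup (Equiv.Perm (Fin 1 → ℤ))}
  {U : L → Matrix.unitaryGroup (Fin 2) ℂ} (hw : IsNormalWalk Sp A L U)

include hw

/-- For vectors of equal length, `x - y` and `x + y` are orthogonal, and in rank one one of them
must vanish. -/
theorem eq_or_eq_neg_line {x y : Fin 1 → ℤ} (hx : x ∈ edgeSet Sp) (hy : y ∈ edgeSet Sp) :
    x = y ∨ x = -y := by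
  by_contra! hne
  have h := hw.le_of_pairwise_form_eq_zero ![x - y, x + y] (by
    intro i
    fin_cases i
    · exact sub_ne_zero.2 hne.1
    · exact fun h => hne.2 (eq_neg_of_add_eq_zero_left h)) (by
    have e1 := hw.form_comm x y
    have e2 := hw.form_eq hx hy
    intro i j hij
    fin_cases i <;> fin_cases j <;> first
      | exact absurd rfl hij
      | (simp; linarith))
  omega

theorem realizedBy_line : RealizedBy Sp integerSteps ∨ RealizedBy Sp integerStepsSymm := by
  have hcard : 1 ≤ Sp.card := hw.dim_le_card fun x hx => Submodule.subset_span hx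
  obtain ⟨g, hg⟩ := Finset.card_pos.1 hcard
  have hg' : g ∈ edgeSet Sp := mem_edgeSet.2 (Or.inl hg)
  have hall : ∀ x ∈ Sp, x = g ∨ x = -g := fun x hx =>
    hw.eq_or_eq_neg_line (mem_edgeSet.2 (Or.inl hx)) hg'
  have hmem : g ∈ Submodule.span ℤ (Set.range ![g]) := Submodule.subset_span ⟨0, rfl⟩
  obtain ⟨φ, hφ, hφv⟩ := exists_realization hw.gen ![g] (by
    intro x hx
    rcases hall x hx with rfl | rfl
    · exact hmem
    · exact neg_mem hmem) ![!₂[(1 : ℝ)]] (by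
    rw [Fintype.linearIndependent_iff]
    intro c hc i
    have h0 := congrArg (fun x : EuclideanSpace ℝ (Fin 1) => x 0) hc
    simp at h0
    fin_cases i
    exact_mod_cast h0)
  have e0 : φ g = !₂[(1 : ℝ)] := hφv 0
  by_cases hng : -g ∈ Sp
  · right
    refine ⟨φ, hφ, ?_⟩
    have : (Sp : Set (Fin 1 → ℤ)) = {g, -g} := by
      ext x
      simp only [Finset.mem_coe, Set.mem_insert_iff, Set.mem_singleton_iff]
      exact ⟨hall x, by rintro (rfl | rfl) <;> assumption⟩
    rw [this, Set.image_insert_eq, Set.image_singleton, _root_.map_neg, e0, integerStepsSymm]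
    congr 2
    ext i
    fin_cases i
    simp
  · left
    refine ⟨φ, hφ, ?_⟩
    have : (Sp : Set (Fin 1 → ℤ)) = {g} := by
      ext x
      simp only [Finset.mem_coe, Set.mem_singleton_iff]
      refine ⟨fun hx => (hall x hx).resolve_right ?_, by rintro rfl; exact hg⟩
      rintro rfl
      exact hng hx
    rw [this, Set.image_singleton, e0, integerSteps]

theorem hasIsotropyRange_singleton {g : Fin 1 → ℤ} (hSp : Sp = {g}) :
    HasIsotropyRange Sp A L U trivialRange := by
  intro h hh
  have hL : ∀ l : L, l = 1 := fun l => hw.eq_one_of_forall l fun x hx => by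
    have h1 := hw.map_mem l x hx
    rw [hSp, Finset.mem_singleton] at hx h1
    rw [h1, hx]
  obtain ⟨B, hB, hk⟩ := exists_unitary_kernel (hw.det_eq_zero (mem_edgeSet.2 (Or.inl hh)))
  obtain ⟨c, hc, h1⟩ := hw.exists_map_one
  have h2 : B * (U 1 : Matrix (Fin 2) (Fin 2) ℂ) * Bᴴ = c • 1 := by rw [h1, conj_smul_one hB]
  refine ⟨B, hB, hk, hw.conj_neg_column hB hk, fun l => ⟨1, rfl, c, hc, ?_⟩, ?_⟩
  · rw [hL l, h2]
  · rintro p rfl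
    exact ⟨1, c, hc, h2⟩

/-- The nontrivial automorphism exchanges `h` and `-h`, whose kernels are orthogonal complements, so
it is represented by an antidiagonal matrix. -/
theorem hasIsotropyRange_pair {g : Fin 1 → ℤ} (hSp : Sp = {g, -g}) :
    HasIsotropyRange Sp A L U rangeX := by
  intro h hh
  have hh' : h ∈ edgeSet Sp := mem_edgeSet.2 (Or.inl hh)
  have hnh : -h ∈ Sp := by
    rw [hSp, Finset.mem_insert, Finset.mem_singleton] at hh ⊢
    rcases hh with rfl | rfl
    · exact Or.inr rfl
    · exact Or.inl (neg_neg g)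
  have hall : ∀ x ∈ Sp, x = h ∨ x = -h := fun x hx =>
    hw.eq_or_eq_neg_line (mem_edgeSet.2 (Or.inl hx)) hh'
  obtain ⟨l, hl⟩ := hw.trans h hh (-h) hnh
  obtain ⟨B, hB, hk⟩ := exists_unitary_kernel (hw.det_eq_zero hh')
  have hext : ∀ m n : L, m.1 h = n.1 h → m = n := fun m n hmn => hw.eq_of_forall fun x hx => by
    rcases hall x hx with rfl | rfl
    · exact hmn
    · rw [hw.map_neg, hw.map_neg, hmn]
  refine hw.exists_rangeX_basis (l := l) (fun n => ?_) hB hk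
    (hw.unitary_entry_eq_zero hh' hB hk (by rw [hl]; exact hw.conj_neg_column hB hk))
  rcases hall _ (hw.map_mem n h hh) with h1 | h1
  · exact Or.inl (hext n 1 h1)
  · exact Or.inr (hext n l (by rw [h1, hl]))

end Line

end IsNormalWalk

/-! ### Dimension two -/

/-- Each orthogonality relation is a linear equation on column `k` of `N` alone. The two equations
are independent because `P` and `Q` have different ranges. -/
theorem apply_eq_zero_of_polarDet {N P Q : Matrix (Fin 2) (Fin 2) ℂ} {k k' : Fin 2} (hk : k ≠ k')
    (hP : ∀ i, P i k = 0) (hQ : ∀ i, Q i k = 0) (hPQ : ¬ SameKer Pᵀ Qᵀ)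
    (h1 : polarDet N P = 0) (h2 : polarDet N Q = 0) : ∀ i, N i k = 0 := by
  have hD : P 0 k' * Q 1 k' - P 1 k' * Q 0 k' ≠ 0 := by
    intro hD
    apply hPQ
    have hk' : ∀ i, i = k ∨ i = k' := by
      intro i; fin_cases k <;> fin_cases k' <;> fin_cases i <;> simp at *
    intro i j
    simp only [Matrix.transpose_apply]
    rcases hk' i with rfl | rfl
    · rw [hP, hP, zero_mul, zero_mul]
    · rcases hk' j with rfl | rfl
      · rw [hQ, hQ, mul_zero, mul_zero]
      · linear_combination hD
  rw [polarDet] at h1 h2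
  intro i
  apply mul_left_cancel₀ hD
  fin_cases k <;> fin_cases k' <;> simp only [Fin.zero_eta, Fin.mk_one, Fin.isValue, ne_eq,
    not_true_eq_false, not_false_eq_true, one_ne_zero, zero_ne_one] at *
  · rw [hP, hP] at h1
    rw [hQ, hQ] at h2
    fin_cases i <;> simp only [Fin.zero_eta, Fin.mk_one, Fin.isValue]
    · linear_combination -Q 0 1 * h1 + P 0 1 * h2
    · linear_combination -Q 1 1 * h1 + P 1 1 * h2
  · rw [hP, hP] at h1
    rw [hQ, hQ] at h2
    fin_cases i <;> simp only [Fin.zero_eta, Fin.mk_one, Fin.isValue]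
    · linear_combination Q 0 0 * h1 - P 0 0 * h2
    · linear_combination Q 1 0 * h1 - P 1 0 * h2

namespace IsNormalWalk

set_option linter.unusedSectionVars false

section Plane

variable {Sp : Finset (Fin 2 → ℤ)}
  {A : (Fin 2 → ℤ) → Matrix (Fin 2) (Fin 2) ℂ} {L : Subgroup (Equiv.Perm (Fin 2 → ℤ))}
  {U : L → Matrix.unitaryGroup (Fin 2) ℂ} (hw : IsNormalWalk Sp A L U)

include hw

theorem eq_zero_of_orthogonal {x y z : Fin 2 → ℤ} (hxy : hw.form x y = 0) (hxz : hw.form x z = 0)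
    (hyz : hw.form y z = 0) : x = 0 ∨ y = 0 ∨ z = 0 := by
  by_contra! hne
  have h := hw.le_of_pairwise_form_eq_zero ![x, y, z] (by
    intro i
    fin_cases i
    · exact hne.1
    · exact hne.2.1
    · exact hne.2.2) (by
    intro i j hij
    fin_cases i <;> fin_cases j <;> first
      | exact absurd rfl hij
      | assumption
      | (rw [hw.form_comm]; assumption))
  omega

/-- A parallelogram inscribed in a circle about the origin: `h + h'`, `x - h` and `x - h'` are
pairwise orthogonal, so one of them vanishes. -/
theorem eq_or_eq_of_add_eq {h h' x y : Fin 2 → ℤ} (hh : h ∈ edgeSet Sp) (hh' : h' ∈ edgeSet Sp)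
    (hx : x ∈ edgeSet Sp) (hy : y ∈ edgeSet Sp) (hxy : x + y = h + h') (hne : h + h' ≠ 0) :
    x = h ∨ x = h' := by
  obtain rfl : y = h + h' - x := by rw [← hxy]; abel
  have e1 := hw.form_eq hh hx
  have e2 := hw.form_eq hh' hx
  have e3 := hw.form_eq hy hx
  have c1 := hw.form_comm h h'
  have c2 := hw.form_comm h x
  have c3 := hw.form_comm h' x
  simp only [_root_.map_sub, _root_.map_add, LinearMap.sub_apply, LinearMap.add_apply] at e3
  rcases hw.eq_zero_of_orthogonal (x := h + h') (y := x - h) (z := x - h')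
    (by simp only [_root_.map_sub, _root_.map_add, LinearMap.add_apply]; linarith)
    (by simp only [_root_.map_sub, _root_.map_add, LinearMap.add_apply]; linarith)
    (by simp only [_root_.map_sub, LinearMap.sub_apply]; linarith) with h1 | h1 | h1
  · exact absurd h1 hne
  · exact Or.inl (sub_eq_zero.1 h1)
  · exact Or.inr (sub_eq_zero.1 h1)

/-- When `h + h'` is not a step, the zero step takes part in no decomposition of it, and circle
geometry makes the decomposition into edges unique. -/
theorem sameKer_or {h h' : Fin 2 → ℤ} (hh : h ∈ edgeSet Sp) (hh' : h' ∈ edgeSet Sp)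
    (hne : h + h' ≠ 0) (hs : h + h' ∉ edgeSet Sp) :
    SameKer (A h) (A h') ∨ SameKer (A h)ᵀ (A h')ᵀ := by
  have hs' : h + h' ∉ stepSet Sp := by
    rw [mem_stepSet, not_or]; exact ⟨hne, hs⟩
  refine sameKer_or_of_polarDet_eq_zero (hw.det_eq_zero hh) (hw.det_eq_zero hh')
    (hw.polarDet_eq_zero_of_unique hne fun x hx hy => ?_)
  rcases mem_stepSet.1 hx with rfl | hx
  · rw [sub_zero] at hy; exact absurd hy hs'
  rcases mem_stepSet.1 hy with hy0 | hy
  · rw [sub_eq_zero] at hy0; exact absurd (hy0 ▸ hx) hs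
  exact hw.eq_or_eq_of_add_eq hh hh' hx hy (add_sub_cancel _ _) hne

/-- The vectors `a`, `x - b` and `x - c` are pairwise orthogonal: only `b` and `c` make the required
angle with `a`. -/
theorem eq_or_eq_of_hexagon {a b c x : Fin 2 → ℤ} (ha : a ∈ edgeSet Sp) (hb : b ∈ edgeSet Sp)
    (hc : c ∈ edgeSet Sp) (h0 : a + b + c = 0) (hx : x ∈ edgeSet Sp) (hxa : x + a ∈ edgeSet Sp) :
    x = b ∨ x = c := by
  obtain rfl : c = -(a + b) := (neg_eq_of_add_eq_zero_right h0).symm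
  have e1 := hw.form_eq ha hx
  have e2 := hw.form_eq hb hx
  have e3 := hw.form_eq hc hx
  have e4 := hw.form_eq hxa hx
  have c1 := hw.form_comm a b
  have c2 := hw.form_comm a x
  have c3 := hw.form_comm b x
  simp only [_root_.map_neg, _root_.map_add, LinearMap.neg_apply, LinearMap.add_apply] at e3 e4
  rcases hw.eq_zero_of_orthogonal (x := a) (y := x - b) (z := x - -(a + b))
    (by simp only [_root_.map_sub]; linarith)
    (by simp only [_root_.map_sub, _root_.map_neg, _root_.map_add]; linarith)
    (by simp only [_root_.map_sub, LinearMap.sub_apply, _root_.map_neg, _root_.map_add]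
        linarith) with h1 | h1 | h1
  · exact absurd h1 (hw.ne_zero_of_mem ha)
  · exact Or.inl (sub_eq_zero.1 h1)
  · exact Or.inr (sub_eq_zero.1 h1)

theorem exists_map_eq_or_neg {x y : Fin 2 → ℤ} (hx : x ∈ edgeSet Sp) (hy : y ∈ edgeSet Sp) :
    ∃ l : L, l.1 x = y ∨ l.1 x = -y := by
  rcases mem_edgeSet.1 hx with hx | hx <;> rcases mem_edgeSet.1 hy with hy | hy
  · obtain ⟨l, hl⟩ := hw.trans _ hx _ hy
    exact ⟨l, Or.inl hl⟩
  · obtain ⟨l, hl⟩ := hw.trans _ hx _ hy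
    exact ⟨l, Or.inr hl⟩
  · obtain ⟨l, hl⟩ := hw.trans _ hx _ hy
    exact ⟨l, Or.inr (by rw [← hl, hw.map_neg, neg_neg])⟩
  · obtain ⟨l, hl⟩ := hw.trans _ hx _ hy
    exact ⟨l, Or.inl (by rw [hw.map_neg] at hl; exact neg_injective hl)⟩

theorem IsShareRel.not_neg {K : (Fin 2 → ℤ) → (Fin 2 → ℤ) → Prop}
    (hK : hw.IsShareRel K) {x y : Fin 2 → ℤ} (hx : x ∈ edgeSet Sp) (hy : y ∈ edgeSet Sp)
    (h : K x y) : ¬ K x (-y) := fun h' => hK.irrefl hy (hK.trans hx (hK.symm h) h')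

/-- The two relations at `a` give `K b c`. An automorphism taking `a` to `± b` maps the triple to
itself up to that sign, and it transports one of the relations at `a` to `K b (-c)` or `K (-b) c`,
which is incompatible with `K b c`. -/
theorem IsShareRel.not_hexagon {K : (Fin 2 → ℤ) → (Fin 2 → ℤ) → Prop}
    (hK : hw.IsShareRel K) {a b c : Fin 2 → ℤ} (ha : a ∈ edgeSet Sp) (hb : b ∈ edgeSet Sp)
    (hc : c ∈ edgeSet Sp) (h0 : a + b + c = 0) (h1 : K a (-b)) (h2 : K a (-c)) : False := by
  have h3 : K b c := by
    have := hK.neg (hK.trans ha (hK.symm h1) h2)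
    rwa [neg_neg, neg_neg] at this
  have h4 : ¬ K b (-c) := hK.not_neg hw hb hc h3
  have h4' : ¬ K (-b) c := fun h => h4 (by simpa using hK.neg h)
  have h0' : b + a + c = 0 := by rw [← h0]; abel
  obtain ⟨l, hl⟩ := hw.exists_map_eq_or_neg ha hb
  have hs : l.1 a + l.1 b + l.1 c = 0 := by
    rw [← hw.map_add, ← hw.map_add, h0, hw.map_zero]
  have m1 := hK.map l h1
  have m2 := hK.map l h2
  rw [hw.map_neg] at m1 m2
  rcases hl with hl | hl
  · rw [hl] at hs m1 m2
    rcases hw.eq_or_eq_of_hexagon hb ha hc h0' (hw.map_mem_edgeSet l hb) (by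
      rw [show l.1 b + b = -l.1 c by rw [eq_neg_iff_add_eq_zero, ← hs]; abel]
      exact neg_mem_edgeSet (hw.map_mem_edgeSet l hc)) with h5 | h5
    · rw [h5, add_comm b a] at hs
      rw [add_left_cancel (hs.trans h0.symm)] at m2
      exact h4 m2
    · rw [h5] at m1
      exact h4 m1
  · rw [hl] at hs m1 m2
    rcases hw.eq_or_eq_of_hexagon hb ha hc h0' (neg_mem_edgeSet (hw.map_mem_edgeSet l hb)) (by
      rw [show -l.1 b + b = l.1 c by
        rw [← sub_eq_zero, ← neg_eq_zero, ← hs]; abel]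
      exact hw.map_mem_edgeSet l hc) with h5 | h5
    · have h6 : -l.1 c = c := by
        have : -l.1 c = -b + l.1 b := by rw [neg_eq_iff_add_eq_zero, ← hs]; abel
        rw [this, ← neg_neg (l.1 b), h5, ← sub_eq_zero, ← neg_eq_zero, ← h0]
        abel
      rw [h6] at m2
      exact h4' m2
    · rw [h5] at m1
      exact h4' m1

/-- The edges contain no hexagon. -/
theorem add_notMem_edgeSet {a b : Fin 2 → ℤ} (ha : a ∈ edgeSet Sp) (hb : b ∈ edgeSet Sp) :
    a + b ∉ edgeSet Sp := by
  intro hab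
  obtain ⟨c, hc, h0⟩ : ∃ c ∈ edgeSet Sp, a + b + c = 0 :=
    ⟨-(a + b), neg_mem_edgeSet hab, add_neg_cancel _⟩
  -- If `x + y` is an edge, then `x - y` has three times the squared length of an edge, so the
  -- kernel-or-range alternative applies to `x` and `-y`.
  have key : ∀ x ∈ edgeSet Sp, ∀ y ∈ edgeSet Sp, x + y ∈ edgeSet Sp →
      SameKer (A x) (A (-y)) ∨ SameKer (A x)ᵀ (A (-y))ᵀ := by
    intro x hx y hy hxy
    have e1 := hw.form_eq hx hy
    have e2 := hw.form_eq hxy hy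
    have e3 := hw.form_comm x y
    have e4 := hw.form_self_pos (hw.ne_zero_of_mem hy)
    simp only [_root_.map_add, LinearMap.add_apply] at e2
    refine hw.sameKer_or hx (neg_mem_edgeSet hy) (fun h => ?_) (fun h => ?_)
    · rw [add_neg_eq_zero] at h
      subst h
      linarith
    · have e5 := hw.form_eq h hy
      simp only [_root_.map_add, LinearMap.add_apply, _root_.map_neg, LinearMap.neg_apply] at e5
      linarith
  have hac : a + c = -b := by rw [eq_neg_iff_add_eq_zero, ← h0]; abel
  have hbc : b + c = -a := by rw [eq_neg_iff_add_eq_zero, ← h0]; abel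
  have s1 := key a ha b hb hab
  have s2 := key a ha c hc (hac ▸ neg_mem_edgeSet hb)
  have s3 := key b hb c hc (hbc ▸ neg_mem_edgeSet ha)
  have hflip : ∀ {K : (Fin 2 → ℤ) → (Fin 2 → ℤ) → Prop}, hw.IsShareRel K → ∀ {x y}, K x (-y) →
      K y (-x) := fun hK x y h => by simpa using hK.neg (hK.symm h)
  have hno : ∀ {K : (Fin 2 → ℤ) → (Fin 2 → ℤ) → Prop}, hw.IsShareRel K →
      ¬ (K a (-b) ∧ K a (-c)) ∧ ¬ (K a (-b) ∧ K b (-c)) ∧ ¬ (K a (-c) ∧ K b (-c)) := by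
    intro K hK
    refine ⟨fun h => hK.not_hexagon hw ha hb hc h0 h.1 h.2,
      fun h => hK.not_hexagon hw hb ha hc (by rw [← h0]; abel) (hflip hK h.1) h.2,
      fun h => hK.not_hexagon hw hc ha hb (by rw [← h0]; abel) (hflip hK h.1) (hflip hK h.2)⟩
  -- Three pairs each satisfy one of two relations, and each relation holds for at most one pair.
  have n1 := hno hw.isShareRel_ker
  have n2 := hno hw.isShareRel_ran
  tauto

/-- The kernel-or-range alternative applies to both `y` and `-y`, and neither relation can hold for
both signs, so the kernel is shared with one sign and the range with the other. -/
theorem exists_sameKer {x y : Fin 2 → ℤ} (hx : x ∈ edgeSet Sp) (hy : y ∈ edgeSet Sp) (h : y ≠ x)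
    (h' : y ≠ -x) : ∃ z ∈ edgeSet Sp, (z = y ∨ z = -y) ∧ SameKer (A x) (A z) ∧
      SameKer (A x)ᵀ (A (-z))ᵀ := by
  have s1 := hw.sameKer_or hx hy (fun h0 => h' (neg_eq_of_add_eq_zero_right h0).symm)
    (hw.add_notMem_edgeSet hx hy)
  have s2 := hw.sameKer_or hx (neg_mem_edgeSet hy) (fun h0 => h (add_neg_eq_zero.1 h0).symm)
    (hw.add_notMem_edgeSet hx (neg_mem_edgeSet hy))
  have n1 := hw.isShareRel_ker.not_neg hw hx hy
  have n2 := hw.isShareRel_ran.not_neg hw hx hy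
  rcases s1 with s1 | s1
  · exact ⟨y, hy, Or.inl rfl, s1, s2.resolve_left (n1 s1)⟩
  · exact ⟨-y, neg_mem_edgeSet hy, Or.inr rfl, s2.resolve_right (n2 s1), by rwa [neg_neg]⟩

/-- There are only two pairs of edges. -/
theorem exists_square {a : Fin 2 → ℤ} (ha : a ∈ edgeSet Sp) : ∃ b ∈ edgeSet Sp, b ≠ a ∧ b ≠ -a ∧
    SameKer (A a) (A b) ∧ SameKer (A a)ᵀ (A (-b))ᵀ ∧
    ∀ x ∈ edgeSet Sp, x = a ∨ x = -a ∨ x = b ∨ x = -b := by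
  obtain ⟨y, hy, hya, hya'⟩ := hw.exists_mem_ne le_rfl a
  obtain ⟨b, hb, hby, hK, hR⟩ := hw.exists_sameKer ha hy hya hya'
  refine ⟨b, hb, ?_, ?_, hK, hR, fun x hx => ?_⟩
  · rcases hby with rfl | rfl
    · exact hya
    · exact fun h => hya' (by rw [← h, neg_neg])
  · rcases hby with rfl | rfl
    · exact hya'
    · exact fun h => hya (neg_injective h)
  -- A representative `z` of a third direction would share both its kernel and its range with `b`,
  -- the latter because `-z` and `-b` share theirs with `a`. Then `b` and `-z` could share neither.
  by_contra! hne
  obtain ⟨z, hz, hzx, hK', hR'⟩ := hw.exists_sameKer ha hx hne.1 hne.2.1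
  have k1 := hw.isShareRel_ker.not_neg hw hb hz (hw.isShareRel_ker.trans ha
    (hw.isShareRel_ker.symm hK) hK')
  have k2 := hw.isShareRel_ran.not_neg hw hb hz (by
    have := hw.isShareRel_ran.neg (hw.isShareRel_ran.trans ha (hw.isShareRel_ran.symm hR) hR')
    rwa [neg_neg, neg_neg] at this)
  have hzb : b + -z ≠ 0 := by
    intro h0
    rw [add_neg_eq_zero] at h0
    rcases hzx with rfl | rfl
    · exact hne.2.2.1 h0.symm
    · exact hne.2.2.2 (by rw [h0, neg_neg])
  rcases hw.sameKer_or hb (neg_mem_edgeSet hz) hzb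
    (hw.add_notMem_edgeSet hb (neg_mem_edgeSet hz)) with h | h
  · exact k1 h
  · exact k2 h

/-- Without hexagons no edge is a sum of two edges, so `0 + x` is its only decomposition up to
order. -/
theorem polarDet_zero_eq_zero {x : Fin 2 → ℤ} (hx : x ∈ edgeSet Sp) :
    polarDet (A 0) (A x) = 0 := by
  refine hw.polarDet_eq_zero_of_unique (by rw [zero_add]; exact hw.ne_zero_of_mem hx)
    fun y hy hy' => ?_
  rw [zero_add] at hy'
  rcases mem_stepSet.1 hy with h | h
  · exact Or.inl h
  · rcases mem_stepSet.1 hy' with h' | h'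
    · exact Or.inr (sub_eq_zero.1 h').symm
    · exact absurd (by rwa [add_sub_cancel]) (hw.add_notMem_edgeSet h h')

theorem nonempty_plane : Sp.Nonempty :=
  Finset.card_pos.1 (two_pos.trans_le (hw.dim_le_card fun _ hx => Submodule.subset_span hx))

/-- The matrices of `a` and `b` have the same kernel but different ranges, so orthogonality to both
annihilates the column of `A 0` along that kernel. The matrices of `-a` and `-b` annihilate the
other column. -/
theorem apply_zero_eq_zero_plane : A 0 = 0 := by
  obtain ⟨a, ha⟩ := hw.nonempty_plane
  have ha' : a ∈ edgeSet Sp := mem_edgeSet.2 (Or.inl ha)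
  obtain ⟨b, hb, -, -, hK, hR, -⟩ := hw.exists_square ha'
  obtain ⟨B, hB, hk⟩ := exists_unitary_kernel (hw.det_eq_zero ha')
  have hBB : Bᴴ * B = 1 := Matrix.mem_unitaryGroup_iff'.1 hB
  have hkb := hK.column (hw.ne_zero a ha') hB hk
  have hback : ∀ M N : Matrix (Fin 2) (Fin 2) ℂ, SameKer (B * M * Bᴴ)ᵀ (B * N * Bᴴ)ᵀ →
      SameKer Mᵀ Nᵀ := by
    intro M N h
    have e : ∀ M : Matrix (Fin 2) (Fin 2) ℂ, Bᵀ * (B * M * Bᴴ)ᵀ * (Bᴴ)ᵀ = Mᵀ := by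
      intro M
      rw [← Matrix.transpose_mul, ← Matrix.transpose_mul]
      congr 1
      rw [mul_assoc B M, ← mul_assoc Bᴴ, ← mul_assoc Bᴴ, hBB, one_mul, mul_assoc, hBB, mul_one]
    have := h.mul Bᵀ Bᵀ (Bᴴ)ᵀ
    rwa [e, e] at this
  have hp : ∀ x ∈ edgeSet Sp, polarDet (B * A 0 * Bᴴ) (B * A x * Bᴴ) = 0 := fun x hx => by
    rw [polarDet_conj_unitary hBB, hw.polarDet_zero_eq_zero hx]
  have hR' : ¬ SameKer (A a)ᵀ (A b)ᵀ := fun h => hw.isShareRel_ran.not_neg hw ha' hb h hR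
  have hR'' : ¬ SameKer (A (-a))ᵀ (A (-b))ᵀ := fun h => hR' (by
    have := hw.isShareRel_ran.neg h
    rwa [neg_neg, neg_neg] at this)
  have h1 := apply_eq_zero_of_polarDet (k := 1) (k' := 0) (by decide) hk hkb
    (fun h => hR' (hback _ _ h)) (hp a ha') (hp b hb)
  have h2 := apply_eq_zero_of_polarDet (k := 0) (k' := 1) (by decide) (hw.conj_neg_column hB hk)
    (hw.conj_neg_column hB hkb) (fun h => hR'' (hback _ _ h)) (hp _ (neg_mem_edgeSet ha'))
    (hp _ (neg_mem_edgeSet hb))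
  refine conj_unitary_injective hB ?_
  rw [mul_zero, zero_mul]
  ext i j
  fin_cases j
  · exact h2 i
  · exact h1 i

theorem neg_mem_of_neg_mem {x y : Fin 2 → ℤ} (hx : x ∈ Sp) (hnx : -x ∈ Sp) (hy : y ∈ Sp) :
    -y ∈ Sp := by
  obtain ⟨l, rfl⟩ := hw.trans x hx y hy
  rw [← hw.map_neg]
  exact hw.map_mem l _ hnx

theorem realizedBy_square : RealizedBy Sp squareSteps ∨ RealizedBy Sp squareStepsSymm := by
  obtain ⟨a, ha⟩ := hw.nonempty_plane
  have ha' : a ∈ edgeSet Sp := mem_edgeSet.2 (Or.inl ha)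
  obtain ⟨b, hb, hba, hba', hall⟩ : ∃ b ∈ Sp, b ≠ a ∧ b ≠ -a ∧
      ∀ x ∈ edgeSet Sp, x = a ∨ x = -a ∨ x = b ∨ x = -b := by
    obtain ⟨b, hb, hba, hba', -, -, hall⟩ := hw.exists_square ha'
    rcases mem_edgeSet.1 hb with hb | hb
    · exact ⟨b, hb, hba, hba', hall⟩
    · refine ⟨-b, hb, fun h => hba' (by rw [← h, neg_neg]), fun h => hba (neg_injective h),
        fun x hx => ?_⟩
      rw [neg_neg]
      have := hall x hx
      tauto
  have hall' : ∀ x ∈ Sp, x = a ∨ x = -a ∨ x = b ∨ x = -b := fun x hx =>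
    hall x (mem_edgeSet.2 (Or.inl hx))
  have h0 : a ∈ Submodule.span ℤ (Set.range ![a, b]) := Submodule.subset_span ⟨0, rfl⟩
  have h1 : b ∈ Submodule.span ℤ (Set.range ![a, b]) := Submodule.subset_span ⟨1, rfl⟩
  obtain ⟨φ, hφ, hφv⟩ := exists_realization hw.gen ![a, b] (by
    intro x hx
    rcases hall' x hx with rfl | rfl | rfl | rfl
    exacts [h0, neg_mem h0, h1, neg_mem h1]) ![!₂[(1 : ℝ), 0], !₂[(0 : ℝ), 1]] (by
    rw [Fintype.linearIndependent_iff]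
    intro c hc
    have h0 := congrArg (fun x : EuclideanSpace ℝ (Fin 2) => x 0) hc
    have h1 := congrArg (fun x : EuclideanSpace ℝ (Fin 2) => x 1) hc
    simp [Fin.sum_univ_two] at h0 h1
    intro i
    fin_cases i
    · exact_mod_cast h0
    · exact_mod_cast h1)
  have e0 : φ a = !₂[(1 : ℝ), 0] := hφv 0
  have e1 : φ b = !₂[(0 : ℝ), 1] := hφv 1
  by_cases hna : -a ∈ Sp
  · right
    refine ⟨φ, hφ, ?_⟩
    have hSp : (Sp : Set (Fin 2 → ℤ)) = {a, b, -a, -b} := by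
      ext x
      simp only [Finset.mem_coe, Set.mem_insert_iff, Set.mem_singleton_iff]
      constructor
      · intro hx; have := hall' x hx; tauto
      · rintro (rfl | rfl | rfl | rfl)
        exacts [ha, hb, hna, hw.neg_mem_of_neg_mem ha hna hb]
    rw [hSp, Set.image_insert_eq, Set.image_insert_eq, Set.image_insert_eq, Set.image_singleton,
      _root_.map_neg, _root_.map_neg, e0, e1, squareStepsSymm]
    congr 4
    · ext i; fin_cases i <;> simp
    · ext i; fin_cases i <;> simp
  · left
    refine ⟨φ, hφ, ?_⟩
    have hSp : (Sp : Set (Fin 2 → ℤ)) = {a, b} := by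
      ext x
      simp only [Finset.mem_coe, Set.mem_insert_iff, Set.mem_singleton_iff]
      constructor
      · intro hx
        rcases hall' x hx with h | rfl | h | rfl
        · exact Or.inl h
        · exact absurd hx hna
        · exact Or.inr h
        · exact absurd (hw.neg_mem_of_neg_mem hb hx ha) hna
      · rintro (rfl | rfl) <;> assumption
    rw [hSp, Set.image_insert_eq, Set.image_singleton, e0, e1, squareSteps]

/-- The nontrivial automorphism exchanges the two generators. If they share a kernel it preserves it
and is diagonal; otherwise it carries the kernel to the orthogonal complement and is antidiagonal.
The condition on kernels is recorded so that explicit walks can be assigned to one alternative. -/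
theorem hasIsotropyRange_square (hneg : ∀ x ∈ Sp, -x ∉ Sp) :
    (HasIsotropyRange Sp A L U rangeX ∧ ∀ x ∈ Sp, ∀ y ∈ Sp, x ≠ y → ¬ SameKer (A x) (A y)) ∨
      (HasIsotropyRange Sp A L U rangeZ ∧ ∀ x ∈ Sp, ∀ y ∈ Sp, SameKer (A x) (A y)) := by
  obtain ⟨a, ha⟩ := hw.nonempty_plane
  have ha' : a ∈ edgeSet Sp := mem_edgeSet.2 (Or.inl ha)
  obtain ⟨b, hb, hba, hba', hK, hR, hall⟩ := hw.exists_square ha'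
  obtain ⟨c, hc, hcb, hcK⟩ : ∃ c ∈ Sp, (c = b ∨ c = -b) ∧
      (SameKer (A a) (A c) ∨ SameKer (A a) (A (-c))) := by
    rcases mem_edgeSet.1 hb with hb | hb
    · exact ⟨b, hb, Or.inl rfl, Or.inl hK⟩
    · exact ⟨-b, hb, Or.inr rfl, Or.inr (by rwa [neg_neg])⟩
  have hca : c ≠ a := by
    rcases hcb with rfl | rfl
    · exact hba
    · exact fun h => hba' (by rw [← h, neg_neg])
  have hSp : ∀ x ∈ Sp, x = a ∨ x = c := by
    intro x hx
    rcases hall x (mem_edgeSet.2 (Or.inl hx)) with h | rfl | h | h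
    · exact Or.inl h
    · exact absurd hx (hneg a ha)
    · rcases hcb with h' | h'
      · exact Or.inr (h.trans h'.symm)
      · exact absurd hx (by rw [h, ← neg_neg b, ← h']; exact hneg c hc)
    · rcases hcb with h' | h'
      · exact absurd hx (by rw [h, ← h']; exact hneg c hc)
      · exact Or.inr (h.trans h'.symm)
  obtain ⟨l, hl⟩ := hw.trans a ha c hc
  have hlc : l.1 c = a := by
    refine (hSp _ (hw.map_mem l c hc)).resolve_right fun h => hca (l.1.injective ?_)
    rw [h, hl]
  have hl1 : l ≠ 1 := by rintro rfl; exact hca hl.symm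
  have hll : l * l = 1 := hw.eq_of_apply_eq le_rfl ha' (by
    change l.1 (l.1 a) = a; rw [hl, hlc])
  have hL : ∀ n : L, n = 1 ∨ n = l := by
    intro n
    rcases hSp _ (hw.map_mem n a ha) with h | h
    · exact Or.inl (hw.eq_of_apply_eq le_rfl ha' h)
    · exact Or.inr (hw.eq_of_apply_eq le_rfl ha' (h.trans hl.symm))
  rcases hcK with hK | hK
  · right
    have hKl : ∀ g ∈ Sp, SameKer (A g) (A (l.1 g)) := by
      intro g hg
      rcases hSp g hg with rfl | rfl
      · rwa [hl]
      · rw [hlc]; exact hK.symm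
    refine ⟨?_, fun x hx y hy => ?_⟩
    swap
    · rcases hSp x hx with rfl | rfl <;> rcases hSp y hy with rfl | rfl
      exacts [hK.trans (hw.ne_zero _ (mem_edgeSet.2 (Or.inl hc))) hK.symm, hK, hK.symm,
        hK.symm.trans (hw.ne_zero _ ha') hK]
    intro g hg
    have hg' : g ∈ edgeSet Sp := mem_edgeSet.2 (Or.inl hg)
    obtain ⟨B, hB, hk⟩ := exists_unitary_kernel (hw.det_eq_zero hg')
    exact hw.exists_rangeZ_basis hl1 hll hL hB hk (unitary_diagonal' (conj_mem_unitaryGroup hB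
      (U l).2) (hw.unitary_entry_eq_zero hg' hB hk ((hKl g hg).column (hw.ne_zero g hg') hB hk)))
  · left
    have hKl : ∀ g ∈ Sp, SameKer (A g) (A (-l.1 g)) := by
      intro g hg
      rcases hSp g hg with rfl | rfl
      · rwa [hl]
      · rw [hlc]
        simpa using hw.isShareRel_ker.neg hK.symm
    refine ⟨?_, fun x hx y hy hxy h => ?_⟩
    swap
    · have hc' : c ∈ edgeSet Sp := mem_edgeSet.2 (Or.inl hc)
      rcases hSp x hx with rfl | rfl <;> rcases hSp y hy with rfl | rfl
      · exact hxy rfl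
      · exact hw.isShareRel_ker.not_neg hw ha' hc' h hK
      · exact hw.isShareRel_ker.not_neg hw ha' hc' h.symm hK
      · exact hxy rfl
    intro g hg
    have hg' : g ∈ edgeSet Sp := mem_edgeSet.2 (Or.inl hg)
    obtain ⟨B, hB, hk⟩ := exists_unitary_kernel (hw.det_eq_zero hg')
    refine hw.exists_rangeX_basis hL hB hk (hw.unitary_entry_eq_zero (l := l) hg' hB hk ?_)
    simpa using hw.conj_neg_column hB ((hKl g hg).column (hw.ne_zero g hg') hB hk)

/-- The element `s` takes `h` to `-h`, and `n` takes `h` to the perpendicular edge with the same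
kernel. Both are involutions that generate the group, and `n` preserves the kernel of `A h`. -/
theorem hasIsotropyRange_square_symm (hneg : ∀ x ∈ Sp, -x ∈ Sp) :
    HasIsotropyRange Sp A L U heisenbergRange := by
  intro h hh
  have hE : ∀ x ∈ edgeSet Sp, x ∈ Sp := fun x hx =>
    (mem_edgeSet.1 hx).elim id fun hx => by simpa using hneg _ hx
  have hh' : h ∈ edgeSet Sp := mem_edgeSet.2 (Or.inl hh)
  obtain ⟨b, hb, hbh, hbh', hK, -, hall⟩ := hw.exists_square hh'
  obtain ⟨s, hs⟩ := hw.trans h hh (-h) (hneg h hh)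
  obtain ⟨n, hn⟩ := hw.trans h hh b (hE b hb)
  have hs1 : s ≠ 1 := by rintro rfl; exact hw.neg_ne_self hh' hs.symm
  have hext : ∀ {k k' : L}, k.1 h = k'.1 h → k = k' := fun h0 => hw.eq_of_apply_eq le_rfl hh' h0
  have hsb : s.1 b = -b := by
    rcases hall _ (hw.map_mem_edgeSet s hb) with h1 | h1 | h1 | h1
    · exact absurd (s.1.injective (h1.trans (by rw [hw.map_neg, hs, neg_neg]))) hbh'
    · exact absurd (s.1.injective (h1.trans hs.symm)) hbh
    · exact absurd (hw.eq_one_of_apply_eq le_rfl hb h1) hs1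
    · exact h1
  have hnb : n.1 b = h := by
    rcases hall _ (hw.map_mem_edgeSet n hb) with h1 | h1 | h1 | h1
    · exact h1
    -- If `n b` were `-h`, transporting the shared kernel by `n` would make `h` share its kernel
    -- with `-h`.
    · have h2 := hw.isShareRel_ker.map n hK
      rw [hn, h1] at h2
      exact absurd (hw.isShareRel_ker.trans hb hK h2) (hw.isShareRel_ker.irrefl hh')
    · exact absurd (n.1.injective (h1.trans hn.symm)) hbh
    · exact absurd (n.1.injective (h1.trans (by rw [hw.map_neg, hn]))) hbh'
  refine hw.exists_heisenberg_basis hh (hw.det_eq_zero hh') (l := n) (m := s) ?_ hs1 ?_ ?_ ?_ ?_ ?_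
    (hw.exists_mul_eq_smul_of_sameKer hh' (hw.det_eq_zero hh') (by rwa [hn]))
  · rintro rfl; exact hbh hn.symm
  · rintro rfl; exact hbh' (hn.symm.trans hs)
  · exact hext (by change n.1 (n.1 h) = h; rw [hn, hnb])
  · exact hext (by change s.1 (s.1 h) = h; rw [hs, hw.map_neg, hs, neg_neg])
  · exact hext (by
      change s.1 (n.1 h) = n.1 (s.1 h)
      rw [hn, hsb, hs, hw.map_neg, hn])
  · intro k
    rcases hall _ (hw.map_mem_edgeSet k hh') with h1 | h1 | h1 | h1
    · exact Or.inl (hext h1)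
    · exact Or.inr (Or.inr (Or.inl (hext (h1.trans hs.symm))))
    · exact Or.inr (Or.inl (hext (h1.trans hn.symm)))
    · refine Or.inr (Or.inr (Or.inr (hext (h1.trans ?_))))
      change -b = n.1 (s.1 h)
      rw [hs, hw.map_neg, hn]

end Plane

end IsNormalWalk

/-! ### Construction of isotropic walks from lattice models -/

section Model

variable {G : Type*} [AddCommGroup G] [DecidableEq G] {H : Type*} [AddCommGroup H]
  {K : Type*} [Group K]

/-- An isotropic walk on a Cayley graph embedded in a group `H` with an action of `K`. -/
theorem exists_isIsotropicWalk {Sp : Finset G} (hg : IsGeneratingSet Sp) {c : G →+ H}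
    (hc : Function.Injective c) (a : H → Matrix (Fin 2) (Fin 2) ℂ) (σ : K →* AddMonoid.End H)
    (V : K → Matrix.unitaryGroup (Fin 2) ℂ)
    (hproj : ∀ k k', ∃ z : ℂ, ‖z‖ = 1 ∧ (V (k * k') : Matrix (Fin 2) (Fin 2) ℂ) =
      z • ((V k : Matrix (Fin 2) (Fin 2) ℂ) * (V k' : Matrix (Fin 2) (Fin 2) ℂ)))
    (hcov : ∀ k v, a (σ k v) =
      (V k : Matrix (Fin 2) (Fin 2) ℂ) * a v * (V k : Matrix (Fin 2) (Fin 2) ℂ)ᴴ)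
    (hmem : ∀ k, ∀ x ∈ Sp, ∃ y ∈ Sp, c y = σ k (c x))
    (htrans : ∀ x ∈ Sp, ∀ y ∈ Sp, ∃ k, σ k (c x) = c y)
    (hfaith : ∀ k, (∀ x ∈ Sp, σ k (c x) = c x) → k = 1)
    (hinj : ∀ x ∈ Sp, ∀ y ∈ Sp, a (c x) = a (c y) → x = y)
    (hne : ∀ x ∈ edgeSet Sp, a (c x) ≠ 0)
    (hW : ∃ W ∈ unitary (WalkSpace G 2 →L[ℂ] WalkSpace G 2),
      IsWalkOperator Sp (fun x => a (c x)) W) :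
    ∃ (L : Subgroup (Equiv.Perm G)) (U : L → Matrix.unitaryGroup (Fin 2) ℂ),
      IsIsotropicWalk Sp (fun x => a (c x)) L U := by
  have hσ1 : ∀ v, σ 1 v = v := fun v => by rw [_root_.map_one]; rfl
  have hσ : ∀ k k' v, σ (k * k') v = σ k (σ k' v) := fun k k' v => by rw [_root_.map_mul]; rfl
  have hrange : ∀ k x, ∃ y, c y = σ k (c x) := by
    intro k x
    have hx : x ∈ AddSubgroup.closure (Sp : Set G) := by rw [hg.closure_eq_top]; trivial
    induction hx using AddSubgroup.closure_induction with
    | mem x hx => obtain ⟨y, -, hy⟩ := hmem k x hx; exact ⟨y, hy⟩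
    | zero => exact ⟨0, by rw [_root_.map_zero, _root_.map_zero]⟩
    | add x y _ _ hx hy =>
      obtain ⟨x', hx⟩ := hx
      obtain ⟨y', hy⟩ := hy
      exact ⟨x' + y', by rw [_root_.map_add, _root_.map_add, _root_.map_add, hx, hy]⟩
    | neg x _ hx =>
      obtain ⟨x', hx⟩ := hx
      exact ⟨-x', by rw [_root_.map_neg, _root_.map_neg, _root_.map_neg, hx]⟩
  choose f hf using hrange
  have hperm : ∀ k, ∃ l : Equiv.Perm G, ∀ x, c (l x) = σ k (c x) := fun k =>
    ⟨⟨f k, f k⁻¹, fun x => hc (by rw [hf, hf, ← hσ, inv_mul_cancel, hσ1]),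
      fun x => hc (by rw [hf, hf, ← hσ, mul_inv_cancel, hσ1])⟩, hf k⟩
  let L : Subgroup (Equiv.Perm G) :=
    { carrier := {l | ∃ k, ∀ x, c (l x) = σ k (c x)}
      one_mem' := ⟨1, fun x => (hσ1 _).symm⟩
      mul_mem' := by
        rintro l m ⟨k, hk⟩ ⟨k', hk'⟩
        refine ⟨k * k', fun x => ?_⟩
        change c (l (m x)) = _
        rw [hk, hk', hσ]
      inv_mem' := by
        rintro l ⟨k, hk⟩
        refine ⟨k⁻¹, fun x => ?_⟩
        obtain ⟨y, rfl⟩ := l.surjective x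
        rw [hk, ← hσ, inv_mul_cancel, hσ1]
        exact congrArg c (l.symm_apply_apply y) }
  have hL : ∀ l : L, ∃ k, ∀ x, c (l.1 x) = σ k (c x) := fun l => l.2
  choose κ hκ using hL
  -- Faithfulness on generators makes the covering element `κ l` unique, which is what makes `κ`
  -- multiplicative.
  have huniq : ∀ (l : L) k, (∀ x ∈ Sp, c (l.1 x) = σ k (c x)) → κ l = k := by
    intro l k hk
    refine (inv_mul_eq_one.1 (hfaith _ fun x hx => ?_)).symm
    rw [hσ, ← hκ, hk x hx, ← hσ, inv_mul_cancel, hσ1]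
  have hLSp : ∀ (l : L), ∀ x ∈ Sp, l.1 x ∈ Sp := by
    intro l x hx
    obtain ⟨y, hy, hyx⟩ := hmem (κ l) x hx
    rwa [← hc (hyx.trans (hκ l x).symm)]
  have hadd : ∀ (l : L) x y, l.1 (x + y) = l.1 x + l.1 y := fun l x y => hc (by
    rw [hκ, _root_.map_add, _root_.map_add, _root_.map_add, hκ, hκ])
  refine ⟨L, fun l => V (κ l), ?_⟩
  refine ⟨⟨fun x hx => hne x (mem_edgeSet.2 (Or.inl hx)), fun x hx =>
    hne (-x) (mem_edgeSet.2 (Or.inr (by rwa [neg_neg]))), hW⟩, ?_, ?_, ?_, ?_, ?_⟩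
  · intro l hl
    refine ⟨hc (by
      have := hκ ⟨l, hl⟩ 0
      rw [c.map_zero] at this
      exact this.trans ((_root_.map_zero (σ _)).trans c.map_zero.symm)), ?_⟩
    let g : Sp → Sp := fun x => ⟨l x.1, hLSp ⟨l, hl⟩ x.1 x.2⟩
    have hginj : Function.Injective g := fun x y hxy =>
      Subtype.ext (l.injective (congrArg Subtype.val hxy))
    exact ⟨Equiv.ofBijective g (Finite.injective_iff_bijective.1 hginj),
      fun x h => hadd ⟨l, hl⟩ x h.1⟩
  · intro l m
    have : κ (l * m) = κ l * κ m := huniq _ _ fun x _ => by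
      change c (l.1 (m.1 x)) = _
      rw [hκ, hκ, hσ]
    rw [this]
    exact hproj _ _
  · intro l x _
    rw [hκ, hcov]
  · intro x hx y hy _
    obtain ⟨k, hk⟩ := htrans x hx y hy
    obtain ⟨l, hl⟩ := hperm k
    exact ⟨l, ⟨k, hl⟩, hc (by rw [hl, hk])⟩
  -- Commutation would make the matrices of `l x` and `x` equal by covariance, whereas `hinj`
  -- separates generators.
  · intro l x hx hlx hcomm
    apply hlx
    refine hinj _ (hLSp l x hx) x hx ?_
    rw [hκ, hcov, hcomm.eq, mul_assoc, ← Matrix.star_eq_conjTranspose,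
      Matrix.mem_unitaryGroup_iff.1 (V (κ l)).2, mul_one]

end Model

/-! ### Resolutions of the identity -/

/-- A family of orthogonal projections, indexed by real numbers, summing up to the identity. -/
structure IsResolution (T : Finset ℝ) (P : ℝ → Matrix (Fin 2) (Fin 2) ℂ) : Prop where
  star : ∀ s, (P s)ᴴ = P s
  mul_self : ∀ s, P s * P s = P s
  mul_ne : ∀ s t, s ≠ t → P s * P t = 0
  eq_zero : ∀ s, s ∉ T → P s = 0
  sum : ∑ s ∈ T, P s = 1

/-- The spectral projections of an involution. -/
noncomputable def spectralProj (σ : Matrix (Fin 2) (Fin 2) ℂ) (s : ℝ) :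
    Matrix (Fin 2) (Fin 2) ℂ :=
  if s = 1 then (1 / 2 : ℂ) • (1 + σ) else if s = -1 then (1 / 2 : ℂ) • (1 - σ) else 0

theorem spectralProj_one (σ : Matrix (Fin 2) (Fin 2) ℂ) :
    spectralProj σ 1 = (1 / 2 : ℂ) • (1 + σ) := if_pos rfl

theorem spectralProj_neg_one (σ : Matrix (Fin 2) (Fin 2) ℂ) :
    spectralProj σ (-1) = (1 / 2 : ℂ) • (1 - σ) := by
  rw [spectralProj, if_neg (by norm_num), if_pos rfl]

theorem spectralProj_of_ne (σ : Matrix (Fin 2) (Fin 2) ℂ) {s : ℝ} (h : s ≠ 1) (h' : s ≠ -1) :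
    spectralProj σ s = 0 := by
  rw [spectralProj, if_neg h, if_neg h']

theorem spectralProj_cases {p : ℝ → Prop} (s : ℝ) (h : p 1) (h' : p (-1))
    (h0 : s ≠ 1 → s ≠ -1 → p s) : p s := by
  by_cases h1 : s = 1
  · rwa [h1]
  by_cases h2 : s = -1
  · rwa [h2]
  exact h0 h1 h2

theorem spectralProj_neg (σ : Matrix (Fin 2) (Fin 2) ℂ) (s : ℝ) :
    spectralProj σ (-s) = spectralProj (-σ) s := by
  refine spectralProj_cases (p := fun s => spectralProj σ (-s) = spectralProj (-σ) s) s ?_ ?_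
    fun h h' => ?_
  · rw [spectralProj_one, spectralProj_neg_one, sub_eq_add_neg]
  · rw [neg_neg, spectralProj_one, spectralProj_neg_one, sub_neg_eq_add]
  · rw [spectralProj_of_ne _ h h', spectralProj_of_ne]
    · exact fun h0 => h' (by rw [← h0, neg_neg])
    · exact fun h0 => h (neg_injective h0)

theorem spectralProj_conj {σ V : Matrix (Fin 2) (Fin 2) ℂ} (hV : V * Vᴴ = 1) (s : ℝ) :
    spectralProj (V * σ * Vᴴ) s = V * spectralProj σ s * Vᴴ := by
  refine spectralProj_cases
    (p := fun s => spectralProj (V * σ * Vᴴ) s = V * spectralProj σ s * Vᴴ) s ?_ ?_ fun h h' => ?_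
  · simp only [spectralProj_one, Matrix.mul_smul, Matrix.smul_mul, mul_add, add_mul, mul_one, hV]
  · simp only [spectralProj_neg_one, Matrix.mul_smul, Matrix.smul_mul, mul_sub, sub_mul, mul_one,
      hV]
  · simp only [spectralProj_of_ne _ h h', mul_zero, zero_mul]

theorem isResolution_spectralProj {σ : Matrix (Fin 2) (Fin 2) ℂ} (h : σᴴ = σ) (hσ : σ * σ = 1) :
    IsResolution {1, -1} (spectralProj σ) where
  star s := by
    refine spectralProj_cases (p := fun s => (spectralProj σ s)ᴴ = spectralProj σ s) s ?_ ?_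
      fun h h' => ?_
    · simp [spectralProj_one, h]
    · simp [spectralProj_neg_one, h]
    · simp [spectralProj_of_ne _ h h']
  mul_self s := by
    refine spectralProj_cases (p := fun s => spectralProj σ s * spectralProj σ s = spectralProj σ s)
      s ?_ ?_ fun h h' => ?_
    · simp only [spectralProj_one, Matrix.mul_smul, Matrix.smul_mul, mul_add, add_mul, mul_one,
        one_mul, hσ]
      module
    · simp only [spectralProj_neg_one, Matrix.mul_smul, Matrix.smul_mul, mul_sub, sub_mul, mul_one,
        one_mul, hσ]
      module
    · simp [spectralProj_of_ne _ h h']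
  mul_ne s t hst := by
    refine spectralProj_cases (p := fun s => s ≠ t → spectralProj σ s * spectralProj σ t = 0)
      s ?_ ?_ (fun h h' _ => ?_) hst
    · refine spectralProj_cases (p := fun t => 1 ≠ t → spectralProj σ 1 * spectralProj σ t = 0)
        t (fun h => absurd rfl h) (fun _ => ?_) (fun h h' _ => ?_)
      · simp only [spectralProj_one, spectralProj_neg_one, Matrix.mul_smul, Matrix.smul_mul,
          mul_sub, add_mul, mul_one, one_mul, hσ]
        module
      · simp [spectralProj_of_ne _ h h']
    · refine spectralProj_cases (p := fun t => -1 ≠ t → spectralProj σ (-1) * spectralProj σ t = 0)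
        t (fun _ => ?_) (fun h => absurd rfl h) (fun h h' _ => ?_)
      · simp only [spectralProj_one, spectralProj_neg_one, Matrix.mul_smul, Matrix.smul_mul,
          mul_add, sub_mul, mul_one, one_mul, hσ]
        module
      · simp [spectralProj_of_ne _ h h']
    · simp [spectralProj_of_ne _ h h']
  eq_zero s hs := by
    simp only [Finset.mem_insert, Finset.mem_singleton, not_or] at hs
    exact spectralProj_of_ne _ hs.1 hs.2
  sum := by
    rw [Finset.sum_pair (by norm_num), spectralProj_one, spectralProj_neg_one]
    module

/-- The trivial resolution of the identity. -/
noncomputable def pointProj (s : ℝ) : Matrix (Fin 2) (Fin 2) ℂ := if s = 0 then 1 else 0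

theorem isResolution_pointProj : IsResolution {0} pointProj where
  star s := by unfold pointProj; split_ifs <;> simp
  mul_self s := by unfold pointProj; split_ifs <;> simp
  mul_ne s t hst := by
    unfold pointProj
    split_ifs with h1 h2
    · exact absurd (h1.trans h2.symm) hst
    all_goals simp
  eq_zero s hs := if_neg (by simpa using hs)
  sum := by simp [pointProj]

theorem IsResolution.sum_conv {T : Finset ℝ} {P : ℝ → Matrix (Fin 2) (Fin 2) ℂ}
    (hP : IsResolution T P) (X Y : Matrix (Fin 2) (Fin 2) ℂ) (y : ℝ) :
    ∑ s ∈ T, X * (P s * P (s - y)) * Y = if y = 0 then X * Y else 0 := by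
  split_ifs with hy
  · subst hy
    simp only [sub_zero, hP.mul_self]
    rw [← Finset.sum_mul, ← Finset.mul_sum, hP.sum, mul_one]
  · refine Finset.sum_eq_zero fun s _ => ?_
    rw [hP.mul_ne s (s - y) (fun h => hy (by linarith)), mul_zero, zero_mul]

/-- The sums collapse from the inside: orthogonality of the innermost projections leaves only `z =
0` and their sum is the identity, and then the same happens for the next family. No commutation
between the families is needed. -/
theorem sum_conv_eq {T₁ T₂ T₃ : Finset ℝ} {P₁ P₂ P₃ : ℝ → Matrix (Fin 2) (Fin 2) ℂ}
    (h₁ : IsResolution T₁ P₁) (h₂ : IsResolution T₂ P₂) (h₃ : IsResolution T₃ P₃) (x y z : ℝ) :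
    ∑ s ∈ T₁, ∑ t ∈ T₂, ∑ u ∈ T₃,
      P₁ s * P₂ t * P₃ u * (P₁ (s - x) * P₂ (t - y) * P₃ (u - z))ᴴ =
      if x = 0 ∧ y = 0 ∧ z = 0 then 1 else 0 := by
  have e1 : ∀ s t, ∑ u ∈ T₃, P₁ s * P₂ t * P₃ u * (P₁ (s - x) * P₂ (t - y) * P₃ (u - z))ᴴ =
      if z = 0 then P₁ s * P₂ t * (P₂ (t - y) * P₁ (s - x)) else 0 := by
    intro s t
    rw [← h₃.sum_conv]
    refine Finset.sum_congr rfl fun u _ => ?_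
    rw [Matrix.conjTranspose_mul, Matrix.conjTranspose_mul, h₁.star, h₂.star, h₃.star]
    simp only [mul_assoc]
  have e2 : ∀ s, ∑ t ∈ T₂, P₁ s * P₂ t * (P₂ (t - y) * P₁ (s - x)) =
      if y = 0 then P₁ s * P₁ (s - x) else 0 := by
    intro s
    rw [← h₂.sum_conv]
    refine Finset.sum_congr rfl fun u _ => ?_
    simp only [mul_assoc]
  have e3 : ∑ s ∈ T₁, P₁ s * P₁ (s - x) = if x = 0 then 1 else 0 := by
    have := h₁.sum_conv 1 1 x
    simpa only [one_mul, mul_one] using this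
  simp only [e1]
  by_cases hz : z = 0
  · simp only [hz, if_true, e2]
    by_cases hy : y = 0
    · simp only [hy, if_true, e3, and_true]
    · simp [hy]
  · simp [hz]

section Product

variable {G : Type*} [AddCommGroup G] [DecidableEq G]

/-- The unitary walk operator given by three resolutions of the identity. -/
theorem exists_unitary_of_isResolution {Sp : Finset G} {c : G →+ ℝ × ℝ × ℝ}
    (hc : Function.Injective c) {T₁ T₂ T₃ : Finset ℝ} {P₁ P₂ P₃ : ℝ → Matrix (Fin 2) (Fin 2) ℂ}
    (h₁ : IsResolution T₁ P₁) (h₂ : IsResolution T₂ P₂) (h₃ : IsResolution T₃ P₃)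
    (hT : ∀ s ∈ T₁, ∀ t ∈ T₂, ∀ u ∈ T₃, ∃ x ∈ stepSet Sp, c x = (s, t, u)) :
    ∃ W ∈ unitary (WalkSpace G 2 →L[ℂ] WalkSpace G 2),
      IsWalkOperator Sp (fun x => P₁ (c x).1 * P₂ (c x).2.1 * P₃ (c x).2.2) W := by
  have hc0 : ∀ y, ((c y).1 = 0 ∧ (c y).2.1 = 0 ∧ (c y).2.2 = 0) ↔ y = 0 := by
    intro y
    rw [← (injective_iff_map_eq_zero' c).1 hc y, Prod.ext_iff, Prod.ext_iff]
    rfl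
  -- Every point of the grid is hit by a step, and steps outside the grid contribute zero.
  have hsum : ∀ F : ℝ × ℝ × ℝ → Matrix (Fin 2) (Fin 2) ℂ,
      (∀ v, (v.1 ∉ T₁ ∨ v.2.1 ∉ T₂ ∨ v.2.2 ∉ T₃) → F v = 0) →
      ∑ g ∈ stepSet Sp, F (c g) = ∑ s ∈ T₁, ∑ t ∈ T₂, ∑ u ∈ T₃, F (s, t, u) := by
    intro F hF
    rw [← Finset.sum_image (f := F) (s := stepSet Sp) (g := c) hc.injOn]
    rw [← Finset.sum_subset (s₁ := T₁ ×ˢ T₂ ×ˢ T₃)]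
    · rw [Finset.sum_product]
      exact Finset.sum_congr rfl fun s _ => Finset.sum_product _ _ _
    · rintro ⟨s, t, u⟩ h
      simp only [Finset.mem_product] at h
      obtain ⟨x, hx, hxc⟩ := hT s h.1 t h.2.1 u h.2.2
      exact Finset.mem_image.2 ⟨x, hx, hxc⟩
    · intro v _ hv
      apply hF
      simp only [Finset.mem_product] at hv
      tauto
  have hvan : ∀ v : ℝ × ℝ × ℝ, (v.1 ∉ T₁ ∨ v.2.1 ∉ T₂ ∨ v.2.2 ∉ T₃) →
      P₁ v.1 * P₂ v.2.1 * P₃ v.2.2 = 0 := by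
    rintro v (h | h | h)
    · rw [h₁.eq_zero _ h, zero_mul, zero_mul]
    · rw [h₂.eq_zero _ h, mul_zero, zero_mul]
    · rw [h₃.eq_zero _ h, mul_zero]
  refine exists_unitary_of_convolution (fun x hx => hvan _ ?_) (fun y => ?_) (fun y => ?_)
  · by_contra! hin
    obtain ⟨x', hx', hcx⟩ := hT _ hin.1 _ hin.2.1 _ hin.2.2
    exact hx (by rwa [← hc hcx])
  · have e := hsum (fun v => (P₁ v.1 * P₂ v.2.1 * P₃ v.2.2)ᴴ *
      (P₁ (v.1 - (c y).1) * P₂ (v.2.1 - (c y).2.1) * P₃ (v.2.2 - (c y).2.2))) (fun v hv => by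
      rw [hvan v hv, Matrix.conjTranspose_zero, zero_mul])
    simp only [_root_.map_sub, Prod.fst_sub, Prod.snd_sub]
    rw [e]
    -- With the adjoint on the left, the first family is innermost, so the families enter in reverse
    -- order.
    have e2 := sum_conv_eq h₃ h₂ h₁ (c y).2.2 (c y).2.1 (c y).1
    rw [if_congr (show _ ↔ y = 0 by rw [← hc0 y]; tauto) rfl rfl] at e2
    rw [← e2, Finset.sum_comm' (t' := T₂) (s' := fun _ => T₁) (by tauto)]
    rw [Finset.sum_congr rfl fun t _ => Finset.sum_comm]
    rw [Finset.sum_comm]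
    refine Finset.sum_congr rfl fun u _ => Finset.sum_congr rfl fun t _ =>
      Finset.sum_congr rfl fun s _ => ?_
    simp only [Matrix.conjTranspose_mul, h₁.star, h₂.star, h₃.star, mul_assoc]
  · have e := hsum (fun v => (P₁ v.1 * P₂ v.2.1 * P₃ v.2.2) *
      (P₁ (v.1 - (c y).1) * P₂ (v.2.1 - (c y).2.1) * P₃ (v.2.2 - (c y).2.2))ᴴ) (fun v hv => by
      rw [hvan v hv, zero_mul])
    simp only [_root_.map_sub, Prod.fst_sub, Prod.snd_sub]
    rw [e, sum_conv_eq h₁ h₂ h₃, if_congr (hc0 y) rfl rfl]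

end Product

/-! ### Walks with Pauli symmetry -/

theorem pauliX_mul_self : pauliX * pauliX = 1 := by
  ext i j; fin_cases i <;> fin_cases j <;> simp [pauliX]

theorem pauliY_mul_self : pauliY * pauliY = 1 := by
  ext i j; fin_cases i <;> fin_cases j <;> simp [pauliY]

theorem pauliZ_mul_self : pauliZ * pauliZ = 1 := by
  ext i j; fin_cases i <;> fin_cases j <;> simp [pauliZ]

theorem pauliX_conjTranspose : pauliXᴴ = pauliX := by
  ext i j; fin_cases i <;> fin_cases j <;> simp [pauliX]

theorem pauliY_conjTranspose : pauliYᴴ = pauliY := by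
  ext i j; fin_cases i <;> fin_cases j <;> simp [pauliY]

theorem pauliZ_conjTranspose : pauliZᴴ = pauliZ := by
  ext i j; fin_cases i <;> fin_cases j <;> simp [pauliZ]

theorem pauliX_mem : pauliX ∈ Matrix.unitaryGroup (Fin 2) ℂ := by
  rw [Matrix.mem_unitaryGroup_iff, Matrix.star_eq_conjTranspose, pauliX_conjTranspose,
    pauliX_mul_self]

theorem pauliZ_mem : pauliZ ∈ Matrix.unitaryGroup (Fin 2) ℂ := by
  rw [Matrix.mem_unitaryGroup_iff, Matrix.star_eq_conjTranspose, pauliZ_conjTranspose,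
    pauliZ_mul_self]

/-- The Pauli matrices as a projective representation of the group of sign changes. -/
def signPauli (e : ℤˣ × ℤˣ) : Matrix.unitaryGroup (Fin 2) ℂ :=
  (if e.1 = 1 then 1 else ⟨pauliZ, pauliZ_mem⟩) * (if e.2 = 1 then 1 else ⟨pauliX, pauliX_mem⟩)

theorem signPauli_eq (e : ℤˣ × ℤˣ) : (signPauli e : Matrix (Fin 2) (Fin 2) ℂ) =
    (if e.1 = 1 then 1 else pauliZ) * (if e.2 = 1 then 1 else pauliX) := by
  rw [signPauli]
  split_ifs <;> rfl

theorem pauliX_mul_pauliZ : pauliX * pauliZ = -(pauliZ * pauliX) := by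
  ext i j; fin_cases i <;> fin_cases j <;> simp [pauliX, pauliZ]

theorem neg_units_ne_one : (-1 : ℤˣ) ≠ 1 := by decide

theorem signPauli_mul (e e' : ℤˣ × ℤˣ) : ∃ z : ℂ, ‖z‖ = 1 ∧
    (signPauli (e * e') : Matrix (Fin 2) (Fin 2) ℂ) =
      z • ((signPauli e : Matrix (Fin 2) (Fin 2) ℂ) * (signPauli e' : Matrix (Fin 2) (Fin 2) ℂ)) := by
  have hXZ : ∀ M, pauliX * (pauliZ * M) = -(pauliZ * (pauliX * M)) := fun M => by
    rw [← mul_assoc, pauliX_mul_pauliZ, neg_mul, mul_assoc]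
  have hZZ : ∀ M, pauliZ * (pauliZ * M) = M := fun M => by
    rw [← mul_assoc, pauliZ_mul_self, one_mul]
  obtain ⟨a, b⟩ := e
  obtain ⟨a', b'⟩ := e'
  simp only [signPauli_eq, Prod.mk_mul_mk]
  rcases Int.units_eq_one_or a with rfl | rfl <;> rcases Int.units_eq_one_or b with rfl | rfl <;>
    rcases Int.units_eq_one_or a' with rfl | rfl <;>
    rcases Int.units_eq_one_or b' with rfl | rfl <;>
    simp only [mul_one, one_mul, mul_neg, neg_neg, if_true, neg_units_ne_one, if_false,
      mul_assoc, hXZ, hZZ, pauliX_mul_self, pauliZ_mul_self, pauliX_mul_pauliZ] <;>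
    first
      | exact ⟨1, norm_one, (one_smul _ _).symm⟩
      | exact ⟨-1, by simp, by rw [neg_smul, one_smul, neg_neg]⟩

/-- The group of sign changes acting on space. -/
noncomputable def signAct : ℤˣ × ℤˣ →* AddMonoid.End (ℝ × ℝ × ℝ) where
  toFun e := AddMonoidHom.mk' (fun v => (((e.1 : ℤ) : ℝ) * v.1,
    ((e.1 : ℤ) : ℝ) * ((e.2 : ℤ) : ℝ) * v.2.1, ((e.2 : ℤ) : ℝ) * v.2.2)) (fun v w => by
      ext <;> simp <;> ring)
  map_one' := AddMonoidHom.ext fun v => by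
    refine Prod.ext ?_ (Prod.ext ?_ ?_)
    · change (((1 : ℤˣ) : ℤ) : ℝ) * v.1 = v.1
      simp
    · change (((1 : ℤˣ) : ℤ) : ℝ) * (((1 : ℤˣ) : ℤ) : ℝ) * v.2.1 = v.2.1
      simp
    · change (((1 : ℤˣ) : ℤ) : ℝ) * v.2.2 = v.2.2
      simp
  map_mul' e e' := AddMonoidHom.ext fun v => by
    refine Prod.ext ?_ (Prod.ext ?_ ?_)
    · change (((e.1 * e'.1 : ℤˣ) : ℤ) : ℝ) * v.1 = ((e.1 : ℤ) : ℝ) * (((e'.1 : ℤ) : ℝ) * v.1)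
      push_cast
      ring
    · change (((e.1 * e'.1 : ℤˣ) : ℤ) : ℝ) * (((e.2 * e'.2 : ℤˣ) : ℤ) : ℝ) * v.2.1 =
        ((e.1 : ℤ) : ℝ) * ((e.2 : ℤ) : ℝ) * (((e'.1 : ℤ) : ℝ) * ((e'.2 : ℤ) : ℝ) * v.2.1)
      push_cast
      ring
    · change (((e.2 * e'.2 : ℤˣ) : ℤ) : ℝ) * v.2.2 = ((e.2 : ℤ) : ℝ) * (((e'.2 : ℤ) : ℝ) * v.2.2)
      push_cast
      ring

theorem signAct_apply (e : ℤˣ × ℤˣ) (v : ℝ × ℝ × ℝ) :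
    signAct e v = (((e.1 : ℤ) : ℝ) * v.1, ((e.1 : ℤ) : ℝ) * ((e.2 : ℤ) : ℝ) * v.2.1,
      ((e.2 : ℤ) : ℝ) * v.2.2) := rfl

theorem unitaryGroup_mul_conjTranspose (V : Matrix.unitaryGroup (Fin 2) ℂ) :
    (V : Matrix (Fin 2) (Fin 2) ℂ) * (V : Matrix (Fin 2) (Fin 2) ℂ)ᴴ = 1 :=
  Matrix.mem_unitaryGroup_iff.1 V.2

theorem unitaryGroup_conjTranspose_mul (V : Matrix.unitaryGroup (Fin 2) ℂ) :
    (V : Matrix (Fin 2) (Fin 2) ℂ)ᴴ * (V : Matrix (Fin 2) (Fin 2) ℂ) = 1 :=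
  Matrix.mem_unitaryGroup_iff'.1 V.2

theorem spectralProj_units_mul {σ : Matrix (Fin 2) (Fin 2) ℂ} {V : Matrix.unitaryGroup (Fin 2) ℂ}
    {e : ℤˣ} (h : (V : Matrix (Fin 2) (Fin 2) ℂ) * σ * (V : Matrix (Fin 2) (Fin 2) ℂ)ᴴ =
      ((e : ℤ) : ℂ) • σ) (s : ℝ) :
    spectralProj σ (((e : ℤ) : ℝ) * s) =
      (V : Matrix (Fin 2) (Fin 2) ℂ) * spectralProj σ s * (V : Matrix (Fin 2) (Fin 2) ℂ)ᴴ := by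
  rw [← spectralProj_conj (unitaryGroup_mul_conjTranspose V), h]
  rcases Int.units_eq_one_or e with rfl | rfl
  · simp
  · simp [spectralProj_neg]

theorem signPauli_conj_pauliX (e : ℤˣ × ℤˣ) : (signPauli e : Matrix (Fin 2) (Fin 2) ℂ) * pauliX *
    (signPauli e : Matrix (Fin 2) (Fin 2) ℂ)ᴴ = ((e.1 : ℤ) : ℂ) • pauliX := by
  obtain ⟨a, b⟩ := e
  rw [signPauli_eq]
  rcases Int.units_eq_one_or a with rfl | rfl <;> rcases Int.units_eq_one_or b with rfl | rfl <;>
    simp only [mul_one, one_mul, if_true, neg_units_ne_one, if_false, Matrix.conjTranspose_one,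
      Matrix.conjTranspose_mul, pauliX_conjTranspose, pauliZ_conjTranspose] <;> ext i j <;>
    fin_cases i <;> fin_cases j <;> simp [pauliX, pauliZ]

theorem signPauli_conj_pauliZ (e : ℤˣ × ℤˣ) : (signPauli e : Matrix (Fin 2) (Fin 2) ℂ) * pauliZ *
    (signPauli e : Matrix (Fin 2) (Fin 2) ℂ)ᴴ = ((e.2 : ℤ) : ℂ) • pauliZ := by
  obtain ⟨a, b⟩ := e
  rw [signPauli_eq]
  rcases Int.units_eq_one_or a with rfl | rfl <;> rcases Int.units_eq_one_or b with rfl | rfl <;>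
    simp only [mul_one, one_mul, if_true, neg_units_ne_one, if_false, Matrix.conjTranspose_one,
      Matrix.conjTranspose_mul, pauliX_conjTranspose, pauliZ_conjTranspose] <;> ext i j <;>
    fin_cases i <;> fin_cases j <;> simp [pauliX, pauliZ]

theorem signPauli_conj_pauliY (e : ℤˣ × ℤˣ) : (signPauli e : Matrix (Fin 2) (Fin 2) ℂ) * pauliY *
    (signPauli e : Matrix (Fin 2) (Fin 2) ℂ)ᴴ = (((e.1 * e.2 : ℤˣ) : ℤ) : ℂ) • pauliY := by
  obtain ⟨a, b⟩ := e
  rw [signPauli_eq]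
  rcases Int.units_eq_one_or a with rfl | rfl <;> rcases Int.units_eq_one_or b with rfl | rfl <;>
    simp only [mul_one, one_mul, if_true, neg_units_ne_one, if_false, Matrix.conjTranspose_one,
      Matrix.conjTranspose_mul, pauliX_conjTranspose, pauliZ_conjTranspose] <;> ext i j <;>
    fin_cases i <;> fin_cases j <;> simp [pauliX, pauliY, pauliZ]

/-- The transition matrices of a walk with Pauli symmetry. -/
noncomputable def pauliStep (P : ℝ → Matrix (Fin 2) (Fin 2) ℂ) (v : ℝ × ℝ × ℝ) :
    Matrix (Fin 2) (Fin 2) ℂ :=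
  spectralProj pauliX v.1 * P v.2.1 * spectralProj pauliZ v.2.2

theorem isResolution_pauliX : IsResolution {1, -1} (spectralProj pauliX) :=
  isResolution_spectralProj pauliX_conjTranspose pauliX_mul_self

theorem isResolution_pauliY : IsResolution {1, -1} (spectralProj pauliY) :=
  isResolution_spectralProj pauliY_conjTranspose pauliY_mul_self

theorem isResolution_pauliZ : IsResolution {1, -1} (spectralProj pauliZ) :=
  isResolution_spectralProj pauliZ_conjTranspose pauliZ_mul_self

/-- Multiplying by the outer projections of `v` fixes its matrix and annihilates that of `w`, unless
the outer coordinates agree. -/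
theorem pauliStep_eq {P : ℝ → Matrix (Fin 2) (Fin 2) ℂ} {v w : ℝ × ℝ × ℝ}
    (hv : pauliStep P v ≠ 0) (h : pauliStep P v = pauliStep P w) : v.1 = w.1 ∧ v.2.2 = w.2.2 := by
  constructor
  · by_contra hne
    apply hv
    have h1 := congrArg (spectralProj pauliX v.1 * ·) h
    simp only [pauliStep] at h1
    rw [← mul_assoc, ← mul_assoc, isResolution_pauliX.mul_self, ← mul_assoc, ← mul_assoc,
      isResolution_pauliX.mul_ne _ _ hne, zero_mul, zero_mul] at h1
    exact h1
  · by_contra hne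
    apply hv
    have h1 := congrArg (· * spectralProj pauliZ v.2.2) h
    simp only [pauliStep] at h1
    rw [mul_assoc, isResolution_pauliZ.mul_self, mul_assoc _ (spectralProj pauliZ w.2.2),
      isResolution_pauliZ.mul_ne _ _ (Ne.symm hne), mul_zero] at h1
    exact h1

section

variable {G : Type*} [AddCommGroup G] [DecidableEq G] {K : Type*} [Group K]

/-- Each family of projections defines a conditional shift along one coordinate, so the composite
walk is unitary, and conjugation by Pauli matrices changes the signs of coordinates. The middle
family `P` is left free: it is trivial for the plane and belongs to `σ_Y` for space. -/
theorem exists_isIsotropicWalk_of_pauli {Sp : Finset G} (hg : IsGeneratingSet Sp)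
    {c : G →+ ℝ × ℝ × ℝ} (hc : Function.Injective c) {M : Set (ℝ × ℝ × ℝ)}
    (hM : c '' (Sp : Set G) = M) (hM0 : M.Nonempty) (ι : K →* ℤˣ × ℤˣ)
    (hι : Function.Injective ι) {T : Finset ℝ} {P : ℝ → Matrix (Fin 2) (Fin 2) ℂ}
    (hP : IsResolution T P) (hPe : ∀ (e : ℤˣ × ℤˣ) (s : ℝ),
      P (((e.1 : ℤ) : ℝ) * ((e.2 : ℤ) : ℝ) * s) = (signPauli e : Matrix (Fin 2) (Fin 2) ℂ) * P s *
        (signPauli e : Matrix (Fin 2) (Fin 2) ℂ)ᴴ)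
    (hne : ∀ v ∈ M, pauliStep P v ≠ 0 ∧ pauliStep P (-v) ≠ 0)
    (hmem : ∀ k, ∀ v ∈ M, signAct (ι k) v ∈ M)
    (htr : ∀ v ∈ M, ∀ w ∈ M, ∃ k, signAct (ι k) v = w)
    (hdist : ∀ v ∈ M, ∀ w ∈ M, v.1 = w.1 → v.2.2 = w.2.2 → v = w)
    (hunit : ∀ v ∈ M, v.1 ≠ 0 ∧ v.2.2 ≠ 0)
    (hT : ∀ s ∈ ({1, -1} : Finset ℝ), ∀ t ∈ T, ∀ u ∈ ({1, -1} : Finset ℝ),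
      (s, t, u) ∈ M ∨ -(s, t, u) ∈ M) :
    ∃ (L : Subgroup (Equiv.Perm G)) (U : L → Matrix.unitaryGroup (Fin 2) ℂ),
      IsIsotropicWalk Sp (fun x => pauliStep P (c x)) L U := by
  have hin : ∀ x ∈ Sp, c x ∈ M := fun x hx => hM ▸ ⟨x, hx, rfl⟩
  have hout : ∀ v ∈ M, ∃ x ∈ Sp, c x = v := fun v hv => by
    rw [← hM] at hv
    obtain ⟨x, hx, h⟩ := hv
    exact ⟨x, hx, h⟩
  refine exists_isIsotropicWalk hg hc (pauliStep P) (signAct.comp ι) (fun k => signPauli (ι k))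
    (fun k k' => by rw [_root_.map_mul]; exact signPauli_mul _ _) ?_
    (fun k x hx => hout _ (hmem k _ (hin x hx))) (fun x hx y hy => htr _ (hin x hx) _ (hin y hy))
    ?_ ?_ ?_ ?_
  · intro k v
    change pauliStep P (signAct (ι k) v) = _
    rw [signAct_apply, pauliStep, pauliStep, hPe,
      spectralProj_units_mul (signPauli_conj_pauliX (ι k)),
      spectralProj_units_mul (signPauli_conj_pauliZ (ι k))]
    have h1 : ∀ X Y : Matrix (Fin 2) (Fin 2) ℂ,
        X * (signPauli (ι k) : Matrix (Fin 2) (Fin 2) ℂ)ᴴ * (signPauli (ι k) * Y) = X * Y := by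
      intro X Y
      rw [mul_assoc, ← mul_assoc _ _ Y, unitaryGroup_conjTranspose_mul, one_mul]
    rw [mul_assoc _ (P v.2.1), h1, mul_assoc _ (spectralProj pauliZ v.2.2), ← mul_assoc _ (P v.2.1),
      h1]
    simp only [mul_assoc]
  · intro k hk
    obtain ⟨v, hv⟩ := hM0
    obtain ⟨x, hx, rfl⟩ := hout v hv
    have h1 : signAct (ι k) (c x) = c x := hk x hx
    obtain ⟨u1, u2⟩ := hunit _ hv
    rw [signAct_apply, Prod.ext_iff, Prod.ext_iff] at h1
    obtain ⟨e1, -, e2⟩ := h1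
    simp only at e1 e2
    have key : ∀ (e : ℤˣ) (r : ℝ), r ≠ 0 → ((e : ℤ) : ℝ) * r = r → e = 1 := by
      intro e r hr h
      have h' := mul_right_cancel₀ hr (h.trans (one_mul r).symm)
      have h'' : (e : ℤ) = 1 := by exact_mod_cast h'
      exact Units.ext h''
    apply hι
    rw [_root_.map_one]
    exact Prod.ext (key _ _ u1 e1) (key _ _ u2 e2)
  · intro x hx y hy h
    obtain ⟨h1, h2⟩ := pauliStep_eq (hne _ (hin x hx)).1 h
    exact hc (hdist _ (hin x hx) _ (hin y hy) h1 h2)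
  · intro x hx
    rcases mem_edgeSet.1 hx with h | h
    · exact (hne _ (hin x h)).1
    · have := (hne _ (hin _ h)).2
      rwa [_root_.map_neg, neg_neg] at this
  · refine exists_unitary_of_isResolution hc isResolution_pauliX hP isResolution_pauliZ
      fun s hs t ht u hu => ?_
    rcases hT s hs t ht u hu with h | h
    · obtain ⟨x, hx, h⟩ := hout _ h
      exact ⟨x, mem_stepSet.2 (Or.inr (mem_edgeSet.2 (Or.inl hx))), h⟩
    · obtain ⟨x, hx, h⟩ := hout _ h
      exact ⟨-x, mem_stepSet.2 (Or.inr (mem_edgeSet.2 (Or.inr (by rwa [neg_neg])))), by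
        rw [_root_.map_neg, h, neg_neg]⟩

end

/-! ### Isotropic walks on the reference lattices -/

theorem spectralProj_pauliX_one : spectralProj pauliX 1 = !![1 / 2, 1 / 2; 1 / 2, 1 / 2] := by
  rw [spectralProj_one]
  ext i j; fin_cases i <;> fin_cases j <;> simp [pauliX]

theorem spectralProj_pauliX_neg_one :
    spectralProj pauliX (-1) = !![1 / 2, -1 / 2; -1 / 2, 1 / 2] := by
  rw [spectralProj_neg_one]
  ext i j; fin_cases i <;> fin_cases j <;> simp [pauliX] <;> ring

theorem spectralProj_pauliY_one :
    spectralProj pauliY 1 = !![1 / 2, -Complex.I / 2; Complex.I / 2, 1 / 2] := by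
  rw [spectralProj_one]
  ext i j; fin_cases i <;> fin_cases j <;> simp [pauliY] <;> ring

theorem spectralProj_pauliY_neg_one :
    spectralProj pauliY (-1) = !![1 / 2, Complex.I / 2; -Complex.I / 2, 1 / 2] := by
  rw [spectralProj_neg_one]
  ext i j; fin_cases i <;> fin_cases j <;> simp [pauliY] <;> ring

theorem spectralProj_pauliZ_one : spectralProj pauliZ 1 = !![1, 0; 0, 0] := by
  rw [spectralProj_one]
  ext i j; fin_cases i <;> fin_cases j <;> norm_num [pauliZ]

theorem spectralProj_pauliZ_neg_one : spectralProj pauliZ (-1) = !![0, 0; 0, 1] := by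
  rw [spectralProj_neg_one]
  ext i j; fin_cases i <;> fin_cases j <;> norm_num [pauliZ]

theorem pauliStep_pointProj_ne_zero {s u : ℝ} (hs : s = 1 ∨ s = -1) (hu : u = 1 ∨ u = -1) :
    pauliStep pointProj (s, 0, u) ≠ 0 := by
  intro h
  have h0 := congrFun (congrFun h 0) 0
  have h1 := congrFun (congrFun h 1) 1
  simp only [pauliStep, pointProj, if_true, mul_one] at h0 h1
  rcases hs with rfl | rfl <;> rcases hu with rfl | rfl <;>
    simp [spectralProj_pauliX_one, spectralProj_pauliX_neg_one, spectralProj_pauliZ_one,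
      spectralProj_pauliZ_neg_one] at h0 h1

theorem pauliStep_pauliY_ne_zero {s t u : ℝ} (hs : s = 1 ∨ s = -1) (ht : t = 1 ∨ t = -1)
    (hu : u = 1 ∨ u = -1) : pauliStep (spectralProj pauliY) (s, t, u) ≠ 0 := by
  intro h
  have h0 := congrArg Complex.re (congrFun (congrFun h 0) 0)
  have h1 := congrArg Complex.re (congrFun (congrFun h 1) 1)
  simp only [pauliStep] at h0 h1
  rcases hs with rfl | rfl <;> rcases ht with rfl | rfl <;> rcases hu with rfl | rfl <;>
    simp [spectralProj_pauliX_one, spectralProj_pauliX_neg_one, spectralProj_pauliY_one,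
      spectralProj_pauliY_neg_one, spectralProj_pauliZ_one, spectralProj_pauliZ_neg_one,
      Matrix.mul_apply, Fin.sum_univ_two] at h0 h1

theorem pointProj_conj (e : ℤˣ × ℤˣ) (s : ℝ) :
    pointProj (((e.1 : ℤ) : ℝ) * ((e.2 : ℤ) : ℝ) * s) =
      (signPauli e : Matrix (Fin 2) (Fin 2) ℂ) * pointProj s *
        (signPauli e : Matrix (Fin 2) (Fin 2) ℂ)ᴴ := by
  have h : ((e.1 : ℤ) : ℝ) * ((e.2 : ℤ) : ℝ) * s = 0 ↔ s = 0 := by simp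
  unfold pointProj
  rw [if_congr h rfl rfl]
  split_ifs
  · rw [mul_one, unitaryGroup_mul_conjTranspose]
  · rw [mul_zero, zero_mul]

theorem spectralProj_pauliY_conj (e : ℤˣ × ℤˣ) (s : ℝ) :
    spectralProj pauliY (((e.1 : ℤ) : ℝ) * ((e.2 : ℤ) : ℝ) * s) =
      (signPauli e : Matrix (Fin 2) (Fin 2) ℂ) * spectralProj pauliY s *
        (signPauli e : Matrix (Fin 2) (Fin 2) ℂ)ᴴ := by
  rw [← spectralProj_units_mul (signPauli_conj_pauliY e)]
  push_cast
  rfl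

theorem exists_units_int {p : ℤˣ → Prop} : (∃ e, p e) ↔ p 1 ∨ p (-1) := by
  constructor
  · rintro ⟨e, he⟩
    rcases Int.units_eq_one_or e with rfl | rfl
    exacts [Or.inl he, Or.inr he]
  · rintro (h | h)
    exacts [⟨_, h⟩, ⟨_, h⟩]

/-- Diagonal coordinates of the plane. -/
def planeCoord : EuclideanSpace ℝ (Fin 2) →+ ℝ × ℝ × ℝ :=
  AddMonoidHom.mk' (fun v => (v 0 + v 1, 0, v 0 - v 1)) fun v w => by
    ext <;> simp <;> ring

/-- Diagonal coordinates of the plane, in the opposite order. -/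
def planeCoord' : EuclideanSpace ℝ (Fin 2) →+ ℝ × ℝ × ℝ :=
  AddMonoidHom.mk' (fun v => (v 0 - v 1, 0, v 0 + v 1)) fun v w => by
    ext <;> simp <;> ring

/-- The coordinates of space. -/
def spaceCoord : EuclideanSpace ℝ (Fin 3) →+ ℝ × ℝ × ℝ :=
  AddMonoidHom.mk' (fun v => (v 0, v 1, v 2)) fun v w => by
    ext <;> simp

theorem planeCoord_apply (v : EuclideanSpace ℝ (Fin 2)) :
    planeCoord v = (v 0 + v 1, 0, v 0 - v 1) := rfl

theorem planeCoord'_apply (v : EuclideanSpace ℝ (Fin 2)) :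
    planeCoord' v = (v 0 - v 1, 0, v 0 + v 1) := rfl

theorem spaceCoord_apply (v : EuclideanSpace ℝ (Fin 3)) : spaceCoord v = (v 0, v 1, v 2) := rfl

theorem planeCoord_injective : Function.Injective planeCoord := by
  intro v w h
  rw [planeCoord_apply, planeCoord_apply, Prod.ext_iff, Prod.ext_iff] at h
  obtain ⟨h1, -, h2⟩ := h
  simp only at h1 h2
  ext i
  fin_cases i <;> simp only [Fin.zero_eta, Fin.mk_one] <;> linarith

theorem planeCoord'_injective : Function.Injective planeCoord' := by
  intro v w h
  rw [planeCoord'_apply, planeCoord'_apply, Prod.ext_iff, Prod.ext_iff] at h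
  obtain ⟨h1, -, h2⟩ := h
  simp only at h1 h2
  ext i
  fin_cases i <;> simp only [Fin.zero_eta, Fin.mk_one] <;> linarith

theorem spaceCoord_injective : Function.Injective spaceCoord := by
  intro v w h
  rw [spaceCoord_apply, spaceCoord_apply, Prod.ext_iff, Prod.ext_iff] at h
  obtain ⟨h1, h2, h3⟩ := h
  ext i
  fin_cases i
  exacts [h1, h2, h3]

section

variable {G : Type*} [AddCommGroup G] [DecidableEq G] {Sp : Finset G}

/-- In diagonal coordinates the four generators are the sign vectors `(±1, 0, ±1)`, permuted simply
transitively by the full group of sign changes. -/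
theorem exists_walk_squareStepsSymm (hg : IsGeneratingSet Sp) (hr : RealizedBy Sp squareStepsSymm) :
    AdmitsIsotropicWalk Sp := by
  obtain ⟨φ, hφ, hN⟩ := hr
  refine ⟨_, exists_isIsotropicWalk_of_pauli hg (c := planeCoord.comp φ)
    (planeCoord_injective.comp hφ)
    (M := {(1, 0, 1), (1, 0, -1), (-1, 0, -1), (-1, 0, 1)}) ?_ ⟨_, Or.inl rfl⟩
    (MonoidHom.id (ℤˣ × ℤˣ)) Function.injective_id isResolution_pointProj pointProj_conj
    ?_ ?_ ?_ ?_ ?_ ?_⟩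
  · rw [AddMonoidHom.coe_comp, Set.image_comp, hN, squareStepsSymm]
    simp [Set.image_insert_eq, planeCoord_apply]
  · rintro v (rfl | rfl | rfl | rfl) <;>
      refine ⟨pauliStep_pointProj_ne_zero (by simp) (by simp), ?_⟩ <;>
      simp only [Prod.neg_mk, neg_zero, neg_neg] <;>
      exact pauliStep_pointProj_ne_zero (by simp) (by simp)
  · rintro ⟨a, b⟩ v (rfl | rfl | rfl | rfl) <;>
      rcases Int.units_eq_one_or a with rfl | rfl <;>
      rcases Int.units_eq_one_or b with rfl | rfl <;> simp [signAct_apply]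
  · rintro v (rfl | rfl | rfl | rfl) w (rfl | rfl | rfl | rfl) <;>
      simp [signAct_apply, exists_units_int, Prod.exists]
  · rintro v (rfl | rfl | rfl | rfl) w (rfl | rfl | rfl | rfl) <;> norm_num
  · rintro v (rfl | rfl | rfl | rfl) <;> simp
  · intro s hs t ht u hu
    simp only [Finset.mem_insert, Finset.mem_singleton] at hs ht hu
    subst ht
    rcases hs with rfl | rfl <;> rcases hu with rfl | rfl <;> simp

/-- The generators are the sign vectors whose coordinates multiply to one, an orbit of the sign
changes; together with their negatives they fill the grid of all sign vectors. -/
theorem exists_walk_bccSteps (hg : IsGeneratingSet Sp) (hr : RealizedBy Sp bccSteps) :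
    AdmitsIsotropicWalk Sp := by
  obtain ⟨φ, hφ, hN⟩ := hr
  refine ⟨_, exists_isIsotropicWalk_of_pauli hg (c := spaceCoord.comp φ)
    (spaceCoord_injective.comp hφ)
    (M := {(1, 1, 1), (1, -1, -1), (-1, 1, -1), (-1, -1, 1)}) ?_ ⟨_, Or.inl rfl⟩
    (MonoidHom.id (ℤˣ × ℤˣ)) Function.injective_id isResolution_pauliY spectralProj_pauliY_conj
    ?_ ?_ ?_ ?_ ?_ ?_⟩
  · rw [AddMonoidHom.coe_comp, Set.image_comp, hN, bccSteps]
    simp [Set.image_insert_eq, spaceCoord_apply]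
  · rintro v (rfl | rfl | rfl | rfl) <;>
      refine ⟨pauliStep_pauliY_ne_zero (by simp) (by simp) (by simp), ?_⟩ <;>
      simp only [Prod.neg_mk, neg_neg] <;>
      exact pauliStep_pauliY_ne_zero (by simp) (by simp) (by simp)
  · rintro ⟨a, b⟩ v (rfl | rfl | rfl | rfl) <;>
      rcases Int.units_eq_one_or a with rfl | rfl <;>
      rcases Int.units_eq_one_or b with rfl | rfl <;> simp [signAct_apply]
  · rintro v (rfl | rfl | rfl | rfl) w (rfl | rfl | rfl | rfl) <;>
      simp [signAct_apply, exists_units_int, Prod.exists]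
  · rintro v (rfl | rfl | rfl | rfl) w (rfl | rfl | rfl | rfl) <;> norm_num
  · rintro v (rfl | rfl | rfl | rfl) <;> simp
  · intro s hs t ht u hu
    simp only [Finset.mem_insert, Finset.mem_singleton] at hs ht hu
    rcases hs with rfl | rfl <;> rcases ht with rfl | rfl <;> rcases hu with rfl | rfl <;> simp

/-- A walk on the square lattice whose generators have distinct kernels. -/
theorem exists_walk_squareSteps (hg : IsGeneratingSet Sp) (hr : RealizedBy Sp squareSteps) :
    ∃ (A : G → Matrix (Fin 2) (Fin 2) ℂ) (L : Subgroup (Equiv.Perm G))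
      (U : L → Matrix.unitaryGroup (Fin 2) ℂ), IsIsotropicWalk Sp A L U ∧
      ∃ x ∈ Sp, ∃ y ∈ Sp, ¬ SameKer (A x) (A y) := by
  obtain ⟨φ, hφ, hN⟩ := hr
  have hM : planeCoord.comp φ '' (Sp : Set G) = {(1, 0, 1), (1, 0, -1)} := by
    rw [AddMonoidHom.coe_comp, Set.image_comp, hN, squareSteps]
    simp [Set.image_insert_eq, planeCoord_apply]
  obtain ⟨L, U, h⟩ := exists_isIsotropicWalk_of_pauli hg (c := planeCoord.comp φ)
    (planeCoord_injective.comp hφ) hM ⟨_, Or.inl rfl⟩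
    -- Only the sign of the `σ_Z` coordinate is changed; that projection stands on the right and
    -- determines the kernel, so the two generators have different kernels.
    (MonoidHom.inr ℤˣ ℤˣ) (fun a b h => (Prod.ext_iff.1 h).2) isResolution_pointProj pointProj_conj
    (by
      rintro v (rfl | rfl) <;>
        refine ⟨pauliStep_pointProj_ne_zero (by simp) (by simp), ?_⟩ <;>
        simp only [Prod.neg_mk, neg_zero, neg_neg] <;>
        exact pauliStep_pointProj_ne_zero (by simp) (by simp))
    (by
      rintro b v (rfl | rfl) <;>
        rcases Int.units_eq_one_or b with rfl | rfl <;> simp [signAct_apply])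
    (by
      rintro v (rfl | rfl) w (rfl | rfl) <;> simp [signAct_apply, exists_units_int])
    (by rintro v (rfl | rfl) w (rfl | rfl) <;> norm_num)
    (by rintro v (rfl | rfl) <;> simp)
    (by
      intro s hs t ht u hu
      simp only [Finset.mem_insert, Finset.mem_singleton] at hs ht hu
      subst ht
      rcases hs with rfl | rfl <;> rcases hu with rfl | rfl <;> simp)
  refine ⟨_, L, U, h, ?_⟩
  obtain ⟨x, hx, hcx⟩ := hM.ge (Or.inl rfl)
  obtain ⟨y, hy, hcy⟩ := hM.ge (Or.inr rfl)
  refine ⟨x, hx, y, hy, fun hs => ?_⟩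
  have := hs 0 0
  simp only [hcx, hcy, pauliStep, pointProj, if_true, mul_one] at this
  simp [spectralProj_pauliX_one, spectralProj_pauliZ_one, spectralProj_pauliZ_neg_one] at this

/-- A walk on the square lattice whose generators have the same kernel. -/
theorem exists_walk_squareSteps' (hg : IsGeneratingSet Sp) (hr : RealizedBy Sp squareSteps) :
    ∃ (A : G → Matrix (Fin 2) (Fin 2) ℂ) (L : Subgroup (Equiv.Perm G))
      (U : L → Matrix.unitaryGroup (Fin 2) ℂ), IsIsotropicWalk Sp A L U ∧
      ∃ x ∈ Sp, ∃ y ∈ Sp, x ≠ y ∧ SameKer (A x) (A y) := by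
  obtain ⟨φ, hφ, hN⟩ := hr
  have hM : planeCoord'.comp φ '' (Sp : Set G) = {(1, 0, 1), (-1, 0, 1)} := by
    rw [AddMonoidHom.coe_comp, Set.image_comp, hN, squareSteps]
    simp [Set.image_insert_eq, planeCoord'_apply]
  obtain ⟨L, U, h⟩ := exists_isIsotropicWalk_of_pauli hg (c := planeCoord'.comp φ)
    (planeCoord'_injective.comp hφ) hM ⟨_, Or.inl rfl⟩
    -- With the diagonal coordinates exchanged, the generators differ only in the `σ_X` coordinate,
    -- so they keep a common projection on the right and a common kernel.
    (MonoidHom.inl ℤˣ ℤˣ) (fun a b h => (Prod.ext_iff.1 h).1) isResolution_pointProj pointProj_conj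
    (by
      rintro v (rfl | rfl) <;>
        refine ⟨pauliStep_pointProj_ne_zero (by simp) (by simp), ?_⟩ <;>
        simp only [Prod.neg_mk, neg_zero, neg_neg] <;>
        exact pauliStep_pointProj_ne_zero (by simp) (by simp))
    (by
      rintro b v (rfl | rfl) <;>
        rcases Int.units_eq_one_or b with rfl | rfl <;> simp [signAct_apply])
    (by
      rintro v (rfl | rfl) w (rfl | rfl) <;> simp [signAct_apply, exists_units_int])
    (by rintro v (rfl | rfl) w (rfl | rfl) <;> norm_num)
    (by rintro v (rfl | rfl) <;> simp)
    (by
      intro s hs t ht u hu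
      simp only [Finset.mem_insert, Finset.mem_singleton] at hs ht hu
      subst ht
      rcases hs with rfl | rfl <;> rcases hu with rfl | rfl <;> simp)
  refine ⟨_, L, U, h, ?_⟩
  obtain ⟨x, hx, hcx⟩ := hM.ge (Or.inl rfl)
  obtain ⟨y, hy, hcy⟩ := hM.ge (Or.inr rfl)
  refine ⟨x, hx, y, hy, ?_, fun i j => ?_⟩
  · rintro rfl
    have := congrArg Prod.fst (hcx.symm.trans hcy)
    norm_num at this
  · simp only [hcx, hcy, pauliStep, pointProj, if_true, mul_one]
    simp [spectralProj_pauliZ_one, Matrix.mul_apply, Fin.sum_univ_two]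

/-! ### Walks on the line with self-interaction -/

/-- The transition matrices of a walk on the line with self-interaction. -/
noncomputable def lineStep (s : ℝ) : Matrix (Fin 2) (Fin 2) ℂ :=
  if s = 0 then !![0, 4 / 5 * Complex.I; 4 / 5 * Complex.I, 0] else
    if s = 1 then !![3 / 5, 0; 0, 0] else if s = -1 then !![0, 0; 0, 3 / 5] else 0

theorem lineStep_zero : lineStep 0 = !![0, 4 / 5 * Complex.I; 4 / 5 * Complex.I, 0] := if_pos rfl

theorem lineStep_one : lineStep 1 = !![3 / 5, 0; 0, 0] := by
  rw [lineStep, if_neg one_ne_zero, if_pos rfl]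

theorem lineStep_neg_one : lineStep (-1) = !![0, 0; 0, 3 / 5] := by
  rw [lineStep, if_neg (by norm_num), if_neg (by norm_num), if_pos rfl]

theorem lineStep_zero_conjTranspose :
    (lineStep 0)ᴴ = !![0, -(4 / 5 * Complex.I); -(4 / 5 * Complex.I), 0] := by
  rw [lineStep_zero]
  ext i j; fin_cases i <;> fin_cases j <;> simp

theorem lineStep_one_conjTranspose : (lineStep 1)ᴴ = !![3 / 5, 0; 0, 0] := by
  rw [lineStep_one]
  ext i j; fin_cases i <;> fin_cases j <;> simp

theorem lineStep_neg_one_conjTranspose : (lineStep (-1))ᴴ = !![0, 0; 0, 3 / 5] := by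
  rw [lineStep_neg_one]
  ext i j; fin_cases i <;> fin_cases j <;> simp

theorem lineStep_of_ne {s : ℝ} (h0 : s ≠ 0) (h1 : s ≠ 1) (h2 : s ≠ -1) : lineStep s = 0 := by
  rw [lineStep, if_neg h0, if_neg h1, if_neg h2]

theorem lineStep_conj (e : ℤˣ) (s : ℝ) : lineStep (((e : ℤ) : ℝ) * s) =
    (signPauli (1, e) : Matrix (Fin 2) (Fin 2) ℂ) * lineStep s *
      (signPauli (1, e) : Matrix (Fin 2) (Fin 2) ℂ)ᴴ := by
  rw [signPauli_eq]
  rcases Int.units_eq_one_or e with rfl | rfl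
  · simp
  · simp only [if_true, neg_units_ne_one, if_false, one_mul, pauliX_conjTranspose]
    rw [show (((-1 : ℤˣ) : ℤ) : ℝ) * s = -s by simp]
    by_cases h0 : s = 0
    · subst h0
      rw [neg_zero, lineStep_zero]
      ext i j; fin_cases i <;> fin_cases j <;> simp [pauliX]
    by_cases h1 : s = 1
    · subst h1
      rw [lineStep_one, lineStep_neg_one]
      ext i j; fin_cases i <;> fin_cases j <;> simp [pauliX]
    by_cases h2 : s = -1
    · subst h2
      rw [neg_neg, lineStep_one, lineStep_neg_one]
      ext i j; fin_cases i <;> fin_cases j <;> simp [pauliX]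
    rw [lineStep_of_ne h0 h1 h2, lineStep_of_ne (neg_ne_zero.2 h0)
      (fun h => h2 (by rw [← h, neg_neg])) (fun h => h1 (neg_injective h)), mul_zero, zero_mul]

/-- At `y = 0` this is `(3/5)² + (4/5)² = 1`. At `y = ±1` the two cross terms cancel because the
self-interaction is imaginary, and at `y = ±2` the edge matrices annihilate each other. -/
theorem lineStep_conv_left (y : ℝ) : (lineStep 0)ᴴ * lineStep (0 - y) +
    (lineStep 1)ᴴ * lineStep (1 - y) + (lineStep (-1))ᴴ * lineStep (-1 - y) =
      if y = 0 then 1 else 0 := by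
  have hI := Complex.I_mul_I
  by_cases h0 : y = 0
  · subst h0
    simp only [sub_zero, if_true, lineStep_zero_conjTranspose, lineStep_one_conjTranspose,
      lineStep_neg_one_conjTranspose]
    simp only [lineStep_zero, lineStep_one, lineStep_neg_one]
    ext i j; fin_cases i <;> fin_cases j <;> simp
    all_goals linear_combination (-16 / 25 : ℂ) * hI
  rw [if_neg h0]
  by_cases h1 : y = 1
  · subst h1
    rw [show (0 : ℝ) - 1 = -1 by norm_num, sub_self, lineStep_of_ne (s := -1 - 1) (by norm_num)
      (by norm_num) (by norm_num)]
    simp only [lineStep_zero_conjTranspose, lineStep_one_conjTranspose,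
      lineStep_neg_one_conjTranspose]
    simp only [lineStep_zero, lineStep_neg_one]
    ext i j; fin_cases i <;> fin_cases j <;> simp
    all_goals ring
  by_cases h2 : y = -1
  · subst h2
    rw [show (0 : ℝ) - -1 = 1 by norm_num, sub_self, lineStep_of_ne (s := 1 - -1) (by norm_num)
      (by norm_num) (by norm_num)]
    simp only [lineStep_zero_conjTranspose, lineStep_one_conjTranspose,
      lineStep_neg_one_conjTranspose]
    simp only [lineStep_zero, lineStep_one]
    ext i j; fin_cases i <;> fin_cases j <;> simp
    all_goals ring
  rw [lineStep_of_ne (s := 0 - y) (by simpa using h0) (fun h => h2 (by linarith))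
    (fun h => h1 (by linarith)), mul_zero, zero_add]
  by_cases h3 : y = 2
  · subst h3
    rw [show (1 : ℝ) - 2 = -1 by norm_num, lineStep_of_ne (s := -1 - 2) (by norm_num)
      (by norm_num) (by norm_num)]
    simp only [lineStep_one_conjTranspose,
      lineStep_neg_one_conjTranspose]
    simp only [lineStep_neg_one]
    ext i j; fin_cases i <;> fin_cases j <;> simp
  by_cases h4 : y = -2
  · subst h4
    rw [show (-1 : ℝ) - -2 = 1 by norm_num, lineStep_of_ne (s := 1 - -2) (by norm_num)
      (by norm_num) (by norm_num)]
    simp only [lineStep_one_conjTranspose,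
      lineStep_neg_one_conjTranspose]
    simp only [lineStep_one]
    ext i j; fin_cases i <;> fin_cases j <;> simp
  rw [lineStep_of_ne (s := 1 - y) (fun h => h1 (by linarith)) (fun h => h0 (by linarith))
    (fun h => h3 (by linarith)), lineStep_of_ne (s := -1 - y) (fun h => h2 (by linarith))
    (fun h => h4 (by linarith)) (fun h => h0 (by linarith)), mul_zero, mul_zero, add_zero]

theorem lineStep_conv_right (y : ℝ) : lineStep 0 * (lineStep (0 - y))ᴴ +
    lineStep 1 * (lineStep (1 - y))ᴴ + lineStep (-1) * (lineStep (-1 - y))ᴴ =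
      if y = 0 then 1 else 0 := by
  have hI := Complex.I_mul_I
  by_cases h0 : y = 0
  · subst h0
    simp only [sub_zero, if_true, lineStep_zero_conjTranspose, lineStep_one_conjTranspose,
      lineStep_neg_one_conjTranspose]
    simp only [lineStep_zero, lineStep_one, lineStep_neg_one]
    ext i j; fin_cases i <;> fin_cases j <;> simp
    all_goals linear_combination (-16 / 25 : ℂ) * hI
  rw [if_neg h0]
  by_cases h1 : y = 1
  · subst h1
    rw [show (0 : ℝ) - 1 = -1 by norm_num, sub_self, lineStep_of_ne (s := -1 - 1) (by norm_num)
      (by norm_num) (by norm_num)]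
    simp only [Matrix.conjTranspose_zero, lineStep_zero_conjTranspose, lineStep_neg_one_conjTranspose]
    simp only [lineStep_zero, lineStep_one, lineStep_neg_one]
    ext i j; fin_cases i <;> fin_cases j <;> simp
    all_goals ring
  by_cases h2 : y = -1
  · subst h2
    rw [show (0 : ℝ) - -1 = 1 by norm_num, sub_self, lineStep_of_ne (s := 1 - -1) (by norm_num)
      (by norm_num) (by norm_num)]
    simp only [Matrix.conjTranspose_zero, lineStep_zero_conjTranspose, lineStep_one_conjTranspose]
    simp only [lineStep_zero, lineStep_one, lineStep_neg_one]
    ext i j; fin_cases i <;> fin_cases j <;> simp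
    all_goals ring
  rw [lineStep_of_ne (s := 0 - y) (by simpa using h0) (fun h => h2 (by linarith))
    (fun h => h1 (by linarith)), Matrix.conjTranspose_zero, mul_zero, zero_add]
  by_cases h3 : y = 2
  · subst h3
    rw [show (1 : ℝ) - 2 = -1 by norm_num, lineStep_of_ne (s := -1 - 2) (by norm_num)
      (by norm_num) (by norm_num)]
    simp only [Matrix.conjTranspose_zero, lineStep_neg_one_conjTranspose]
    simp only [lineStep_one, lineStep_neg_one]
    ext i j; fin_cases i <;> fin_cases j <;> simp
  by_cases h4 : y = -2
  · subst h4
    rw [show (-1 : ℝ) - -2 = 1 by norm_num, lineStep_of_ne (s := 1 - -2) (by norm_num)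
      (by norm_num) (by norm_num)]
    simp only [Matrix.conjTranspose_zero, lineStep_one_conjTranspose]
    simp only [lineStep_one, lineStep_neg_one]
    ext i j; fin_cases i <;> fin_cases j <;> simp
  rw [lineStep_of_ne (s := 1 - y) (fun h => h1 (by linarith)) (fun h => h0 (by linarith))
    (fun h => h3 (by linarith)), lineStep_of_ne (s := -1 - y) (fun h => h2 (by linarith))
    (fun h => h4 (by linarith)) (fun h => h0 (by linarith)), Matrix.conjTranspose_zero, mul_zero,
    mul_zero, add_zero]

/-- The steps are the same for one generator and for a symmetric pair; only the group `K` changes,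
trivial in the first case and of order two in the second. -/
theorem exists_isIsotropicWalk_line {K : Type*} [Group K] (hg : IsGeneratingSet Sp) {c : G →+ ℝ}
    (hc : Function.Injective c) (ι : K →* ℤˣ) (hι : Function.Injective ι) {M : Set ℝ}
    (hM : c '' (Sp : Set G) = M) (h1 : 1 ∈ M) (hM1 : ∀ v ∈ M, v = 1 ∨ v = -1)
    (hmem : ∀ k, ∀ v ∈ M, ((ι k : ℤ) : ℝ) * v ∈ M)
    (htr : ∀ v ∈ M, ∀ w ∈ M, ∃ k, ((ι k : ℤ) : ℝ) * v = w) :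
    ∃ (L : Subgroup (Equiv.Perm G)) (U : L → Matrix.unitaryGroup (Fin 2) ℂ),
      IsIsotropicWalk Sp (fun x => lineStep (c x)) L U := by
  have hin : ∀ x ∈ Sp, c x ∈ M := fun x hx => hM ▸ ⟨x, hx, rfl⟩
  have hout : ∀ v ∈ M, ∃ x ∈ Sp, c x = v := fun v hv => by
    rw [← hM] at hv
    obtain ⟨x, hx, h⟩ := hv
    exact ⟨x, hx, h⟩
  obtain ⟨g, hgSp, hcg⟩ := hout 1 h1
  have hact : ∀ k (v : ℝ), (DistribMulAction.toAddMonoidEnd ℤˣ ℝ).comp ι k v =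
      ((ι k : ℤ) : ℝ) * v := fun k v => by
    change ι k • v = _
    rw [Units.smul_def, zsmul_eq_mul]
  have hall : ∀ x ∈ edgeSet Sp, c x = 1 ∨ c x = -1 := by
    intro x hx
    rcases mem_edgeSet.1 hx with h | h
    · exact hM1 _ (hin x h)
    · have := hM1 _ (hin _ h)
      rw [_root_.map_neg, neg_eq_iff_eq_neg, neg_inj] at this
      exact this.symm
  have hge : g ∈ edgeSet Sp := mem_edgeSet.2 (Or.inl hgSp)
  have hg0 : g ≠ 0 := fun h0 => by
    rw [h0, _root_.map_zero] at hcg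
    exact zero_ne_one hcg
  have hgg : g ≠ -g := fun h0 => by
    have := congrArg c h0
    rw [_root_.map_neg, hcg] at this
    norm_num at this
  have hstep : stepSet Sp = {0, g, -g} := by
    ext x
    simp only [Finset.mem_insert, Finset.mem_singleton]
    rw [mem_stepSet]
    constructor
    · rintro (h | h)
      · exact Or.inl h
      · rcases hall x h with h | h
        · exact Or.inr (Or.inl (hc (h.trans hcg.symm)))
        · exact Or.inr (Or.inr (hc (by rw [h, _root_.map_neg, hcg])))
    · rintro (h | rfl | rfl)
      exacts [Or.inl h, Or.inr hge, Or.inr (neg_mem_edgeSet hge)]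
  have hsum : ∀ F : G → Matrix (Fin 2) (Fin 2) ℂ,
      ∑ x ∈ stepSet Sp, F x = F 0 + F g + F (-g) := by
    intro F
    rw [hstep, Finset.sum_insert, Finset.sum_pair hgg, add_assoc]
    simp only [Finset.mem_insert, Finset.mem_singleton, not_or]
    exact ⟨hg0.symm, (neg_ne_zero.2 hg0).symm⟩
  refine exists_isIsotropicWalk hg hc lineStep ((DistribMulAction.toAddMonoidEnd ℤˣ ℝ).comp ι)
    (fun k => signPauli (1, ι k)) (fun k k' => ?_) (fun k v => ?_) (fun k x hx => ?_)
    (fun x hx y hy => ?_) (fun k hk => ?_) (fun x hx y hy h => ?_) (fun x hx => ?_) ?_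
  · have := signPauli_mul (1, ι k) (1, ι k')
    rwa [Prod.mk_mul_mk, one_mul, ← _root_.map_mul] at this
  · rw [hact, lineStep_conj]
  · rw [hact]
    exact hout _ (hmem k _ (hin x hx))
  · obtain ⟨k, hk⟩ := htr _ (hin x hx) _ (hin y hy)
    exact ⟨k, by rw [hact, hk]⟩
  · have := hk g hgSp
    rw [hact, hcg, mul_one] at this
    apply hι
    rw [_root_.map_one]
    exact Units.ext (by rw [Units.val_one]; exact_mod_cast this)
  · apply hc
    rcases hM1 _ (hin x hx) with h1 | h1 <;> rcases hM1 _ (hin y hy) with h2 | h2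
    · rw [h1, h2]
    · rw [h1, h2] at h
      have := congrFun (congrFun h 0) 0
      simp [lineStep_one, lineStep_neg_one] at this
    · rw [h1, h2] at h
      have := congrFun (congrFun h 0) 0
      norm_num [lineStep_one, lineStep_neg_one] at this
    · rw [h1, h2]
  · intro h
    rcases hall x hx with h1 | h1 <;> rw [h1] at h
    · have := congrFun (congrFun h 0) 0
      simp [lineStep_one] at this
    · have := congrFun (congrFun h 1) 1
      simp [lineStep_neg_one] at this
  · have hy0 : ∀ y, c y = 0 ↔ y = 0 := (injective_iff_map_eq_zero' c).1 hc
    refine exists_unitary_of_convolution (fun x hx => ?_) (fun y => ?_) (fun y => ?_)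
    · rw [hstep] at hx
      simp only [Finset.mem_insert, Finset.mem_singleton, not_or] at hx
      refine lineStep_of_ne (fun h => hx.1 ((hy0 x).1 h)) (fun h => hx.2.1 (hc (h.trans hcg.symm)))
        (fun h => hx.2.2 (hc (by rw [h, _root_.map_neg, hcg])))
    · rw [hsum, ← if_congr (hy0 y) rfl rfl, ← lineStep_conv_left]
      simp only [_root_.map_sub, _root_.map_neg, _root_.map_zero, hcg]
    · rw [hsum, ← if_congr (hy0 y) rfl rfl, ← lineStep_conv_right]
      simp only [_root_.map_sub, _root_.map_neg, _root_.map_zero, hcg]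

/-- The coordinate of the line. -/
def lineCoord : EuclideanSpace ℝ (Fin 1) →+ ℝ := AddMonoidHom.mk' (fun v => v 0) fun _ _ => rfl

theorem lineCoord_apply (v : EuclideanSpace ℝ (Fin 1)) : lineCoord v = v 0 := rfl

theorem lineCoord_injective : Function.Injective lineCoord := by
  intro v w h
  ext i
  fin_cases i
  exact h

theorem supportsSelfInteraction_line (hg : IsGeneratingSet Sp)
    (hr : RealizedBy Sp integerSteps ∨ RealizedBy Sp integerStepsSymm) :
    SupportsSelfInteraction Sp := by
  have h0 : lineStep 0 ≠ 0 := fun h => by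
    have := congrFun (congrFun h 0) 1
    simp [lineStep_zero] at this
  rcases hr with ⟨φ, hφ, hN⟩ | ⟨φ, hφ, hN⟩
  · obtain ⟨L, U, h⟩ := exists_isIsotropicWalk_line hg (c := lineCoord.comp φ)
      (lineCoord_injective.comp hφ) (1 : Unit →* ℤˣ) (Function.injective_of_subsingleton _)
      (M := {1}) (by
        rw [AddMonoidHom.coe_comp, Set.image_comp, hN, integerSteps]
        simp [lineCoord_apply]) rfl (by simp) (by simp) (by simp)
    exact ⟨_, L, U, h, by simpa using h0⟩
  · obtain ⟨L, U, h⟩ := exists_isIsotropicWalk_line hg (c := lineCoord.comp φ)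
      (lineCoord_injective.comp hφ) (MonoidHom.id ℤˣ) Function.injective_id
      (M := {1, -1}) (by
        rw [AddMonoidHom.coe_comp, Set.image_comp, hN, integerStepsSymm]
        simp [lineCoord_apply, Set.image_insert_eq]) (Or.inl rfl) (by simp) (by
        rintro k v (rfl | rfl) <;> rcases Int.units_eq_one_or k with rfl | rfl <;> simp) (by
        rintro v (rfl | rfl) w (rfl | rfl) <;> simp [exists_units_int])
    exact ⟨_, L, U, h, by simpa using h0⟩

end

/-! ### The classification -/

theorem eq_singleton_of_integerSteps {G : Type*} [AddCommGroup G] {Sp : Finset G}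
    (h : RealizedBy Sp integerSteps) : ∃ g, Sp = {g} := by
  obtain ⟨φ, hφ, hN⟩ := h
  have hmem : ∀ x, x ∈ Sp ↔ φ x = !₂[(1 : ℝ)] := fun x => by
    rw [← Finset.mem_coe, ← hφ.mem_set_image, hN]
    rfl
  obtain ⟨g, hg, hφg⟩ := hN.ge rfl
  refine ⟨g, Finset.ext fun x => ?_⟩
  rw [Finset.mem_singleton, hmem, ← hφg, hφ.eq_iff]

theorem eq_pair_of_integerStepsSymm {G : Type*} [AddCommGroup G] [DecidableEq G] {Sp : Finset G}
    (h : RealizedBy Sp integerStepsSymm) : ∃ g, Sp = {g, -g} := by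
  obtain ⟨φ, hφ, hN⟩ := h
  have hmem : ∀ x, x ∈ Sp ↔ φ x = !₂[(1 : ℝ)] ∨ φ x = !₂[(-1 : ℝ)] := fun x => by
    rw [← Finset.mem_coe, ← hφ.mem_set_image, hN]
    rfl
  obtain ⟨g, hg, hφg⟩ := hN.ge (Or.inl rfl)
  have hneg : φ (-g) = !₂[(-1 : ℝ)] := by
    rw [map_neg, hφg]
    ext i; fin_cases i; simp
  refine ⟨g, Finset.ext fun x => ?_⟩
  rw [Finset.mem_insert, Finset.mem_singleton, hmem, ← hneg, ← hφg, hφ.eq_iff, hφ.eq_iff]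

theorem neg_notMem_of_squareSteps {G : Type*} [AddCommGroup G] {Sp : Finset G}
    (h : RealizedBy Sp squareSteps) : ∀ x ∈ Sp, -x ∉ Sp := by
  obtain ⟨φ, hφ, hN⟩ := h
  intro x hx hnx
  have h1 : φ x ∈ squareSteps := hN ▸ ⟨x, hx, rfl⟩
  have h2 : φ (-x) ∈ squareSteps := hN ▸ ⟨-x, hnx, rfl⟩
  rw [map_neg] at h2
  rcases h1 with h1 | h1 <;> rcases h2 with h2 | h2 <;> rw [h1] at h2
  · have := congrArg (fun v : EuclideanSpace ℝ (Fin 2) => v 0) h2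
    norm_num at this
  · have := congrArg (fun v : EuclideanSpace ℝ (Fin 2) => v 0) h2
    norm_num at this
  · have := congrArg (fun v : EuclideanSpace ℝ (Fin 2) => v 1) h2
    norm_num at this
  · have := congrArg (fun v : EuclideanSpace ℝ (Fin 2) => v 1) h2
    norm_num at this

theorem neg_mem_of_squareStepsSymm {G : Type*} [AddCommGroup G] {Sp : Finset G}
    (h : RealizedBy Sp squareStepsSymm) : ∀ x ∈ Sp, -x ∈ Sp := by
  obtain ⟨φ, hφ, hN⟩ := h
  intro x hx
  have h1 : φ x ∈ squareStepsSymm := hN ▸ ⟨x, hx, rfl⟩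
  have h2 : φ (-x) ∈ squareStepsSymm := by
    rw [map_neg]
    have e1 : -!₂[(1 : ℝ), 0] = !₂[-1, 0] := by ext i; fin_cases i <;> simp
    have e2 : -!₂[(0 : ℝ), 1] = !₂[0, -1] := by ext i; fin_cases i <;> simp
    rcases h1 with h1 | h1 | h1 | h1 <;> rw [h1]
    · rw [e1]; exact Or.inr (Or.inr (Or.inl rfl))
    · rw [e2]; exact Or.inr (Or.inr (Or.inr rfl))
    · rw [← e1, neg_neg]; exact Or.inl rfl
    · rw [← e2, neg_neg]; exact Or.inr (Or.inl rfl)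
  rw [← hN] at h2
  exact (hφ.mem_set_image).1 h2

/-- If every isotropic walk has the isotropy range `P`, then `P` is the list of ranges. -/
theorem isotropyRangesAre_singleton {G : Type*} [AddCommGroup G] [DecidableEq G] {Sp : Finset G}
    {P : Set (Matrix (Fin 2) (Fin 2) ℂ)} (hA : AdmitsIsotropicWalk Sp)
    (h : ∀ (A : G → Matrix (Fin 2) (Fin 2) ℂ) (L : Subgroup (Equiv.Perm G))
      (U : L → Matrix.unitaryGroup (Fin 2) ℂ), IsIsotropicWalk Sp A L U →
        HasIsotropyRange Sp A L U P) : IsotropyRangesAre Sp {P} := by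
  refine ⟨fun A L U hw => ⟨P, rfl, h A L U hw⟩, ?_⟩
  rintro _ rfl
  obtain ⟨A, L, U, hw⟩ := hA
  exact ⟨A, L, U, hw, h A L U hw⟩

theorem SupportsSelfInteraction.admits {G : Type*} [AddCommGroup G] [DecidableEq G] {Sp : Finset G}
    (h : SupportsSelfInteraction Sp) : AdmitsIsotropicWalk Sp := by
  obtain ⟨A, L, U, hw, -⟩ := h
  exact ⟨A, L, U, hw⟩

/-- Left multiplication by a unitary does not affect kernels, so the alternative passes from the
normalised walk to the original one. -/
theorem IsIsotropicWalk.hasIsotropyRange_square {Sp : Finset (Fin 2 → ℤ)} (hg : IsGeneratingSet Sp)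
    {A : (Fin 2 → ℤ) → Matrix (Fin 2) (Fin 2) ℂ} {L : Subgroup (Equiv.Perm (Fin 2 → ℤ))}
    {U : L → Matrix.unitaryGroup (Fin 2) ℂ} (h : IsIsotropicWalk Sp A L U)
    (hneg : ∀ x ∈ Sp, -x ∉ Sp) :
    (HasIsotropyRange Sp A L U rangeX ∧ ∀ x ∈ Sp, ∀ y ∈ Sp, x ≠ y → ¬ SameKer (A x) (A y)) ∨
      (HasIsotropyRange Sp A L U rangeZ ∧ ∀ x ∈ Sp, ∀ y ∈ Sp, SameKer (A x) (A y)) := by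
  obtain ⟨W, A', hw, hWW, hW⟩ := exists_normal_of_isIsotropicWalk hg h
  have hin : ∀ x ∈ Sp, x ∈ stepSet Sp := fun x hx =>
    mem_stepSet.2 (Or.inr (mem_edgeSet.2 (Or.inl hx)))
  rcases hw.hasIsotropyRange_square hneg with ⟨h1, h2⟩ | ⟨h1, h2⟩
  · refine Or.inl ⟨h1.of_mul_left hW, fun x hx y hy hxy hs => h2 x hx y hy hxy ?_⟩
    have e : ∀ M : Matrix (Fin 2) (Fin 2) ℂ, Wᴴ * (W * M) * 1 = M := fun M => by
      rw [mul_one, ← mul_assoc, hWW, one_mul]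
    have := hs.mul Wᴴ Wᴴ 1
    rwa [hW x (hin x hx), hW y (hin y hy), e, e] at this
  · refine Or.inr ⟨h1.of_mul_left hW, fun x hx y hy => ?_⟩
    have := (h2 x hx y hy).mul W W 1
    rwa [mul_one, mul_one, ← hW x (hin x hx), ← hW y (hin y hy)] at this

theorem isotropyRangesAre_squareSteps {Sp : Finset (Fin 2 → ℤ)} (hg : IsGeneratingSet Sp)
    (hr : RealizedBy Sp squareSteps) : IsotropyRangesAre Sp {rangeX, rangeZ} := by
  have hneg := neg_notMem_of_squareSteps hr
  refine ⟨fun A L U hw => ?_, ?_⟩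
  · rcases hw.hasIsotropyRange_square hg hneg with h | h
    · exact ⟨_, Or.inl rfl, h.1⟩
    · exact ⟨_, Or.inr rfl, h.1⟩
  -- Each explicit walk falls under one of the two alternatives, and its kernels exclude the other.
  · rintro _ (rfl | rfl)
    · obtain ⟨A, L, U, hw, x, hx, y, hy, hs⟩ := exists_walk_squareSteps hg hr
      refine ⟨A, L, U, hw, ?_⟩
      rcases hw.hasIsotropyRange_square hg hneg with h | h
      · exact h.1
      · exact absurd (h.2 x hx y hy) hs
    · obtain ⟨A, L, U, hw, x, hx, y, hy, hxy, hs⟩ := exists_walk_squareSteps' hg hr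
      refine ⟨A, L, U, hw, ?_⟩
      rcases hw.hasIsotropyRange_square hg hneg with h | h
      · exact absurd hs (h.2 x hx y hy hxy)
      · exact h.1

theorem zero_mem_stepSet {G : Type*} [AddCommGroup G] [DecidableEq G] {Sp : Finset G} :
    (0 : G) ∈ stepSet Sp := mem_stepSet.2 (Or.inl rfl)

theorem mainTheorem2 :
    (∀ Sp : Finset (Fin 1 → ℤ), IsGeneratingSet Sp →
      (AdmitsIsotropicWalk Sp ↔ RealizedBy Sp integerSteps ∨ RealizedBy Sp integerStepsSymm) ∧
      (RealizedBy Sp integerSteps → IsotropyRangesAre Sp {trivialRange}) ∧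
      (RealizedBy Sp integerStepsSymm → IsotropyRangesAre Sp {rangeX}) ∧
      (AdmitsIsotropicWalk Sp → SupportsSelfInteraction Sp)) ∧
    (∀ Sp : Finset (Fin 2 → ℤ), IsGeneratingSet Sp →
      (AdmitsIsotropicWalk Sp ↔ RealizedBy Sp squareSteps ∨ RealizedBy Sp squareStepsSymm) ∧
      (RealizedBy Sp squareSteps → IsotropyRangesAre Sp {rangeX, rangeZ}) ∧
      (RealizedBy Sp squareStepsSymm → IsotropyRangesAre Sp {heisenbergRange}) ∧
      ¬ SupportsSelfInteraction Sp) ∧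
    (∀ Sp : Finset (Fin 3 → ℤ), IsGeneratingSet Sp →
      (AdmitsIsotropicWalk Sp ↔ RealizedBy Sp bccSteps) ∧
      (RealizedBy Sp bccSteps → IsotropyRangesAre Sp {heisenbergRange}) ∧
      ¬ SupportsSelfInteraction Sp) := by
  refine ⟨fun Sp hg => ?_, fun Sp hg => ?_, fun Sp hg => ?_⟩
  · have hnec : AdmitsIsotropicWalk Sp →
        RealizedBy Sp integerSteps ∨ RealizedBy Sp integerStepsSymm := by
      rintro ⟨A, L, U, h⟩
      obtain ⟨W, A', hw, -⟩ := exists_normal_of_isIsotropicWalk hg h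
      exact hw.realizedBy_line
    have hsuf := supportsSelfInteraction_line hg
    refine ⟨⟨hnec, fun hr => (hsuf hr).admits⟩, fun hr => ?_, fun hr => ?_, fun h => hsuf (hnec h)⟩
    · obtain ⟨g, hSp⟩ := eq_singleton_of_integerSteps hr
      refine isotropyRangesAre_singleton (hsuf (Or.inl hr)).admits fun A L U h => ?_
      obtain ⟨W, A', hw, -, hW⟩ := exists_normal_of_isIsotropicWalk hg h
      exact (hw.hasIsotropyRange_singleton hSp).of_mul_left hW
    · obtain ⟨g, hSp⟩ := eq_pair_of_integerStepsSymm hr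
      refine isotropyRangesAre_singleton (hsuf (Or.inr hr)).admits fun A L U h => ?_
      obtain ⟨W, A', hw, -, hW⟩ := exists_normal_of_isIsotropicWalk hg h
      exact (hw.hasIsotropyRange_pair hSp).of_mul_left hW
  · refine ⟨⟨?_, ?_⟩, isotropyRangesAre_squareSteps hg, fun hr => ?_, ?_⟩
    · rintro ⟨A, L, U, h⟩
      obtain ⟨W, A', hw, -⟩ := exists_normal_of_isIsotropicWalk hg h
      exact hw.realizedBy_square
    · rintro (hr | hr)
      · obtain ⟨A, L, U, h, -⟩ := exists_walk_squareSteps hg hr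
        exact ⟨A, L, U, h⟩
      · exact exists_walk_squareStepsSymm hg hr
    · refine isotropyRangesAre_singleton (exists_walk_squareStepsSymm hg hr) fun A L U h => ?_
      obtain ⟨W, A', hw, -, hW⟩ := exists_normal_of_isIsotropicWalk hg h
      exact (hw.hasIsotropyRange_square_symm (neg_mem_of_squareStepsSymm hr)).of_mul_left hW
    · rintro ⟨A, L, U, h, h0⟩
      obtain ⟨W, A', hw, -, hW⟩ := exists_normal_of_isIsotropicWalk hg h
      exact h0 (by rw [hW 0 zero_mem_stepSet, hw.apply_zero_eq_zero_plane, mul_zero])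
  · refine ⟨⟨?_, exists_walk_bccSteps hg⟩, fun hr => ?_, ?_⟩
    · rintro ⟨A, L, U, h⟩
      obtain ⟨W, A', hw, -⟩ := exists_normal_of_isIsotropicWalk hg h
      exact hw.realizedBy_bccSteps
    · refine isotropyRangesAre_singleton (exists_walk_bccSteps hg hr) fun A L U h => ?_
      obtain ⟨W, A', hw, -, hW⟩ := exists_normal_of_isIsotropicWalk hg h
      exact hw.hasIsotropyRange_space.of_mul_left hW
    · rintro ⟨A, L, U, h, h0⟩
      obtain ⟨W, A', hw, -, hW⟩ := exists_normal_of_isIsotropicWalk hg h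
      exact h0 (by rw [hW 0 zero_mem_stepSet, hw.apply_zero_eq_zero_space, mul_zero])
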